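/- Let $F$ be a non-Archimedean local field with ring of integers $O_F$, let $\Delta$ be a central division algebra over $F$ with $[\Delta:F]=d^2$, and let $V$ be a right $\Delta$-vector space of finite rank $m\ge 1$, so that $D:=\mathrm{End}_\Delta(V)\cong\mathrm{Mat}_m(\Delta)$. Let $L/F$ be a finite unramified field extension with ring of integers $O_L$, let $\iota:L\hookrightarrow D$ be an $F$-algebra embedding, and put $t=\gcd([L:F],d)$. For a finite-dimensional division algebra $A$ over $F$ let $O_A$ be its maximal compact subring, $\mathfrak P_A$ the maximal two-sided ideal of $O_A$ and $\mathbb F_A=O_A/\mathfrak P_A$. Let $f=(f_1,\dots,f_r)$ be positive integers with $f_1+\cdots+f_r=m$. An $(O_L,O_\Delta)$-flag in $V$ of type $(\iota,f)$ is a tuple $N_*=(N_1,\dots,N_r)$ of free right $O_\Delta$-submodules of $V$ of rank $m$ such that $N_1\supsetneq\cdots\supsetneq N_r\supsetneq N_{r+1}:=N_1\mathfrak P_\Delta$, $\dim_{\mathbb F_\Delta}(N_i/N_{i+1})=f_i$ and $\iota(O_L)N_i\subseteq N_i$ for $1\le i\le r$. A morphism $N_*\to N'_*$ is a $\phi\in\mathrm{End}_\Delta(V)$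 that commutes with $\iota(O_L)$ and satisfies $\phi(N_i)\subseteq N_i'$ for all $i$. (0) There are a central division algebra $\Delta'$ over $L$ with $[\Delta':L]=(d/t)^2$ and an isomorphism of $L$-algebras $\Theta:\Delta\otimes_FL\to\mathrm{Mat}_t(\Delta')$ that carries $O_\Delta\otimes_{O_F}O_L$ onto the Iwahori order of matrices with entries in $O_{\Delta'}$ whose entries strictly below the diagonal lie in $\mathfrak P_{\Delta'}$. Fix any division algebra $\Delta'$ over $L$ and any such $\Theta$, regard $V$ as a right $\Delta\otimes_FL$-module via $\iota$, let $E_{k,l}\in\Delta\otimes_FL$ correspond to the elementary matrices, and regard $V^{(t)}:=VE_{t,t}$ as a right $\Delta'$-vector space. For a flag $N_*$ put $N_{i,j}:=N_iE_{t+1-j,t}\subset V^{(t)}$ $(1\le i\le r,\ 1\le j\le t)$. Then $$N_{1,1}\supseteq\cdots\supseteq N_{r,1}\supseteq N_{1,2}\supseteq\cdots\supseteq N_{r,2}\supseteq\cdots\supseteq N_{1,t}\supseteq\cdots\supseteq N_{r,t}\supseteq N_{1,1}\mathfrak P_{\Delta'}$$ is a chain of right $O_{\Delta'}$-modules. Let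 $f_{i,j}$ be the $\mathbb F_{\Delta'}$-dimension of the quotient of $N_{i,j}$ by the next term of the chain. (1) $N_*\mapsto(f_{i,j})$ induces a bijection from the set of isomorphism classes of $(O_L,O_\Delta)$-flags in $V$ of type $(\iota,f)$ onto the set of arrays $(f_{i,j})_{1\le i\le r,\,1\le j\le t}$ of non-negative integers with $$\frac{[L:F]}{t}\sum_{j=1}^t f_{i,j}=f_i\qquad(1\le i\le r).$$ (2) Let $N_*$ be a flag with array $(f_{i,j})$, and let $(g_1,\dots,g_s)$ be the list obtained from $(f_{1,1},\dots,f_{r,1},f_{1,2},\dots,f_{r,2},\dots,f_{1,t},\dots,f_{r,t})$ by removing the zero entries and reversing the order. Then $g_1+\cdots+g_s=m':=mt/[L:F]$, and there is an $L$-algebra isomorphism from the centralizer of $\iota(L)$ in $D$ onto $\mathrm{Mat}_{m'}(\Delta')$ that carries $\mathrm{End}_{(O_L,O_\Delta)}(N_*)$ onto the hereditary order of all block matrices $(X_{p,q})_{1\le p,q\le s}$ with $X_{p,q}\in\mathrm{Mat}_{g_p\times g_q}(O_{\Delta'})$ for $p\le q$ and $X_{p,q}\in\mathrm{Mat}_{g_p\times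 g_q}(\mathfrak P_{\Delta'})$ for $p>q$. -/

import Mathlib

open scoped TensorProduct ValuativeRel

noncomputable section

namespace LocalFlag

section Orders

/-- The maximal compact subring of a finite-dimensional division algebra `A` over a local field
`F`: the largest subring that is compact for the canonical (module) topology of `A` over `F`. -/
def maxCompactSubring (F A : Type*) [Field F] [TopologicalSpace F] [DivisionRing A]
    [Algebra F A] : Subring A :=
  sSup {S : Subring A | @IsCompact A (moduleTopology F A) (S : Set A)}

/-- The maximal two-sided ideal of a ring with a unique maximal two-sided ideal: the largest
proper two-sided ideal. -/
def maxIdeal (R : Type*) [Ring R] : Ideal R :=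
  TwoSidedIdeal.asIdeal (sSup {I : TwoSidedIdeal R | I ≠ ⊤})

instance (R : Type*) [Ring R] : (maxIdeal R).IsTwoSided :=
  inferInstanceAs (TwoSidedIdeal.asIdeal _).IsTwoSided

/-- `M` is killed by the maximal two-sided ideal `𝔓` of `R` and has dimension `n` over
`R ⧸ 𝔓`. -/
def HasResidueDim (R M : Type*) [Ring R] [AddCommGroup M] [Module R M] (n : ℕ) : Prop :=
  ∃ h : Module.IsTorsionBySet R M (maxIdeal R),
    letI := h.module
    Module.rank (R ⧸ maxIdeal R) M = n

/-- Matrices over the subring `O` of `A` whose rows and columns are grouped in blocks by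
`b : n → ι`, and whose entries in the blocks `(p, q)` with `p > q` (strictly below the diagonal)
lie in the maximal two-sided ideal of `O`. -/
def blockOrder {A n ι : Type*} [Ring A] [Fintype n] [DecidableEq n] [LinearOrder ι]
    (O : Subring A) (b : n → ι) : Subring (Matrix n n A) where
  carrier := {X | ∀ k l, ∃ h : X k l ∈ O, b l < b k → (⟨X k l, h⟩ : O) ∈ maxIdeal O}
  zero_mem' k l := ⟨O.zero_mem, fun _ => (maxIdeal O).zero_mem⟩
  one_mem' k l := by
    by_cases hkl : k = l
    · subst hkl
      exact ⟨by simp [O.one_mem], fun h => absurd h (lt_irrefl _)⟩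
    · refine ⟨by simp [Matrix.one_apply_ne hkl, O.zero_mem], fun _ => ?_⟩
      convert (maxIdeal O).zero_mem
      exact Matrix.one_apply_ne hkl
  add_mem' {X Y} hX hY k l := by
    obtain ⟨h1, h1'⟩ := hX k l
    obtain ⟨h2, h2'⟩ := hY k l
    exact ⟨O.add_mem h1 h2, fun h => (maxIdeal O).add_mem (h1' h) (h2' h)⟩
  neg_mem' {X} hX k l := by
    obtain ⟨h1, h1'⟩ := hX k l
    exact ⟨O.neg_mem h1, fun h => (maxIdeal O).neg_mem (h1' h)⟩
  mul_mem' {X Y} hX hY k l := by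
    choose hx hx' using hX
    choose hy hy' using hY
    have e : (X * Y) k l = ((∑ c, (⟨X k c, hx k c⟩ : O) * ⟨Y c l, hy c l⟩ : O) : A) := by
      simp [Matrix.mul_apply]
    refine ⟨by rw [e]; exact SetLike.coe_mem _, fun h => ?_⟩
    have e' : (⟨(X * Y) k l, by rw [e]; exact SetLike.coe_mem _⟩ : O)
        = ∑ c, (⟨X k c, hx k c⟩ : O) * ⟨Y c l, hy c l⟩ := Subtype.ext e
    rw [e']
    refine Ideal.sum_mem _ fun c _ => ?_
    by_cases hc : b c < b k
    · exact Ideal.mul_mem_right _ _ (hx' k c hc)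
    · exact Ideal.mul_mem_left _ _ (hy' c l (lt_of_lt_of_le h (not_lt.mp hc)))

end Orders

section Flags

variable (F Δ : Type*) [Field F] [TopologicalSpace F] [DivisionRing Δ] [Algebra F Δ]

/-- The opposite of the maximal compact subring `O_Δ`: right `O_Δ`-modules are modules over it. -/
abbrev OrdOp : Subring Δᵐᵒᵖ := (maxCompactSubring F Δ).op

variable {V : Type*} [AddCommGroup V] [Module Δᵐᵒᵖ V]

variable {F Δ} in
/-- The term after `N i` in the chain `N_1, …, N_r, N_1 𝔓_Δ`. -/
def nextTerm {r : ℕ} (N : Fin r → Submodule (OrdOp F Δ) V) (i : Fin r) :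
    Submodule (OrdOp F Δ) V :=
  if h : i.1 + 1 < r then N ⟨i.1 + 1, h⟩
  else maxIdeal (OrdOp F Δ) • N ⟨0, i.pos⟩

/-- `O_Δ`-flags of type `f` in the right `Δ`-vector space `V`. -/
structure IsFlag {r : ℕ} (f : Fin r → ℕ) (N : Fin r → Submodule (OrdOp F Δ) V) : Prop where
  free : ∀ i, Nonempty (Module.Basis (Fin (Module.finrank Δᵐᵒᵖ V)) (OrdOp F Δ) (N i))
  lt : ∀ i, nextTerm N i < N i
  dim : ∀ i, HasResidueDim (OrdOp F Δ) (N i ⧸ (nextTerm N i).submoduleOf (N i)) (f i)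

variable [Module F V] [IsScalarTower F Δᵐᵒᵖ V]
variable {F Δ} [ValuativeRel F] {L : Type*} [Field L] [Algebra F L]

/-- `(O_L, O_Δ)`-flags in `V` of type `(ι, f)`. -/
structure BiFlag (ι : L →ₐ[F] Module.End Δᵐᵒᵖ V) {r : ℕ} (f : Fin r → ℕ) where
  N : Fin r → Submodule (OrdOp F Δ) V
  isFlag : IsFlag F Δ f N
  stable : ∀ i, ∀ a ∈ integralClosure 𝒪[F] L, ∀ v ∈ N i, ι a v ∈ N i

namespace BiFlag

variable {ι : L →ₐ[F] Module.End Δᵐᵒᵖ V} {r : ℕ} {f : Fin r → ℕ}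

/-- Morphisms of `(O_L, O_Δ)`-flags. -/
def IsHom (N N' : BiFlag ι f) (φ : Module.End Δᵐᵒᵖ V) : Prop :=
  (∀ i, ∀ v ∈ N.N i, φ v ∈ N'.N i) ∧ ∀ a ∈ integralClosure 𝒪[F] L, φ * ι a = ι a * φ

theorem IsHom.one (N : BiFlag ι f) : IsHom N N 1 :=
  ⟨fun _ _ h => h, fun a _ => by rw [one_mul, mul_one]⟩

theorem IsHom.mul {N N' N'' : BiFlag ι f} {φ ψ : Module.End Δᵐᵒᵖ V}
    (hψ : IsHom N' N'' ψ) (hφ : IsHom N N' φ) : IsHom N N'' (ψ * φ) :=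
  ⟨fun i v h => hψ.1 i _ (hφ.1 i v h), fun a ha => by
    rw [mul_assoc, hφ.2 a ha, ← mul_assoc, hψ.2 a ha, mul_assoc]⟩

/-- The endomorphism ring of an `(O_L, O_Δ)`-flag. -/
def endRing (N : BiFlag ι f) : Subring (Module.End Δᵐᵒᵖ V) where
  carrier := {φ | IsHom N N φ}
  zero_mem' := ⟨fun i _ _ => (N.N i).zero_mem, fun a _ => by rw [zero_mul, mul_zero]⟩
  one_mem' := IsHom.one N
  add_mem' h h' := ⟨fun i v hv => (N.N i).add_mem (h.1 i v hv) (h'.1 i v hv), fun a ha => by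
    rw [add_mul, mul_add, h.2 a ha, h'.2 a ha]⟩
  neg_mem' h := ⟨fun i v hv => (N.N i).neg_mem (h.1 i v hv), fun a ha => by
    rw [neg_mul, mul_neg, h.2 a ha]⟩
  mul_mem' h h' := IsHom.mul h h'

/-- Isomorphism of `(O_L, O_Δ)`-flags: there are mutually inverse morphisms. -/
instance isoSetoid (ι : L →ₐ[F] Module.End Δᵐᵒᵖ V) {r : ℕ} (f : Fin r → ℕ) :
    Setoid (BiFlag ι f) where
  r N N' := ∃ φ ψ, IsHom N N' φ ∧ IsHom N' N ψ ∧ ψ * φ = 1 ∧ φ * ψ = 1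
  iseqv :=
    { refl := fun N => ⟨1, 1, IsHom.one N, IsHom.one N, one_mul 1, one_mul 1⟩
      symm := fun ⟨φ, ψ, h1, h2, h3, h4⟩ => ⟨ψ, φ, h2, h1, h4, h3⟩
      trans := fun ⟨φ, ψ, h1, h2, h3, h4⟩ ⟨φ', ψ', h1', h2', h3', h4'⟩ =>
        ⟨φ' * φ, ψ * ψ', h1'.mul h1, h2.mul h2',
          by rw [mul_assoc, ← mul_assoc ψ', h3', one_mul, h3],
          by rw [mul_assoc, ← mul_assoc φ, h4, one_mul, h4']⟩ }

end BiFlag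

/-- `FL(O_L, O_Δ, m, ι, f)`: the set of isomorphism classes of `(O_L, O_Δ)`-flags. -/
abbrev FL (ι : L →ₐ[F] Module.End Δᵐᵒᵖ V) {r : ℕ} (f : Fin r → ℕ) : Type _ :=
  Quotient (BiFlag.isoSetoid ι f)

end Flags

section Splitting

variable {F Δ V L : Type*} [Field F] [DivisionRing Δ] [Algebra F Δ]
  [AddCommGroup V] [Module Δᵐᵒᵖ V] [Module F V] [IsScalarTower F Δᵐᵒᵖ V]
  [Field L] [Algebra F L]

/-- The right action of `L ⊗ Δ` on `V`: `v · (a ⊗ x) = ι(a)(v) x`, as a homomorphism to the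
opposite of `End_F(V)`. -/
def rightAct (ι : L →ₐ[F] Module.End Δᵐᵒᵖ V) : L ⊗[F] Δ →ₐ[F] (Module.End F V)ᵐᵒᵖ :=
  Algebra.TensorProduct.lift
    { toFun := fun a => MulOpposite.op ((ι a).restrictScalars F)
      map_one' := by rw [map_one]; rfl
      map_mul' := fun a b => by
        rw [mul_comm, map_mul]; rfl
      map_zero' := by rw [map_zero]; rfl
      map_add' := fun a b => by rw [map_add]; rfl
      commutes' := fun c => by rw [AlgHom.commutes]; rfl }
    { toFun := fun x => MulOpposite.op (Algebra.lsmul F F V (MulOpposite.op x))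
      map_one' := by rw [MulOpposite.op_one, map_one]; rfl
      map_mul' := fun x y => by rw [MulOpposite.op_mul, map_mul]; rfl
      map_zero' := by rw [MulOpposite.op_zero, map_zero]; rfl
      map_add' := fun x y => by rw [MulOpposite.op_add, map_add]; rfl
      commutes' := fun c => by
        rw [← MulOpposite.algebraMap_apply, AlgHom.commutes]; rfl }
    (fun a x => MulOpposite.unop_injective <| LinearMap.ext fun v =>
      ((ι a).map_smul (MulOpposite.op x) v).symm)

/-- `v · z` for `v : V` and `z : L ⊗ Δ`. -/
def rmul (ι : L →ₐ[F] Module.End Δᵐᵒᵖ V) (z : L ⊗[F] Δ) : Module.End F V :=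
  (rightAct ι z).unop

theorem rmul_tmul (ι : L →ₐ[F] Module.End Δᵐᵒᵖ V) (a : L) (x : Δ) (v : V) :
    rmul ι (a ⊗ₜ x) v = MulOpposite.op x • ι a v := rfl

theorem rmul_rmul (ι : L →ₐ[F] Module.End Δᵐᵒᵖ V) (z w : L ⊗[F] Δ) (v : V) :
    rmul ι w (rmul ι z v) = rmul ι (z * w) v := by
  simp [rmul, map_mul]

/-- The order `O_L ⊗ O_Δ` in `L ⊗ Δ`. -/
def tensorOrder (F Δ L : Type*) [Field F] [TopologicalSpace F] [ValuativeRel F] [DivisionRing Δ]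
    [Algebra F Δ] [Field L] [Algebra F L] : Subring (L ⊗[F] Δ) :=
  Subring.closure {z | ∃ a ∈ integralClosure 𝒪[F] L, ∃ x ∈ maxCompactSubring F Δ, z = a ⊗ₜ x}

variable {Δ' : Type*} [DivisionRing Δ'] [Algebra L Δ'] {t : ℕ}

/-- An isomorphism `L ⊗ Δ ≃ Mat_t(Δ')` of `L`-algebras that carries `O_L ⊗ O_Δ` onto the standard
Iwahori order: entries in `O_Δ'`, entries strictly below the diagonal in `𝔓_Δ'`. -/
def IsIwahori [TopologicalSpace F] [ValuativeRel F] [Algebra F Δ']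
    (Θ : L ⊗[F] Δ ≃ₐ[L] Matrix (Fin t) (Fin t) Δ') : Prop :=
  ∀ z, z ∈ tensorOrder F Δ L ↔ Θ z ∈ blockOrder (maxCompactSubring F Δ') (id : Fin t → Fin t)

/-- The element of `L ⊗ Δ` corresponding to `x • E_{k,l}`. -/
def unitElt (Θ : L ⊗[F] Δ ≃ₐ[L] Matrix (Fin t) (Fin t) Δ') (k l : Fin t) (x : Δ') : L ⊗[F] Δ :=
  Θ.symm (Matrix.single k l x)

theorem unitElt_mul (Θ : L ⊗[F] Δ ≃ₐ[L] Matrix (Fin t) (Fin t) Δ') (k l m : Fin t) (x y : Δ') :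
    unitElt Θ k l x * unitElt Θ l m y = unitElt Θ k m (x * y) := by
  simp [unitElt, ← map_mul]

variable [NeZero t]

/-- `V^{(t)} = V · E_{t,t}`; the last index of `Fin t` is written `Fin.rev 0`. -/
def corner (ι : L →ₐ[F] Module.End Δᵐᵒᵖ V) (Θ : L ⊗[F] Δ ≃ₐ[L] Matrix (Fin t) (Fin t) Δ') :
    Submodule F V :=
  LinearMap.range (rmul ι (unitElt Θ (Fin.rev 0) (Fin.rev 0) 1))

theorem rmul_unitElt_mem (ι : L →ₐ[F] Module.End Δᵐᵒᵖ V)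
    (Θ : L ⊗[F] Δ ≃ₐ[L] Matrix (Fin t) (Fin t) Δ') (k : Fin t) (x : Δ') (v : V) :
    rmul ι (unitElt Θ k (Fin.rev 0) x) v ∈ corner ι Θ :=
  ⟨rmul ι (unitElt Θ k (Fin.rev 0) x) v, by rw [rmul_rmul, unitElt_mul, mul_one]⟩

/-- The right `Δ'`-module structure of `V^{(t)}`: `v · x = v · (x E_{t,t})`. -/
instance cornerModule (ι : L →ₐ[F] Module.End Δᵐᵒᵖ V)
    (Θ : L ⊗[F] Δ ≃ₐ[L] Matrix (Fin t) (Fin t) Δ') : Module Δ'ᵐᵒᵖ (corner ι Θ) where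
  smul x v := ⟨rmul ι (unitElt Θ (Fin.rev 0) (Fin.rev 0) x.unop) v, rmul_unitElt_mem ι Θ _ _ _⟩
  one_smul := by
    rintro ⟨_, v, rfl⟩
    exact Subtype.ext (by
      change rmul ι (unitElt Θ (Fin.rev 0) (Fin.rev 0) 1) _ = _
      rw [rmul_rmul, unitElt_mul, mul_one])
  mul_smul x y v := Subtype.ext (by
    change rmul ι (unitElt Θ _ _ (y.unop * x.unop)) _ =
      rmul ι (unitElt Θ _ _ x.unop) (rmul ι (unitElt Θ _ _ y.unop) _)
    rw [rmul_rmul, unitElt_mul])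
  smul_zero x := Subtype.ext (map_zero _)
  smul_add x v w := Subtype.ext (map_add _ _ _)
  add_smul x y v := Subtype.ext (by
    change rmul ι (unitElt Θ _ _ (x.unop + y.unop)) _ =
      rmul ι (unitElt Θ _ _ x.unop) _ + rmul ι (unitElt Θ _ _ y.unop) _
    simp [unitElt, Matrix.single_add, rmul])
  zero_smul v := Subtype.ext (by
    change rmul ι (unitElt Θ _ _ 0) _ = 0
    simp [unitElt, rmul])

variable [TopologicalSpace F] [ValuativeRel F] [Algebra F Δ']
  {ι : L →ₐ[F] Module.End Δᵐᵒᵖ V} {r : ℕ} {f : Fin r → ℕ}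

/-- The `O_Δ'`-lattice `N_{i,j} = N_i · E_{t+1-j,t}` in `V^{(t)}`. -/
def doubleChain (Θ : L ⊗[F] Δ ≃ₐ[L] Matrix (Fin t) (Fin t) Δ') (N : BiFlag ι f)
    (i : Fin r) (j : Fin t) : Submodule (OrdOp F Δ') (corner ι Θ) :=
  Submodule.span _
    {w | ∃ v ∈ N.N i, w = ⟨rmul ι (unitElt Θ (Fin.rev j) (Fin.rev 0) 1) v,
      rmul_unitElt_mem ι Θ _ _ _⟩}

/-- The term after `N_{i,j}` in the chain
`N_{1,1}, …, N_{r,1}, N_{1,2}, …, N_{r,2}, …, N_{1,t}, …, N_{r,t}, N_{1,1} 𝔓_Δ'`. -/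
def nextDouble (Θ : L ⊗[F] Δ ≃ₐ[L] Matrix (Fin t) (Fin t) Δ') (N : BiFlag ι f)
    (i : Fin r) (j : Fin t) : Submodule (OrdOp F Δ') (corner ι Θ) :=
  if h : i.1 + 1 < r then doubleChain Θ N ⟨i.1 + 1, h⟩ j
  else if h' : j.1 + 1 < t then doubleChain Θ N ⟨0, i.pos⟩ ⟨j.1 + 1, h'⟩
  else maxIdeal (OrdOp F Δ') • doubleChain Θ N ⟨0, i.pos⟩ 0

/-- `g` is the vector `(f_{i,j})` of the flag `N`: `f_{i,j}` is the dimension over the residue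
division ring of `O_Δ'` of the quotient of `N_{i,j}` by the next term of the chain. -/
def HasVector (Θ : L ⊗[F] Δ ≃ₐ[L] Matrix (Fin t) (Fin t) Δ') (N : BiFlag ι f)
    (g : Fin r → Fin t → ℕ) : Prop :=
  ∀ i j, nextDouble Θ N i j ≤ doubleChain Θ N i j ∧
    HasResidueDim (OrdOp F Δ')
      (doubleChain Θ N i j ⧸ (nextDouble Θ N i j).submoduleOf (doubleChain Θ N i j)) (g i j)

end Splitting

section Blocks

/-- The positions of the nonzero entries of `g`, in the order
`(1,1), …, (r,1), (1,2), …, (r,2), …, (1,t), …, (r,t)`. -/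
abbrev Support {r t : ℕ} (g : Fin r → Fin t → ℕ) : Type :=
  {p : Fin t ×ₗ Fin r // g (ofLex p).2 (ofLex p).1 ≠ 0}

/-- Row and column indices of a matrix cut into blocks: one block of size `g_{i,j}` for each
nonzero entry `g_{i,j}`. -/
abbrev BlockIndex {r t : ℕ} (g : Fin r → Fin t → ℕ) : Type :=
  Σ p : Support g, Fin (g (ofLex p.1).2 (ofLex p.1).1)

/-- The hereditary order `Mat_{m'}(f, O)` where `f` lists the nonzero entries of `g` in
the reverse of the order `(1,1), …, (r,1), (1,2), …, (r,t)`. -/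
def hereditaryOrder {A : Type*} [Ring A] (O : Subring A) {r t : ℕ} (g : Fin r → Fin t → ℕ) :
    Subring (Matrix (BlockIndex g) (BlockIndex g) A) :=
  blockOrder O (fun k : BlockIndex g => OrderDual.toDual k.1)

end Blocks

end LocalFlag

end

universe u v w x y

/-!
# Flags over `O_L` and `O_Δ`, and hereditary orders

A finite-dimensional division algebra over a local field carries a discrete valuation
(`LocalFlag.exists_valuation`): the valuation of the norm is ultrametric because the elements of
bounded norm have bounded coordinates. Its ring is the maximal compact subring, its residue ring is
a finite field, and `e f = n` holds in the form `LocalFlag.resCard_pow_ramIdx`. Dimensions over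
residue fields are therefore computed as indices of lattices throughout.

**Classification of flags.** Let `Θ` identify `L ⊗ Δ` with `Mat_t(Δ')` and `O_L ⊗ O_Δ` with the
Iwahori order. Matrix units decompose `V` into `t` copies of `V^{(t)}`, and a lattice stable under
`O_L` into its components, which are lattices in `V^{(t)}` (`LocalFlag.piece`). Since `L` is
unramified, `O_L ⊗ (O_Δ / 𝔓_Δ)` is reduced; hence the ideal generated by `𝔓_Δ` is the preimage of
the radical of the Iwahori order (`LocalFlag.IsIwahori.mem_tball_neg_one_iff`). The radical is
generated by the cyclic shift matrix with one entry in `𝔓_Δ'`, so multiplication of a stable lattice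
by `𝔓_Δ` shifts its components cyclically (`LocalFlag.rowMap_mem_smul_iff_succ`,
`LocalFlag.rowMap_mem_smul_iff_last`). Thus the flags in `V` are the chains `N_{i,j}` in `V^{(t)}`
between a lattice and its multiple by `𝔓_Δ'`, and counting relates the dimensions
(`LocalFlag.HasVector.sum_eq`). Such a chain has an adapted basis (`LocalFlag.exists_flag_basis`),
by lifting bases of the successive quotients. Consequently the dimensions determine the chain up to
isomorphism (`LocalFlag.HasVector.equiv`), every array of dimensions with the right sums occurs
(`LocalFlag.exists_flag_of_vector`), and in an adapted basis the endomorphism ring is the hereditary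
order (`LocalFlag.endRing_iff`), the centralizer of `L` being `End_Δ'(V^{(t)})`
(`LocalFlag.centralizerMatrix`).

**Existence of `Δ'` and `Θ`.** The algebra `Δ` is generated by a root of unity `z` that generates
the residue field, of degree `d`, and a uniformizer `ϖ` that normalizes `⟨z⟩` and acts on it by a
generator of the Galois group (`LocalFlag.exists_cyclic_presentation`): Teichmüller representatives
give `z`, averaging over `⟨z⟩` gives `ϖ`. A suitable power `ω` of `z` has its eigenvalues in `L`,
and the projection `e` to an eigenspace of `1 ⊗ ω` in `L ⊗ Δ` has exactly `t` conjugates under `ϖ`,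
which are orthogonal with sum `1` (`LocalFlag.exists_isCornerIdem`). In the reduction of `O_L ⊗ O_Δ` the
idempotent `e` cuts out a domain. Therefore the levels for the filtration by the powers of `𝔓_Δ` are
additive on the corner ring `e (L ⊗ Δ) e` (`LocalFlag.IsCornerIdem.mem_tball_or_of_mul`), which thus
is a division algebra `Δ'`, with valuation given by the levels; these are multiples of `t`, because
`ϖ ^ k` maps `e` to a conjugate orthogonal to `e` unless `t` divides `k`. Finally `Θ` sends an
element to its matrix of components for the decomposition of `1` into the conjugates of `e`, and the
levels of the components show that it carries `O_L ⊗ O_Δ` to the Iwahori order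
(`LocalFlag.isIwahori_peirceEquiv`).
-/


open scoped WithZero
set_option linter.unusedSectionVars false

noncomputable section

namespace LocalFlag

/-! ### The valuation of the base field -/

section BaseField

variable (F : Type*) [Field F] [ValuativeRel F] [TopologicalSpace F]
  [IsNonarchimedeanLocalField F]

/-- The normalized valuation of the local field `F`, with values in `ℤᵐ⁰`. -/
def baseVal : Valuation F ℤᵐ⁰ :=
  (ValuativeRel.valuation F).map
    (MonoidWithZeroHom.ofClass
      (IsNonarchimedeanLocalField.valueGroupWithZeroIsoInt F))
    (OrderHomClass.mono (IsNonarchimedeanLocalField.valueGroupWithZeroIsoInt F))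

variable {F}

theorem baseVal_apply (x : F) : baseVal F x =
    IsNonarchimedeanLocalField.valueGroupWithZeroIsoInt F (ValuativeRel.valuation F x) := rfl

theorem baseVal_le_iff (x : F) (c : ℤᵐ⁰) : baseVal F x ≤ c ↔ ValuativeRel.valuation F x ≤
    (IsNonarchimedeanLocalField.valueGroupWithZeroIsoInt F).symm c := by
  rw [baseVal_apply, ← OrderIsoClass.map_le_map_iff
    (IsNonarchimedeanLocalField.valueGroupWithZeroIsoInt F).symm]
  simp

theorem mem_integers_iff (x : F) : x ∈ 𝒪[F] ↔ baseVal F x ≤ 1 := by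
  rw [baseVal_le_iff, map_one]; rfl

theorem baseVal_surjective : Function.Surjective (baseVal F) := fun c => by
  obtain ⟨x, hx⟩ := ValuativeRel.valuation_surjective
    ((IsNonarchimedeanLocalField.valueGroupWithZeroIsoInt F).symm c)
  exact ⟨x, by rw [baseVal_apply, hx]; simp⟩

theorem isCompact_baseVal_le (c : ℤᵐ⁰) : IsCompact {x : F | baseVal F x ≤ c} := by
  simp_rw [baseVal_le_iff]
  exact IsNonarchimedeanLocalField.isCompact_closedBall F _

/-- Balls of nonzero radius are open additive subgroups. -/
theorem isOpen_baseVal_le {c : ℤᵐ⁰} (hc : c ≠ 0) : IsOpen {x : F | baseVal F x ≤ c} := by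
  let H : AddSubgroup F :=
    { carrier := {x : F | baseVal F x ≤ c}
      zero_mem' := by simp
      add_mem' := fun {a b} ha hb => ((baseVal F).map_add a b).trans (max_le ha hb)
      neg_mem' := fun {a} ha => by simpa using ha }
  refine H.isOpen_of_mem_nhds (g := 0) ?_
  refine (IsValuativeTopology.hasBasis_nhds_zero' F).mem_iff.mpr
    ⟨(IsNonarchimedeanLocalField.valueGroupWithZeroIsoInt F).symm c, ?_, fun x hx => ?_⟩
  · simpa using hc
  · exact (baseVal_le_iff x c).mpr hx.le

theorem isClosed_baseVal_le {c : ℤᵐ⁰} (hc : c ≠ 0) : IsClosed {x : F | baseVal F x ≤ c} := by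
  let H : AddSubgroup F :=
    { carrier := {x : F | baseVal F x ≤ c}
      zero_mem' := by simp
      add_mem' := fun {a b} ha hb => ((baseVal F).map_add a b).trans (max_le ha hb)
      neg_mem' := fun {a} ha => by simpa using ha }
  exact H.isClosed_of_isOpen (isOpen_baseVal_le hc)

/-- The valuation is bounded on compact sets. -/
theorem exists_baseVal_le_of_isCompact {K : Set F} (hK : IsCompact K) :
    ∃ n : ℤ, ∀ x ∈ K, baseVal F x ≤ WithZero.exp n := by
  refine hK.elim_directed_cover (fun n : ℤ => {x : F | baseVal F x ≤ WithZero.exp n})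
    (fun n => isOpen_baseVal_le (by simp)) (fun x _ => ?_) ?_
  · rw [Set.mem_iUnion]
    by_cases hx : baseVal F x = 0
    · exact ⟨0, by simp [hx]⟩
    · exact ⟨WithZero.log (baseVal F x), by simp [WithZero.exp_log hx]⟩
  · exact (Monotone.directed_le (f := fun n : ℤ => {x : F | baseVal F x ≤ WithZero.exp n})
      fun a b hab x hx => le_trans hx (WithZero.exp_le_exp.mpr hab))

theorem isCompact_baseVal_eq {c : ℤᵐ⁰} (hc : c ≠ 0) : IsCompact {x : F | baseVal F x = c} := by
  obtain ⟨k, rfl⟩ : ∃ k : ℤ, c = WithZero.exp k := ⟨_, (WithZero.exp_log hc).symm⟩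
  have : {x : F | baseVal F x = WithZero.exp k} =
      {x : F | baseVal F x ≤ WithZero.exp k} ∩ {x : F | baseVal F x ≤ WithZero.exp (k - 1)}ᶜ := by
    ext x
    simp only [Set.mem_ofPred_eq, Set.mem_inter_iff, Set.mem_compl_iff, not_le]
    constructor
    · intro h; rw [h]; exact ⟨le_rfl, WithZero.exp_lt_exp.mpr (by omega)⟩
    · rintro ⟨h1, h2⟩
      have h0 : baseVal F x ≠ 0 := (zero_le.trans_lt h2).ne'
      rw [← WithZero.exp_log h0] at h1 h2 ⊢
      rw [WithZero.exp_le_exp] at h1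
      rw [WithZero.exp_lt_exp] at h2
      rw [WithZero.exp_inj]; omega
  rw [this]
  exact (isCompact_baseVal_le _).inter_right (isOpen_baseVal_le (by simp)).isClosed_compl

end BaseField

/-! ### The norm and the valuation of a division algebra -/

section IntegerPowers

/-- An element of a discrete value group with bounded powers is at most `1`. -/
theorem le_one_of_pow_le {x : ℤᵐ⁰} {n : ℤ} (h : ∀ k : ℕ, x ^ k ≤ WithZero.exp n) : x ≤ 1 := by
  by_contra hx
  rw [not_le] at hx
  have h0 : x ≠ 0 := (zero_le.trans_lt hx).ne'
  obtain ⟨m, rfl⟩ : ∃ m : ℤ, x = WithZero.exp m := ⟨_, (WithZero.exp_log h0).symm⟩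
  rw [← WithZero.exp_zero, WithZero.exp_lt_exp] at hx
  have h1 := h (n.toNat + 1)
  rw [← WithZero.exp_nsmul, WithZero.exp_le_exp, nsmul_eq_mul] at h1
  push_cast at h1
  have : n ≤ n.toNat := Int.self_le_toNat n
  nlinarith

theorem exists_eq_exp {x : ℤᵐ⁰} (hx : x ≠ 0) : ∃ m : ℤ, x = WithZero.exp m :=
  ⟨_, (WithZero.exp_log hx).symm⟩

end IntegerPowers

section NormValuation

variable {F : Type*} [Field F] [ValuativeRel F] [TopologicalSpace F]
  [IsNonarchimedeanLocalField F]

variable (F) in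
/-- An element of `F` of valuation `exp (-1)`. -/
def baseUnif : F := (baseVal_surjective (F := F) (WithZero.exp (-1))).choose

theorem baseVal_baseUnif : baseVal F (baseUnif F) = WithZero.exp (-1) :=
  (baseVal_surjective (F := F) (WithZero.exp (-1))).choose_spec

theorem baseUnif_ne_zero : baseUnif F ≠ 0 := fun h => by
  have := baseVal_baseUnif (F := F)
  rw [h, map_zero] at this
  exact WithZero.exp_ne_zero this.symm

theorem baseUnif_mem : baseUnif F ∈ 𝒪[F] := by
  rw [mem_integers_iff, baseVal_baseUnif, ← WithZero.exp_zero, WithZero.exp_le_exp]; norm_num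

variable (F) (D : Type*) [DivisionRing D] [Algebra F D]

/-- The valuation of the norm, i.e. of the determinant of left multiplication. -/
def normVal (x : D) : ℤᵐ⁰ := baseVal F (Algebra.norm F x)

/-- The elements whose coordinates with respect to a fixed basis have valuation at most `exp n`. -/
def coordBall [FiniteDimensional F D] (n : ℤ) : AddSubgroup D where
  carrier := {x | ∀ i, baseVal F ((Module.finBasis F D).repr x i) ≤ WithZero.exp n}
  zero_mem' i := by simp
  add_mem' {a b} ha hb i := by
    rw [map_add, Finsupp.add_apply]
    exact ((baseVal F).map_add _ _).trans (max_le (ha i) (hb i))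
  neg_mem' {a} ha i := by
    rw [map_neg, Finsupp.neg_apply, Valuation.map_neg]
    exact ha i

variable {F D}

theorem normVal_mul (x y : D) : normVal F D (x * y) = normVal F D x * normVal F D y := by
  simp [normVal]

theorem normVal_one : normVal F D 1 = 1 := by simp [normVal]

theorem normVal_pow (x : D) (n : ℕ) : normVal F D (x ^ n) = normVal F D x ^ n := by
  simp [normVal]

theorem normVal_ne_zero {x : D} (hx : x ≠ 0) : normVal F D x ≠ 0 := fun h => by
  have := normVal_mul (F := F) x x⁻¹
  rw [h, mul_inv_cancel₀ hx, normVal_one, zero_mul] at this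
  exact one_ne_zero this

variable [FiniteDimensional F D]

theorem normVal_zero : normVal F D 0 = 0 := by
  have : Algebra.norm F (0 : D) = 0 := by
    rw [Algebra.norm_apply, map_zero]
    have : Nonempty (Fin (Module.finrank F D)) := ⟨⟨0, Module.finrank_pos⟩⟩
    exact LinearMap.det_zero' (Module.finBasis F D)
  simp [normVal, this]

theorem normVal_algebraMap (c : F) :
    normVal F D (algebraMap F D c) = baseVal F c ^ Module.finrank F D := by
  rw [normVal, Algebra.norm_algebraMap, map_pow]

section Topology

/-- Boxes in coordinates are compact for the module topology. -/
theorem isCompact_image_coord (s : Fin (Module.finrank F D) → Set F) (hs : ∀ i, IsCompact (s i)) :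
    @IsCompact D (moduleTopology F D) {x | ∀ i, (Module.finBasis F D).repr x i ∈ s i} := by
  let : TopologicalSpace D := moduleTopology F D
  have : IsModuleTopology F D := ⟨rfl⟩
  have := IsModuleTopology.toContinuousAdd F D
  have h := (isCompact_univ_pi hs).image
    (IsModuleTopology.continuous_of_linearMap
      ((Module.finBasis F D).equivFun.symm : (Fin (Module.finrank F D) → F) →ₗ[F] D))
  convert h using 1
  ext x
  simp only [Set.mem_ofPred_eq, Set.mem_image, Set.mem_univ_pi]
  constructor
  · intro hx
    exact ⟨(Module.finBasis F D).equivFun x, hx, (Module.finBasis F D).equivFun.symm_apply_apply x⟩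
  · rintro ⟨y, hy, rfl⟩ i
    have := congrFun ((Module.finBasis F D).equivFun.apply_symm_apply y) i
    rw [Module.Basis.equivFun_apply] at this
    exact this ▸ hy i

theorem isCompact_coordBall (n : ℤ) :
    @IsCompact D (moduleTopology F D) (coordBall F D n : Set D) :=
  isCompact_image_coord _ fun _ => isCompact_baseVal_le _

theorem continuous_norm : @Continuous D F (moduleTopology F D) _ (Algebra.norm F) := by
  let : TopologicalSpace D := moduleTopology F D
  have : IsModuleTopology F D := ⟨rfl⟩
  have : (fun x : D => Algebra.norm F x) =
      fun x => (Algebra.leftMulMatrix (Module.finBasis F D) x).det := by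
    ext x; exact Algebra.norm_eq_matrix_det _ x
  change Continuous (fun x : D => Algebra.norm F x)
  rw [this]
  refine Continuous.matrix_det ?_
  exact IsModuleTopology.continuous_of_linearMap
    (Algebra.leftMulMatrix (Module.finBasis F D)).toLinearMap

theorem exists_normVal_le_of_isCompact {K : Set D} (hK : @IsCompact D (moduleTopology F D) K) :
    ∃ n : ℤ, ∀ x ∈ K, normVal F D x ≤ WithZero.exp n := by
  let : TopologicalSpace D := moduleTopology F D
  obtain ⟨n, hn⟩ := exists_baseVal_le_of_isCompact (hK.image continuous_norm)
  exact ⟨n, fun x hx => hn _ ⟨x, hx, rfl⟩⟩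

/-- On the elements whose coordinates have maximal valuation `1`, the norm is bounded below. -/
theorem exists_le_normVal :
    ∃ n : ℤ, ∀ x : D, (∀ i, baseVal F ((Module.finBasis F D).repr x i) ≤ 1) →
      (∃ i, baseVal F ((Module.finBasis F D).repr x i) = 1) → WithZero.exp n ≤ normVal F D x := by
  let : TopologicalSpace D := moduleTopology F D
  have key (j : Fin (Module.finrank F D)) : ∃ n : ℤ, ∀ x : D,
      (∀ i, baseVal F ((Module.finBasis F D).repr x i) ≤ 1) →
      baseVal F ((Module.finBasis F D).repr x j) = 1 → (normVal F D x)⁻¹ ≤ WithZero.exp n := by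
    have hc := isCompact_image_coord (F := F) (D := D)
      (fun i => if i = j then {x | baseVal F x = 1} else {x | baseVal F x ≤ 1}) (fun i => by
        split_ifs
        · exact isCompact_baseVal_eq one_ne_zero
        · exact isCompact_baseVal_le _)
    have hinv : ContinuousOn (fun x : D => (Algebra.norm F x)⁻¹)
        {x | ∀ i, (Module.finBasis F D).repr x i ∈
          (if i = j then {x | baseVal F x = 1} else {x | baseVal F x ≤ 1} : Set F)} := by
      refine ContinuousOn.inv₀ continuous_norm.continuousOn fun x hx h0 => ?_
      have hx0 : x = 0 := by
        by_contra hne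
        exact normVal_ne_zero (F := F) hne (by simp [normVal, h0])
      have := hx j
      simp [hx0] at this
    obtain ⟨n, hn⟩ := exists_baseVal_le_of_isCompact (hc.image_of_continuousOn hinv)
    refine ⟨n, fun x h1 h2 => ?_⟩
    rw [normVal, ← map_inv₀]
    refine hn _ ⟨x, fun i => ?_, rfl⟩
    split_ifs with hij
    · subst hij; exact h2
    · exact h1 i
  choose m hm using key
  refine ⟨-∑ j, |m j|, fun x h1 ⟨j, hj⟩ => ?_⟩
  have hne : normVal F D x ≠ 0 := normVal_ne_zero fun h => by simp [h] at hj
  have h3 := hm j x h1 hj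
  obtain ⟨k, hk⟩ := exists_eq_exp hne
  rw [hk, ← WithZero.exp_neg, WithZero.exp_le_exp] at h3
  rw [hk, WithZero.exp_le_exp]
  have := Finset.single_le_sum (f := fun j => |m j|) (fun i _ => abs_nonneg _) (Finset.mem_univ j)
  have h4 := le_abs_self (m j)
  omega

/-- The elements of norm at most `exp n` have bounded coordinates. -/
theorem exists_mem_coordBall (k : ℤ) : ∃ n : ℤ, ∀ x : D, normVal F D x ≤ WithZero.exp k →
    x ∈ coordBall F D n := by
  obtain ⟨n, hn⟩ := exists_le_normVal (F := F) (D := D)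
  refine ⟨|k - n|, fun x hx => ?_⟩
  by_cases hx0 : x = 0
  · rw [hx0]; exact zero_mem _
  have : Nonempty (Fin (Module.finrank F D)) := ⟨⟨0, Module.finrank_pos⟩⟩
  have hd : 0 < Module.finrank F D := Module.finrank_pos
  obtain ⟨j, hj⟩ := Finite.exists_max fun i => baseVal F ((Module.finBasis F D).repr x i)
  have hj0 : baseVal F ((Module.finBasis F D).repr x j) ≠ 0 := fun h => by
    refine hx0 ((Module.finBasis F D).repr.map_eq_zero_iff.mp (Finsupp.ext fun i => ?_))
    have := hj i
    rw [h, le_zero_iff, Valuation.zero_iff] at this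
    exact this
  obtain ⟨e, he⟩ := exists_eq_exp hj0
  have hv : baseVal F (baseUnif F ^ e) = WithZero.exp (-e) := by
    rw [map_zpow₀, baseVal_baseUnif, ← WithZero.exp_zsmul]; simp
  have h1 := hn (baseUnif F ^ e • x) (fun i => ?_) ⟨j, ?_⟩
  · rw [Algebra.smul_def, normVal_mul, normVal_algebraMap, hv, ← WithZero.exp_nsmul] at h1
    have h2 := h1.trans (mul_le_mul_right hx _)
    rw [← WithZero.exp_add, WithZero.exp_le_exp, nsmul_eq_mul] at h2
    intro i
    refine (hj i).trans ?_
    simp only [he]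
    rw [WithZero.exp_le_exp]
    have h3 := le_abs_self (k - n)
    by_contra hlt
    push Not at hlt
    have h4 : 0 ≤ |k - n| := abs_nonneg _
    have h5 : (1 : ℤ) ≤ Module.finrank F D := by exact_mod_cast hd
    nlinarith
  · rw [map_smul, Finsupp.smul_apply, smul_eq_mul, map_mul, hv]
    refine (mul_le_mul_right (hj i) _).trans ?_
    simp only [he]
    rw [← WithZero.exp_add]; simp
  · rw [map_smul, Finsupp.smul_apply, smul_eq_mul, map_mul, hv, he, ← WithZero.exp_add]; simp

/-- For `x` of norm at most `1` the powers of `x`, hence also those of `x + 1`, lie in a fixed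
compact coordinate ball, so the norms of the powers of `x + 1` are bounded. -/
theorem normVal_add_one_le {x : D} (hx : normVal F D x ≤ 1) : normVal F D (x + 1) ≤ 1 := by
  obtain ⟨n, hn⟩ := exists_mem_coordBall (F := F) (D := D) 0
  obtain ⟨c, hc⟩ := exists_normVal_le_of_isCompact (isCompact_coordBall (F := F) (D := D) n)
  refine le_one_of_pow_le (n := c) fun k => ?_
  rw [← normVal_pow]
  refine hc _ ?_
  rw [SetLike.mem_coe, (Commute.one_right x).add_pow]
  refine sum_mem fun m _ => ?_
  rw [one_pow, mul_one, ← nsmul_eq_mul']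
  refine nsmul_mem (hn _ ?_) _
  rw [normVal_pow]
  exact pow_le_one₀ zero_le hx

/-- The valuation of the norm is ultrametric, by the case `y = 1`. -/
theorem normVal_add_le (x y : D) :
    normVal F D (x + y) ≤ max (normVal F D x) (normVal F D y) := by
  wlog h : normVal F D x ≤ normVal F D y generalizing x y
  · rw [add_comm, max_comm]; exact this y x (le_of_not_ge h)
  rw [max_eq_right h]
  by_cases hy : y = 0
  · have h' := h
    rw [hy, normVal_zero, le_zero_iff] at h'
    have hx : x = 0 := by by_contra hx; exact normVal_ne_zero hx h'
    simp [hx, hy]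
  have h1 : x + y = (x * y⁻¹ + 1) * y := by
    rw [add_mul, mul_assoc, inv_mul_cancel₀ hy, mul_one, one_mul]
  rw [h1, normVal_mul]
  have h2 : normVal F D (x * y⁻¹) ≤ 1 := by
    have h3 : normVal F D (x * y⁻¹) * normVal F D y = normVal F D x := by
      rw [← normVal_mul, mul_assoc, inv_mul_cancel₀ hy, mul_one]
    have h4 := zero_lt_iff.mpr (normVal_ne_zero (F := F) hy)
    rw [← mul_le_mul_iff_left₀ h4, h3, one_mul]
    exact h
  calc _ ≤ 1 * normVal F D y := mul_le_mul_left (normVal_add_one_le h2) _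
    _ = _ := one_mul _

theorem isCompact_normVal_le : @IsCompact D (moduleTopology F D) {x | normVal F D x ≤ 1} := by
  let : TopologicalSpace D := moduleTopology F D
  obtain ⟨n, hn⟩ := exists_mem_coordBall (F := F) (D := D) 0
  have h1 := (isCompact_coordBall (F := F) (D := D) n).inter_right
    ((isClosed_baseVal_le (F := F) one_ne_zero).preimage continuous_norm)
  convert h1 using 1
  ext x
  exact ⟨fun hx => ⟨hn x hx, hx⟩, fun hx => hx.2⟩

end Topology

/-- The elements of norm at most `1` form a compact subring. Conversely, the powers of an element of
a compact subring have bounded norm. -/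
theorem mem_maxCompactSubring_iff_normVal (x : D) :
    x ∈ maxCompactSubring F D ↔ normVal F D x ≤ 1 := by
  let S : Subring D :=
    { carrier := {x | normVal F D x ≤ 1}
      zero_mem' := by simp [normVal_zero]
      one_mem' := by simp [normVal_one]
      add_mem' := fun {a b} ha hb => (normVal_add_le a b).trans (max_le ha hb)
      mul_mem' := fun {a b} ha hb => by
        rw [Set.mem_ofPred_eq, normVal_mul]; exact mul_le_one' ha hb
      neg_mem' := fun {a} ha => by
        rw [Set.mem_ofPred_eq] at ha ⊢
        refine le_one_of_pow_le (n := 0) fun k => ?_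
        rw [← normVal_pow]
        have h : normVal F D ((-a) ^ k) ^ 2 = normVal F D (a ^ k) ^ 2 := by
          simp only [← normVal_pow, ← pow_mul, (even_two.mul_left k).neg_pow]
        rw [WithZero.exp_zero, ← pow_le_one_iff (n := 2) two_ne_zero, h]
        refine pow_le_one₀ zero_le ?_
        rw [normVal_pow]
        exact pow_le_one₀ zero_le ha }
  have hS : maxCompactSubring F D = S := by
    refine le_antisymm (sSup_le fun T hT y hy => ?_) (le_sSup isCompact_normVal_le)
    obtain ⟨n, hn⟩ := exists_normVal_le_of_isCompact hT
    refine le_one_of_pow_le (n := n) fun k => ?_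
    rw [← normVal_pow]
    exact hn _ (pow_mem hy k)
  rw [hS]; rfl

variable (F D) in
/-- A finite-dimensional division algebra over a local field carries a normalized discrete
valuation whose ring is the maximal compact subring. -/
theorem exists_valuation : ∃ v : Valuation D ℤᵐ⁰, Function.Surjective v ∧
    ∀ x, x ∈ maxCompactSubring F D ↔ v x ≤ 1 := by
  -- the values of the norm form a nonzero subgroup of `ℤ`; divide by its generator
  let H : AddSubgroup ℤ :=
    { carrier := {n | ∃ x : D, normVal F D x = WithZero.exp n}
      zero_mem' := ⟨1, by simp [normVal_one]⟩
      add_mem' := fun {a b} ⟨x, hx⟩ ⟨y, hy⟩ => ⟨x * y, by rw [normVal_mul, hx, hy]; rfl⟩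
      neg_mem' := fun {a} ⟨x, hx⟩ => ⟨x⁻¹, by
        have hx0 : x ≠ 0 := fun h => by
          rw [h, normVal_zero] at hx; exact WithZero.exp_ne_zero hx.symm
        have := normVal_mul (F := F) x x⁻¹
        rw [mul_inv_cancel₀ hx0, normVal_one, hx] at this
        rw [WithZero.exp_neg]
        exact (eq_inv_of_mul_eq_one_right this.symm)⟩ }
  obtain ⟨g, hg⟩ := Int.subgroup_cyclic H
  have hgH : ∀ n, n ∈ H ↔ g ∣ n := fun n => by
    rw [hg, ← AddSubgroup.zmultiples_eq_closure, Int.mem_zmultiples_iff]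
  have hg0 : g ≠ 0 := fun h => by
    have h1 : -(Module.finrank F D : ℤ) ∈ H := ⟨algebraMap F D (baseUnif F), by
      rw [normVal_algebraMap, baseVal_baseUnif, ← WithZero.exp_nsmul]; simp⟩
    rw [hgH, h, zero_dvd_iff, neg_eq_zero, Nat.cast_eq_zero] at h1
    exact Module.finrank_pos.ne' h1
  have hg' : 0 < |g| := abs_pos.mpr hg0
  have key : ∀ x : D, x ≠ 0 → ∃ n : ℤ, normVal F D x = WithZero.exp (|g| * n) := fun x hx => by
    obtain ⟨m, hm⟩ := exists_eq_exp (normVal_ne_zero (F := F) hx)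
    obtain ⟨n, rfl⟩ : |g| ∣ m := (abs_dvd g m).mpr ((hgH m).mp ⟨x, hm⟩)
    exact ⟨n, hm⟩
  classical
  choose! k hk using key
  let w : D → ℤᵐ⁰ := fun x => if x = 0 then 0 else WithZero.exp (k x)
  have w0 : w 0 = 0 := if_pos rfl
  have hw : ∀ x (n : ℤ), w x = WithZero.exp n ↔ normVal F D x = WithZero.exp (|g| * n) := by
    intro x n
    by_cases hx : x = 0
    · rw [hx, w0, normVal_zero]
      exact ⟨fun h => absurd h.symm WithZero.exp_ne_zero,
        fun h => absurd h.symm WithZero.exp_ne_zero⟩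
    · have h1 : w x = WithZero.exp (k x) := if_neg hx
      rw [h1, hk x hx, WithZero.exp_inj, WithZero.exp_inj]
      exact ⟨fun h => by rw [h], fun h => mul_left_cancel₀ hg'.ne' h⟩
  have hwn : ∀ x, x ≠ 0 → ∃ n : ℤ, w x = WithZero.exp n := fun x hx => ⟨_, if_neg hx⟩
  have hle : ∀ x y, w x ≤ w y ↔ normVal F D x ≤ normVal F D y := by
    intro x y
    by_cases hx : x = 0
    · simp [hx, w0, normVal_zero]
    obtain ⟨n, hn⟩ := hwn x hx
    have hn' := (hw x n).mp hn
    by_cases hy : y = 0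
    · simp [hy, w0, normVal_zero, hn, hn']
    obtain ⟨m, hm⟩ := hwn y hy
    have hm' := (hw y m).mp hm
    rw [hn, hm, hn', hm', WithZero.exp_le_exp, WithZero.exp_le_exp, mul_le_mul_iff_right₀ hg']
  have w1 : w 1 = 1 := by
    rw [← WithZero.exp_zero, hw, normVal_one]; simp
  let v : Valuation D ℤᵐ⁰ :=
    { toFun := w
      map_zero' := w0
      map_one' := w1
      map_mul' := fun x y => by
        by_cases hx : x = 0
        · simp [hx, w0]
        by_cases hy : y = 0
        · simp [hy, w0]
        obtain ⟨n, hn⟩ := hwn x hx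
        obtain ⟨m, hm⟩ := hwn y hy
        rw [hn, hm, ← WithZero.exp_add, hw, normVal_mul, (hw x n).mp hn, (hw y m).mp hm, mul_add,
          WithZero.exp_add]
      map_add_le_max' := fun x y => by
        rcases le_total (w x) (w y) with h | h
        · rw [max_eq_right h, hle]
          exact (normVal_add_le x y).trans_eq (max_eq_right ((hle x y).mp h))
        · rw [max_eq_left h, hle]
          exact (normVal_add_le x y).trans_eq (max_eq_left ((hle y x).mp h)) }
  refine ⟨v, fun c => ?_, fun x => ?_⟩
  · by_cases hc : c = 0
    · exact ⟨0, by rw [hc]; exact w0⟩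
    · obtain ⟨n, rfl⟩ := exists_eq_exp hc
      obtain ⟨x, hx⟩ := (hgH (|g| * n)).mpr (Dvd.dvd.mul_right (self_dvd_abs g) n)
      exact ⟨x, (hw x n).mpr hx⟩
  · have h1 := hle x 1
    rw [w1, normVal_one] at h1
    exact (mem_maxCompactSubring_iff_normVal x).trans h1.symm

end NormValuation

/-! ### Valuation rings and residue rings -/

section ValuationRings

variable {E : Type*} [DivisionRing E]

/-- The elements of valuation at most `exp n`. -/
def ball (v : Valuation E ℤᵐ⁰) (n : ℤ) : AddSubgroup E where
  carrier := {x | v x ≤ WithZero.exp n}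
  zero_mem' := by simp
  add_mem' {a b} ha hb := (v.map_add a b).trans (max_le ha hb)
  neg_mem' {a} ha := by rw [Set.mem_ofPred_eq, v.map_neg]; exact ha

theorem mem_ball {v : Valuation E ℤᵐ⁰} {n : ℤ} {x : E} : x ∈ ball v n ↔ v x ≤ WithZero.exp n :=
  Iff.rfl

theorem ball_mono (v : Valuation E ℤᵐ⁰) {m n : ℤ} (h : m ≤ n) : ball v m ≤ ball v n :=
  fun _ hx => le_trans hx (WithZero.exp_le_exp.mpr h)

theorem lt_exp_iff {x : ℤᵐ⁰} {n : ℤ} : x < WithZero.exp n ↔ x ≤ WithZero.exp (n - 1) := by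
  by_cases hx : x = 0
  · simp [hx]
  obtain ⟨m, rfl⟩ := exists_eq_exp hx
  rw [WithZero.exp_lt_exp, WithZero.exp_le_exp]; omega

theorem lt_one_iff {x : ℤᵐ⁰} : x < 1 ↔ x ≤ WithZero.exp (-1) := by
  rw [← WithZero.exp_zero, lt_exp_iff]; simp

/-- The opposite of a valuation. -/
def opVal (v : Valuation E ℤᵐ⁰) : Valuation Eᵐᵒᵖ ℤᵐ⁰ where
  toFun x := v x.unop
  map_zero' := by simp
  map_one' := by simp
  map_mul' x y := by rw [MulOpposite.unop_mul, map_mul, mul_comm]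
  map_add_le_max' x y := v.map_add _ _

theorem opVal_apply (v : Valuation E ℤᵐ⁰) (x : Eᵐᵒᵖ) : opVal v x = v x.unop := rfl

variable {v : Valuation E ℤᵐ⁰} {R : Subring E}

/-- In the ring of a valuation, the largest proper two-sided ideal consists of the non-units. -/
theorem mem_maxIdeal_iff (hR : ∀ x, x ∈ R ↔ v x ≤ 1) (x : R) :
    x ∈ maxIdeal R ↔ v x < 1 := by
  let I : TwoSidedIdeal R := TwoSidedIdeal.mk' {x : R | v x < 1} (by simp)
    (fun {x y} hx hy => lt_of_le_of_lt (v.map_add x y) (max_lt hx hy))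
    (fun {x} hx => by
      rw [Set.mem_ofPred_eq, Subring.coe_neg, v.map_neg]; exact hx)
    (fun {x y} hy => by
      rw [Set.mem_ofPred_eq, Subring.coe_mul, map_mul]
      exact (mul_le_of_le_one_left' ((hR x).mp x.2)).trans_lt hy)
    (fun {x y} hx => by
      rw [Set.mem_ofPred_eq, Subring.coe_mul, map_mul]
      exact (mul_le_of_le_one_right' ((hR y).mp y.2)).trans_lt hx)
  have hI : ∀ x, x ∈ I ↔ v x < 1 := fun x => TwoSidedIdeal.mem_mk' _ _ _ _ _ _ _
  have h : sSup {I : TwoSidedIdeal R | I ≠ ⊤} = I := by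
    refine le_antisymm (sSup_le fun J hJ y hy => ?_) (le_sSup fun h => ?_)
    · rw [hI]
      by_contra hlt
      have h1 : v y = 1 := le_antisymm ((hR y).mp y.2) (not_lt.mp hlt)
      have hy0 : (y : E) ≠ 0 := fun h => by simp [h] at h1
      have hy1 : (y : E)⁻¹ ∈ R := by rw [hR, map_inv₀, h1, inv_one]
      refine hJ ((TwoSidedIdeal.one_mem_iff J).mp ?_)
      have : (⟨(y : E)⁻¹, hy1⟩ : R) * y = 1 := Subtype.ext (inv_mul_cancel₀ hy0)
      rw [← this]
      exact J.mul_mem_left _ _ hy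
    · have : (1 : R) ∈ I := by rw [h]; trivial
      rw [hI] at this
      simp at this
  rw [maxIdeal, h, TwoSidedIdeal.mem_asIdeal, hI]

theorem card_quotient_maxIdeal (hR : ∀ x, x ∈ R ↔ v x ≤ 1) :
    Nat.card (R ⧸ maxIdeal R) = (ball v (-1)).relIndex (ball v 0) := by
  have h0 : ball v 0 = R.toAddSubgroup := by
    ext x; rw [mem_ball, WithZero.exp_zero, ← hR]; rfl
  have h1 : (maxIdeal R).toAddSubgroup = (ball v (-1)).addSubgroupOf R.toAddSubgroup := by
    ext x
    rw [AddSubgroup.mem_addSubgroupOf, mem_ball, ← lt_one_iff]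
    exact mem_maxIdeal_iff hR x
  rw [h0, AddSubgroup.relIndex, ← h1]
  rfl

end ValuationRings

section DivisionAlgebra

variable (F : Type*) [Field F] [ValuativeRel F] [TopologicalSpace F]
  [IsNonarchimedeanLocalField F] (D : Type*) [DivisionRing D] [Algebra F D]
  [FiniteDimensional F D]

/-- The normalized valuation of a finite-dimensional division algebra over a local field. -/
def divVal : Valuation D ℤᵐ⁰ := (exists_valuation F D).choose

theorem divVal_surjective : Function.Surjective (divVal F D) :=
  (exists_valuation F D).choose_spec.1

variable {F D}

theorem mem_maxCompactSubring_iff (x : D) : x ∈ maxCompactSubring F D ↔ divVal F D x ≤ 1 :=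
  (exists_valuation F D).choose_spec.2 x

theorem mem_ordOp_iff (x : Dᵐᵒᵖ) : x ∈ OrdOp F D ↔ opVal (divVal F D) x ≤ 1 :=
  mem_maxCompactSubring_iff x.unop

theorem mem_maxIdeal_maxCompactSubring_iff (x : maxCompactSubring F D) :
    x ∈ maxIdeal (maxCompactSubring F D) ↔ divVal F D x < 1 :=
  mem_maxIdeal_iff mem_maxCompactSubring_iff x

variable (F D)

/-- A uniformizer. -/
def divUnif : D := (divVal_surjective F D (WithZero.exp (-1))).choose

theorem divVal_divUnif : divVal F D (divUnif F D) = WithZero.exp (-1) :=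
  (divVal_surjective F D (WithZero.exp (-1))).choose_spec

theorem divUnif_ne_zero : divUnif F D ≠ 0 := fun h => by
  have := divVal_divUnif F D
  rw [h, map_zero] at this
  exact WithZero.exp_ne_zero this.symm

/-- The cardinality of the residue division ring. -/
def resCard : ℕ := (ball (divVal F D) (-1)).relIndex (ball (divVal F D) 0)

theorem card_residue : Nat.card (maxCompactSubring F D ⧸ maxIdeal (maxCompactSubring F D)) =
    resCard F D := card_quotient_maxIdeal mem_maxCompactSubring_iff

theorem card_residue_op : Nat.card (OrdOp F D ⧸ maxIdeal (OrdOp F D)) = resCard F D := by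
  rw [card_quotient_maxIdeal mem_ordOp_iff, resCard]
  let e : D →+ Dᵐᵒᵖ := MulOpposite.opAddEquiv.toAddMonoidHom
  have h (n : ℤ) : ball (opVal (divVal F D)) n = (ball (divVal F D) n).map e := by
    ext x
    constructor
    · intro hx; exact ⟨x.unop, hx, rfl⟩
    · rintro ⟨y, hy, rfl⟩; exact hy
  rw [h, h]
  exact AddSubgroup.relIndex_map_map_of_injective _ _ MulOpposite.op_injective

variable {F D}

theorem divVal_algebraMap_le_one_iff (c : F) :
    divVal F D (algebraMap F D c) ≤ 1 ↔ baseVal F c ≤ 1 := by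
  rw [← mem_maxCompactSubring_iff, mem_maxCompactSubring_iff_normVal, normVal_algebraMap,
    pow_le_one_iff Module.finrank_pos.ne']

theorem divVal_algebraMap_lt_one_iff (c : F) :
    divVal F D (algebraMap F D c) < 1 ↔ baseVal F c < 1 := by
  by_cases hc : c = 0
  · simp [hc]
  have := (divVal_algebraMap_le_one_iff (D := D) c⁻¹).not
  rw [map_inv₀, map_inv₀, map_inv₀, not_le, not_le, one_lt_inv₀, one_lt_inv₀] at this
  · exact this
  · rw [zero_lt_iff, ne_eq, Valuation.zero_iff]; exact hc
  · rw [zero_lt_iff, ne_eq, Valuation.zero_iff, map_eq_zero]; exact hc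

variable (F D) in
theorem exists_ramification : ∃ e : ℕ, 0 < e ∧
    divVal F D (algebraMap F D (baseUnif F)) = WithZero.exp (-(e : ℤ)) := by
  obtain ⟨m, hm⟩ := exists_eq_exp (x := divVal F D (algebraMap F D (baseUnif F)))
    (by rw [ne_eq, Valuation.zero_iff, map_eq_zero]; exact baseUnif_ne_zero)
  have h := (divVal_algebraMap_lt_one_iff (D := D) (baseUnif F)).mpr (by
    rw [baseVal_baseUnif, lt_one_iff])
  rw [hm, ← WithZero.exp_zero, WithZero.exp_lt_exp] at h
  refine ⟨m.natAbs, by omega, ?_⟩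
  rw [hm, WithZero.exp_inj]; omega

variable (F D) in
/-- The ramification index `e` of `D` over `F`: in `D`, a uniformizer of `F` has valuation `exp
(-e)`. -/
def ramIdx : ℕ := (exists_ramification F D).choose

theorem ramIdx_pos : 0 < ramIdx F D := (exists_ramification F D).choose_spec.1

theorem divVal_algebraMap_baseUnif :
    divVal F D (algebraMap F D (baseUnif F)) = WithZero.exp (-(ramIdx F D : ℤ)) :=
  (exists_ramification F D).choose_spec.2

theorem divVal_algebraMap (c : F) :
    divVal F D (algebraMap F D c) = baseVal F c ^ ramIdx F D := by
  by_cases hc : c = 0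
  · simp [hc, ramIdx_pos.ne']
  obtain ⟨m, hm⟩ := exists_eq_exp (x := baseVal F c) (by simpa using hc)
  have h1 : ∃ u : F, baseVal F u = 1 ∧ c = u * baseUnif F ^ (-m) := by
    refine ⟨c * baseUnif F ^ m, ?_, ?_⟩
    · rw [map_mul, map_zpow₀, baseVal_baseUnif, hm, ← WithZero.exp_zsmul, ← WithZero.exp_add]
      simp
    · rw [mul_assoc, ← zpow_add₀ baseUnif_ne_zero]; simp
  obtain ⟨u, hu, hcu⟩ := h1
  have hu' : divVal F D (algebraMap F D u) = 1 := by
    refine le_antisymm ((divVal_algebraMap_le_one_iff u).mpr hu.le) (not_lt.mp fun h => ?_)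
    rw [divVal_algebraMap_lt_one_iff, hu] at h
    exact lt_irrefl _ h
  rw [hm]
  conv_lhs => rw [hcu]
  rw [map_mul, map_mul, hu', one_mul, map_zpow₀, map_zpow₀, divVal_algebraMap_baseUnif,
    ← WithZero.exp_zsmul, ← WithZero.exp_nsmul, WithZero.exp_inj]
  simp [mul_comm]

variable (F D) in
/-- The maximal compact subring as a lattice over the integers of `F`. -/
def intLattice : Submodule 𝒪[F] D where
  carrier := {x | divVal F D x ≤ 1}
  zero_mem' := by simp
  add_mem' {a b} ha hb := ((divVal F D).map_add a b).trans (max_le ha hb)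
  smul_mem' c x hx := by
    have h : c • x = algebraMap F D c * x := by
      rw [← Algebra.smul_def]; rfl
    rw [Set.mem_ofPred_eq, h, map_mul]
    exact mul_le_one' ((divVal_algebraMap_le_one_iff _).mpr ((mem_integers_iff _).mp c.2)) hx

theorem mem_intLattice (x : D) : x ∈ intLattice F D ↔ divVal F D x ≤ 1 := Iff.rfl

variable (F D) in
/-- The maximal compact subring lies in a lattice, as its elements have bounded coordinates. -/
theorem intLattice_fg : (intLattice F D).FG := by
  obtain ⟨n, hn⟩ := exists_mem_coordBall (F := F) (D := D) 0
  let b := Module.finBasis F D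
  let S : Submodule 𝒪[F] D := Submodule.span 𝒪[F] (Set.range fun i => (baseUnif F ^ (-n)) • b i)
  have hS : S.FG := Submodule.fg_span (Set.finite_range _)
  have hle : intLattice F D ≤ S := by
    intro x hx
    have hx' := hn x (by
      rw [WithZero.exp_zero, ← mem_maxCompactSubring_iff_normVal, mem_maxCompactSubring_iff]
      exact hx)
    rw [← b.sum_repr x]
    refine sum_mem fun i _ => ?_
    have hi : b.repr x i * baseUnif F ^ n ∈ 𝒪[F] := by
      rw [mem_integers_iff, map_mul, map_zpow₀, baseVal_baseUnif, ← WithZero.exp_zsmul]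
      refine (mul_le_mul_left (hx' i) _).trans ?_
      rw [← WithZero.exp_add]; simp
    have : b.repr x i • b i =
        (⟨b.repr x i * baseUnif F ^ n, hi⟩ : 𝒪[F]) • (baseUnif F ^ (-n) • b i) := by
      change _ = (b.repr x i * baseUnif F ^ n) • (baseUnif F ^ (-n) • b i)
      rw [smul_smul, mul_assoc, ← zpow_add₀ baseUnif_ne_zero]; simp
    rw [this]
    exact Submodule.smul_mem _ _ (Submodule.subset_span ⟨i, rfl⟩)
  have : IsNoetherian 𝒪[F] S := isNoetherian_of_fg_of_noetherian S hS
  exact Submodule.FG.of_le hS hle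

theorem baseVal_lt_one_of_mem_maximalIdeal {c : 𝒪[F]} (hc : c ∈ 𝓂[F]) :
    baseVal F (c : F) < 1 := by
  by_contra h
  have h1 : baseVal F (c : F) = 1 := le_antisymm ((mem_integers_iff _).mp c.2) (not_lt.mp h)
  have h0 : (c : F) ≠ 0 := fun h0 => by simp [h0] at h1
  refine (IsLocalRing.mem_maximalIdeal c).mp hc (IsUnit.of_mul_eq_one
    ⟨(c : F)⁻¹, by rw [mem_integers_iff, map_inv₀, h1, inv_one]⟩ (Subtype.ext ?_))
  exact mul_inv_cancel₀ h0

variable (F D) in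
theorem resCard_ne_zero : resCard F D ≠ 0 := by
  have hfg : (⊤ : Submodule 𝒪[F] (intLattice F D)).FG :=
    (Submodule.fg_top _).mpr (intLattice_fg F D)
  have h1 : Finite (𝒪[F] ⧸ 𝓂[F]) := inferInstanceAs (Finite 𝓀[F])
  have h2 : Finite (intLattice F D ⧸ (⊤ : Submodule 𝒪[F] (intLattice F D))) := inferInstance
  have h3 := Submodule.finite_quotient_smul 𝓂[F] hfg
  have h4 : (𝓂[F] • (⊤ : Submodule 𝒪[F] (intLattice F D))).toAddSubgroup ≤
      (ball (divVal F D) (-1)).addSubgroupOf (intLattice F D).toAddSubgroup := by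
    intro x hx
    rw [AddSubgroup.mem_addSubgroupOf, mem_ball, ← lt_one_iff]
    refine Submodule.smul_induction_on (p := fun x => divVal F D x.1 < 1) hx
      (fun c hc x _ => ?_) (fun x y hx hy => ?_)
    · have h : ((c • x : intLattice F D) : D) = algebraMap F D c * x := by
        rw [← Algebra.smul_def]; rfl
      rw [h, map_mul]
      exact mul_lt_one_of_lt_of_le ((divVal_algebraMap_lt_one_iff _).mpr
        (baseVal_lt_one_of_mem_maximalIdeal hc)) x.2
    · exact lt_of_le_of_lt ((divVal F D).map_add x y) (max_lt hx hy)
  have h0 : ball (divVal F D) 0 = (intLattice F D).toAddSubgroup := by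
    ext x; rw [mem_ball, WithZero.exp_zero]; rfl
  rw [resCard, h0, AddSubgroup.relIndex]
  have h5 : (𝓂[F] • (⊤ : Submodule 𝒪[F] (intLattice F D))).toAddSubgroup.index ≠ 0 :=
    AddSubgroup.index_ne_zero_iff_finite.mpr h3
  exact fun h => h5 (Nat.eq_zero_of_zero_dvd (h ▸ AddSubgroup.index_dvd_of_le h4))

/-- The maximal compact subring consists of the integral elements. -/
theorem mem_maxCompactSubring_iff_isIntegral (x : D) :
    x ∈ maxCompactSubring F D ↔ IsIntegral 𝒪[F] x := by
  rw [mem_maxCompactSubring_iff]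
  constructor
  · intro hx
    let A : Subalgebra 𝒪[F] D :=
      { intLattice F D with
        one_mem' := by simp [mem_intLattice]
        mul_mem' := fun {a b} ha hb => by
          change divVal F D (a * b) ≤ 1
          rw [map_mul]; exact mul_le_one' ha hb
        algebraMap_mem' := fun c =>
          (divVal_algebraMap_le_one_iff (D := D) (c : F)).mpr ((mem_integers_iff _).mp c.2) }
    have : Module.Finite 𝒪[F] A := Module.Finite.iff_fg.mpr (intLattice_fg F D)
    have h1 : IsIntegral 𝒪[F] (⟨x, hx⟩ : A) := IsIntegral.of_finite _ _
    exact h1.map A.val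
  · rintro ⟨p, hp, hpx⟩
    by_contra hlt
    rw [not_le] at hlt
    have hx0 : divVal F D x ≠ 0 := (zero_le.trans_lt hlt).ne'
    rw [← Polynomial.aeval_def, Polynomial.aeval_eq_sum_range, Finset.sum_range_succ,
      hp.coeff_natDegree, one_smul] at hpx
    by_cases hdeg : p.natDegree = 0
    · rw [hdeg] at hpx; simp at hpx
    have h1 : divVal F D (x ^ p.natDegree) ≤ divVal F D x ^ (p.natDegree - 1) := by
      rw [eq_neg_of_add_eq_zero_right hpx, Valuation.map_neg]
      refine Valuation.map_sum_le _ fun i hi => ?_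
      have h : p.coeff i • x ^ i = algebraMap F D (p.coeff i) * x ^ i := by
        rw [← Algebra.smul_def]; rfl
      rw [h, map_mul, map_pow]
      refine (mul_le_of_le_one_left' ((divVal_algebraMap_le_one_iff _).mpr
        ((mem_integers_iff _).mp (p.coeff i).2))).trans ?_
      exact pow_le_pow_right₀ hlt.le (by rw [Finset.mem_range] at hi; omega)
    rw [map_pow] at h1
    exact absurd h1 (not_le.mpr (pow_lt_pow_right₀ hlt (by omega)))

end DivisionAlgebra

/-! ### Integral bases and the fundamental identity -/

section Index

/-- The index of a product of subgroups is the product of the indices. -/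
theorem relIndex_pi {ι : Type*} [Fintype ι] {A : ι → Type*} [∀ i, AddCommGroup (A i)]
    (H G : ∀ i, AddSubgroup (A i)) :
    (AddSubgroup.pi Set.univ H).relIndex (AddSubgroup.pi Set.univ G) =
      ∏ i, (H i).relIndex (G i) := by
  let f : (∀ i, A i) →+ ∀ i, A i ⧸ H i :=
    { toFun := fun x i => (x i : A i ⧸ H i)
      map_zero' := rfl
      map_add' := fun _ _ => rfl }
  have hf : f.ker = AddSubgroup.pi Set.univ H := by
    ext x
    rw [AddMonoidHom.mem_ker, AddSubgroup.mem_pi, funext_iff]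
    exact forall_congr' fun i =>
      (QuotientAddGroup.eq_zero_iff (x i)).trans ⟨fun h _ => h, fun h => h trivial⟩
  have hG : (AddSubgroup.pi Set.univ G).map f =
      AddSubgroup.pi Set.univ fun i => (G i).map (QuotientAddGroup.mk' (H i)) := by
    ext y
    rw [AddSubgroup.mem_pi]
    constructor
    · rintro ⟨x, hx, rfl⟩ i hi
      exact ⟨x i, hx i hi, rfl⟩
    · intro h
      choose x hx hxy using fun i => h i trivial
      exact ⟨x, fun i _ => hx i, funext hxy⟩
  rw [← hf, AddSubgroup.relIndex_ker, hG]
  have e : (AddSubgroup.pi Set.univ fun i => (G i).map (QuotientAddGroup.mk' (H i))) ≃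
      ∀ i, (G i).map (QuotientAddGroup.mk' (H i)) :=
    { toFun := fun x i => ⟨x.1 i, x.2 i trivial⟩
      invFun := fun x => ⟨fun i => x i, fun i _ => (x i).2⟩
      left_inv := fun _ => rfl
      right_inv := fun _ => rfl }
  rw [Nat.card_congr e, Nat.card_pi]
  refine Finset.prod_congr rfl fun i _ => ?_
  rw [← AddSubgroup.relIndex_ker, QuotientAddGroup.ker_mk']

/-- Indices may be computed in coordinates. -/
theorem relIndex_comap_of_surjective {A B : Type*} [AddCommGroup A] [AddCommGroup B] (f : A →+ B)
    (hf : Function.Surjective f) (H K : AddSubgroup B) :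
    (H.comap f).relIndex (K.comap f) = H.relIndex K := by
  rw [AddSubgroup.relIndex_comap, AddSubgroup.map_comap_eq_self_of_surjective hf]

theorem relIndex_comap_pi {A : Type*} [AddCommGroup A] {ι : Type*} [Fintype ι] {B : ι → Type*}
    [∀ i, AddCommGroup (B i)] (f : A →+ ∀ i, B i) (hf : Function.Surjective f)
    (H K : ∀ i, AddSubgroup (B i)) :
    ((AddSubgroup.pi Set.univ H).comap f).relIndex ((AddSubgroup.pi Set.univ K).comap f) =
      ∏ i, (H i).relIndex (K i) := by
  rw [relIndex_comap_of_surjective f hf, relIndex_pi]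

end Index

section IntegralBasis

variable (F : Type*) [Field F] [ValuativeRel F] [TopologicalSpace F]
  [IsNonarchimedeanLocalField F] (D : Type*) [DivisionRing D] [Algebra F D]
  [FiniteDimensional F D]

/-- The maximal compact subring is free over the integers of `F`. -/
theorem exists_integral_basis : ∃ a : Module.Basis (Fin (Module.finrank F D)) F D,
    ∀ x, x ∈ maxCompactSubring F D ↔ ∀ i, baseVal F (a.repr x i) ≤ 1 := by
  have hspan : Submodule.span F (intLattice F D : Set D) = ⊤ := by
    rw [eq_top_iff]
    intro x _
    obtain ⟨n, hn⟩ : ∃ n : ℕ, divVal F D (algebraMap F D (baseUnif F ^ n) * x) ≤ 1 := by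
      by_cases hx : x = 0
      · exact ⟨0, by simp [hx]⟩
      obtain ⟨m, hm⟩ := exists_eq_exp (x := divVal F D x) (by simpa using hx)
      refine ⟨m.natAbs, ?_⟩
      rw [map_mul, map_pow, map_pow, divVal_algebraMap_baseUnif, hm, ← WithZero.exp_nsmul,
        ← WithZero.exp_add, ← WithZero.exp_zero, WithZero.exp_le_exp]
      have h1 : (1 : ℤ) ≤ ramIdx F D := by exact_mod_cast ramIdx_pos
      have h2 : m ≤ |m| := le_abs_self m
      rw [nsmul_eq_mul, Int.natCast_natAbs]
      nlinarith [abs_nonneg m]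
    have h0 : baseUnif F ^ n ≠ 0 := pow_ne_zero _ baseUnif_ne_zero
    have : x = (baseUnif F ^ n)⁻¹ • (algebraMap F D (baseUnif F ^ n) * x) := by
      rw [← Algebra.smul_def, smul_smul, inv_mul_cancel₀ h0, one_smul]
    rw [this]
    exact Submodule.smul_mem _ _ (Submodule.subset_span hn)
  have : Submodule.IsLattice F (intLattice F D) := ⟨intLattice_fg F D, hspan⟩
  let b := Module.Free.chooseBasis 𝒪[F] (intLattice F D)
  let a := b.extendOfIsLattice F
  have hab : ∀ k, a k = b k := b.extendOfIsLattice_apply F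
  let e : Module.Free.ChooseBasisIndex 𝒪[F] (intLattice F D) ≃ Fin (Module.finrank F D) :=
    Fintype.equivFinOfCardEq (Module.finrank_eq_card_basis a).symm
  refine ⟨a.reindex e, fun x => ?_⟩
  rw [mem_maxCompactSubring_iff]
  constructor
  · intro hx i
    have h1 : x = ∑ k, ((b.repr ⟨x, hx⟩ k : 𝒪[F]) : F) • a k := by
      have := congrArg (Submodule.subtype _) (b.sum_repr ⟨x, hx⟩)
      rw [map_sum] at this
      refine this.symm.trans (Finset.sum_congr rfl fun k _ => ?_)
      rw [hab]; rfl
    rw [Module.Basis.repr_reindex_apply]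
    conv_lhs => rw [h1]
    rw [Module.Basis.repr_sum_self]
    exact (mem_integers_iff _).mp (b.repr ⟨x, hx⟩ (e.symm i)).2
  · intro h
    rw [← (a.reindex e).sum_repr x]
    refine Valuation.map_sum_le _ fun i _ => ?_
    rw [Algebra.smul_def, map_mul]
    refine mul_le_one' ((divVal_algebraMap_le_one_iff _).mpr (h i)) ?_
    rw [Module.Basis.reindex_apply, hab]
    exact (b _).2

/-- The cardinality of the residue field of `F`. -/
def baseCard : ℕ := (ball (baseVal F) (-1)).relIndex (ball (baseVal F) 0)

variable {F D}

/-- Multiplication by an element of valuation `exp k` shifts balls by `k`. -/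
theorem relIndex_ball_shift {E : Type*} [DivisionRing E] {v : Valuation E ℤᵐ⁰} {x : E} {k : ℤ}
    (hx : v x = WithZero.exp k) (m n : ℤ) :
    (ball v (m + k)).relIndex (ball v (n + k)) = (ball v m).relIndex (ball v n) := by
  have hx0 : x ≠ 0 := fun h => by
    rw [h, map_zero] at hx; exact WithZero.exp_ne_zero hx.symm
  have key (n : ℤ) : ball v (n + k) = (ball v n).map (AddMonoidHom.mulLeft x) := by
    ext y
    constructor
    · intro hy
      refine ⟨x⁻¹ * y, ?_, mul_inv_cancel_left₀ hx0 y⟩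
      rw [mem_ball, WithZero.exp_add] at hy
      change v _ ≤ _
      rw [map_mul, map_inv₀, hx, mul_comm, ← div_eq_mul_inv, div_le_iff₀ (by simp)]
      exact hy
    · rintro ⟨z, hz, rfl⟩
      change v (x * z) ≤ _
      rw [map_mul, hx, WithZero.exp_add, mul_comm]
      exact mul_le_mul_left hz _
  rw [key, key]
  exact AddSubgroup.relIndex_map_map_of_injective _ _ (mul_right_injective₀ hx0)

variable (F D)

theorem relIndex_ball_pow (n : ℕ) :
    (ball (divVal F D) (-(n : ℤ))).relIndex (ball (divVal F D) 0) = resCard F D ^ n := by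
  induction n with
  | zero => simp
  | succ n ih =>
    rw [pow_succ', ← ih, resCard]
    obtain ⟨x, hx⟩ := divVal_surjective F D (WithZero.exp (-(n : ℤ)))
    rw [← relIndex_ball_shift hx (-1) 0, zero_add, AddSubgroup.relIndex_mul_relIndex]
    · congr 2; push_cast; ring
    · exact ball_mono _ (by omega)
    · exact ball_mono _ (by omega)

/-- The fundamental identity `e f = n`, in terms of cardinalities. -/
theorem resCard_pow_ramIdx : resCard F D ^ ramIdx F D = baseCard F ^ Module.finrank F D := by
  obtain ⟨a, ha⟩ := exists_integral_basis F D
  have h0 : ball (divVal F D) 0 = (AddSubgroup.pi Set.univ fun _ => ball (baseVal F) 0).comap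
      (a.equivFun : D →+ (Fin (Module.finrank F D) → F)) := by
    ext x
    rw [mem_ball, WithZero.exp_zero, ← mem_maxCompactSubring_iff, ha]
    exact ⟨fun h i _ => h i, fun h i => h i trivial⟩
  have h1 : ball (divVal F D) (-(ramIdx F D : ℤ)) =
      (AddSubgroup.pi Set.univ fun _ => ball (baseVal F) (-1)).comap
        (a.equivFun : D →+ (Fin (Module.finrank F D) → F)) := by
    ext x
    have hmul : x = algebraMap F D (baseUnif F) * ((baseUnif F)⁻¹ • x) := by
      rw [← Algebra.smul_def, smul_smul, mul_inv_cancel₀ baseUnif_ne_zero, one_smul]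
    have h2 : x ∈ ball (divVal F D) (-(ramIdx F D : ℤ)) ↔
        (baseUnif F)⁻¹ • x ∈ maxCompactSubring F D := by
      rw [mem_ball, mem_maxCompactSubring_iff]
      conv_lhs => rw [hmul]
      rw [map_mul, divVal_algebraMap_baseUnif]
      nth_rewrite 2 [← mul_one (WithZero.exp (-(ramIdx F D : ℤ)))]
      exact mul_le_mul_iff_right₀ (by simp)
    rw [h2, ha]
    refine Iff.trans (forall_congr' fun i => ?_) (⟨fun h i _ => h i, fun h i => h i trivial⟩)
    rw [map_smul, Finsupp.smul_apply, smul_eq_mul, map_mul, map_inv₀, baseVal_baseUnif,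
      ← WithZero.exp_neg, neg_neg]
    change _ ↔ baseVal F (a.repr x i) ≤ WithZero.exp (-1)
    rw [WithZero.exp_neg, ← one_div, le_div_iff₀ (by simp), mul_comm]
  rw [← relIndex_ball_pow, h0, h1, relIndex_comap_pi _ a.equivFun.surjective]
  simp [baseCard]

end IntegralBasis

/-! ### Residue fields and unramified extensions -/

section ResidueRing

variable {E : Type*} [DivisionRing E] {v : Valuation E ℤᵐ⁰} {R : Subring E}

theorem maxIdeal_ne_top (hR : ∀ x, x ∈ R ↔ v x ≤ 1) : maxIdeal R ≠ ⊤ := fun h => by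
  have : (1 : R) ∈ maxIdeal R := by rw [h]; trivial
  rw [mem_maxIdeal_iff hR] at this
  simp at this

theorem nontrivial_residue (hR : ∀ x, x ∈ R ↔ v x ≤ 1) : Nontrivial (R ⧸ maxIdeal R) :=
  Ideal.Quotient.nontrivial_iff.mpr (maxIdeal_ne_top hR)

theorem isUnit_or_eq_zero_residue (hR : ∀ x, x ∈ R ↔ v x ≤ 1) (a : R ⧸ maxIdeal R) :
    IsUnit a ∨ a = 0 := by
  obtain ⟨x, rfl⟩ := Ideal.Quotient.mk_surjective a
  by_cases hx : v x < 1
  · exact Or.inr (Ideal.Quotient.eq_zero_iff_mem.mpr ((mem_maxIdeal_iff hR x).mpr hx))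
  · have h1 : v x = 1 := le_antisymm ((hR x).mp x.2) (not_lt.mp hx)
    have hx0 : (x : E) ≠ 0 := fun h => by simp [h] at h1
    exact Or.inl (IsUnit.map _ ⟨⟨x, ⟨(x : E)⁻¹, by rw [hR, map_inv₀, h1, inv_one]⟩,
      Subtype.ext (mul_inv_cancel₀ hx0), Subtype.ext (inv_mul_cancel₀ hx0)⟩, rfl⟩)

/-- The residue ring of a valuation ring is a division ring. -/
abbrev residueDivisionRing (hR : ∀ x, x ∈ R ↔ v x ≤ 1) : DivisionRing (R ⧸ maxIdeal R) :=
  let _ := nontrivial_residue hR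
  DivisionRing.ofIsUnitOrEqZero (isUnit_or_eq_zero_residue hR)

theorem residue_mk_eq_iff (hR : ∀ x, x ∈ R ↔ v x ≤ 1) (x y : R) :
    Ideal.Quotient.mk (maxIdeal R) x = Ideal.Quotient.mk (maxIdeal R) y ↔
      v (x - y : E) < 1 := by
  rw [Ideal.Quotient.mk_eq_mk_iff_sub_mem, mem_maxIdeal_iff hR]; rfl

/-- Residue dimensions over a valuation ring with finite residue ring are read off from
cardinalities. -/
theorem hasResidueDim_iff (hR : ∀ x, x ∈ R ↔ v x ≤ 1) (hfin : Nat.card (R ⧸ maxIdeal R) ≠ 0)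
    {M : Type*} [AddCommGroup M] [Module R M] (n : ℕ) :
    HasResidueDim R M n ↔ Module.IsTorsionBySet R M (maxIdeal R) ∧
      Nat.card M = Nat.card (R ⧸ maxIdeal R) ^ n := by
  let K : DivisionRing (R ⧸ maxIdeal R) := residueDivisionRing hR
  have hK : Finite (R ⧸ maxIdeal R) := Nat.finite_of_card_ne_zero hfin
  have hK1 : 1 < Nat.card (R ⧸ maxIdeal R) := Finite.one_lt_card
  constructor
  · rintro ⟨h, hr⟩
    refine ⟨h, ?_⟩
    let := h.module
    have : Module.Finite (R ⧸ maxIdeal R) M := Module.rank_lt_aleph0_iff.mp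
      (hr ▸ Cardinal.natCast_lt_aleph0)
    rw [Module.natCard_eq_pow_finrank (K := R ⧸ maxIdeal R), Module.finrank_eq_of_rank_eq hr]
  · rintro ⟨h, hc⟩
    refine ⟨h, ?_⟩
    let := h.module
    have : Finite M := Nat.finite_of_card_ne_zero (hc ▸ pow_ne_zero _ hfin)
    have : Module.Finite (R ⧸ maxIdeal R) M := Module.Finite.of_finite
    rw [Module.natCard_eq_pow_finrank (K := R ⧸ maxIdeal R)] at hc
    have := Nat.pow_right_injective hK1 hc
    change Module.rank (R ⧸ maxIdeal R) M = n
    rw [← this, Module.finrank_eq_rank]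

end ResidueRing

section ResidueField

variable {F : Type*} [Field F] [ValuativeRel F] [TopologicalSpace F]
  [IsNonarchimedeanLocalField F] {D : Type*} [DivisionRing D] [Algebra F D]
  [FiniteDimensional F D]

variable (F D) in
/-- The residue field of a division algebra; it is commutative by Wedderburn's theorem. -/
abbrev ResField : Type _ := maxCompactSubring F D ⧸ maxIdeal (maxCompactSubring F D)

theorem finite_resField : Finite (ResField F D) :=
  Nat.finite_of_card_ne_zero (by rw [card_residue]; exact resCard_ne_zero F D)

variable (F D) in
abbrev resField : Field (ResField F D) :=
  let _ := finite_resField (F := F) (D := D)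
  @littleWedderburn (ResField F D) (residueDivisionRing mem_maxCompactSubring_iff) _

/-- Commutators of integral elements lie in the maximal ideal, as the finite residue division ring
is commutative. -/
theorem divVal_commutator_lt_one {x y : D} (hx : divVal F D x ≤ 1) (hy : divVal F D y ≤ 1) :
    divVal F D (x * y - y * x) < 1 := by
  have hx' := (mem_maxCompactSubring_iff x).mpr hx
  have hy' := (mem_maxCompactSubring_iff y).mpr hy
  refine (residue_mk_eq_iff mem_maxCompactSubring_iff
    (⟨x, hx'⟩ * ⟨y, hy'⟩ : maxCompactSubring F D) (⟨y, hy'⟩ * ⟨x, hx'⟩)).mp ?_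
  rw [map_mul, map_mul]
  exact (resField F D).mul_comm _ _

theorem divVal_pow_resCard_sub_lt_one {x : D} (hx : divVal F D x ≤ 1) :
    divVal F D (x ^ resCard F D - x) < 1 := by
  have hx' := (mem_maxCompactSubring_iff x).mpr hx
  refine (residue_mk_eq_iff mem_maxCompactSubring_iff
    (⟨x, hx'⟩ ^ resCard F D : maxCompactSubring F D) ⟨x, hx'⟩).mp ?_
  rw [map_pow]
  let := resField F D
  have := finite_resField (F := F) (D := D)
  let := Fintype.ofFinite (ResField F D)
  rw [← card_residue, Nat.card_eq_fintype_card]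
  exact FiniteField.pow_card _

theorem one_lt_resCard : 1 < resCard F D := by
  rw [← card_residue]
  have := finite_resField (F := F) (D := D)
  have := nontrivial_residue (mem_maxCompactSubring_iff (F := F) (D := D))
  exact Finite.one_lt_card

variable (F D) in
/-- The residue field has prime power order `p ^ k`, where `p` is not a unit in the integers of `F`.
-/
theorem exists_resCard_eq_pow : ∃ p : ℕ, p.Prime ∧ baseVal F (p : F) < 1 ∧
    ∃ k, resCard F D = p ^ k := by
  let := resField F D
  have := finite_resField (F := F) (D := D)
  let := Fintype.ofFinite (ResField F D)
  obtain ⟨p, hp⟩ := CharP.exists (ResField F D)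
  obtain ⟨n, h1, h2⟩ := FiniteField.card (ResField F D) p
  refine ⟨p, h1, ?_, n, ?_⟩
  · rw [← divVal_algebraMap_lt_one_iff (D := D), map_natCast]
    have h3 := CharP.cast_eq_zero (ResField F D) p
    have h4 : Ideal.Quotient.mk (maxIdeal (maxCompactSubring F D)) (p : maxCompactSubring F D) =
        Ideal.Quotient.mk _ 0 := by
      rw [map_natCast, map_zero]; exact h3
    rw [residue_mk_eq_iff mem_maxCompactSubring_iff] at h4
    simpa using h4
  · rw [← card_residue, Nat.card_eq_fintype_card, h2]

variable (F) in
theorem exists_resChar : ∃ p : ℕ, p.Prime ∧ baseVal F (p : F) < 1 := by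
  obtain ⟨p, hp, h, -⟩ := exists_resCard_eq_pow F F
  exact ⟨p, hp, h⟩

variable (F) in
/-- The residue characteristic of a local field. -/
def resChar : ℕ := (exists_resChar F).choose

theorem resChar_prime : (resChar F).Prime := (exists_resChar F).choose_spec.1

theorem baseVal_resChar_lt_one : baseVal F (resChar F : F) < 1 := (exists_resChar F).choose_spec.2

/-- At most one prime number is a non-unit in the integers of `F`, since `1` is a combination of any
two. -/
theorem eq_resChar {p : ℕ} (hp : p.Prime) (h : baseVal F (p : F) < 1) : p = resChar F := by
  by_contra hne
  have hcop := Nat.isCoprime_iff_coprime.mpr ((Nat.coprime_primes hp resChar_prime).mpr hne)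
  obtain ⟨a, b, hab⟩ := hcop
  have hint (n : ℤ) : baseVal F (n : F) ≤ 1 := by
    rw [← mem_integers_iff]; exact intCast_mem _ n
  have h1 : ((a : F) * (p : F) + (b : F) * (resChar F : F)) = 1 := by
    have := congrArg (Int.cast : ℤ → F) hab
    push_cast at this
    exact this
  have h2 := (baseVal F).map_add (a * p : F) (b * resChar F)
  rw [h1, map_one, map_mul, map_mul] at h2
  refine absurd h2 (not_le.mpr (max_lt ?_ ?_))
  · exact (mul_le_of_le_one_left' (hint a)).trans_lt h
  · exact (mul_le_of_le_one_left' (hint b)).trans_lt baseVal_resChar_lt_one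

variable (F D) in
theorem exists_resCard_eq_resChar_pow : ∃ k, resCard F D = resChar F ^ k := by
  obtain ⟨p, hp, h, k, hk⟩ := exists_resCard_eq_pow F D
  rw [eq_resChar hp h] at hk
  exact ⟨k, hk⟩

end ResidueField

section Unramified

variable {F : Type*} [Field F] [ValuativeRel F] [TopologicalSpace F]
  [IsNonarchimedeanLocalField F] {L : Type*} [Field L] [Algebra F L] [FiniteDimensional F L]

theorem mem_integralClosure_iff (x : L) : x ∈ integralClosure 𝒪[F] L ↔ divVal F L x ≤ 1 := by
  rw [← mem_maxCompactSubring_iff, mem_maxCompactSubring_iff_isIntegral]; rfl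

theorem isUnit_integralClosure_iff (x : integralClosure 𝒪[F] L) :
    IsUnit x ↔ divVal F L x = 1 := by
  constructor
  · rintro ⟨u, rfl⟩
    refine le_antisymm ((mem_integralClosure_iff _).mp u.1.2) ?_
    have h1 : divVal F L ((u : integralClosure 𝒪[F] L) : L) *
        divVal F L ((u⁻¹ : (integralClosure 𝒪[F] L)ˣ) : integralClosure 𝒪[F] L) = 1 := by
      rw [← map_mul, ← MulMemClass.coe_mul, Units.mul_inv]; simp
    rw [← h1]
    exact mul_le_of_le_one_right' ((mem_integralClosure_iff _).mp (u⁻¹).1.2)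
  · intro h
    have h0 : (x : L) ≠ 0 := fun h0 => by simp [h0] at h
    exact IsUnit.of_mul_eq_one
      ⟨(x : L)⁻¹, by rw [mem_integralClosure_iff, map_inv₀, h, inv_one]⟩
      (Subtype.ext (mul_inv_cancel₀ h0))

instance isLocalRing_integralClosure : IsLocalRing (integralClosure 𝒪[F] L) := by
  refine IsLocalRing.of_nonunits_add fun x y hx hy => ?_
  rw [mem_nonunits_iff, isUnit_integralClosure_iff] at hx hy ⊢
  have hx' := lt_of_le_of_ne ((mem_integralClosure_iff _).mp x.2) hx
  have hy' := lt_of_le_of_ne ((mem_integralClosure_iff _).mp y.2) hy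
  exact ((Valuation.map_add _ _ _).trans_lt (max_lt hx' hy')).ne

instance finite_integralClosure : Module.Finite 𝒪[F] (integralClosure 𝒪[F] L) := by
  have h : Subalgebra.toSubmodule (integralClosure 𝒪[F] L) = intLattice F L := by
    ext x; exact mem_integralClosure_iff x
  exact Module.Finite.iff_fg.mpr (h ▸ intLattice_fg F L)

instance isLocalHom_integralClosure :
    IsLocalHom (algebraMap 𝒪[F] (integralClosure 𝒪[F] L)) := by
  refine ⟨fun c hc => ?_⟩
  rw [isUnit_integralClosure_iff] at hc
  have h1 : divVal F L (algebraMap F L c) = 1 := hc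
  by_contra h
  have h2 := baseVal_lt_one_of_mem_maximalIdeal ((IsLocalRing.mem_maximalIdeal c).mpr h)
  rw [← divVal_algebraMap_lt_one_iff (D := L), h1] at h2
  exact lt_irrefl _ h2

/-- Unramified extensions have ramification index `1`. -/
theorem ramIdx_eq_one [Algebra.FormallyUnramified 𝒪[F] (integralClosure 𝒪[F] L)] :
    ramIdx F L = 1 := by
  have h := Algebra.FormallyUnramified.map_maximalIdeal
    (R := 𝒪[F]) (S := integralClosure 𝒪[F] L)
  let u : integralClosure 𝒪[F] L := ⟨divUnif F L, by
    rw [mem_integralClosure_iff, divVal_divUnif, ← WithZero.exp_zero, WithZero.exp_le_exp]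
    norm_num⟩
  have hu : u ∈ IsLocalRing.maximalIdeal (integralClosure 𝒪[F] L) := by
    rw [IsLocalRing.mem_maximalIdeal, mem_nonunits_iff, isUnit_integralClosure_iff]
    change divVal F L (divUnif F L) ≠ 1
    rw [divVal_divUnif, ← WithZero.exp_zero, ne_eq, WithZero.exp_inj]; norm_num
  rw [← h] at hu
  have key : ∀ y ∈ (𝓂[F]).map (algebraMap 𝒪[F] (integralClosure 𝒪[F] L)),
      divVal F L (y : L) ≤ WithZero.exp (-(ramIdx F L : ℤ)) := by
    intro y hy
    refine Submodule.span_induction (fun z hz => ?_) (by simp) (fun a b _ _ ha hb => ?_)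
      (fun a b _ hb => ?_) hy
    · obtain ⟨c, hc, rfl⟩ := hz
      change divVal F L (algebraMap F L c) ≤ _
      rw [divVal_algebraMap]
      have h1 := baseVal_lt_one_of_mem_maximalIdeal hc
      rw [lt_one_iff] at h1
      refine (pow_le_pow_left₀ zero_le h1 _).trans_eq ?_
      rw [← WithZero.exp_nsmul]; simp
    · exact (Valuation.map_add _ _ _).trans (max_le ha hb)
    · rw [smul_eq_mul, MulMemClass.coe_mul, map_mul]
      exact (mul_le_of_le_one_left' ((mem_integralClosure_iff _).mp a.2)).trans hb
  have h2 := key u hu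
  change divVal F L (divUnif F L) ≤ _ at h2
  rw [divVal_divUnif, WithZero.exp_le_exp] at h2
  have := ramIdx_pos (F := F) (D := L)
  omega

end Unramified

/-! ### The order `O_L ⊗ O_Δ` and its reduction -/

section TensorOrder

variable {F : Type*} [Field F] [ValuativeRel F] [TopologicalSpace F]
  [IsNonarchimedeanLocalField F] {L : Type*} [Field L] [Algebra F L] [FiniteDimensional F L]
  {Δ : Type*} [DivisionRing Δ] [Algebra F Δ] [FiniteDimensional F Δ]

variable (F L) in
/-- A basis of `L` over `F` that is also a basis of the integers of `L` over those of `F`. -/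
def intBasis : Module.Basis (Fin (Module.finrank F L)) F L := (exists_integral_basis F L).choose

theorem divVal_le_one_iff_intBasis (x : L) :
    divVal F L x ≤ 1 ↔ ∀ i, baseVal F ((intBasis F L).repr x i) ≤ 1 := by
  rw [← mem_maxCompactSubring_iff]; exact (exists_integral_basis F L).choose_spec x

theorem divVal_intBasis_le_one (i) : divVal F L (intBasis F L i) ≤ 1 := by
  rw [divVal_le_one_iff_intBasis]
  intro j
  rw [Module.Basis.repr_self, Finsupp.single_apply]
  split_ifs <;> simp

variable (F L Δ) in
/-- Coordinates of `L ⊗ Δ` over `Δ` with respect to the integral basis of `L`. -/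
def tcoord : L ⊗[F] Δ ≃ₗ[F] (Fin (Module.finrank F L) → Δ) :=
  (TensorProduct.equivFinsuppOfBasisLeft (intBasis F L)).trans
    (Finsupp.linearEquivFunOnFinite F Δ _)

theorem tcoord_tmul (x : L) (y : Δ) (i) :
    tcoord F L Δ (x ⊗ₜ y) i = (intBasis F L).repr x i • y := by
  simp [tcoord]

theorem sum_tcoord (z : L ⊗[F] Δ) : ∑ i, intBasis F L i ⊗ₜ[F] tcoord F L Δ z i = z := by
  refine (tcoord F L Δ).injective ?_
  ext j
  rw [map_sum, Finset.sum_apply]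
  simp_rw [tcoord_tmul, Module.Basis.repr_self, Finsupp.single_apply, ite_smul, one_smul, zero_smul]
  simp

theorem tcoord_mul_right (z : L ⊗[F] Δ) (y : Δ) (i) :
    tcoord F L Δ (z * (1 ⊗ₜ y)) i = tcoord F L Δ z i * y := by
  induction z with
  | zero => simp
  | add a b ha hb => simp only [add_mul, map_add, Pi.add_apply, ha, hb]
  | tmul a b =>
    rw [Algebra.TensorProduct.tmul_mul_tmul, mul_one, tcoord_tmul, tcoord_tmul, smul_mul_assoc]

theorem tcoord_mul_left (z : L ⊗[F] Δ) (y : Δ) (i) :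
    tcoord F L Δ ((1 ⊗ₜ y) * z) i = y * tcoord F L Δ z i := by
  induction z with
  | zero => simp
  | add a b ha hb => simp only [mul_add, map_add, Pi.add_apply, ha, hb]
  | tmul a b =>
    rw [Algebra.TensorProduct.tmul_mul_tmul, one_mul, tcoord_tmul, tcoord_tmul, mul_smul_comm]

variable (F L Δ) in
/-- The filtration of `L ⊗ Δ` by the powers of the ideal of `O_L ⊗ O_Δ` generated by the maximal
ideal of `O_Δ`. -/
def tball (n : ℤ) : AddSubgroup (L ⊗[F] Δ) :=
  (AddSubgroup.pi Set.univ fun _ => ball (divVal F Δ) n).comap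
    (tcoord F L Δ : L ⊗[F] Δ →+ (Fin (Module.finrank F L) → Δ))

theorem mem_tball {n : ℤ} {z : L ⊗[F] Δ} :
    z ∈ tball F L Δ n ↔ ∀ i, divVal F Δ (tcoord F L Δ z i) ≤ WithZero.exp n :=
  ⟨fun h i => h i trivial, fun h i _ => h i⟩

theorem tball_mono {m n : ℤ} (h : m ≤ n) : tball F L Δ m ≤ tball F L Δ n := fun _ hz =>
  mem_tball.mpr fun i => (mem_tball.mp hz i).trans (WithZero.exp_le_exp.mpr h)

theorem tmul_mem_tball {x : L} {y : Δ} {n : ℤ} (hx : divVal F L x ≤ 1)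
    (hy : divVal F Δ y ≤ WithZero.exp n) : x ⊗ₜ y ∈ tball F L Δ n := by
  rw [mem_tball]
  intro i
  rw [tcoord_tmul, Algebra.smul_def, map_mul]
  exact (mul_le_of_le_one_left' ((divVal_algebraMap_le_one_iff _).mpr
    ((divVal_le_one_iff_intBasis x).mp hx i))).trans hy

theorem mul_mem_tball {z w : L ⊗[F] Δ} {m n : ℤ} (hz : z ∈ tball F L Δ m)
    (hw : w ∈ tball F L Δ n) : z * w ∈ tball F L Δ (m + n) := by
  rw [← sum_tcoord z, ← sum_tcoord w, Finset.sum_mul_sum]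
  refine sum_mem fun i _ => sum_mem fun j _ => ?_
  rw [Algebra.TensorProduct.tmul_mul_tmul]
  refine tmul_mem_tball ?_ ?_
  · rw [map_mul]; exact mul_le_one' (divVal_intBasis_le_one i) (divVal_intBasis_le_one j)
  · rw [map_mul, WithZero.exp_add]
    exact mul_le_mul' (mem_tball.mp hz i) (mem_tball.mp hw j)

theorem one_mem_tball : (1 : L ⊗[F] Δ) ∈ tball F L Δ 0 :=
  tmul_mem_tball (by simp) (by simp)

theorem pow_mem_tball {z : L ⊗[F] Δ} {m : ℤ} (hz : z ∈ tball F L Δ m) (n : ℕ) :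
    z ^ n ∈ tball F L Δ (n * m) := by
  induction n with
  | zero => simpa using one_mem_tball
  | succ n ih =>
    have h : ((n + 1 : ℕ) : ℤ) * m = n * m + m := by push_cast; ring
    rw [pow_succ, h]
    exact mul_mem_tball ih hz

/-- The order `O_L ⊗ O_Δ` consists of the elements with integral coordinates. -/
theorem mem_tensorOrder_iff (z : L ⊗[F] Δ) : z ∈ tensorOrder F Δ L ↔ z ∈ tball F L Δ 0 := by
  constructor
  · intro hz
    refine Subring.closure_induction ?_ (zero_mem _) one_mem_tball
      (fun _ _ _ _ => add_mem) (fun _ _ => neg_mem)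
      (fun a b _ _ ha hb => by simpa using mul_mem_tball ha hb) hz
    rintro _ ⟨a, ha, x, hx, rfl⟩
    exact tmul_mem_tball ((mem_integralClosure_iff a).mp ha)
      (by rw [WithZero.exp_zero]; exact (mem_maxCompactSubring_iff x).mp hx)
  · intro hz
    rw [← sum_tcoord z]
    refine sum_mem fun i _ => Subring.subset_closure ⟨_, ?_, _, ?_, rfl⟩
    · exact (mem_integralClosure_iff _).mpr (divVal_intBasis_le_one i)
    · rw [mem_maxCompactSubring_iff, ← WithZero.exp_zero]; exact mem_tball.mp hz i

theorem exists_mem_tball (z : L ⊗[F] Δ) : ∃ n : ℕ, z ∈ tball F L Δ n := by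
  have (i : Fin (Module.finrank F L)) : ∃ n : ℕ, divVal F Δ (tcoord F L Δ z i) ≤ WithZero.exp (n : ℤ) := by
    by_cases h : divVal F Δ (tcoord F L Δ z i) = 0
    · exact ⟨0, by simp [h]⟩
    · obtain ⟨m, hm⟩ := exists_eq_exp h
      exact ⟨m.toNat, by rw [hm, WithZero.exp_le_exp]; omega⟩
  choose n hn using this
  refine ⟨∑ i, n i, mem_tball.mpr fun i => (hn i).trans (WithZero.exp_le_exp.mpr ?_)⟩
  exact_mod_cast Finset.single_le_sum (f := n) (fun i _ => Nat.zero_le _) (Finset.mem_univ i)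

theorem eq_zero_of_forall_mem_tball {z : L ⊗[F] Δ} (h : ∀ n : ℕ, z ∈ tball F L Δ (-(n : ℤ))) :
    z = 0 := by
  refine (tcoord F L Δ).injective ?_
  ext i
  rw [map_zero, Pi.zero_apply]
  by_contra hi
  obtain ⟨m, hm⟩ := exists_eq_exp (x := divVal F Δ (tcoord F L Δ z i)) (by simpa using hi)
  have := mem_tball.mp (h (1 - m).toNat) i
  rw [hm, WithZero.exp_le_exp] at this
  omega

theorem mul_unif_mem_tball_iff {z : L ⊗[F] Δ} {y : Δ} {k : ℤ} (hy : divVal F Δ y = WithZero.exp k)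
    (n : ℤ) : z * (1 ⊗ₜ y) ∈ tball F L Δ (n + k) ↔ z ∈ tball F L Δ n := by
  rw [mem_tball, mem_tball]
  refine forall_congr' fun i => ?_
  rw [tcoord_mul_right, map_mul, hy, WithZero.exp_add]
  exact mul_le_mul_iff_left₀ (by simp)

theorem unif_mul_mem_tball_iff {z : L ⊗[F] Δ} {y : Δ} {k : ℤ} (hy : divVal F Δ y = WithZero.exp k)
    (n : ℤ) : (1 ⊗ₜ y) * z ∈ tball F L Δ (n + k) ↔ z ∈ tball F L Δ n := by
  rw [mem_tball, mem_tball]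
  refine forall_congr' fun i => ?_
  rw [tcoord_mul_left, map_mul, hy, mul_comm, WithZero.exp_add]
  exact mul_le_mul_iff_left₀ (by simp)

variable (F L Δ) in
theorem relIndex_tball :
    (tball F L Δ (-1)).relIndex (tball F L Δ 0) = resCard F Δ ^ Module.finrank F L := by
  rw [tball, tball, relIndex_comap_pi _ (tcoord F L Δ).surjective]
  simp [resCard]

/-- `O_L ⊗ O_Δ` is commutative modulo the ideal generated by `𝔓_Δ`. -/
theorem commutator_mem_tball {z w : L ⊗[F] Δ} (hz : z ∈ tball F L Δ 0) (hw : w ∈ tball F L Δ 0) :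
    z * w - w * z ∈ tball F L Δ (-1) := by
  rw [← sum_tcoord z, ← sum_tcoord w, Finset.sum_mul_sum, Finset.sum_mul_sum, Finset.sum_comm,
    ← Finset.sum_sub_distrib]
  refine sum_mem fun i _ => ?_
  rw [← Finset.sum_sub_distrib]
  refine sum_mem fun j _ => ?_
  rw [Algebra.TensorProduct.tmul_mul_tmul, Algebra.TensorProduct.tmul_mul_tmul,
    mul_comm (intBasis F L j), ← TensorProduct.tmul_sub]
  refine tmul_mem_tball ?_ ?_
  · rw [map_mul]; exact mul_le_one' (divVal_intBasis_le_one _) (divVal_intBasis_le_one _)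
  · rw [← lt_one_iff]
    exact divVal_commutator_lt_one (by simpa using mem_tball.mp hz j)
      (by simpa using mem_tball.mp hw i)

variable (F L Δ) in
/-- The ideal of `O_L ⊗ O_Δ` generated by the maximal ideal of `O_Δ`. -/
def tensorIdeal : Ideal (tensorOrder F Δ L) where
  carrier := {z | (z : L ⊗[F] Δ) ∈ tball F L Δ (-1)}
  zero_mem' := (tball F L Δ (-1)).zero_mem
  add_mem' ha hb := (tball F L Δ (-1)).add_mem ha hb
  smul_mem' c z hz := by
    have := mul_mem_tball ((mem_tensorOrder_iff _).mp c.2) hz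
    rwa [zero_add] at this

instance : (tensorIdeal F L Δ).IsTwoSided :=
  ⟨fun {a} b ha => by
    have := mul_mem_tball ha ((mem_tensorOrder_iff _).mp b.2)
    rwa [add_zero] at this⟩

theorem mul_sub_mul_mem_tensorIdeal (x y : tensorOrder F Δ L) :
    x * y - y * x ∈ tensorIdeal F L Δ :=
  commutator_mem_tball ((mem_tensorOrder_iff _).mp x.2) ((mem_tensorOrder_iff _).mp y.2)

variable (F L Δ) in
/-- The quotient `O_L ⊗ (O_Δ / 𝔓_Δ)` of `O_L ⊗ O_Δ`. -/
def TensorResidue : Type _ := tensorOrder F Δ L ⧸ tensorIdeal F L Δ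

instance : CommRing (TensorResidue F L Δ) :=
  { (Ideal.Quotient.ring (tensorIdeal F L Δ)) with
    mul_comm := fun a b => by
      obtain ⟨x, rfl⟩ := Ideal.Quotient.mk_surjective a
      obtain ⟨y, rfl⟩ := Ideal.Quotient.mk_surjective b
      exact (Ideal.Quotient.mk_eq_mk_iff_sub_mem (x * y) (y * x)).mpr
        (mul_sub_mul_mem_tensorIdeal x y) }

variable (F L Δ) in
/-- Reduction of `O_L ⊗ O_Δ`. -/
def tmk : tensorOrder F Δ L →+* TensorResidue F L Δ := Ideal.Quotient.mk (tensorIdeal F L Δ)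

theorem tmk_surjective : Function.Surjective (tmk F L Δ) := Ideal.Quotient.mk_surjective

theorem tmk_eq_iff (x y : tensorOrder F Δ L) :
    tmk F L Δ x = tmk F L Δ y ↔ (x - y : L ⊗[F] Δ) ∈ tball F L Δ (-1) :=
  Ideal.Quotient.mk_eq_mk_iff_sub_mem x y

theorem tmk_eq_zero_iff (x : tensorOrder F Δ L) :
    tmk F L Δ x = 0 ↔ (x : L ⊗[F] Δ) ∈ tball F L Δ (-1) :=
  Ideal.Quotient.eq_zero_iff_mem

variable (F L Δ) in
/-- `O_L ⊗ (O_Δ / 𝔓_Δ)` is free over `O_Δ / 𝔓_Δ`, of rank the degree of `L`. -/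
theorem card_tensorResidue :
    Nat.card (TensorResidue F L Δ) = resCard F Δ ^ Module.finrank F L := by
  have h0 : tball F L Δ 0 = (tensorOrder F Δ L).toAddSubgroup := by
    ext x; exact (mem_tensorOrder_iff (F := F) (L := L) (Δ := Δ) x).symm
  have h1 : (tensorIdeal F L Δ).toAddSubgroup =
      (tball F L Δ (-1)).addSubgroupOf (tensorOrder F Δ L).toAddSubgroup := by
    ext x
    rw [AddSubgroup.mem_addSubgroupOf]; exact Iff.rfl
  rw [← relIndex_tball, h0, AddSubgroup.relIndex, ← h1]
  rfl

/-- For an unramified extension `L` the ring `O_L ⊗ (O_Δ / 𝔓_Δ)` is a finite reduced ring: all its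
elements are fixed by a power of the Frobenius. -/
theorem tensorResidue_pow (hL : ramIdx F L = 1) {N : ℕ} {kL kΔ mL mΔ : ℕ}
    (hkL : resCard F L = resChar F ^ kL) (hkΔ : resCard F Δ = resChar F ^ kΔ)
    (hmL : N = kL * mL) (hmΔ : N = kΔ * mΔ) (b : TensorResidue F L Δ) :
    b ^ resChar F ^ N = b := by
  have hp0 : ((resChar F : ℕ) : TensorResidue F L Δ) = 0 := by
    rw [← map_natCast (tmk F L Δ), tmk_eq_zero_iff]
    have h1 : (((resChar F : ℕ) : tensorOrder F Δ L) : L ⊗[F] Δ) = 1 ⊗ₜ ((resChar F : ℕ) : Δ) := by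
      have : (1 : L) ⊗ₜ[F] ((resChar F : ℕ) : Δ) =
        (Algebra.TensorProduct.includeRight : Δ →ₐ[F] L ⊗[F] Δ) (resChar F : ℕ) := rfl
      rw [this, map_natCast, SubringClass.coe_natCast]
    rw [h1]
    refine tmul_mem_tball (by simp) ?_
    rw [← lt_one_iff, ← map_natCast (algebraMap F Δ), divVal_algebraMap_lt_one_iff]
    exact baseVal_resChar_lt_one
  have hiter (q m : ℕ) (c : TensorResidue F L Δ) (h : c ^ q = c) : c ^ q ^ m = c := by
    induction m with
    | zero => simp
    | succ m ih => rw [pow_succ, pow_mul, ih, h]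
  obtain ⟨z, rfl⟩ := tmk_surjective b
  obtain ⟨z, hz⟩ := z
  let S : AddSubgroup (TensorResidue F L Δ) :=
    { carrier := {b | b ^ resChar F ^ N = b}
      zero_mem' := zero_pow (pow_ne_zero _ (resChar_prime (F := F)).ne_zero)
      add_mem' := fun {a b} ha hb => by
        rw [Set.mem_ofPred_eq] at ha hb ⊢
        rw [Commute.add_pow_prime_pow_eq resChar_prime (Commute.all a b), hp0, ha, hb]
        ring
      neg_mem' := fun {a} ha => by
        rw [Set.mem_ofPred_eq] at ha ⊢
        have h := Commute.add_pow_prime_pow_eq (resChar_prime (F := F)) (Commute.all a (-a)) N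
        rw [hp0, add_neg_cancel, zero_pow (pow_ne_zero _ (resChar_prime (F := F)).ne_zero), ha] at h
        linear_combination -h }
  change tmk F L Δ ⟨z, hz⟩ ∈ S
  have hmem : ∀ i, intBasis F L i ⊗ₜ[F] tcoord F L Δ z i ∈ tensorOrder F Δ L := fun i =>
    (mem_tensorOrder_iff _).mpr (tmul_mem_tball (divVal_intBasis_le_one i)
      (mem_tball.mp ((mem_tensorOrder_iff _).mp hz) i))
  have hsum : (⟨z, hz⟩ : tensorOrder F Δ L) = ∑ i, ⟨_, hmem i⟩ :=
    Subtype.ext (by rw [AddSubmonoidClass.coe_finsetSum]; exact (sum_tcoord z).symm)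
  rw [hsum, map_sum]
  refine sum_mem fun i _ => ?_
  set x := tcoord F L Δ z i with hx
  have hx1 : divVal F Δ x ≤ 1 := by
    simpa using mem_tball.mp ((mem_tensorOrder_iff _).mp hz) i
  set a := intBasis F L i with ha
  have ha1 : divVal F L a ≤ 1 := divVal_intBasis_le_one i
  have m1 : a ⊗ₜ[F] (1 : Δ) ∈ tensorOrder F Δ L :=
    (mem_tensorOrder_iff _).mpr (tmul_mem_tball ha1 (by simp))
  have m2 : (1 : L) ⊗ₜ[F] x ∈ tensorOrder F Δ L :=
    (mem_tensorOrder_iff _).mpr (tmul_mem_tball (by simp) (by simpa using hx1))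
  have hprod : (⟨_, hmem i⟩ : tensorOrder F Δ L) = ⟨_, m1⟩ * ⟨_, m2⟩ := Subtype.ext (by
    change _ = a ⊗ₜ[F] (1 : Δ) * (1 : L) ⊗ₜ[F] x
    rw [Algebra.TensorProduct.tmul_mul_tmul, mul_one, one_mul])
  rw [hprod, map_mul]
  change (_ * _) ^ _ = _ * _
  rw [mul_pow]
  congr 1
  · rw [hmL, pow_mul, ← hkL]
    refine hiter _ _ _ ?_
    rw [← map_pow, tmk_eq_iff]
    change (a ⊗ₜ[F] (1 : Δ)) ^ resCard F L - a ⊗ₜ[F] (1 : Δ) ∈ tball F L Δ (-1)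
    rw [Algebra.TensorProduct.tmul_pow, one_pow, ← TensorProduct.sub_tmul]
    have h1 := divVal_pow_resCard_sub_lt_one ha1
    have h2 : a ^ resCard F L - a = baseUnif F • ((baseUnif F)⁻¹ • (a ^ resCard F L - a)) := by
      rw [smul_smul, mul_inv_cancel₀ baseUnif_ne_zero, one_smul]
    rw [h2, TensorProduct.smul_tmul]
    refine tmul_mem_tball ?_ ?_
    · rw [Algebra.smul_def, map_mul, map_inv₀, map_inv₀, divVal_algebraMap_baseUnif, hL,
        ← WithZero.exp_neg]
      rw [lt_one_iff] at h1
      refine (mul_le_mul_right h1 _).trans ?_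
      rw [← WithZero.exp_add]; simp
    · rw [Algebra.smul_def, mul_one, divVal_algebraMap_baseUnif, WithZero.exp_le_exp]
      have := ramIdx_pos (F := F) (D := Δ)
      omega
  · rw [hmΔ, pow_mul, ← hkΔ]
    refine hiter _ _ _ ?_
    rw [← map_pow, tmk_eq_iff]
    change ((1 : L) ⊗ₜ[F] x) ^ resCard F Δ - (1 : L) ⊗ₜ[F] x ∈ tball F L Δ (-1)
    rw [Algebra.TensorProduct.tmul_pow, one_pow, ← TensorProduct.tmul_sub]
    refine tmul_mem_tball (by simp) ?_
    rw [← lt_one_iff]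
    exact divVal_pow_resCard_sub_lt_one hx1

end TensorOrder

/-! ### Iwahori orders -/

section Iwahori

/-- The Iwahori conditions as one inequality for the `t`-th powers of the entries; in this form they
are visibly multiplicative. -/
theorem pow_le_exp_iff_iwahori {x : ℤᵐ⁰} {t : ℕ} {k l : Fin t} :
    x ^ t ≤ WithZero.exp ((l : ℤ) - k) ↔ x ≤ WithZero.exp (if l < k then -1 else 0) := by
  have hk := k.2
  have hl := l.2
  by_cases hx : x = 0
  · have : t ≠ 0 := by omega
    simp [hx, this]
  obtain ⟨m, rfl⟩ := exists_eq_exp hx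
  rw [← WithZero.exp_nsmul, WithZero.exp_le_exp, WithZero.exp_le_exp, nsmul_eq_mul]
  have ht : (0 : ℤ) < t := by omega
  split_ifs with h
  · rw [Fin.lt_def] at h
    constructor
    · intro h1
      by_contra h2
      have : 0 ≤ m := by omega
      have := mul_nonneg ht.le this
      omega
    · intro h1
      have : (t : ℤ) * m ≤ t * (-1) := mul_le_mul_of_nonneg_left h1 ht.le
      omega
  · rw [Fin.lt_def] at h
    constructor
    · intro h1
      by_contra h2
      have : (t : ℤ) * 1 ≤ t * m := mul_le_mul_of_nonneg_left (by omega) ht.le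
      omega
    · intro h1
      have : (t : ℤ) * m ≤ t * 0 := mul_le_mul_of_nonneg_left h1 ht.le
      omega

/-- The same for the radical of the Iwahori order. -/
theorem pow_le_exp_iff_iwahoriRad {x : ℤᵐ⁰} {t : ℕ} {k l : Fin t} :
    x ^ t ≤ WithZero.exp ((l : ℤ) - k - 1) ↔ x ≤ WithZero.exp (if l ≤ k then -1 else 0) := by
  have hk := k.2
  have hl := l.2
  by_cases hx : x = 0
  · have : t ≠ 0 := by omega
    simp [hx, this]
  obtain ⟨m, rfl⟩ := exists_eq_exp hx
  rw [← WithZero.exp_nsmul, WithZero.exp_le_exp, WithZero.exp_le_exp, nsmul_eq_mul]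
  have ht : (0 : ℤ) < t := by omega
  split_ifs with h
  · rw [Fin.le_def] at h
    constructor
    · intro h1
      by_contra h2
      have : 0 ≤ m := by omega
      have := mul_nonneg ht.le this
      omega
    · intro h1
      have : (t : ℤ) * m ≤ t * (-1) := mul_le_mul_of_nonneg_left h1 ht.le
      omega
  · rw [Fin.le_def] at h
    constructor
    · intro h1
      by_contra h2
      have : (t : ℤ) * 1 ≤ t * m := mul_le_mul_of_nonneg_left (by omega) ht.le
      omega
    · intro h1
      have : (t : ℤ) * m ≤ t * 0 := mul_le_mul_of_nonneg_left h1 ht.le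
      omega

variable {E : Type*} [DivisionRing E] (v : Valuation E ℤᵐ⁰) (t : ℕ)

/-- The standard Iwahori order: entries in the valuation ring, entries strictly below the diagonal
in its maximal ideal. -/
def iwahori : AddSubgroup (Matrix (Fin t) (Fin t) E) :=
  AddSubgroup.pi Set.univ fun k => AddSubgroup.pi Set.univ fun l =>
    ball v (if l < k then -1 else 0)

/-- The radical of the standard Iwahori order: diagonal entries are in the maximal ideal as well. -/
def iwahoriRad : AddSubgroup (Matrix (Fin t) (Fin t) E) :=
  AddSubgroup.pi Set.univ fun k => AddSubgroup.pi Set.univ fun l =>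
    ball v (if l ≤ k then -1 else 0)

variable {v t}

theorem mem_iwahori {Z : Matrix (Fin t) (Fin t) E} :
    Z ∈ iwahori v t ↔ ∀ k l, v (Z k l) ≤ WithZero.exp (if l < k then -1 else 0) :=
  ⟨fun h k l => h k trivial l trivial, fun h k _ l _ => h k l⟩

theorem mem_iwahoriRad {Z : Matrix (Fin t) (Fin t) E} :
    Z ∈ iwahoriRad v t ↔ ∀ k l, v (Z k l) ≤ WithZero.exp (if l ≤ k then -1 else 0) :=
  ⟨fun h k l => h k trivial l trivial, fun h k _ l _ => h k l⟩

theorem mem_iwahori_iff_pow {Z : Matrix (Fin t) (Fin t) E} :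
    Z ∈ iwahori v t ↔ ∀ k l : Fin t, v (Z k l) ^ t ≤ WithZero.exp ((l : ℤ) - k) := by
  simp_rw [mem_iwahori, pow_le_exp_iff_iwahori]

theorem mem_iwahoriRad_iff_pow {Z : Matrix (Fin t) (Fin t) E} :
    Z ∈ iwahoriRad v t ↔ ∀ k l : Fin t, v (Z k l) ^ t ≤ WithZero.exp ((l : ℤ) - k - 1) := by
  simp_rw [mem_iwahoriRad, pow_le_exp_iff_iwahoriRad]

/-- With the weights `v (Z k l) ^ t * exp (k - l)` the powers of the radical are visibly
contained in a multiplicative filtration. -/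
theorem iwahori_weight_mul {X Y : Matrix (Fin t) (Fin t) E} {m n : ℤ}
    (hX : ∀ k l : Fin t, v (X k l) ^ t ≤ WithZero.exp ((l : ℤ) - k - m))
    (hY : ∀ k l : Fin t, v (Y k l) ^ t ≤ WithZero.exp ((l : ℤ) - k - n)) (k l : Fin t) :
    v ((X * Y) k l) ^ t ≤ WithZero.exp ((l : ℤ) - k - (m + n)) := by
  have ht : t ≠ 0 := by have := k.2; omega
  rw [Matrix.mul_apply]
  have : Nonempty (Fin t) := ⟨k⟩
  obtain ⟨c, hc⟩ := Finite.exists_max fun c => v (X k c * Y c l)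
  have h1 : v (∑ c, X k c * Y c l) ≤ v (X k c * Y c l) := v.map_sum_le fun i _ => hc i
  refine (pow_le_pow_left₀ zero_le h1 t).trans ?_
  rw [map_mul, mul_pow]
  refine (mul_le_mul' (hX k c) (hY c l)).trans ?_
  rw [← WithZero.exp_add, WithZero.exp_le_exp]
  omega

theorem iwahori_weight_pow {X : Matrix (Fin t) (Fin t) E} (hX : X ∈ iwahoriRad v t) (n : ℕ)
    (k l : Fin t) : v ((X ^ n) k l) ^ t ≤ WithZero.exp ((l : ℤ) - k - n) := by
  rw [mem_iwahoriRad_iff_pow] at hX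
  induction n generalizing k l with
  | zero =>
    have ht : t ≠ 0 := by have := k.2; omega
    by_cases h : k = l
    · subst h; simp
    · simp [Matrix.one_apply_ne h, ht]
  | succ n ih =>
    rw [pow_succ]
    have := iwahori_weight_mul ih hX k l
    push_cast
    exact this

/-- The reduction of the diagonal is multiplicative on the Iwahori order. -/
theorem iwahori_mul_diag {X Y : Matrix (Fin t) (Fin t) E} (hX : X ∈ iwahori v t)
    (hY : Y ∈ iwahori v t) (k : Fin t) : v ((X * Y) k k - X k k * Y k k) < 1 := by
  rw [Matrix.mul_apply, ← Finset.add_sum_erase _ _ (Finset.mem_univ k), add_sub_cancel_left]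
  refine v.map_sum_lt one_ne_zero fun c hc => ?_
  have hck : c ≠ k := Finset.ne_of_mem_erase hc
  rw [map_mul]
  have h1 := mem_iwahori.mp hX k c
  have h2 := mem_iwahori.mp hY c k
  rw [lt_one_iff]
  refine (mul_le_mul' h1 h2).trans ?_
  rw [← WithZero.exp_add, WithZero.exp_le_exp]
  rcases lt_or_gt_of_ne hck with h | h
  · simp [h, h.asymm]
  · simp [h, h.asymm]

theorem iwahori_one_mem : (1 : Matrix (Fin t) (Fin t) E) ∈ iwahori v t := by
  rw [mem_iwahori]
  intro k l
  by_cases h : k = l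
  · subst h; simp
  · simp [Matrix.one_apply_ne h]

theorem iwahori_mul_mem {X Y : Matrix (Fin t) (Fin t) E} (hX : X ∈ iwahori v t)
    (hY : Y ∈ iwahori v t) : X * Y ∈ iwahori v t := by
  rw [mem_iwahori_iff_pow] at hX hY ⊢
  intro k l
  have := iwahori_weight_mul (m := 0) (n := 0) (by simpa using hX) (by simpa using hY) k l
  simpa using this

theorem iwahori_pow_diag {X : Matrix (Fin t) (Fin t) E} (hX : X ∈ iwahori v t) (n : ℕ)
    (k : Fin t) : X ^ n ∈ iwahori v t ∧ v ((X ^ n) k k - X k k ^ n) < 1 := by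
  induction n with
  | zero => exact ⟨by simpa using iwahori_one_mem, by simp⟩
  | succ n ih =>
    rw [pow_succ, pow_succ]
    refine ⟨iwahori_mul_mem ih.1 hX, ?_⟩
    have h1 := iwahori_mul_diag ih.1 hX k
    have h2 : v (((X ^ n) k k - X k k ^ n) * X k k) < 1 := by
      rw [map_mul]
      exact (mul_le_of_le_one_right' (by simpa using mem_iwahori.mp hX k k)).trans_lt ih.2
    have h3 : (X ^ n * X) k k - X k k ^ n * X k k =
      ((X ^ n * X) k k - (X ^ n) k k * X k k) + ((X ^ n) k k - X k k ^ n) * X k k := by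
      rw [sub_mul]; abel
    rw [h3]
    exact (v.map_add _ _).trans_lt (max_lt h1 h2)

theorem relIndex_iwahoriRad :
    (iwahoriRad v t).relIndex (iwahori v t) = (ball v (-1)).relIndex (ball v 0) ^ t := by
  rw [iwahori, iwahoriRad]
  refine (relIndex_pi _ _).trans ?_
  have h (k : Fin t) : (AddSubgroup.pi Set.univ fun l => ball v (if l ≤ k then -1 else 0)).relIndex
      (AddSubgroup.pi Set.univ fun l => ball v (if l < k then -1 else 0)) =
      (ball v (-1)).relIndex (ball v 0) := by
    rw [relIndex_pi, Finset.prod_eq_single k]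
    · simp
    · intro l _ hl
      rcases lt_or_gt_of_ne hl with h | h
      · simp [h, h.le]
      · simp [h.not_ge, h.asymm]
    · simp
  rw [Finset.prod_congr rfl fun k _ => h k]
  simp

end Iwahori

section IwahoriIso

variable {F : Type*} [Field F] [ValuativeRel F] [TopologicalSpace F]
  [IsNonarchimedeanLocalField F] {L : Type*} [Field L] [Algebra F L] [FiniteDimensional F L]
  {Δ : Type*} [DivisionRing Δ] [Algebra F Δ] [FiniteDimensional F Δ]
  {Δ' : Type*} [DivisionRing Δ'] [Algebra L Δ'] [Algebra F Δ'] [IsScalarTower F L Δ']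
  [FiniteDimensional F Δ'] {t : ℕ} {Θ : L ⊗[F] Δ ≃ₐ[L] Matrix (Fin t) (Fin t) Δ'}

/-- The two descriptions of the standard Iwahori order agree. -/
theorem mem_blockOrder_id_iff (Z : Matrix (Fin t) (Fin t) Δ') :
    Z ∈ blockOrder (maxCompactSubring F Δ') (id : Fin t → Fin t) ↔
      Z ∈ iwahori (divVal F Δ') t := by
  rw [mem_iwahori]
  refine forall_congr' fun k => forall_congr' fun l => ?_
  constructor
  · rintro ⟨h1, h2⟩
    split_ifs with h
    · rw [← lt_one_iff]
      exact (mem_maxIdeal_maxCompactSubring_iff _).mp (h2 h)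
    · rw [WithZero.exp_zero]
      exact (mem_maxCompactSubring_iff _).mp h1
  · intro h
    have h1 : Z k l ∈ maxCompactSubring F Δ' := by
      rw [mem_maxCompactSubring_iff, ← WithZero.exp_zero]
      refine h.trans (WithZero.exp_le_exp.mpr ?_)
      split_ifs <;> omega
    refine ⟨h1, fun hlk => ?_⟩
    rw [mem_maxIdeal_maxCompactSubring_iff, lt_one_iff]
    have hlk' : l < k := hlk
    simpa [hlk'] using h

theorem IsIwahori.mem_tball_zero_iff (hΘ : IsIwahori Θ) (z : L ⊗[F] Δ) :
    z ∈ tball F L Δ 0 ↔ Θ z ∈ iwahori (divVal F Δ') t := by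
  rw [← mem_tensorOrder_iff, ← mem_blockOrder_id_iff]; exact hΘ z

theorem smul_apply_eq_algebraMap_mul (c : F) (z : L ⊗[F] Δ) (k l : Fin t) :
    Θ (c • z) k l = algebraMap F Δ' c * Θ z k l := by
  rw [← algebraMap_smul L c z, map_smul, Matrix.smul_apply, Algebra.smul_def,
    ← IsScalarTower.algebraMap_apply]

theorem mem_tball_ramIdx_iff (z : L ⊗[F] Δ) :
    baseUnif F • z ∈ tball F L Δ (-(ramIdx F Δ : ℤ)) ↔ z ∈ tball F L Δ 0 := by
  rw [mem_tball, mem_tball]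
  refine forall_congr' fun i => ?_
  rw [map_smul, Pi.smul_apply, Algebra.smul_def, map_mul, divVal_algebraMap_baseUnif,
    WithZero.exp_zero]
  nth_rewrite 2 [← mul_one (WithZero.exp (-(ramIdx F Δ : ℤ)))]
  exact mul_le_mul_iff_right₀ (by simp)

/-- Since reductions are fixed by a power of the Frobenius, nilpotent reductions vanish. -/
theorem mem_tball_of_pow_mem {Q : ℕ} (hQ : ∀ b : TensorResidue F L Δ, b ^ Q = b)
    (z : tensorOrder F Δ L) (m : ℕ) (h : (z : L ⊗[F] Δ) ^ Q ^ m ∈ tball F L Δ (-1)) :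
    (z : L ⊗[F] Δ) ∈ tball F L Δ (-1) := by
  have hiter : ∀ n : ℕ, ∀ b : TensorResidue F L Δ, b ^ Q ^ n = b := by
    intro n b
    induction n with
    | zero => rw [pow_zero, pow_one]
    | succ n ih => rw [pow_succ, pow_mul, ih, hQ]
  rw [← SubmonoidClass.coe_pow, ← tmk_eq_zero_iff, map_pow, hiter] at h
  exact (tmk_eq_zero_iff _).mp h

/-- An isomorphism carrying `O_L ⊗ O_Δ` to the Iwahori order carries the ideal generated by `𝔓_Δ`
to the radical of the Iwahori order, because the quotients by these nilpotent ideals are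
reduced. -/
theorem IsIwahori.mem_tball_neg_one_iff (hL : ramIdx F L = 1) (hΘ : IsIwahori Θ)
    (z : L ⊗[F] Δ) : z ∈ tball F L Δ (-1) ↔ Θ z ∈ iwahoriRad (divVal F Δ') t := by
  constructor
  · intro hz
    have hz0 : Θ z ∈ iwahori (divVal F Δ') t :=
      (hΘ.mem_tball_zero_iff z).mp (tball_mono (by omega) hz)
    have hdiag : ∀ k, divVal F Δ' (Θ z k k) < 1 := by
      intro k
      -- with `e` the ramification index, `z ^ e` is divisible by the uniformizer of `F`; modulo the
      -- maximal ideal the diagonal of its image consists of the `e`-th powers of the `Θ z k k`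
      have h1 := pow_mem_tball hz (ramIdx F Δ)
      set w := z ^ ramIdx F Δ with hw
      have h2 : w = baseUnif F • ((baseUnif F)⁻¹ • w) := by
        rw [smul_smul, mul_inv_cancel₀ baseUnif_ne_zero, one_smul]
      rw [mul_neg_one, h2, mem_tball_ramIdx_iff, hΘ.mem_tball_zero_iff, mem_iwahori] at h1
      have h3 : divVal F Δ' ((Θ z ^ ramIdx F Δ) k k) < 1 := by
        rw [← map_pow, ← hw, h2, smul_apply_eq_algebraMap_mul, map_mul]
        refine (mul_le_of_le_one_right' (by simpa using h1 k k)).trans_lt ?_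
        rw [divVal_algebraMap_lt_one_iff, baseVal_baseUnif, lt_one_iff]
      have h4 := (iwahori_pow_diag hz0 (ramIdx F Δ) k).2
      have h5 : Θ z k k ^ ramIdx F Δ = (Θ z ^ ramIdx F Δ) k k -
        ((Θ z ^ ramIdx F Δ) k k - Θ z k k ^ ramIdx F Δ) := by abel
      have h6 : divVal F Δ' (Θ z k k ^ ramIdx F Δ) < 1 := by
        rw [h5]
        exact ((divVal F Δ').map_sub _ _).trans_lt (max_lt h3 h4)
      rw [map_pow] at h6
      exact (pow_lt_one_iff ramIdx_pos.ne').mp h6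
    rw [mem_iwahoriRad]
    intro k l
    have h1 := mem_iwahori.mp hz0 k l
    by_cases hkl : l = k
    · subst hkl
      rw [if_pos le_rfl, ← lt_one_iff]
      exact hdiag l
    · have : l ≤ k ↔ l < k := ⟨fun h => lt_of_le_of_ne h hkl, le_of_lt⟩
      simp only [this]
      exact h1
  · intro hz
    have hz0 : z ∈ tensorOrder F Δ L := by
      rw [mem_tensorOrder_iff, hΘ.mem_tball_zero_iff, mem_iwahori]
      intro k l
      refine (mem_iwahoriRad.mp hz k l).trans (WithZero.exp_le_exp.mpr ?_)
      by_cases h : l < k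
      · simp [h, h.le]
      · rw [if_neg h]; split_ifs <;> omega
    obtain ⟨kL, hkL⟩ := exists_resCard_eq_resChar_pow F L
    obtain ⟨kΔ, hkΔ⟩ := exists_resCard_eq_resChar_pow F Δ
    have hfix := tensorResidue_pow (L := L) (Δ := Δ) hL hkL hkΔ rfl (mul_comm kL kΔ)
    set Q := resChar F ^ (kL * kΔ) with hQ
    have hQ1 : 1 < Q := by
      rw [hQ, pow_mul, ← hkL]
      refine Nat.one_lt_pow ?_ one_lt_resCard
      rintro rfl
      rw [pow_zero] at hkΔ
      exact absurd hkΔ one_lt_resCard.ne'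
    -- a large power of `z` is divisible by the uniformizer of `F`; the exponent is chosen as a
    -- power of `Q` because the reduction is fixed by the `Q`-th power map
    set N := Q ^ (t * ramIdx F Δ') with hN
    have hNle : t * ramIdx F Δ' ≤ N := (Nat.lt_pow_self hQ1).le
    have h1 : z ^ N ∈ tball F L Δ (-1) := by
      have h2 : z ^ N = baseUnif F • ((baseUnif F)⁻¹ • z ^ N) := by
        rw [smul_smul, mul_inv_cancel₀ baseUnif_ne_zero, one_smul]
      refine tball_mono (m := -(ramIdx F Δ : ℤ)) ?_ ?_
      · have := ramIdx_pos (F := F) (D := Δ); omega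
      rw [h2, mem_tball_ramIdx_iff, hΘ.mem_tball_zero_iff, mem_iwahori_iff_pow]
      intro k l
      rw [smul_apply_eq_algebraMap_mul, map_mul, mul_pow, map_pow, map_inv₀, map_inv₀,
        divVal_algebraMap_baseUnif, ← WithZero.exp_neg, neg_neg, ← WithZero.exp_nsmul]
      refine (mul_le_mul_right (iwahori_weight_pow hz N k l) _).trans ?_
      rw [← WithZero.exp_add, WithZero.exp_le_exp, nsmul_eq_mul]
      have : (t : ℤ) * ramIdx F Δ' ≤ N := by exact_mod_cast hNle
      omega
    exact mem_tball_of_pow_mem hfix ⟨z, hz0⟩ _ h1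

/-- Both sides count the reduction of `O_L ⊗ O_Δ`: the one as a product of `t` copies of the residue
field of `Δ'`, the other as `O_L ⊗ (O_Δ / 𝔓_Δ)`. -/
theorem IsIwahori.resCard_pow (hL : ramIdx F L = 1) (hΘ : IsIwahori Θ) :
    resCard F Δ' ^ t = resCard F Δ ^ Module.finrank F L := by
  have h0 : tball F L Δ 0 = (iwahori (divVal F Δ') t).comap
      (Θ : L ⊗[F] Δ →+ Matrix (Fin t) (Fin t) Δ') := by
    ext z; exact hΘ.mem_tball_zero_iff z
  have h1 : tball F L Δ (-1) = (iwahoriRad (divVal F Δ') t).comap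
      (Θ : L ⊗[F] Δ →+ Matrix (Fin t) (Fin t) Δ') := by
    ext z; exact hΘ.mem_tball_neg_one_iff hL z
  rw [← relIndex_tball, h0, h1, relIndex_comap_of_surjective _ Θ.surjective, relIndex_iwahoriRad]
  rfl

end IwahoriIso

/-! ### Adapted bases of chains of lattices -/

section AdaptedBasis

variable {E : Type*} [DivisionRing E] {v : Valuation E ℤᵐ⁰} {R : Subring E}
  {W : Type*} [AddCommGroup W] [Module E W]

/-- Multiplication by the maximal ideal is multiplication by a uniformizer. -/
theorem mem_maxIdeal_smul_iff (hR : ∀ x, x ∈ R ↔ v x ≤ 1) {π : E}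
    (hπ : v π = WithZero.exp (-1)) (N : Submodule R W) (w : W) :
    w ∈ maxIdeal R • N ↔ π⁻¹ • w ∈ N := by
  have hπ0 : π ≠ 0 := fun h => by rw [h, map_zero] at hπ; exact WithZero.exp_ne_zero hπ.symm
  constructor
  · intro hw
    refine Submodule.smul_induction_on hw (fun x hx n hn => ?_) (fun a b ha hb => ?_)
    · have hx' := (mem_maxIdeal_iff hR x).mp hx
      have hmem : π⁻¹ * x ∈ R := by
        rw [hR, map_mul, map_inv₀, hπ, ← WithZero.exp_neg, neg_neg]
        rw [lt_one_iff] at hx'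
        refine (mul_le_mul_right hx' _).trans ?_
        rw [← WithZero.exp_add]; simp
      have : π⁻¹ • x • n = (⟨π⁻¹ * x, hmem⟩ : R) • n := smul_smul π⁻¹ (x : E) n
      rw [this]
      exact N.smul_mem _ hn
    · rw [smul_add]; exact add_mem ha hb
  · intro hw
    have hπR : π ∈ R := by
      rw [hR, hπ, ← WithZero.exp_zero, WithZero.exp_le_exp]; norm_num
    have : w = (⟨π, hπR⟩ : R) • (π⁻¹ • w) := by
      change w = π • π⁻¹ • w
      rw [smul_smul, mul_inv_cancel₀ hπ0, one_smul]
    rw [this]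
    refine Submodule.smul_mem_smul ((mem_maxIdeal_iff hR _).mpr ?_) hw
    change v π < 1
    rw [hπ, lt_one_iff]

theorem maxIdeal_le_jacobson (hR : ∀ x, x ∈ R ↔ v x ≤ 1) : maxIdeal R ≤ Ring.jacobson R := by
  rw [Ring.jacobson, Module.jacobson]
  refine le_sInf fun m hm => ?_
  have hm' : m ≤ maxIdeal R := by
    intro y hy
    rw [mem_maxIdeal_iff hR]
    by_contra hlt
    have h1 : v y = 1 := le_antisymm ((hR y).mp y.2) (not_lt.mp hlt)
    have hy0 : (y : E) ≠ 0 := fun h => by simp [h] at h1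
    have hy1 : (y : E)⁻¹ ∈ R := by rw [hR, map_inv₀, h1, inv_one]
    refine hm.1 ((Ideal.eq_top_iff_one m).mpr ?_)
    have : (⟨(y : E)⁻¹, hy1⟩ : R) * y = 1 := Subtype.ext (inv_mul_cancel₀ hy0)
    rw [← this]
    exact m.smul_mem _ hy
  by_contra hne
  exact maxIdeal_ne_top hR (hm.2 _ (lt_of_le_not_ge hm' hne))

/-- Lifts of a basis over the residue ring. -/
theorem exists_residue_basis (hR : ∀ x, x ∈ R ↔ v x ≤ 1) {M : Type*} [AddCommGroup M] [Module R M]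
    {J : Type*} [Fintype J] (h : HasResidueDim R M (Fintype.card J)) :
    ∃ m : J → M, (∀ x, ∃ c : J → R, x = ∑ j, c j • m j) ∧
      ∀ c : J → R, ∑ j, c j • m j = 0 → ∀ j, c j ∈ maxIdeal R := by
  let K : DivisionRing (R ⧸ maxIdeal R) := residueDivisionRing hR
  obtain ⟨h, hr⟩ := h
  let := h.module
  have hfin : Module.Finite (R ⧸ maxIdeal R) M := Module.rank_lt_aleph0_iff.mp
    (hr ▸ Cardinal.natCast_lt_aleph0)
  let b := (Module.finBasisOfFinrankEq (R ⧸ maxIdeal R) M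
    (Module.finrank_eq_of_rank_eq hr)).reindex (Fintype.equivFin J).symm
  have hsmul (c : R) (x : M) : Ideal.Quotient.mk (maxIdeal R) c • x = c • x := rfl
  refine ⟨b, fun x => ?_, fun c hc j => ?_⟩
  · choose c hc using fun j => Ideal.Quotient.mk_surjective (b.repr x j)
    refine ⟨c, ?_⟩
    conv_lhs => rw [← b.sum_repr x]
    exact Finset.sum_congr rfl fun j _ => by rw [← hc, hsmul]
  · have := Fintype.linearIndependent_iff.mp b.linearIndependent
      (fun j => Ideal.Quotient.mk (maxIdeal R) (c j)) (by simpa only [hsmul] using hc) j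
    exact Ideal.Quotient.eq_zero_iff_mem.mp this

/-- A chain of lattices `C p` with semisimple successive quotients has an adapted basis: up to
elements of the maximal ideal, `C q` is spanned by the basis vectors in the blocks `≥ q`. -/
theorem exists_adapted_basis (hR : ∀ x, x ∈ R ↔ v x ≤ 1) {κ : Type*} [LinearOrder κ] [Finite κ]
    {B : Type*} [Fintype B] (bl : B → κ) (C nC : κ → Submodule R W) (p₀ : κ) (hp₀ : ∀ p, p₀ ≤ p)
    (hlt : ∀ p q, p < q → C q ≤ nC p) (hle : ∀ p, nC p ≤ C p)
    (hP : ∀ p, maxIdeal R • C p₀ ≤ nC p)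
    (hnext : ∀ p, nC p ≤ maxIdeal R • C p₀ ∨ ∃ q, p < q ∧ nC p ≤ C q)
    (hdim : ∀ p, HasResidueDim R (C p ⧸ (nC p).submoduleOf (C p)) (Nat.card {k // bl k = p}))
    (hfg : (C p₀).FG) (hspan : Submodule.span E (C p₀ : Set W) = ⊤) :
    ∃ b : Module.Basis B E W, ∀ q x, x ∈ C q ↔
      ∀ k, v (b.repr x k) ≤ 1 ∧ (bl k < q → v (b.repr x k) < 1) := by
  classical
  have hmono : ∀ p q, p ≤ q → C q ≤ C p := fun p q hpq => by
    rcases hpq.eq_or_lt with rfl | h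
    · exact le_rfl
    · exact (hlt p q h).trans (hle p)
  -- lift bases of the successive quotients
  have hex : ∀ p, ∃ β : {k // bl k = p} → W, (∀ k, β k ∈ C p) ∧
      (∀ x ∈ C p, ∃ c : {k // bl k = p} → R, x - ∑ k, c k • β k ∈ nC p) ∧
      ∀ c : {k // bl k = p} → R, ∑ k, c k • β k ∈ nC p → ∀ k, c k ∈ maxIdeal R := by
    intro p
    have hd := hdim p
    rw [Nat.card_eq_fintype_card] at hd
    obtain ⟨m, h1, h2⟩ := exists_residue_basis hR hd
    choose β hβ using fun k => Submodule.Quotient.mk_surjective _ (m k)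
    have hsum (c : {k // bl k = p} → R) :
        ∑ k, c k • m k = Submodule.Quotient.mk (∑ k, c k • β k) := by
      rw [← Submodule.mkQ_apply, map_sum]
      refine Finset.sum_congr rfl fun k _ => ?_
      rw [map_smul, Submodule.mkQ_apply, hβ]
    refine ⟨fun k => β k, fun k => (β k).2, fun x hx => ?_, fun c hc => h2 c ?_⟩
    · obtain ⟨c, hc⟩ := h1 (Submodule.Quotient.mk ⟨x, hx⟩)
      rw [hsum, Submodule.Quotient.eq] at hc
      refine ⟨c, ?_⟩
      have hc' : (C p).subtype (⟨x, hx⟩ - ∑ k, c k • β k) ∈ nC p := hc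
      simpa using hc'
    · rw [hsum, Submodule.Quotient.mk_eq_zero]
      change (C p).subtype (∑ k, c k • β k) ∈ nC p
      simpa using hc
  choose β' hβC hgen' hind' using hex
  let β : B → W := fun k => β' (bl k) ⟨k, rfl⟩
  have hββ' (p) (k : {k // bl k = p}) : β' p k = β k := by
    obtain ⟨k, rfl⟩ := k; rfl
  have hβ (k) : β k ∈ C (bl k) := hβC _ _
  have hgen (p) (x) (hx : x ∈ C p) : ∃ c : B → R,
      x - ∑ k with bl k = p, c k • β k ∈ nC p := by
    obtain ⟨c, hc⟩ := hgen' p x hx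
    refine ⟨fun k => if h : bl k = p then c ⟨k, h⟩ else 0, ?_⟩
    convert hc using 2
    rw [Finset.sum_subtype (p := fun k => bl k = p) _ (by simp)]
    refine Finset.sum_congr rfl fun k _ => ?_
    simp only [hββ', dif_pos k.2]
  have hind (p) (c : B → R) (hc : ∑ k with bl k = p, c k • β k ∈ nC p) (k) (hk : bl k = p) :
      c k ∈ maxIdeal R := by
    refine hind' p (fun k => c k) ?_ ⟨k, hk⟩
    convert hc using 1
    rw [Finset.sum_subtype (p := fun k => bl k = p) _ (by simp)]
    exact Finset.sum_congr rfl fun k _ => by rw [hββ']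
  let S : Submodule R W := Submodule.span R (Set.range β)
  have hβS (k) : β k ∈ S := Submodule.subset_span ⟨k, rfl⟩
  -- by descending induction the lifts generate modulo the maximal ideal
  have hA : ∀ p, C p ≤ S ⊔ maxIdeal R • C p₀ := by
    intro p
    induction p using WellFoundedGT.induction with
    | _ p ih =>
      intro x hx
      obtain ⟨c, hc⟩ := hgen p x hx
      have h1 : ∑ k with bl k = p, c k • β k ∈ S ⊔ maxIdeal R • C p₀ :=
        Submodule.mem_sup_left (sum_mem fun k _ => S.smul_mem _ (hβS k))
      have h2 : x - ∑ k with bl k = p, c k • β k ∈ S ⊔ maxIdeal R • C p₀ := by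
        rcases hnext p with h | ⟨q, hq, h⟩
        · exact Submodule.mem_sup_right (h hc)
        · exact ih q hq (h hc)
      simpa using add_mem h2 h1
  have hS : C p₀ ≤ S := by
    have h1 : (C p₀).map S.mkQ = ⊥ := by
      refine (hfg.map S.mkQ).eq_bot_of_le_jacobson_smul ?_
      rintro _ ⟨x, hx, rfl⟩
      obtain ⟨s, hs, y, hy, rfl⟩ := Submodule.mem_sup.mp (hA p₀ hx)
      have h0 : S.mkQ s = 0 := (Submodule.Quotient.mk_eq_zero S).mpr hs
      rw [map_add, h0, zero_add]
      refine Submodule.smul_mono_left (maxIdeal_le_jacobson hR) ?_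
      rw [← Submodule.map_smul'']
      exact ⟨y, hy, rfl⟩
    intro x hx
    have h2 : S.mkQ x ∈ (C p₀).map S.mkQ := ⟨x, hx, rfl⟩
    rw [h1, Submodule.mem_bot] at h2
    exact (Submodule.Quotient.mk_eq_zero S).mp h2
  have hspanβ : ⊤ ≤ Submodule.span E (Set.range β) := by
    rw [← hspan, Submodule.span_le]
    intro x hx
    refine Submodule.span_induction (fun y hy => Submodule.subset_span hy) (zero_mem _)
      (fun _ _ _ _ => add_mem) (fun c y _ hy => ?_) (hS hx)
    exact Submodule.smul_mem _ (c : E) hy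
  have hterm (p) (x : R) (k) (h : bl k < p → x ∈ maxIdeal R) (hne : bl k ≠ p) :
      x • β k ∈ nC p := by
    rcases lt_or_gt_of_ne hne with h1 | h1
    · exact hP p (Submodule.smul_mem_smul (h h1) (hmono _ _ (hp₀ _) (hβ k)))
    · exact (nC p).smul_mem _ (hlt _ _ h1 (hβ k))
  have hB (p) (x : B → R) (hx : ∑ k, x k • β k ∈ nC p)
      (hlow : ∀ k, bl k < p → x k ∈ maxIdeal R) (k) (hk : bl k = p) : x k ∈ maxIdeal R := by
    refine hind p x ?_ k hk
    rw [← Finset.sum_filter_add_sum_filter_not Finset.univ (fun k => bl k = p)] at hx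
    refine (Submodule.add_mem_iff_left _ (sum_mem fun k hk => ?_)).mp hx
    exact hterm p (x k) k (hlow k) (by simpa using hk)
  have hB' (x : B → R) (T : κ → Prop) (hT : ∀ p q, p < q → T q → T p)
      (hx : ∀ p, T p → ∑ k, x k • β k ∈ nC p) : ∀ p, T p → ∀ k, bl k = p → x k ∈ maxIdeal R := by
    intro p
    induction p using WellFoundedLT.induction with
    | _ p ih => exact fun hp => hB p x (hx p hp) fun k hk => ih _ hk (hT _ _ hk hp) k rfl
  have hli : LinearIndependent E β := by
    rw [Fintype.linearIndependent_iff]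
    by_contra hcon
    push Not at hcon
    obtain ⟨x, hx, k₁, hk₁⟩ := hcon
    have : Nonempty B := ⟨k₁⟩
    obtain ⟨k₀, hk₀⟩ := Finite.exists_max fun k => v (x k)
    have hx0 : x k₀ ≠ 0 := fun h => hk₁ (by
      have := hk₀ k₁
      rw [h, map_zero, le_zero_iff, Valuation.zero_iff] at this
      exact this)
    have hv0 : 0 < v (x k₀) := zero_lt_iff.mpr (by simpa using hx0)
    have hmem (k) : (x k₀)⁻¹ * x k ∈ R := by
      rw [hR, map_mul, map_inv₀, mul_comm, ← div_eq_mul_inv]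
      exact div_le_one_of_le₀ (hk₀ k) zero_le
    have hsum : ∑ k, (⟨_, hmem k⟩ : R) • β k = 0 := by
      have h1 : ∑ k, (⟨_, hmem k⟩ : R) • β k = (x k₀)⁻¹ • ∑ k, x k • β k := by
        rw [Finset.smul_sum]
        exact Finset.sum_congr rfl fun k _ => (smul_smul _ _ _).symm
      rw [h1, hx, smul_zero]
    have h2 := hB' (fun k => ⟨_, hmem k⟩) (fun _ => True) (fun _ _ _ _ => trivial)
      (fun p _ => by rw [hsum]; exact zero_mem _) (bl k₀) trivial k₀ rfl
    rw [mem_maxIdeal_iff hR] at h2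
    change v ((x k₀)⁻¹ * x k₀) < 1 at h2
    rw [inv_mul_cancel₀ hx0, map_one] at h2
    exact lt_irrefl _ h2
  refine ⟨Module.Basis.mk hli hspanβ, fun q x => ⟨fun hx => ?_, fun hx => ?_⟩⟩
  · obtain ⟨c, hc⟩ := (Submodule.mem_span_range_iff_exists_fun R).mp (hS (hmono _ _ (hp₀ q) hx))
    have hrepr (k) : (Module.Basis.mk hli hspanβ).repr x k = c k := by
      have h1 : x = ∑ k, (c k : E) • Module.Basis.mk hli hspanβ k := by
        rw [← hc]
        exact Finset.sum_congr rfl fun k _ => by rw [Module.Basis.mk_apply]; rfl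
      conv_lhs => rw [h1]
      rw [Module.Basis.repr_sum_self]
    intro k
    rw [hrepr]
    refine ⟨(hR _).mp (c k).2, fun hk => (mem_maxIdeal_iff hR _).mp ?_⟩
    exact hB' c (fun p => p < q) (fun p p' h h' => h.trans h')
      (fun p hp => by rw [hc]; exact hlt p q hp hx) (bl k) hk k rfl
  · rw [← (Module.Basis.mk hli hspanβ).sum_repr x]
    refine sum_mem fun k _ => ?_
    rw [Module.Basis.mk_apply]
    have hk := hx k
    have hsm : (Module.Basis.mk hli hspanβ).repr x k • β k =
        (⟨_, (hR _).mpr hk.1⟩ : R) • β k := rfl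
    rw [hsm]
    by_cases hkq : bl k = q
    · exact (C q).smul_mem _ (hkq ▸ hβ k)
    · exact hle q (hterm q _ k (fun h => (mem_maxIdeal_iff hR _).mpr (hk.2 h)) hkq)

end AdaptedBasis

/-! ### The decomposition of `V` and of its stable lattices -/

section Morita

variable {F Δ V L : Type*} [Field F] [DivisionRing Δ] [Algebra F Δ]
  [AddCommGroup V] [Module Δᵐᵒᵖ V] [Module F V] [IsScalarTower F Δᵐᵒᵖ V]
  [Field L] [Algebra F L] {Δ' : Type*} [DivisionRing Δ'] [Algebra L Δ'] {t : ℕ} [NeZero t]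
  (ι : L →ₐ[F] Module.End Δᵐᵒᵖ V) (Θ : L ⊗[F] Δ ≃ₐ[L] Matrix (Fin t) (Fin t) Δ')

theorem rmul_add (z w : L ⊗[F] Δ) (v : V) : rmul ι (z + w) v = rmul ι z v + rmul ι w v := by
  simp [rmul]

theorem rmul_zero (v : V) : rmul ι (0 : L ⊗[F] Δ) v = 0 := by
  simp [rmul]

theorem rmul_sum {J : Type*} (s : Finset J) (z : J → L ⊗[F] Δ) (v : V) :
    rmul ι (∑ j ∈ s, z j) v = ∑ j ∈ s, rmul ι (z j) v := by
  simp [rmul]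

theorem rmul_one (v : V) : rmul ι (1 : L ⊗[F] Δ) v = v := by
  simp [rmul]

theorem rmul_one_tmul (x : Δ) (v : V) : rmul ι (1 ⊗ₜ[F] x) v = MulOpposite.op x • v := by
  rw [rmul_tmul, map_one]; rfl

theorem rmul_tmul_one (a : L) (v : V) : rmul ι (a ⊗ₜ[F] (1 : Δ)) v = ι a v := by
  rw [rmul_tmul, MulOpposite.op_one, one_smul]

theorem sum_comp_rev {M : Type*} [AddCommMonoid M] (f : Fin t → M) :
    ∑ j, f (Fin.rev j) = ∑ j, f j := Equiv.sum_comp Fin.revPerm f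

/-- The map `v ↦ v E_{t-j,t}` from `V` to `V^{(t)}`, for `j` counted from `0`. -/
def colMap (j : Fin t) : V →ₗ[F] corner ι Θ :=
  LinearMap.codRestrict _ (rmul ι (unitElt Θ (Fin.rev j) (Fin.rev 0) 1))
    (rmul_unitElt_mem ι Θ _ 1)

/-- The map `w ↦ w E_{t,t-j}` from `V^{(t)}` to `V`, for `j` counted from `0`. -/
def rowMap (j : Fin t) : corner ι Θ →ₗ[F] V :=
  (rmul ι (unitElt Θ (Fin.rev 0) (Fin.rev j) 1)).comp (corner ι Θ).subtype

theorem coe_colMap (j : Fin t) (v : V) :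
    (colMap ι Θ j v : V) = rmul ι (unitElt Θ (Fin.rev j) (Fin.rev 0) 1) v := rfl

theorem rowMap_apply (j : Fin t) (w : corner ι Θ) :
    rowMap ι Θ j w = rmul ι (unitElt Θ (Fin.rev 0) (Fin.rev j) 1) w := rfl

theorem coe_op_smul (x : Δ') (w : corner ι Θ) :
    ((MulOpposite.op x • w : corner ι Θ) : V) =
      rmul ι (unitElt Θ (Fin.rev 0) (Fin.rev 0) x) w := rfl

theorem rowMap_op_smul (j : Fin t) (x : Δ') (w : corner ι Θ) :
    rowMap ι Θ j (MulOpposite.op x • w) = rmul ι (unitElt Θ (Fin.rev 0) (Fin.rev j) x) w := by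
  rw [rowMap_apply, coe_op_smul, rmul_rmul, unitElt_mul, mul_one]

theorem rmul_unitElt_rowMap (j k : Fin t) (x : Δ') (w : corner ι Θ) :
    rmul ι (unitElt Θ (Fin.rev j) (Fin.rev k) x) (rowMap ι Θ j w) =
      rowMap ι Θ k (MulOpposite.op x • w) := by
  rw [rowMap_op_smul, rowMap_apply, rmul_rmul, unitElt_mul, one_mul]

theorem unitElt_mul_of_ne {k l l' m : Fin t} (h : l ≠ l') (x y : Δ') :
    unitElt Θ k l x * unitElt Θ l' m y = 0 := by
  rw [unitElt, unitElt, ← map_mul, Matrix.single_mul_single_of_ne _ _ _ _ h, map_zero]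

theorem colMap_rowMap (j k : Fin t) (w : corner ι Θ) :
    colMap ι Θ j (rowMap ι Θ k w) = if j = k then w else 0 := by
  apply Subtype.ext
  rw [coe_colMap, rowMap_apply, rmul_rmul]
  split_ifs with h
  · subst h
    rw [unitElt_mul, mul_one]
    exact (coe_op_smul ι Θ 1 w).symm.trans (by rw [MulOpposite.op_one, one_smul])
  · rw [unitElt_mul_of_ne _ (fun h' => h (Fin.rev_injective h').symm), rmul_zero]; rfl

theorem sum_unitElt_diag : ∑ j : Fin t, unitElt Θ j j (1 : Δ') = 1 := by
  simp only [unitElt]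
  rw [← map_sum, Matrix.sum_single_one, map_one]

theorem sum_rowMap_colMap (v : V) : ∑ j, rowMap ι Θ j (colMap ι Θ j v) = v := by
  have h (j : Fin t) : rowMap ι Θ j (colMap ι Θ j v) =
      rmul ι (unitElt Θ (Fin.rev j) (Fin.rev j) 1) v := by
    rw [rowMap_apply, coe_colMap, rmul_rmul, unitElt_mul, mul_one]
  simp only [h]
  rw [← rmul_sum, sum_comp_rev (fun j => unitElt Θ j j (1 : Δ')), sum_unitElt_diag, rmul_one]

/-- In the coordinates given by `colMap` the ring `L ⊗ Δ` acts through `Θ` by matrix multiplication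
from the right. -/
theorem colMap_rmul (j : Fin t) (z : L ⊗[F] Δ) (v : V) :
    colMap ι Θ j (rmul ι z v) =
      ∑ k, MulOpposite.op (Θ z (Fin.rev k) (Fin.rev j)) • colMap ι Θ k v := by
  apply Subtype.ext
  rw [coe_colMap, rmul_rmul, AddSubmonoidClass.coe_finsetSum]
  simp only [coe_op_smul, coe_colMap, rmul_rmul, unitElt_mul, one_mul]
  rw [← rmul_sum, sum_comp_rev (fun k => unitElt Θ k (Fin.rev 0) (Θ z k (Fin.rev j)))]
  congr 2
  apply Θ.injective
  simp only [unitElt, map_mul, map_sum, AlgEquiv.apply_symm_apply]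
  ext a b
  rw [Matrix.sum_apply]
  by_cases hb : Fin.rev 0 = b
  · subst hb
    simp [Matrix.single_apply]
  · simp [hb, Matrix.mul_apply]

/-- The decomposition `V ≃ (V^{(t)})^t`. -/
def cornerEquiv : V ≃ₗ[F] (Fin t → corner ι Θ) where
  toFun v j := colMap ι Θ j v
  map_add' v w := by ext; simp
  map_smul' c v := by ext; simp
  invFun w := ∑ j, rowMap ι Θ j (w j)
  left_inv v := sum_rowMap_colMap ι Θ v
  right_inv w := by
    ext j
    simp [colMap_rowMap, map_sum]

variable [Algebra F Δ'] [IsScalarTower F L Δ']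

theorem smul_corner_eq (c : F) (w : corner ι Θ) :
    c • w = MulOpposite.op (algebraMap F Δ' c) • w := by
  apply Subtype.ext
  rw [coe_op_smul]
  have h1 : unitElt Θ (Fin.rev 0) (Fin.rev 0) (algebraMap F Δ' c) =
      unitElt Θ (Fin.rev 0) (Fin.rev 0) 1 * (algebraMap F L c) ⊗ₜ[F] (1 : Δ) := by
    have : (algebraMap F L c) ⊗ₜ[F] (1 : Δ) = algebraMap L (L ⊗[F] Δ) (algebraMap F L c) := rfl
    rw [this, ← Algebra.commutes, ← Algebra.smul_def, unitElt, unitElt, ← map_smul,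
      Matrix.smul_single, Algebra.smul_def, mul_one, ← IsScalarTower.algebraMap_apply]
  rw [h1, ← rmul_rmul, rmul_tmul_one, AlgHom.commutes]
  have h2 : rmul ι (unitElt Θ (Fin.rev 0) (Fin.rev 0) 1) (w : V) = w :=
    (coe_op_smul ι Θ 1 w).symm.trans (by rw [MulOpposite.op_one, one_smul])
  rw [h2, Module.algebraMap_end_apply]
  rfl

instance : IsScalarTower F Δ'ᵐᵒᵖ (corner ι Θ) where
  smul_assoc c x w := by
    rw [Algebra.smul_def, mul_smul, smul_corner_eq]; rfl

end Morita

section Lattices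

/-- A shortcut for instance search. -/
instance ordOpModule {F D W : Type*} [Field F] [TopologicalSpace F] [DivisionRing D] [Algebra F D]
    [AddCommGroup W] [Module Dᵐᵒᵖ W] : Module (OrdOp F D) W := inferInstance

/-- A shortcut for instance search. -/
instance ordOpIdealSMul {F D W : Type*} [Field F] [TopologicalSpace F] [DivisionRing D]
    [Algebra F D] [AddCommGroup W] [Module Dᵐᵒᵖ W] :
    SMul (Ideal (OrdOp F D)) (Submodule (OrdOp F D) W) := inferInstance

variable {F : Type*} [Field F] [TopologicalSpace F] [ValuativeRel F]
  [IsNonarchimedeanLocalField F]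
  {Δ V L : Type*} [DivisionRing Δ] [Algebra F Δ] [FiniteDimensional F Δ]
  [AddCommGroup V] [Module Δᵐᵒᵖ V] [Module F V] [IsScalarTower F Δᵐᵒᵖ V]
  [Field L] [Algebra F L] [FiniteDimensional F L]
  {Δ' : Type*} [DivisionRing Δ'] [Algebra L Δ'] [Algebra F Δ'] [IsScalarTower F L Δ']
  [FiniteDimensional F Δ'] {t : ℕ} [NeZero t]
  {ι : L →ₐ[F] Module.End Δᵐᵒᵖ V} {Θ : L ⊗[F] Δ ≃ₐ[L] Matrix (Fin t) (Fin t) Δ'}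

/-- `M` is stable under the action of the integers of `L`. -/
def IsStable (ι : L →ₐ[F] Module.End Δᵐᵒᵖ V) (M : Submodule (OrdOp F Δ) V) : Prop :=
  ∀ a ∈ integralClosure 𝒪[F] L, ∀ v ∈ M, ι a v ∈ M

theorem IsStable.rmul_mem {M : Submodule (OrdOp F Δ) V} (hM : IsStable ι M) {z : L ⊗[F] Δ}
    (hz : z ∈ tball F L Δ 0) : ∀ v ∈ M, rmul ι z v ∈ M := by
  rw [← mem_tensorOrder_iff] at hz
  refine Subring.closure_induction (p := fun z _ => ∀ v ∈ M, rmul ι z v ∈ M)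
    ?_ ?_ ?_ ?_ ?_ ?_ hz
  · rintro _ ⟨a, ha, x, hx, rfl⟩ v hv
    rw [rmul_tmul]
    exact M.smul_mem (⟨MulOpposite.op x, hx⟩ : OrdOp F Δ) (hM a ha v hv)
  · intro v _; rw [rmul_zero]; exact M.zero_mem
  · intro v hv; rwa [rmul_one]
  · intro a b _ _ ha hb v hv; rw [rmul_add]; exact M.add_mem (ha v hv) (hb v hv)
  · intro a _ ha v hv
    have : rmul ι (-a) v = -rmul ι a v := by simp [rmul]
    rw [this]; exact M.neg_mem (ha v hv)
  · intro a b _ _ ha hb v hv; rw [← rmul_rmul]; exact hb _ (ha v hv)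

theorem IsStable.maxIdeal_smul {M : Submodule (OrdOp F Δ) V} (hM : IsStable ι M) :
    IsStable ι (maxIdeal (OrdOp F Δ) • M) := by
  intro a ha v hv
  refine Submodule.smul_induction_on hv (fun x hx n hn => ?_) (fun v w hv hw => ?_)
  · have : ι a (x • n) = x • ι a n := (ι a).map_smul (x : Δᵐᵒᵖ) n
    rw [this]
    exact Submodule.smul_mem_smul hx (hM a ha n hn)
  · rw [map_add]; exact add_mem hv hw

omit [Module F V] [IsScalarTower F Δᵐᵒᵖ V] in
theorem mem_maxIdeal_smul_iff_divUnif {M : Submodule (OrdOp F Δ) V} {v : V} :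
    v ∈ maxIdeal (OrdOp F Δ) • M ↔ (MulOpposite.op (divUnif F Δ))⁻¹ • v ∈ M :=
  mem_maxIdeal_smul_iff (π := MulOpposite.op (divUnif F Δ)) mem_ordOp_iff (divVal_divUnif F Δ) M v

theorem IsStable.rmul_mem_smul {M : Submodule (OrdOp F Δ) V} (hM : IsStable ι M) {z : L ⊗[F] Δ}
    (hz : z ∈ tball F L Δ (-1)) {v : V} (hv : v ∈ M) :
    rmul ι z v ∈ maxIdeal (OrdOp F Δ) • M := by
  have hunif := divUnif_ne_zero F Δ
  rw [mem_maxIdeal_smul_iff_divUnif, ← MulOpposite.op_inv, ← rmul_one_tmul ι, rmul_rmul]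
  refine hM.rmul_mem ?_ v hv
  have h : divVal F Δ (divUnif F Δ)⁻¹ = WithZero.exp 1 := by
    rw [map_inv₀, divVal_divUnif, ← WithZero.exp_neg, neg_neg]
  have := (mul_unif_mem_tball_iff (z := z) h (-1)).mpr hz
  rwa [neg_add_cancel] at this

variable (hL : ramIdx F L = 1) (hΘ : IsIwahori Θ)
include hL hΘ

/-- A uniformizer of `Δ` lies in the radical of the Iwahori order. -/
theorem tmul_divUnif_weight (k l : Fin t) :
    divVal F Δ' (Θ (1 ⊗ₜ divUnif F Δ) k l) ^ t ≤ WithZero.exp ((l : ℤ) - k - 1) := by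
  refine mem_iwahoriRad_iff_pow.mp ((hΘ.mem_tball_neg_one_iff hL _).mp ?_) k l
  have := tmul_mem_tball (F := F) (L := L) (Δ := Δ) (x := 1) (y := divUnif F Δ) (n := -1)
    (by simp) (divVal_divUnif F Δ).le
  exact this

/-- Elements in the inverse of the radical of the Iwahori order move `M 𝔓` into `M`. -/
theorem rmul_mem_of_weight {M : Submodule (OrdOp F Δ) V} (hM : IsStable ι M) {z : L ⊗[F] Δ}
    (hz : ∀ k l, divVal F Δ' (Θ z k l) ^ t ≤ WithZero.exp ((l : ℤ) - k - (-1 : ℤ)))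
    {v : V} (hv : v ∈ maxIdeal (OrdOp F Δ) • M) : rmul ι z v ∈ M := by
  rw [mem_maxIdeal_smul_iff_divUnif] at hv
  have hunif := divUnif_ne_zero F Δ
  have hv' : v = rmul ι (1 ⊗ₜ divUnif F Δ) ((MulOpposite.op (divUnif F Δ))⁻¹ • v) := by
    rw [rmul_one_tmul, smul_smul, mul_inv_cancel₀ (by simpa using hunif), one_smul]
  rw [hv', rmul_rmul]
  refine hM.rmul_mem ?_ _ hv
  rw [hΘ.mem_tball_zero_iff, mem_iwahori_iff_pow, map_mul]
  intro k l
  have := iwahori_weight_mul (m := 1) (n := -1) (tmul_divUnif_weight hL hΘ) hz k l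
  simpa using this

/-- Elements of the radical of the Iwahori order move `M` into `M 𝔓`. -/
theorem rmul_mem_smul_of_weight {M : Submodule (OrdOp F Δ) V} (hM : IsStable ι M) {z : L ⊗[F] Δ}
    (hz : ∀ k l, divVal F Δ' (Θ z k l) ^ t ≤ WithZero.exp ((l : ℤ) - k - 1))
    {v : V} (hv : v ∈ M) : rmul ι z v ∈ maxIdeal (OrdOp F Δ) • M :=
  hM.rmul_mem_smul ((hΘ.mem_tball_neg_one_iff hL z).mpr (mem_iwahoriRad_iff_pow.mpr hz)) hv

omit hL hΘ in
theorem weight_unitElt {x : Δ'} {k l : Fin t} {m : ℤ}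
    (hx : divVal F Δ' x ^ t ≤ WithZero.exp ((l : ℤ) - k - m)) (k' l' : Fin t) :
    divVal F Δ' (Θ (unitElt Θ k l x) k' l') ^ t ≤ WithZero.exp ((l' : ℤ) - k' - m) := by
  rw [unitElt, AlgEquiv.apply_symm_apply]
  by_cases h : k = k' ∧ l = l'
  · obtain ⟨rfl, rfl⟩ := h
    simpa using hx
  · rw [Matrix.single_apply, if_neg h, map_zero, zero_pow (NeZero.ne t)]
    exact zero_le

/-- If `x E_{t-j,t-k}` lies in the radical of the Iwahori order, then it moves a stable lattice
`M` into `M 𝔓`. -/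
theorem rowMap_op_smul_mem_smul {M : Submodule (OrdOp F Δ) V} (hM : IsStable ι M) {j k : Fin t}
    {x : Δ'} (hx : divVal F Δ' x ^ t ≤ WithZero.exp ((j : ℤ) - k - 1)) {w : corner ι Θ}
    (hw : rowMap ι Θ j w ∈ M) :
    rowMap ι Θ k (MulOpposite.op x • w) ∈ maxIdeal (OrdOp F Δ) • M := by
  rw [← rmul_unitElt_rowMap ι Θ j]
  refine rmul_mem_smul_of_weight hL hΘ hM (weight_unitElt ?_) hw
  have h1 := Fin.val_rev j
  have h2 := Fin.val_rev k
  have h3 := j.2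
  have h4 := k.2
  convert hx using 2
  omega

/-- If `x E_{t-j,t-k}` lies in the inverse of the radical of the Iwahori order, then it moves `M 𝔓`
into `M`. -/
theorem rowMap_op_smul_mem {M : Submodule (OrdOp F Δ) V} (hM : IsStable ι M) {j k : Fin t}
    {x : Δ'} (hx : divVal F Δ' x ^ t ≤ WithZero.exp ((j : ℤ) - k - (-1 : ℤ))) {w : corner ι Θ}
    (hw : rowMap ι Θ j w ∈ maxIdeal (OrdOp F Δ) • M) :
    rowMap ι Θ k (MulOpposite.op x • w) ∈ M := by
  rw [← rmul_unitElt_rowMap ι Θ j]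
  refine rmul_mem_of_weight hL hΘ hM (weight_unitElt ?_) hw
  have h1 := Fin.val_rev j
  have h2 := Fin.val_rev k
  have h3 := j.2
  have h4 := k.2
  convert hx using 2
  omega

/-- The later components of `M` lie in the earlier components of `M 𝔓`. -/
theorem rowMap_mem_smul_of_lt {M : Submodule (OrdOp F Δ) V} (hM : IsStable ι M) {j k : Fin t}
    (hjk : k < j) {w : corner ι Θ} (hw : rowMap ι Θ j w ∈ M) :
    rowMap ι Θ k w ∈ maxIdeal (OrdOp F Δ) • M := by
  have := rowMap_op_smul_mem_smul hL hΘ hM (k := k) (x := 1) (by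
    rw [map_one, one_pow, ← WithZero.exp_zero, WithZero.exp_le_exp]
    rw [Fin.lt_def] at hjk
    omega) hw
  rwa [MulOpposite.op_one, one_smul] at this

/-- Multiplication by `𝔓` shifts the components of a stable lattice: the component of `M 𝔓` at `k`
is the component of `M` at `k + 1`. -/
theorem rowMap_mem_smul_iff_succ {M : Submodule (OrdOp F Δ) V} (hM : IsStable ι M) {j k : Fin t}
    (hjk : (j : ℕ) = k + 1) {w : corner ι Θ} :
    rowMap ι Θ k w ∈ maxIdeal (OrdOp F Δ) • M ↔ rowMap ι Θ j w ∈ M := by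
  refine ⟨fun hw => ?_, rowMap_mem_smul_of_lt hL hΘ hM (by rw [Fin.lt_def]; omega)⟩
  have := rowMap_op_smul_mem hL hΘ hM (k := j) (x := 1) (by
    rw [map_one, one_pow, ← WithZero.exp_zero, WithZero.exp_le_exp]
    omega) hw
  rwa [MulOpposite.op_one, one_smul] at this

/-- At the last index the shift wraps around: the last component of `M 𝔓_Δ` is `𝔓_Δ'` times the
first component of `M`. -/
theorem rowMap_mem_smul_iff_last {M : Submodule (OrdOp F Δ) V} (hM : IsStable ι M) {j : Fin t}
    (hj : (j : ℕ) + 1 = t) {w : corner ι Θ} :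
    rowMap ι Θ j w ∈ maxIdeal (OrdOp F Δ) • M ↔
      rowMap ι Θ 0 ((MulOpposite.op (divUnif F Δ'))⁻¹ • w) ∈ M := by
  have hπ := divUnif_ne_zero F Δ'
  have h0 : ((0 : Fin t) : ℕ) = 0 := rfl
  constructor
  · intro hw
    rw [← MulOpposite.op_inv]
    refine rowMap_op_smul_mem hL hΘ hM ?_ hw
    rw [map_inv₀, divVal_divUnif, ← WithZero.exp_neg, ← WithZero.exp_nsmul, WithZero.exp_le_exp,
      nsmul_eq_mul]
    omega
  · intro hw
    have := rowMap_op_smul_mem_smul hL hΘ hM (k := j) (x := divUnif F Δ') (by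
      rw [divVal_divUnif, ← WithZero.exp_nsmul, WithZero.exp_le_exp, nsmul_eq_mul]
      omega) hw
    rwa [smul_smul, mul_inv_cancel₀ (by simpa using hπ), one_smul] at this

omit hL in
theorem rowMap_smul_mem {M : Submodule (OrdOp F Δ) V} (hM : IsStable ι M) (j : Fin t)
    (x : OrdOp F Δ') {w : corner ι Θ} (hw : rowMap ι Θ j w ∈ M) : rowMap ι Θ j (x • w) ∈ M := by
  change rowMap ι Θ j (MulOpposite.op (x : Δ'ᵐᵒᵖ).unop • w) ∈ M
  rw [← rmul_unitElt_rowMap ι Θ j]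
  refine hM.rmul_mem ?_ _ hw
  rw [hΘ.mem_tball_zero_iff, mem_iwahori_iff_pow]
  intro k l
  have := weight_unitElt (Θ := Θ) (x := (x : Δ'ᵐᵒᵖ).unop) (k := Fin.rev j) (l := Fin.rev j)
    (m := 0) (by
      rw [sub_self, sub_zero, WithZero.exp_zero]
      exact pow_le_one' ((mem_ordOp_iff _).mp x.2) t) k l
  simpa using this

omit hL hΘ in
theorem IsStable.rowMap_colMap_mem (hΘ : IsIwahori Θ) {M : Submodule (OrdOp F Δ) V}
    (hM : IsStable ι M) (j : Fin t) {v : V} (hv : v ∈ M) :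
    rowMap ι Θ j (colMap ι Θ j v) ∈ M := by
  rw [rowMap_apply, coe_colMap, rmul_rmul, unitElt_mul, mul_one]
  refine hM.rmul_mem ?_ _ hv
  rw [hΘ.mem_tball_zero_iff, mem_iwahori_iff_pow]
  intro k l
  have := weight_unitElt (Θ := Θ) (x := (1 : Δ')) (k := Fin.rev j) (l := Fin.rev j)
    (m := 0) (by simp) k l
  simpa using this

omit hL in
/-- A stable lattice is the direct sum of its components. -/
theorem mem_iff_forall_rowMap_colMap {M : Submodule (OrdOp F Δ) V}
    (hM : IsStable ι M) {v : V} : v ∈ M ↔ ∀ j, rowMap ι Θ j (colMap ι Θ j v) ∈ M := by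
  refine ⟨fun hv j => hM.rowMap_colMap_mem hΘ j hv, fun h => ?_⟩
  rw [← sum_rowMap_colMap ι Θ v]
  exact sum_mem fun j _ => h j

omit hL hΘ in
/-- The `j`-th component of a lattice in `V`. -/
def piece (Θ : L ⊗[F] Δ ≃ₐ[L] Matrix (Fin t) (Fin t) Δ') (M : Submodule (OrdOp F Δ) V)
    (j : Fin t) : AddSubgroup (corner ι Θ) :=
  M.toAddSubgroup.comap (rowMap ι Θ j).toAddMonoidHom

omit hL in
/-- Indices of stable lattices are computed in components. -/
theorem relIndex_eq_prod_piece {M M' : Submodule (OrdOp F Δ) V} (hM : IsStable ι M)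
    (hM' : IsStable ι M') : M'.toAddSubgroup.relIndex M.toAddSubgroup =
      ∏ j, (piece (ι := ι) Θ M' j).relIndex (piece Θ M j) := by
  have h {M : Submodule (OrdOp F Δ) V} (hM : IsStable ι M) : M.toAddSubgroup =
      (AddSubgroup.pi Set.univ (piece (ι := ι) Θ M)).comap
        (cornerEquiv ι Θ).toLinearMap.toAddMonoidHom := by
    ext v
    change v ∈ M ↔ _
    rw [mem_iff_forall_rowMap_colMap hΘ hM]
    exact ⟨fun h j _ => h j, fun h j => h j trivial⟩
  rw [h hM, h hM', relIndex_comap_pi _ (cornerEquiv ι Θ).surjective]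

end Lattices

/-! ### Residue dimensions and vectors of flags -/

section ResidueDim

theorem exists_hasResidueDim {E : Type*} [DivisionRing E] {v : Valuation E ℤᵐ⁰} {R : Subring E}
    (hR : ∀ x, x ∈ R ↔ v x ≤ 1) {M : Type*} [AddCommGroup M] [Module R M] [Module.Finite R M]
    (h : Module.IsTorsionBySet R M (maxIdeal R)) : ∃ n, HasResidueDim R M n := by
  let K : DivisionRing (R ⧸ maxIdeal R) := residueDivisionRing hR
  let := h.module
  have : Module.Finite (R ⧸ maxIdeal R) M := by
    obtain ⟨s, hs⟩ := (Module.Finite.fg_top : (⊤ : Submodule R M).FG)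
    refine ⟨s, ?_⟩
    rw [eq_top_iff]
    intro x _
    have hx : x ∈ Submodule.span R (s : Set M) := hs ▸ trivial
    refine Submodule.span_induction (fun y hy => Submodule.subset_span hy) (zero_mem _)
      (fun _ _ _ _ => add_mem) (fun c y _ hy => ?_) hx
    exact Submodule.smul_mem _ (Ideal.Quotient.mk _ c) hy
  obtain ⟨n, hn⟩ := Cardinal.lt_aleph0.mp (Module.rank_lt_aleph0 (R ⧸ maxIdeal R) M)
  exact ⟨n, h, hn⟩

variable {F : Type*} [Field F] [TopologicalSpace F] [ValuativeRel F]
  [IsNonarchimedeanLocalField F] {D W : Type*} [DivisionRing D] [Algebra F D]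
  [FiniteDimensional F D] [AddCommGroup W] [Module Dᵐᵒᵖ W]

/-- The dimension of a quotient of lattices is determined by the index. -/
theorem hasResidueDim_quotient_iff (M M' : Submodule (OrdOp F D) W) (n : ℕ) :
    HasResidueDim (OrdOp F D) (M ⧸ M'.submoduleOf M) n ↔
      maxIdeal (OrdOp F D) • M ≤ M' ∧
        M'.toAddSubgroup.relIndex M.toAddSubgroup = resCard F D ^ n := by
  rw [hasResidueDim_iff mem_ordOp_iff (by rw [card_residue_op]; exact resCard_ne_zero F D),
    card_residue_op]
  refine and_congr ?_ Iff.rfl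
  constructor
  · intro h
    rw [Submodule.smul_le]
    intro x hx m hm
    have := @h (Submodule.Quotient.mk ⟨m, hm⟩) ⟨x, hx⟩
    exact (Submodule.Quotient.mk_eq_zero (M'.submoduleOf M)
      (x := (⟨x, hx⟩ : {y // y ∈ maxIdeal (OrdOp F D)}).1 • (⟨m, hm⟩ : M))).mp this
  · rintro h m ⟨x, hx⟩
    obtain ⟨m, rfl⟩ := Submodule.Quotient.mk_surjective _ m
    exact (Submodule.Quotient.mk_eq_zero _).mpr (h (Submodule.smul_mem_smul hx m.2))

variable [Module F W] [IsScalarTower F Dᵐᵒᵖ W]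

theorem divVal_algebraMap_integer (c : 𝒪[F]) : divVal F D (algebraMap F D c) ≤ 1 :=
  (divVal_algebraMap_le_one_iff _).mpr ((mem_integers_iff _).mp c.2)

/-- A right lattice over the integers of `D`, as a module over the integers of `F`. -/
def intRestrict (M : Submodule (OrdOp F D) W) : Submodule 𝒪[F] W where
  carrier := M
  zero_mem' := M.zero_mem
  add_mem' := M.add_mem
  smul_mem' c x hx := by
    have : c • x = (⟨MulOpposite.op (algebraMap F D c),
        (mem_maxCompactSubring_iff _).mpr (divVal_algebraMap_integer c)⟩ : OrdOp F D) • x := by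
      change (c : F) • x = MulOpposite.op (algebraMap F D c) • x
      rw [← algebraMap_smul Dᵐᵒᵖ (c : F) x]; rfl
    rw [this]
    exact M.smul_mem _ hx

theorem mem_intRestrict {M : Submodule (OrdOp F D) W} {x : W} : x ∈ intRestrict M ↔ x ∈ M :=
  Iff.rfl

/-- The orbit map of `w`, linear over the integers of `F`. -/
def orbitMap (F : Type*) [Field F] [ValuativeRel F] [TopologicalSpace F]
    [IsNonarchimedeanLocalField F] {D W : Type*} [DivisionRing D] [Algebra F D] [AddCommGroup W]
    [Module Dᵐᵒᵖ W] [Module F W] [IsScalarTower F Dᵐᵒᵖ W] (w : W) : D →ₗ[𝒪[F]] W where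
  toFun x := MulOpposite.op x • w
  map_add' x y := by rw [MulOpposite.op_add, add_smul]
  map_smul' c x := by
    change MulOpposite.op ((c : F) • x) • w = (c : F) • MulOpposite.op x • w
    rw [MulOpposite.op_smul, smul_assoc]

/-- Finite generation may be tested over the noetherian ring of integers of `F`. -/
theorem intRestrict_fg_iff (M : Submodule (OrdOp F D) W) : (intRestrict M).FG ↔ M.FG := by
  classical
  constructor
  · rintro ⟨s, hs⟩
    refine ⟨s, le_antisymm (Submodule.span_le.mpr fun x hx => ?_) fun x hx => ?_⟩
    · exact (hs ▸ Submodule.subset_span hx : x ∈ intRestrict M)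
    · have h1 : Submodule.span 𝒪[F] (s : Set W) ≤
          intRestrict (Submodule.span (OrdOp F D) (s : Set W)) :=
        Submodule.span_le.mpr fun y hy => Submodule.subset_span hy
      rw [hs] at h1
      exact h1 hx
  · rintro ⟨s, hs⟩
    have h : intRestrict M = ⨆ w ∈ s, (intLattice F D).map (orbitMap F w) := by
      refine le_antisymm (fun x hx => ?_) (iSup₂_le fun w hw => ?_)
      · have hx' : x ∈ Submodule.span (OrdOp F D) (s : Set W) := hs ▸ hx
        obtain ⟨c, -, rfl⟩ := Submodule.mem_span_finset.mp hx'
        refine sum_mem fun w hw => Submodule.mem_iSup_of_mem w (Submodule.mem_iSup_of_mem hw ?_)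
        exact ⟨(c w : Dᵐᵒᵖ).unop, (mem_ordOp_iff _).mp (c w).2, rfl⟩
      · rintro _ ⟨x, hx, rfl⟩
        exact M.smul_mem (⟨MulOpposite.op x, (mem_maxCompactSubring_iff _).mpr hx⟩ : OrdOp F D)
          (hs ▸ Submodule.subset_span hw : w ∈ M)
    rw [h]
    exact Submodule.fg_biSup _ _ fun w _ => (intLattice_fg F D).map _

end ResidueDim

section Vectors

variable {F : Type*} [Field F] [TopologicalSpace F] [ValuativeRel F]
  [IsNonarchimedeanLocalField F]
  {Δ V L : Type*} [DivisionRing Δ] [Algebra F Δ] [FiniteDimensional F Δ]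
  [AddCommGroup V] [Module Δᵐᵒᵖ V] [Module F V] [IsScalarTower F Δᵐᵒᵖ V]
  [Field L] [Algebra F L] [FiniteDimensional F L]
  {Δ' : Type*} [DivisionRing Δ'] [Algebra L Δ'] [Algebra F Δ'] [IsScalarTower F L Δ']
  [FiniteDimensional F Δ'] {t : ℕ} [NeZero t]
  {ι : L →ₐ[F] Module.End Δᵐᵒᵖ V} {Θ : L ⊗[F] Δ ≃ₐ[L] Matrix (Fin t) (Fin t) Δ'}
  {r : ℕ} {f : Fin r → ℕ}

/-- The successor of `C i j` in the chain obtained from the lattices `C i j`. -/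
def nextChain {F D W : Type*} [Field F] [TopologicalSpace F] [DivisionRing D]
    [Algebra F D] [AddCommGroup W] [Module Dᵐᵒᵖ W] {r t : ℕ} [NeZero t]
    (C : Fin r → Fin t → Submodule (OrdOp F D) W) (i : Fin r) (j : Fin t) :
    Submodule (OrdOp F D) W :=
  if h : i.1 + 1 < r then C ⟨i.1 + 1, h⟩ j
  else if h' : j.1 + 1 < t then C ⟨0, i.pos⟩ ⟨j.1 + 1, h'⟩
  else maxIdeal (OrdOp F D) • C ⟨0, i.pos⟩ 0

theorem isStable_nextTerm {N : Fin r → Submodule (OrdOp F Δ) V} (hN : ∀ i, IsStable ι (N i))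
    (i : Fin r) : IsStable ι (nextTerm N i) := by
  unfold nextTerm
  split_ifs
  · exact hN _
  · exact (hN _).maxIdeal_smul

theorem BiFlag.isStable (N : BiFlag ι f) (i : Fin r) : IsStable ι (N.N i) := N.stable i

/-- If the `C i j` are the components of the lattices `N i`, then the successors in the chain of the
`C i j` are the components of the successors in the chain of the `N i`. At the end of a row this is
the shift of components by multiplication with `𝔓`. -/
theorem mem_nextChain_iff (hL : ramIdx F L = 1) (hΘ : IsIwahori Θ)
    {N : Fin r → Submodule (OrdOp F Δ) V} (hN : ∀ i, IsStable ι (N i))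
    {C : Fin r → Fin t → Submodule (OrdOp F Δ') (corner ι Θ)}
    (hC : ∀ i j w, w ∈ C i j ↔ rowMap ι Θ j w ∈ N i) (i : Fin r) (j : Fin t) (w : corner ι Θ) :
    w ∈ nextChain C i j ↔ rowMap ι Θ j w ∈ nextTerm N i := by
  unfold nextChain nextTerm
  split_ifs with h h'
  · exact hC _ _ _
  · rw [hC, rowMap_mem_smul_iff_succ hL hΘ (hN _) (j := ⟨j.1 + 1, h'⟩) rfl]
  · rw [mem_maxIdeal_smul_iff_divUnif, hC,
      rowMap_mem_smul_iff_last hL hΘ (hN _) (by have := j.2; omega)]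

/-- `N_{i,j}` is the `j`-th component of `N_i`. -/
theorem mem_doubleChain (hΘ : IsIwahori Θ) (N : BiFlag ι f) (i : Fin r) (j : Fin t)
    (w : corner ι Θ) : w ∈ doubleChain Θ N i j ↔ rowMap ι Θ j w ∈ N.N i := by
  constructor
  · intro hw
    refine Submodule.span_induction (p := fun w _ => rowMap ι Θ j w ∈ N.N i)
      ?_ ?_ (fun x y _ _ hx hy => ?_) (fun c x _ hx => ?_) hw
    · rintro _ ⟨v, hv, rfl⟩
      exact (N.isStable i).rowMap_colMap_mem hΘ j hv
    · rw [map_zero]; exact zero_mem _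
    · rw [map_add]; exact add_mem hx hy
    · exact rowMap_smul_mem hΘ (N.isStable i) j c hx
  · intro hw
    refine Submodule.subset_span ⟨_, hw, ?_⟩
    exact ((colMap_rowMap ι Θ j j w).trans (if_pos rfl)).symm

/-- The term after `N_{i,j}` is the `j`-th component of the term after `N_i`. -/
theorem mem_nextDouble (hL : ramIdx F L = 1) (hΘ : IsIwahori Θ) (N : BiFlag ι f) (i : Fin r)
    (j : Fin t) (w : corner ι Θ) :
    w ∈ nextDouble Θ N i j ↔ rowMap ι Θ j w ∈ nextTerm N.N i :=
  mem_nextChain_iff hL hΘ N.isStable (mem_doubleChain hΘ N) i j w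

theorem le_zero_of_nextTerm_le {N : Fin r → Submodule (OrdOp F Δ) V}
    (hN : ∀ i, nextTerm N i ≤ N i) (i i' : Fin r) (h : i < i') : N i' ≤ nextTerm N i := by
  obtain ⟨k, hk⟩ : ∃ k, i'.1 = i.1 + 1 + k := ⟨i'.1 - i.1 - 1, by
    rw [Fin.lt_def] at h; omega⟩
  induction k generalizing i' with
  | zero =>
    rw [nextTerm, dif_pos (by have := i'.2; omega)]
    exact le_of_eq (congrArg N (Fin.ext hk))
  | succ k ih =>
    have hi : i.1 + 1 + k < r := by have := i'.2; omega
    refine le_trans ?_ (ih ⟨i.1 + 1 + k, hi⟩ (by rw [Fin.lt_def]; change _ < i.1 + 1 + k; omega) rfl)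
    have h1 := hN ⟨i.1 + 1 + k, hi⟩
    rw [nextTerm, dif_pos (by change i.1 + 1 + k + 1 < r; have := i'.2; omega)] at h1
    exact (le_of_eq (congrArg N (Fin.ext hk))).trans h1

theorem maxIdeal_smul_le_nextTerm {N : Fin r → Submodule (OrdOp F Δ) V}
    (hN : ∀ i, nextTerm N i ≤ N i) (i i₀ : Fin r) (h0 : i₀.1 = 0) :
    maxIdeal (OrdOp F Δ) • N i₀ ≤ nextTerm N i := by
  have hr : r - 1 < r := by have := i.2; omega
  have h1 : nextTerm N ⟨r - 1, hr⟩ = maxIdeal (OrdOp F Δ) • N i₀ := by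
    rw [nextTerm, dif_neg (by change ¬ (r - 1 + 1 < r); omega)]
    exact congrArg _ (congrArg N (Fin.ext h0.symm))
  rw [← h1]
  by_cases h : i.1 = r - 1
  · exact le_of_eq (congrArg _ (Fin.ext h.symm))
  · refine (hN _).trans (le_zero_of_nextTerm_le hN _ _ ?_)
    rw [Fin.lt_def]
    have := i.2
    change i.1 < r - 1
    omega

theorem maxIdeal_smul_doubleChain_le (hL : ramIdx F L = 1) (hΘ : IsIwahori Θ) (N : BiFlag ι f)
    (i : Fin r) (j : Fin t) (i₀ : Fin r) (h0 : i₀.1 = 0) :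
    maxIdeal (OrdOp F Δ') • doubleChain Θ N i₀ 0 ≤ nextDouble Θ N i j := by
  intro w hw
  rw [mem_maxIdeal_smul_iff_divUnif, mem_doubleChain hΘ] at hw
  rw [mem_nextDouble hL hΘ]
  refine maxIdeal_smul_le_nextTerm (fun i => (N.isFlag.lt i).le) i i₀ h0 ?_
  have := rowMap_op_smul_mem_smul hL hΘ (N.isStable i₀) (k := j) (x := divUnif F Δ') (by
      rw [divVal_divUnif, ← WithZero.exp_nsmul, WithZero.exp_le_exp, nsmul_eq_mul]
      have h0 : ((0 : Fin t) : ℕ) = 0 := rfl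
      have := j.2
      omega) hw
  rwa [smul_smul, mul_inv_cancel₀ (by simpa using divUnif_ne_zero F Δ'), one_smul] at this

theorem nextDouble_le (hL : ramIdx F L = 1) (hΘ : IsIwahori Θ) (N : BiFlag ι f)
    (i : Fin r) (j : Fin t) : nextDouble Θ N i j ≤ doubleChain Θ N i j := fun w hw => by
  rw [mem_nextDouble hL hΘ] at hw
  rw [mem_doubleChain hΘ]
  exact (N.isFlag.lt i).le hw

theorem doubleChain_le_nextDouble (hL : ramIdx F L = 1) (hΘ : IsIwahori Θ) (N : BiFlag ι f)
    {i i' : Fin r} {j j' : Fin t} (h : toLex (j, i) < toLex (j', i')) :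
    doubleChain Θ N i' j' ≤ nextDouble Θ N i j := fun w hw => by
  rw [mem_doubleChain hΘ] at hw
  rw [mem_nextDouble hL hΘ]
  have hN := fun i => (N.isFlag.lt i).le
  rcases Prod.Lex.toLex_lt_toLex.mp h with h | ⟨h, h'⟩
  · let i₀ : Fin r := ⟨0, i.pos⟩
    refine maxIdeal_smul_le_nextTerm hN i i₀ rfl ?_
    refine rowMap_mem_smul_of_lt hL hΘ (N.isStable i₀) h ?_
    rcases (Nat.zero_le i'.1).eq_or_lt with h0 | h0
    · exact (Fin.ext h0.symm : i' = i₀) ▸ hw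
    · exact (hN i₀) (le_zero_of_nextTerm_le hN i₀ i' h0 hw)
  · obtain rfl : j = j' := h
    exact le_zero_of_nextTerm_le hN _ _ h' hw

theorem doubleChain_le_zero (hL : ramIdx F L = 1) (hΘ : IsIwahori Θ) (N : BiFlag ι f)
    (i : Fin r) (j : Fin t) : doubleChain Θ N i j ≤ doubleChain Θ N ⟨0, i.pos⟩ 0 := by
  by_cases h : toLex (0, (⟨0, i.pos⟩ : Fin r)) < toLex (j, i)
  · exact (doubleChain_le_nextDouble hL hΘ N h).trans (nextDouble_le hL hΘ N _ _)
  · have h' : toLex (j, i) = toLex (0, (⟨0, i.pos⟩ : Fin r)) := by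
      refine le_antisymm (not_lt.mp h) ?_
      rw [Prod.Lex.toLex_le_toLex]
      rcases (Fin.zero_le j).eq_or_lt with h0 | h0
      · exact Or.inr ⟨h0, Nat.zero_le _⟩
      · exact Or.inl h0
    have h'' : (j, i) = (0, (⟨0, i.pos⟩ : Fin r)) := h'
    rw [Prod.mk.injEq] at h''
    obtain ⟨rfl, hi⟩ := h''
    exact le_of_eq (congrArg (fun i => doubleChain Θ N i 0) hi)

/-- The vector of a flag in terms of the indices of the components of its lattices. -/
theorem hasVector_iff (hL : ramIdx F L = 1) (hΘ : IsIwahori Θ) (N : BiFlag ι f)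
    (g : Fin r → Fin t → ℕ) : HasVector Θ N g ↔ ∀ i j,
      (piece (ι := ι) Θ (nextTerm N.N i) j).relIndex (piece Θ (N.N i) j) =
        resCard F Δ' ^ g i j := by
  refine forall_congr' fun i => forall_congr' fun j => ?_
  have h1 : (doubleChain Θ N i j).toAddSubgroup = piece Θ (N.N i) j := by
    ext w; exact mem_doubleChain hΘ N i j w
  have h2 : (nextDouble Θ N i j).toAddSubgroup = piece Θ (nextTerm N.N i) j := by
    ext w; exact mem_nextDouble hL hΘ N i j w
  rw [hasResidueDim_quotient_iff, h1, h2]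
  refine ⟨fun h => h.2.2, fun h => ⟨nextDouble_le hL hΘ N i j, ?_, h⟩⟩
  refine le_trans ?_ (maxIdeal_smul_doubleChain_le hL hΘ N i j ⟨0, i.pos⟩ rfl)
  refine Submodule.smul_mono le_rfl ?_
  exact doubleChain_le_zero hL hΘ N i j

theorem relIndex_flag (N : BiFlag ι f) (i : Fin r) :
    (nextTerm N.N i).toAddSubgroup.relIndex (N.N i).toAddSubgroup = resCard F Δ ^ f i :=
  ((hasResidueDim_quotient_iff _ _ _).mp (N.isFlag.dim i)).2

/-- The indices in the components multiply up to the index in `V`. -/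
theorem prod_relIndex_piece (hΘ : IsIwahori Θ) (N : BiFlag ι f) (i : Fin r) :
    ∏ j, (piece (ι := ι) Θ (nextTerm N.N i) j).relIndex (piece Θ (N.N i) j) =
      resCard F Δ ^ f i := by
  rw [← relIndex_flag N i, relIndex_eq_prod_piece hΘ (N.isStable i) (isStable_nextTerm N.isStable i)]

theorem exists_hasVector (hL : ramIdx F L = 1) (hΘ : IsIwahori Θ) (N : BiFlag ι f) :
    ∃ g, HasVector Θ N g := by
  have h (i j) : ∃ n, HasResidueDim (OrdOp F Δ')
      (doubleChain Θ N i j ⧸ (nextDouble Θ N i j).submoduleOf (doubleChain Θ N i j)) n := by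
    have h1 : (doubleChain Θ N i j).toAddSubgroup = piece Θ (N.N i) j := by
      ext w; exact mem_doubleChain hΘ N i j w
    have h2 : (nextDouble Θ N i j).toAddSubgroup = piece Θ (nextTerm N.N i) j := by
      ext w; exact mem_nextDouble hL hΘ N i j w
    have hne : (nextDouble Θ N i j).toAddSubgroup.relIndex (doubleChain Θ N i j).toAddSubgroup
        ≠ 0 := by
      rw [h1, h2]
      intro h0
      have := prod_relIndex_piece hΘ N i
      rw [Finset.prod_eq_zero (Finset.mem_univ j) h0] at this
      exact pow_ne_zero _ (resCard_ne_zero F Δ) this.symm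
    have : Finite (doubleChain Θ N i j ⧸ (nextDouble Θ N i j).submoduleOf (doubleChain Θ N i j)) :=
      Nat.finite_of_card_ne_zero hne
    have : Module.Finite (OrdOp F Δ')
      (doubleChain Θ N i j ⧸ (nextDouble Θ N i j).submoduleOf (doubleChain Θ N i j)) := inferInstance
    refine exists_hasResidueDim mem_ordOp_iff ?_
    rintro m ⟨x, hx⟩
    obtain ⟨m, rfl⟩ := Submodule.Quotient.mk_surjective _ m
    refine (Submodule.Quotient.mk_eq_zero _).mpr ?_
    refine maxIdeal_smul_doubleChain_le hL hΘ N i j ⟨0, i.pos⟩ rfl ?_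
    refine Submodule.smul_mem_smul hx ?_
    exact doubleChain_le_zero hL hΘ N i j m.2
  choose g hg using h
  exact ⟨g, fun i j => ⟨nextDouble_le hL hΘ N i j, hg i j⟩⟩

theorem HasVector.unique (hL : ramIdx F L = 1) (hΘ : IsIwahori Θ) {N : BiFlag ι f}
    {g g' : Fin r → Fin t → ℕ} (h : HasVector Θ N g) (h' : HasVector Θ N g') : g = g' := by
  rw [hasVector_iff hL hΘ] at h h'
  ext i j
  exact Nat.pow_right_injective ((one_lt_resCard : 1 < resCard F Δ')) ((h i j).symm.trans (h' i j))

/-- Dimensions over the residue fields of `Δ` and `Δ'` are compared through cardinalities. -/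
theorem sum_eq_iff (hL : ramIdx F L = 1) (hΘ : IsIwahori Θ)
    (ht : t ∣ Module.finrank F L) (n k : ℕ) :
    Module.finrank F L / t * n = k ↔ resCard F Δ' ^ n = resCard F Δ ^ k := by
  have h := hΘ.resCard_pow hL
  obtain ⟨c, hc⟩ := ht
  have ht0 := NeZero.pos t
  rw [hc, Nat.mul_div_cancel_left _ ht0]
  have h1 : resCard F Δ' = resCard F Δ ^ c := by
    rw [hc, mul_comm, pow_mul] at h
    exact Nat.pow_left_injective (NeZero.ne t) h
  rw [h1, ← pow_mul]
  exact (Nat.pow_right_injective (one_lt_resCard : 1 < resCard F Δ)).eq_iff.symm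

/-- The constraint on the vector of a flag, from counting `N_i / N_{i+1}`. -/
theorem HasVector.sum_eq (hL : ramIdx F L = 1) (hΘ : IsIwahori Θ)
    (ht : t ∣ Module.finrank F L) {N : BiFlag ι f}
    {g : Fin r → Fin t → ℕ} (h : HasVector Θ N g) (i : Fin r) :
    Module.finrank F L / t * ∑ j, g i j = f i := by
  rw [hasVector_iff hL hΘ] at h
  rw [sum_eq_iff hL hΘ ht, ← prod_relIndex_piece hΘ N i, ← Finset.prod_pow_eq_pow_sum]
  exact Finset.prod_congr rfl fun j _ => (h i j).symm

end Vectors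

/-! ### The centralizer of `L` as a matrix algebra -/

section EndMatrix

variable {E W B : Type*} [DivisionRing E] [AddCommGroup W] [Module Eᵐᵒᵖ W] [Fintype B]
  [DecidableEq B]

/-- The matrix of an endomorphism of a right vector space. -/
def endMatrix (b : Module.Basis B Eᵐᵒᵖ W) : Module.End Eᵐᵒᵖ W ≃+* Matrix B B E where
  toFun φ := Matrix.of fun k l => (b.repr (φ (b l)) k).unop
  invFun X := b.constr ℕ fun l => ∑ k, MulOpposite.op (X k l) • b k
  left_inv φ := b.ext fun l => by
    rw [Module.Basis.constr_basis]
    simp only [Matrix.of_apply, MulOpposite.op_unop]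
    exact b.sum_repr _
  right_inv X := by
    ext k l
    change (b.repr (b.constr ℕ (fun l => ∑ k, MulOpposite.op (X k l) • b k) (b l)) k).unop = X k l
    rw [Module.Basis.constr_basis, b.repr_sum_self]
    rfl
  map_add' φ ψ := by
    ext k l
    simp
  map_mul' φ ψ := by
    ext k l
    rw [Matrix.mul_apply, Matrix.of_apply, Module.End.mul_apply]
    conv_lhs => rw [← b.sum_repr (ψ (b l))]
    rw [map_sum, map_sum, Finsupp.finsetSum_apply, Finset.unop_sum]
    refine Finset.sum_congr rfl fun c _ => ?_
    rw [map_smul, map_smul, Finsupp.smul_apply, smul_eq_mul, MulOpposite.unop_mul]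
    rfl

theorem endMatrix_apply (b : Module.Basis B Eᵐᵒᵖ W) (φ : Module.End Eᵐᵒᵖ W) (k l : B) :
    endMatrix b φ k l = (b.repr (φ (b l)) k).unop := rfl

/-- Coordinates of the image, with the products in the order of matrix multiplication. -/
theorem repr_end_apply (b : Module.Basis B Eᵐᵒᵖ W) (φ : Module.End Eᵐᵒᵖ W) (w : W) (k : B) :
    (b.repr (φ w) k).unop = ∑ l, endMatrix b φ k l * (b.repr w l).unop := by
  conv_lhs => rw [← b.sum_repr w]
  rw [map_sum, map_sum, Finsupp.finsetSum_apply, Finset.unop_sum]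
  refine Finset.sum_congr rfl fun c _ => ?_
  rw [map_smul, map_smul, Finsupp.smul_apply, smul_eq_mul, MulOpposite.unop_mul]
  rfl

end EndMatrix

section Centralizer

variable {F Δ V L : Type*} [Field F] [DivisionRing Δ] [Algebra F Δ]
  [AddCommGroup V] [Module Δᵐᵒᵖ V] [Module F V] [IsScalarTower F Δᵐᵒᵖ V]
  [Field L] [Algebra F L] {Δ' : Type*} [DivisionRing Δ'] [Algebra L Δ'] {t : ℕ} [NeZero t]
  (ι : L →ₐ[F] Module.End Δᵐᵒᵖ V) (Θ : L ⊗[F] Δ ≃ₐ[L] Matrix (Fin t) (Fin t) Δ')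

theorem mem_centralizer_iff_commute {φ : Module.End Δᵐᵒᵖ V} :
    φ ∈ Subalgebra.centralizer F (Set.range ι) ↔ ∀ a v, φ (ι a v) = ι a (φ v) := by
  rw [Subalgebra.mem_centralizer_iff]
  constructor
  · intro h a v
    exact (LinearMap.congr_fun (h _ ⟨a, rfl⟩) v).symm
  · rintro h _ ⟨a, rfl⟩
    exact LinearMap.ext fun v => (h a v).symm

theorem map_rmul_of_mem_centralizer {φ : Module.End Δᵐᵒᵖ V}
    (h : φ ∈ Subalgebra.centralizer F (Set.range ι)) (z : L ⊗[F] Δ) (v : V) :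
    φ (rmul ι z v) = rmul ι z (φ v) := by
  rw [mem_centralizer_iff_commute] at h
  induction z using TensorProduct.induction_on with
  | zero => rw [rmul_zero, rmul_zero, map_zero]
  | tmul a x => rw [rmul_tmul, rmul_tmul, map_smul, h]
  | add z w hz hw => rw [rmul_add, rmul_add, map_add, hz, hw]

theorem rowMap_zero_apply (w : corner ι Θ) : rowMap ι Θ 0 w = w := by
  have := coe_op_smul ι Θ 1 w
  rw [MulOpposite.op_one, one_smul] at this
  exact this.symm

theorem colMap_zero_coe (w : corner ι Θ) : colMap ι Θ 0 w = w := by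
  conv_lhs => rw [← rowMap_zero_apply ι Θ w]
  rw [colMap_rowMap, if_pos rfl]

/-- The endomorphism of `V^{(t)}` induced by an element of the centralizer of `L`. -/
def cornerEnd (φ : Subalgebra.centralizer F (Set.range ι)) :
    Module.End Δ'ᵐᵒᵖ (corner ι Θ) where
  toFun w := colMap ι Θ 0 (φ.1 w)
  map_add' v w := by rw [Submodule.coe_add, map_add, map_add]
  map_smul' x w := by
    have h := coe_op_smul ι Θ x.unop w
    rw [MulOpposite.op_unop] at h
    rw [h, map_rmul_of_mem_centralizer ι φ.2]
    apply Subtype.ext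
    rw [RingHom.id_apply, coe_colMap, rmul_rmul, unitElt_mul, mul_one]
    have h' := coe_op_smul ι Θ x.unop (colMap ι Θ 0 (φ.1 w))
    rw [MulOpposite.op_unop] at h'
    rw [h', coe_colMap, rmul_rmul, unitElt_mul, one_mul]

theorem coe_cornerEnd (φ : Subalgebra.centralizer F (Set.range ι)) (w : corner ι Θ) :
    (cornerEnd ι Θ φ w : V) = φ.1 w := by
  change (colMap ι Θ 0 (φ.1 w) : V) = φ.1 w
  rw [coe_colMap, ← map_rmul_of_mem_centralizer ι φ.2]
  exact congrArg _ (rowMap_zero_apply ι Θ w)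

theorem rowMap_cornerEnd (φ : Subalgebra.centralizer F (Set.range ι)) (j : Fin t)
    (w : corner ι Θ) : rowMap ι Θ j (cornerEnd ι Θ φ w) = φ.1 (rowMap ι Θ j w) := by
  rw [rowMap_apply, coe_cornerEnd, ← map_rmul_of_mem_centralizer ι φ.2]
  rfl

theorem colMap_of_mem_centralizer (φ : Subalgebra.centralizer F (Set.range ι)) (j : Fin t)
    (v : V) : colMap ι Θ j (φ.1 v) = cornerEnd ι Θ φ (colMap ι Θ j v) := by
  apply Subtype.ext
  rw [coe_colMap, coe_cornerEnd, coe_colMap, map_rmul_of_mem_centralizer ι φ.2]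

theorem ext_colMap {v w : V} (h : ∀ j, colMap ι Θ j v = colMap ι Θ j w) : v = w :=
  (cornerEquiv ι Θ).injective (funext h)

/-- The endomorphism of `V` induced by an endomorphism of `V^{(t)}`, as an additive map. -/
def liftAux (g : Module.End Δ'ᵐᵒᵖ (corner ι Θ)) : V →+ V where
  toFun v := ∑ j, rowMap ι Θ j (g (colMap ι Θ j v))
  map_zero' := by simp
  map_add' v w := by simp [Finset.sum_add_distrib]

theorem colMap_liftAux (g : Module.End Δ'ᵐᵒᵖ (corner ι Θ)) (j : Fin t) (v : V) :
    colMap ι Θ j (liftAux ι Θ g v) = g (colMap ι Θ j v) := by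
  change colMap ι Θ j (∑ k, rowMap ι Θ k (g (colMap ι Θ k v))) = _
  simp [colMap_rowMap, map_sum]

theorem liftAux_rmul (g : Module.End Δ'ᵐᵒᵖ (corner ι Θ)) (z : L ⊗[F] Δ) (v : V) :
    liftAux ι Θ g (rmul ι z v) = rmul ι z (liftAux ι Θ g v) := by
  refine ext_colMap ι Θ fun j => ?_
  rw [colMap_liftAux, colMap_rmul, colMap_rmul, map_sum]
  refine Finset.sum_congr rfl fun k _ => ?_
  rw [map_smul, colMap_liftAux]

/-- Restriction to `V^{(t)}` identifies the centralizer of `L` in `End_Δ(V)` with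
`End_Δ'(V^{(t)})`. -/
def centralizerEquiv :
    Subalgebra.centralizer F (Set.range ι) ≃+* Module.End Δ'ᵐᵒᵖ (corner ι Θ) where
  toFun := cornerEnd ι Θ
  invFun g := ⟨{ toFun := liftAux ι Θ g
                 map_add' := map_add _
                 map_smul' := fun x v => by
                  have := liftAux_rmul ι Θ g (1 ⊗ₜ[F] x.unop) v
                  rwa [rmul_one_tmul, rmul_one_tmul, MulOpposite.op_unop] at this },
    (mem_centralizer_iff_commute ι).mpr fun a v => by
      have := liftAux_rmul ι Θ g (a ⊗ₜ[F] 1) v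
      rwa [rmul_tmul_one, rmul_tmul_one] at this⟩
  left_inv φ := by
    apply Subtype.ext
    refine LinearMap.ext fun v => ext_colMap ι Θ fun j => ?_
    refine (colMap_liftAux ι Θ (cornerEnd ι Θ φ) j v).trans ?_
    rw [colMap_of_mem_centralizer]
  right_inv g := by
    refine LinearMap.ext fun w => ?_
    change colMap ι Θ 0 (liftAux ι Θ g w) = g w
    rw [colMap_liftAux, colMap_zero_coe]
  map_add' φ ψ := by
    refine LinearMap.ext fun w => Subtype.ext ?_
    rw [LinearMap.add_apply, Submodule.coe_add]
    simp only [coe_cornerEnd]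
    rfl
  map_mul' φ ψ := by
    refine LinearMap.ext fun w => Subtype.ext ?_
    rw [Module.End.mul_apply]
    simp only [coe_cornerEnd]
    rfl

theorem centralizerEquiv_apply (φ : Subalgebra.centralizer F (Set.range ι)) :
    centralizerEquiv ι Θ φ = cornerEnd ι Θ φ := rfl

theorem mem_centralizer_ι (a : L) : ι a ∈ Subalgebra.centralizer F (Set.range ι) := by
  rw [mem_centralizer_iff_commute]
  intro b v
  rw [← Module.End.mul_apply, ← Module.End.mul_apply, ← map_mul, ← map_mul, mul_comm]

theorem cornerEnd_ι (a : L) (w : corner ι Θ) :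
    cornerEnd ι Θ ⟨ι a, mem_centralizer_ι ι a⟩ w =
      MulOpposite.op (algebraMap L Δ' a) • w := by
  apply Subtype.ext
  rw [coe_cornerEnd, coe_op_smul]
  change ι a w = _
  have h1 : unitElt Θ (Fin.rev 0) (Fin.rev 0) (algebraMap L Δ' a) =
      unitElt Θ (Fin.rev 0) (Fin.rev 0) 1 * a ⊗ₜ[F] (1 : Δ) := by
    have : a ⊗ₜ[F] (1 : Δ) = algebraMap L (L ⊗[F] Δ) a := rfl
    rw [this, ← Algebra.commutes, ← Algebra.smul_def, unitElt, unitElt, ← map_smul,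
      Matrix.smul_single, Algebra.smul_def, mul_one]
  rw [h1, ← rmul_rmul, rmul_tmul_one]
  exact congrArg _ (rowMap_zero_apply ι Θ w).symm

variable [Algebra F Δ'] [IsScalarTower F L Δ'] {B : Type*} [Fintype B] [DecidableEq B]

omit [Algebra F Δ'] [IsScalarTower F L Δ'] in
theorem endMatrix_cornerEnd_ι (b : Module.Basis B Δ'ᵐᵒᵖ (corner ι Θ)) (a : L) :
    endMatrix b (cornerEnd ι Θ ⟨ι a, mem_centralizer_ι ι a⟩) =
      algebraMap L (Matrix B B Δ') a := by
  ext k l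
  rw [endMatrix_apply, cornerEnd_ι, map_smul, b.repr_self, Finsupp.smul_apply, smul_eq_mul,
    MulOpposite.unop_mul, MulOpposite.unop_op, Matrix.algebraMap_matrix_apply,
    Finsupp.single_apply]
  by_cases h : k = l
  · subst h; simp
  · simp [h, Ne.symm h]

/-- The identification of the centralizer of `L` with a matrix algebra over `Δ'` given by a basis
of `V^{(t)}`. -/
def centralizerMatrix (b : Module.Basis B Δ'ᵐᵒᵖ (corner ι Θ)) :
    Subalgebra.centralizer F (Set.range ι) ≃ₐ[F] Matrix B B Δ' :=
  AlgEquiv.ofRingEquiv (f := (centralizerEquiv ι Θ).trans (endMatrix b)) fun c => by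
    have h1 : algebraMap F (Subalgebra.centralizer F (Set.range ι)) c =
        ⟨ι (algebraMap F L c), mem_centralizer_ι ι _⟩ := by
      apply Subtype.ext
      change algebraMap F (Module.End Δᵐᵒᵖ V) c = ι (algebraMap F L c)
      rw [AlgHom.commutes]
    rw [h1, RingEquiv.trans_apply, centralizerEquiv_apply, endMatrix_cornerEnd_ι,
      ← IsScalarTower.algebraMap_apply]

theorem centralizerMatrix_apply (b : Module.Basis B Δ'ᵐᵒᵖ (corner ι Θ))
    (φ : Subalgebra.centralizer F (Set.range ι)) :
    centralizerMatrix ι Θ b φ = endMatrix b (cornerEnd ι Θ φ) := rfl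

theorem centralizerMatrix_ι (b : Module.Basis B Δ'ᵐᵒᵖ (corner ι Θ)) (a : L) :
    centralizerMatrix ι Θ b ⟨ι a, mem_centralizer_ι ι a⟩ = algebraMap L _ a :=
  endMatrix_cornerEnd_ι ι Θ b a

end Centralizer

/-! ### Free lattices and adapted bases of flags -/

section Spanning

/-- Dividing a linear relation by its largest coefficient gives an integral relation with a
coefficient equal to `1`. -/
theorem linearIndependent_of_integral {E : Type*} [DivisionRing E] {v : Valuation E ℤᵐ⁰}
    {R : Subring E} (hR : ∀ x, x ∈ R ↔ v x ≤ 1) {W : Type*} [AddCommGroup W] [Module E W]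
    {B : Type*} [Fintype B] {β : B → W}
    (h : ∀ x : B → R, ∑ k, x k • β k = 0 → ∀ k, x k = 0) : LinearIndependent E β := by
  rw [Fintype.linearIndependent_iff]
  by_contra hcon
  push Not at hcon
  obtain ⟨x, hx, k₁, hk₁⟩ := hcon
  have : Nonempty B := ⟨k₁⟩
  obtain ⟨k₀, hk₀⟩ := Finite.exists_max fun k => v (x k)
  have hx0 : x k₀ ≠ 0 := fun h => hk₁ (by
    have := hk₀ k₁
    rw [h, map_zero, le_zero_iff, Valuation.zero_iff] at this
    exact this)
  have hmem (k) : (x k₀)⁻¹ * x k ∈ R := by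
    rw [hR, map_mul, map_inv₀]
    refine (mul_le_mul_right (hk₀ k) _).trans ?_
    rw [inv_mul_cancel₀ (by simpa using hx0)]
  have := h (fun k => ⟨_, hmem k⟩) (by
    change ∑ k, ((x k₀)⁻¹ * x k) • β k = 0
    simp only [mul_smul]
    rw [← Finset.smul_sum, hx, smul_zero]) k₀
  have h1 := congrArg Subtype.val this
  simp [hx0] at h1

variable {F : Type*} [Field F] [TopologicalSpace F] [ValuativeRel F]
  [IsNonarchimedeanLocalField F] {D W : Type*} [DivisionRing D] [Algebra F D]
  [FiniteDimensional F D] [AddCommGroup W] [Module Dᵐᵒᵖ W]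

theorem span_eq_top_of_basis [Module.Finite Dᵐᵒᵖ W] {M : Submodule (OrdOp F D) W}
    (b : Module.Basis (Fin (Module.finrank Dᵐᵒᵖ W)) (OrdOp F D) M) :
    Submodule.span Dᵐᵒᵖ (M : Set W) = ⊤ := by
  have hli : LinearIndependent Dᵐᵒᵖ fun k => (b k : W) := by
    refine linearIndependent_of_integral (mem_ordOp_iff (F := F) (D := D)) fun x hx => ?_
    refine Fintype.linearIndependent_iff.mp b.linearIndependent x (Subtype.ext ?_)
    rw [AddSubmonoidClass.coe_finsetSum]
    exact hx
  have h := hli.span_eq_top_of_card_eq_finrank' (by simp)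
  rw [eq_top_iff, ← h]
  refine Submodule.span_mono ?_
  rintro _ ⟨k, rfl⟩
  exact (b k).2

theorem exists_pow_mul_le_one (x : D) :
    ∃ n : ℕ, divVal F D (algebraMap F D (baseUnif F ^ n) * x) ≤ 1 := by
  by_cases hx : divVal F D x = 0
  · exact ⟨0, by simp [hx]⟩
  obtain ⟨m, hm⟩ := exists_eq_exp hx
  refine ⟨m.toNat, ?_⟩
  have he : 0 < ramIdx F D := ramIdx_pos
  rw [map_mul, map_pow, map_pow, divVal_algebraMap_baseUnif, hm, ← WithZero.exp_nsmul,
    ← WithZero.exp_add, ← WithZero.exp_zero, WithZero.exp_le_exp, nsmul_eq_mul]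
  have h1 : m ≤ m.toNat := Int.self_le_toNat m
  have h2 : (m.toNat : ℤ) * 1 ≤ m.toNat * (ramIdx F D : ℤ) :=
    mul_le_mul_of_nonneg_left (by omega) (by omega)
  linarith

variable [Module F W] [IsScalarTower F Dᵐᵒᵖ W]

theorem smul_mem_of_baseVal_le {M : Submodule (OrdOp F D) W} {c : F} (hc : baseVal F c ≤ 1) {w : W}
    (hw : w ∈ M) : c • w ∈ M :=
  (intRestrict M).smul_mem (⟨c, (mem_integers_iff c).mpr hc⟩ : 𝒪[F]) hw

theorem baseVal_baseUnif_le : baseVal F (baseUnif F) ≤ 1 := by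
  rw [baseVal_baseUnif, ← WithZero.exp_zero, WithZero.exp_le_exp]; omega

theorem pow_smul_mem_of_le {M : Submodule (OrdOp F D) W} {m n : ℕ} (hmn : m ≤ n) {w : W}
    (hw : baseUnif F ^ m • w ∈ M) : baseUnif F ^ n • w ∈ M := by
  obtain ⟨k, rfl⟩ := Nat.exists_eq_add_of_le hmn
  rw [add_comm, pow_add, mul_smul]
  exact smul_mem_of_baseVal_le (by rw [map_pow]; exact pow_le_one' baseVal_baseUnif_le k) hw

/-- A right lattice spans iff it absorbs every vector. -/
theorem span_eq_top_iff (M : Submodule (OrdOp F D) W) :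
    Submodule.span Dᵐᵒᵖ (M : Set W) = ⊤ ↔ ∀ w, ∃ n : ℕ, baseUnif F ^ n • w ∈ M := by
  constructor
  · intro h w
    have hw : w ∈ Submodule.span Dᵐᵒᵖ (M : Set W) := h ▸ trivial
    induction hw using Submodule.span_induction with
    | mem x hx => exact ⟨0, by rwa [pow_zero, one_smul]⟩
    | zero => exact ⟨0, by rw [smul_zero]; exact M.zero_mem⟩
    | add x y _ _ hx hy =>
      obtain ⟨m, hm⟩ := hx
      obtain ⟨n, hn⟩ := hy
      refine ⟨max m n, ?_⟩
      rw [smul_add]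
      exact M.add_mem (pow_smul_mem_of_le (le_max_left _ _) hm)
        (pow_smul_mem_of_le (le_max_right _ _) hn)
    | smul c x _ hx =>
      obtain ⟨m, hm⟩ := hx
      obtain ⟨n, hn⟩ := exists_pow_mul_le_one (F := F) c.unop
      refine ⟨n + m, ?_⟩
      have h1 : baseUnif F ^ (n + m) • c • x =
          (⟨MulOpposite.op (algebraMap F D (baseUnif F ^ n) * c.unop),
            (mem_maxCompactSubring_iff _).mpr hn⟩ : OrdOp F D) • (baseUnif F ^ m • x) := by
        change _ = MulOpposite.op (algebraMap F D (baseUnif F ^ n) * c.unop) • (baseUnif F ^ m • x)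
        rw [← Algebra.smul_def, MulOpposite.op_smul, MulOpposite.op_unop, smul_assoc, pow_add,
          mul_smul, smul_comm c]
      rw [h1]
      exact M.smul_mem _ hm
  · intro h
    rw [eq_top_iff]
    intro w _
    obtain ⟨n, hn⟩ := h w
    have h0 : baseUnif F ^ n ≠ 0 := pow_ne_zero _ baseUnif_ne_zero
    have : w = algebraMap F Dᵐᵒᵖ (baseUnif F ^ n)⁻¹ • baseUnif F ^ n • w := by
      rw [algebraMap_smul, smul_smul, inv_mul_cancel₀ h0, one_smul]
    rw [this]
    exact Submodule.smul_mem _ _ (Submodule.subset_span hn)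

/-- A finitely generated spanning lattice is free of the expected rank. -/
theorem nonempty_basis_of_fg {M : Submodule (OrdOp F D) W} (hfg : M.FG)
    (hspan : Submodule.span Dᵐᵒᵖ (M : Set W) = ⊤) :
    Nonempty (Module.Basis (Fin (Module.finrank Dᵐᵒᵖ W)) (OrdOp F D) M) := by
  have : Module.Finite (OrdOp F D) M := Module.Finite.iff_fg.mpr hfg
  have htors : Module.IsTorsionBySet (OrdOp F D)
      (M ⧸ (maxIdeal (OrdOp F D) • M).submoduleOf M) (maxIdeal (OrdOp F D)) := by
    rintro m ⟨x, hx⟩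
    obtain ⟨m, rfl⟩ := Submodule.Quotient.mk_surjective _ m
    exact (Submodule.Quotient.mk_eq_zero _).mpr (Submodule.smul_mem_smul hx m.2)
  obtain ⟨n, hn⟩ := exists_hasResidueDim mem_ordOp_iff htors
  obtain ⟨b, hb⟩ := exists_adapted_basis (κ := Unit) (B := Fin n) (mem_ordOp_iff (F := F) (D := D))
    (fun _ => ()) (fun _ => M) (fun _ => maxIdeal (OrdOp F D) • M) () (fun _ => le_rfl)
    (fun _ _ h => absurd h (lt_irrefl _)) (fun _ => Submodule.smul_le_right)
    (fun _ => le_rfl) (fun _ => Or.inl le_rfl) (fun _ => by simpa using hn) hfg hspan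
  have hfr : Module.finrank Dᵐᵒᵖ W = n := by
    rw [Module.finrank_eq_card_basis b, Fintype.card_fin]
  rw [hfr]
  have hb' (x : W) : x ∈ M ↔ ∀ k, b.repr x k ∈ OrdOp F D := by
    rw [hb () x]
    refine forall_congr' fun k => ?_
    rw [mem_ordOp_iff]
    simp
  have hbM (k) : b k ∈ M := by
    rw [hb']
    intro l
    rw [b.repr_self, Finsupp.single_apply]
    split_ifs
    · exact one_mem _
    · exact zero_mem _
  have hcoe (s : Finset (Fin n)) (x : Fin n → OrdOp F D) :
      ((∑ k ∈ s, x k • (⟨b k, hbM k⟩ : M) : M) : W) = ∑ k ∈ s, (x k : Dᵐᵒᵖ) • b k := by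
    rw [AddSubmonoidClass.coe_finsetSum]; rfl
  refine ⟨Module.Basis.mk (v := fun k => (⟨b k, hbM k⟩ : M)) ?_ ?_⟩
  · rw [Fintype.linearIndependent_iff]
    intro x hx k
    have := congrArg Subtype.val hx
    rw [hcoe] at this
    exact Subtype.ext (Fintype.linearIndependent_iff.mp b.linearIndependent
      (fun k => (x k : Dᵐᵒᵖ)) this k)
  · rintro ⟨x, hx⟩ -
    have h1 := (hb' x).mp hx
    have h2 : (⟨x, hx⟩ : M) = ∑ k, (⟨b.repr x k, h1 k⟩ : OrdOp F D) • (⟨b k, hbM k⟩ : M) := by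
      apply Subtype.ext
      rw [hcoe]
      exact (b.sum_repr x).symm
    rw [h2]
    exact sum_mem fun k _ => Submodule.smul_mem _ _ (Submodule.subset_span ⟨k, rfl⟩)

end Spanning

section FlagBasis

/-- The block of `p` has the prescribed size, also where this size is zero. -/
theorem card_fiber_blockIndex {r t : ℕ} (g : Fin r → Fin t → ℕ) (p : Fin t ×ₗ Fin r) :
    Nat.card {k : BlockIndex g // k.1.1 = p} = g (ofLex p).2 (ofLex p).1 := by
  by_cases h : g (ofLex p).2 (ofLex p).1 = 0
  · rw [h]
    have : IsEmpty {k : BlockIndex g // k.1.1 = p} :=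
      ⟨fun ⟨⟨⟨p', hp'⟩, a⟩, hk⟩ => hp' (by obtain rfl : p' = p := hk; exact h)⟩
    exact Nat.card_of_isEmpty
  · rw [← Nat.card_fin (g (ofLex p).2 (ofLex p).1)]
    symm
    refine Nat.card_eq_of_bijective
      (fun a => (⟨⟨⟨p, h⟩, a⟩, rfl⟩ : {k : BlockIndex g // k.1.1 = p})) ⟨fun a b hab => ?_, ?_⟩
    · simpa using hab
    · rintro ⟨⟨⟨p', hp'⟩, a⟩, hk⟩
      obtain rfl : p' = p := hk
      exact ⟨a, rfl⟩

theorem card_blockIndex {r t : ℕ} (g : Fin r → Fin t → ℕ) :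
    Fintype.card (BlockIndex g) = ∑ i, ∑ j, g i j := by
  classical
  have h1 : Fintype.card (BlockIndex g) =
      ∑ p : Fin t ×ₗ Fin r, Fintype.card {k : BlockIndex g // k.1.1 = p} := by
    rw [← Fintype.card_sigma]
    exact Fintype.card_congr (Equiv.sigmaFiberEquiv (fun k : BlockIndex g => k.1.1)).symm
  rw [h1, Finset.sum_comm, ← Fintype.sum_prod_type' (f := fun j i => g i j)]
  refine Fintype.sum_equiv ofLex _ _ fun p => ?_
  rw [← Nat.card_eq_fintype_card, card_fiber_blockIndex]

variable {F : Type*} [Field F] [TopologicalSpace F] [ValuativeRel F]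
  [IsNonarchimedeanLocalField F]
  {Δ V L : Type*} [DivisionRing Δ] [Algebra F Δ] [FiniteDimensional F Δ]
  [AddCommGroup V] [Module Δᵐᵒᵖ V] [Module F V] [IsScalarTower F Δᵐᵒᵖ V]
  [Field L] [Algebra F L] [FiniteDimensional F L]
  {Δ' : Type*} [DivisionRing Δ'] [Algebra L Δ'] [Algebra F Δ'] [IsScalarTower F L Δ']
  [FiniteDimensional F Δ'] {t : ℕ} [NeZero t]
  {ι : L →ₐ[F] Module.End Δᵐᵒᵖ V} {Θ : L ⊗[F] Δ ≃ₐ[L] Matrix (Fin t) (Fin t) Δ'}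
  {r : ℕ} {f : Fin r → ℕ}

theorem doubleChain_fg (hΘ : IsIwahori Θ) (N : BiFlag ι f) (i : Fin r) (j : Fin t) :
    (doubleChain Θ N i j).FG := by
  rw [← intRestrict_fg_iff]
  have h : intRestrict (doubleChain Θ N i j) =
      (intRestrict (N.N i)).map ((colMap ι Θ j).restrictScalars 𝒪[F]) := by
    ext w
    rw [mem_intRestrict, mem_doubleChain hΘ]
    constructor
    · intro hw
      exact ⟨_, hw, (colMap_rowMap ι Θ j j w).trans (if_pos rfl)⟩
    · rintro ⟨v, hv, rfl⟩
      exact (N.isStable i).rowMap_colMap_mem hΘ j hv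
  rw [h]
  refine Submodule.FG.map _ ((intRestrict_fg_iff _).mpr ?_)
  obtain ⟨b⟩ := N.isFlag.free i
  exact Module.Finite.iff_fg.mp (Module.Finite.of_basis b)

variable [Module.Finite Δᵐᵒᵖ V]

/-- The lattices `N_{i,j}` have full rank. -/
theorem span_doubleChain (hΘ : IsIwahori Θ) (N : BiFlag ι f) (i : Fin r) (j : Fin t) :
    Submodule.span Δ'ᵐᵒᵖ (doubleChain Θ N i j : Set (corner ι Θ)) = ⊤ := by
  obtain ⟨b⟩ := N.isFlag.free i
  have h := (span_eq_top_iff (N.N i)).mp (span_eq_top_of_basis b)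
  rw [span_eq_top_iff]
  intro w
  obtain ⟨n, hn⟩ := h (rowMap ι Θ j w)
  refine ⟨n, ?_⟩
  rw [mem_doubleChain hΘ, map_smul]
  exact hn

/-- The chain `N_{i,j}` of a flag has a basis adapted to it. -/
theorem exists_flag_basis [NeZero r] (hL : ramIdx F L = 1) (hΘ : IsIwahori Θ) (N : BiFlag ι f)
    {g : Fin r → Fin t → ℕ} (hg : HasVector Θ N g) :
    ∃ b : Module.Basis (BlockIndex g) Δ'ᵐᵒᵖ (corner ι Θ), ∀ i j w, w ∈ doubleChain Θ N i j ↔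
      ∀ k, opVal (divVal F Δ') (b.repr w k) ≤ 1 ∧
        (k.1.1 < toLex (j, i) → opVal (divVal F Δ') (b.repr w k) < 1) := by
  have hbot (p : Fin t ×ₗ Fin r) : toLex (0, 0) ≤ p := by
    rw [← toLex_ofLex p, Prod.Lex.toLex_le_toLex]
    rcases (Fin.zero_le (ofLex p).1).eq_or_lt with h0 | h0
    · exact Or.inr ⟨h0, Fin.zero_le _⟩
    · exact Or.inl h0
  have hnext (p : Fin t ×ₗ Fin r) : nextDouble Θ N (ofLex p).2 (ofLex p).1 ≤
        maxIdeal (OrdOp F Δ') • doubleChain Θ N 0 0 ∨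
      ∃ q, p < q ∧ nextDouble Θ N (ofLex p).2 (ofLex p).1 ≤
        doubleChain Θ N (ofLex q).2 (ofLex q).1 := by
    unfold nextDouble
    split_ifs with h h'
    · refine Or.inr ⟨toLex ((ofLex p).1, ⟨(ofLex p).2.1 + 1, h⟩), ?_, le_rfl⟩
      conv_lhs => rw [← toLex_ofLex p]
      rw [Prod.Lex.toLex_lt_toLex]
      exact Or.inr ⟨rfl, by rw [Fin.lt_def]; exact Nat.lt_succ_self _⟩
    · refine Or.inr ⟨toLex (⟨(ofLex p).1.1 + 1, h'⟩, ⟨0, (ofLex p).2.pos⟩), ?_, le_rfl⟩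
      conv_lhs => rw [← toLex_ofLex p]
      rw [Prod.Lex.toLex_lt_toLex]
      exact Or.inl (by rw [Fin.lt_def]; exact Nat.lt_succ_self _)
    · exact Or.inl le_rfl
  obtain ⟨b, hb⟩ := exists_adapted_basis (κ := Fin t ×ₗ Fin r) (B := BlockIndex g)
    (mem_ordOp_iff (F := F) (D := Δ'))
    (fun k => k.1.1) (fun p => doubleChain Θ N (ofLex p).2 (ofLex p).1)
    (fun p => nextDouble Θ N (ofLex p).2 (ofLex p).1) (toLex (0, 0)) hbot
    (fun p q h => doubleChain_le_nextDouble hL hΘ N h) (fun p => nextDouble_le hL hΘ N _ _)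
    (fun p => maxIdeal_smul_doubleChain_le hL hΘ N _ _ _ rfl) hnext
    (fun p => by rw [card_fiber_blockIndex]; exact (hg _ _).2)
    (doubleChain_fg hΘ N _ _) (span_doubleChain hΘ N _ _)
  exact ⟨b, fun i j w => hb (toLex (j, i)) w⟩

end FlagBasis

/-! ### Adapted chains and the classification of flags -/

section AdaptedChains

theorem mul_lt_one_of_le_one_of_lt_one {a b : ℤᵐ⁰} (ha : a ≤ 1) (hb : b < 1) : a * b < 1 :=
  (mul_le_of_le_one_left' ha).trans_lt hb

theorem mul_lt_one_of_lt_one_of_le_one {a b : ℤᵐ⁰} (ha : a < 1) (hb : b ≤ 1) : a * b < 1 :=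
  (mul_le_of_le_one_right' hb).trans_lt ha

variable {F : Type*} [Field F] [TopologicalSpace F] [ValuativeRel F]
  [IsNonarchimedeanLocalField F] {D W : Type*} [DivisionRing D] [Algebra F D]
  [FiniteDimensional F D] [AddCommGroup W] [Module Dᵐᵒᵖ W] {r t : ℕ} [NeZero t]
  {g : Fin r → Fin t → ℕ}

/-- The chain of lattices attached to a basis indexed by blocks: `C i j` consists of the vectors
with integral coordinates whose coordinates in the blocks before `(j, i)` lie in the maximal
ideal. -/
def adaptedChain (F : Type*) [Field F] [TopologicalSpace F] [ValuativeRel F]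
    [IsNonarchimedeanLocalField F] {D W : Type*} [DivisionRing D] [Algebra F D]
    [FiniteDimensional F D] [AddCommGroup W] [Module Dᵐᵒᵖ W] {r t : ℕ}
    {g : Fin r → Fin t → ℕ} (b : Module.Basis (BlockIndex g) Dᵐᵒᵖ W) (i : Fin r) (j : Fin t) :
    Submodule (OrdOp F D) W where
  carrier := {w | ∀ k, opVal (divVal F D) (b.repr w k) ≤ 1 ∧
    (k.1.1 < toLex (j, i) → opVal (divVal F D) (b.repr w k) < 1)}
  zero_mem' k := by simp
  add_mem' {x y} hx hy k := by
    rw [map_add, Finsupp.add_apply]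
    exact ⟨((opVal (divVal F D)).map_add _ _).trans (max_le (hx k).1 (hy k).1),
      fun h => (opVal (divVal F D)).map_add_lt ((hx k).2 h) ((hy k).2 h)⟩
  smul_mem' c x hx k := by
    have h : b.repr (c • x) k = (c : Dᵐᵒᵖ) * b.repr x k := by
      change b.repr ((c : Dᵐᵒᵖ) • x) k = _
      rw [map_smul, Finsupp.smul_apply, smul_eq_mul]
    have hc : opVal (divVal F D) (c : Dᵐᵒᵖ) ≤ 1 := (mem_ordOp_iff _).mp c.2
    rw [h, map_mul]
    exact ⟨mul_le_one' hc (hx k).1, fun h => mul_lt_one_of_le_one_of_lt_one hc ((hx k).2 h)⟩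

theorem mem_adaptedChain {b : Module.Basis (BlockIndex g) Dᵐᵒᵖ W} {i : Fin r} {j : Fin t} {w : W} :
    w ∈ adaptedChain F b i j ↔ ∀ k, opVal (divVal F D) (b.repr w k) ≤ 1 ∧
      (k.1.1 < toLex (j, i) → opVal (divVal F D) (b.repr w k) < 1) := Iff.rfl

variable (b : Module.Basis (BlockIndex g) Dᵐᵒᵖ W)

/-- An endomorphism preserves an adapted chain iff its matrix lies in the hereditary order. -/
theorem forall_mem_adaptedChain_iff [DecidableEq (BlockIndex g)] (φ : Module.End Dᵐᵒᵖ W) :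
    (∀ i j, ∀ w ∈ adaptedChain F b i j, φ w ∈ adaptedChain F b i j) ↔
      endMatrix b φ ∈ hereditaryOrder (maxCompactSubring F D) g := by
  have hX : endMatrix b φ ∈ hereditaryOrder (maxCompactSubring F D) g ↔
      ∀ k l, divVal F D (endMatrix b φ k l) ≤ 1 ∧
        (k.1.1 < l.1.1 → divVal F D (endMatrix b φ k l) < 1) := by
    refine forall_congr' fun k => forall_congr' fun l => ?_
    constructor
    · rintro ⟨h1, h2⟩
      refine ⟨(mem_maxCompactSubring_iff _).mp h1, fun h => ?_⟩
      exact (mem_maxIdeal_maxCompactSubring_iff _).mp (h2 h)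
    · rintro ⟨h1, h2⟩
      exact ⟨(mem_maxCompactSubring_iff _).mpr h1, fun h =>
        (mem_maxIdeal_maxCompactSubring_iff _).mpr (h2 h)⟩
  rw [hX]
  constructor
  · intro h k l
    have hl : b l ∈ adaptedChain F b (ofLex l.1.1).2 (ofLex l.1.1).1 := by
      intro k
      rw [b.repr_self, Finsupp.single_apply]
      split_ifs with hk
      · subst hk
        exact ⟨by rw [map_one], fun h => absurd h (lt_irrefl _)⟩
      · simp
    exact h _ _ _ hl k
  · intro h i j w hw k
    change divVal F D (b.repr (φ w) k).unop ≤ 1 ∧ (_ → divVal F D (b.repr (φ w) k).unop < 1)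
    rw [repr_end_apply]
    refine ⟨(divVal F D).map_sum_le fun l _ => ?_, fun hk => (divVal F D).map_sum_lt one_ne_zero
      fun l _ => ?_⟩
    · rw [map_mul]
      exact mul_le_one' (h k l).1 (hw l).1
    · rw [map_mul]
      by_cases hl : l.1.1 < toLex (j, i)
      · exact mul_lt_one_of_le_one_of_lt_one (h k l).1 ((hw l).2 hl)
      · exact mul_lt_one_of_lt_one_of_le_one ((h k l).2 (hk.trans_le (not_lt.mp hl))) (hw l).1

theorem smul_mem_adaptedChain {i : Fin r} {j : Fin t} (i' : Fin r) (j' : Fin t) {x : D} {w : W}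
    (hx : divVal F D x < 1) (hw : w ∈ adaptedChain F b i j) :
    MulOpposite.op x • w ∈ adaptedChain F b i' j' := by
  intro k
  rw [map_smul, Finsupp.smul_apply, smul_eq_mul, map_mul]
  have : opVal (divVal F D) (MulOpposite.op x) * opVal (divVal F D) (b.repr w k) < 1 :=
    mul_lt_one_of_lt_one_of_le_one hx (hw k).1
  exact ⟨this.le, fun _ => this⟩

theorem adaptedChain_le {i i' : Fin r} {j j' : Fin t} (h : toLex (j, i) ≤ toLex (j', i')) :
    adaptedChain F b i' j' ≤ adaptedChain F b i j := fun _ hw k =>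
  ⟨(hw k).1, fun hk => (hw k).2 (hk.trans_le h)⟩

theorem mem_nextChain_adaptedChain {i : Fin r} {j : Fin t} {w : W} :
    w ∈ nextChain (adaptedChain F b) i j ↔ ∀ k, opVal (divVal F D) (b.repr w k) ≤ 1 ∧
      (k.1.1 ≤ toLex (j, i) → opVal (divVal F D) (b.repr w k) < 1) := by
  have key (p : Fin t ×ₗ Fin r) : p ≤ toLex (j, i) ↔
      (ofLex p).1.1 < j.1 ∨ (ofLex p).1.1 = j.1 ∧ (ofLex p).2.1 ≤ i.1 := by
    conv_lhs => rw [← toLex_ofLex p]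
    rw [Prod.Lex.toLex_le_toLex, Fin.lt_def, Fin.ext_iff, Fin.le_def]
  have key' (p : Fin t ×ₗ Fin r) (i : Fin r) (j : Fin t) : p < toLex (j, i) ↔
      (ofLex p).1.1 < j.1 ∨ (ofLex p).1.1 = j.1 ∧ (ofLex p).2.1 < i.1 := by
    conv_lhs => rw [← toLex_ofLex p]
    rw [Prod.Lex.toLex_lt_toLex, Fin.lt_def, Fin.ext_iff, Fin.lt_def]
  unfold nextChain
  split_ifs with h h'
  · rw [mem_adaptedChain]
    refine forall_congr' fun k => and_congr_right fun _ => imp_congr_left ?_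
    rw [key, key']
    exact or_congr_right (and_congr_right fun _ => Nat.lt_succ_iff)
  · rw [mem_adaptedChain]
    refine forall_congr' fun k => and_congr_right fun _ => imp_congr_left ?_
    rw [key, key']
    have h1 := (ofLex k.1.1).2.2
    have h2 := i.2
    change _ < j.1 + 1 ∨ _ = j.1 + 1 ∧ _ < 0 ↔ _
    omega
  · rw [mem_maxIdeal_smul_iff_divUnif, mem_adaptedChain]
    refine forall_congr' fun k => ?_
    have h1 := (ofLex k.1.1).2.2
    have h2 := i.2
    have h3 := (ofLex k.1.1).1.2
    have h4 := j.2
    have hlt : ¬ k.1.1 < toLex (0, (⟨0, i.pos⟩ : Fin r)) := by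
      rw [key']
      change ¬ (_ < 0 ∨ _ = 0 ∧ _ < 0)
      omega
    have hle : k.1.1 ≤ toLex (j, i) := by
      rw [key]; omega
    have hv : opVal (divVal F D) (b.repr ((MulOpposite.op (divUnif F D))⁻¹ • w) k) =
        WithZero.exp 1 * opVal (divVal F D) (b.repr w k) := by
      rw [map_smul, Finsupp.smul_apply, smul_eq_mul, map_mul, map_inv₀, opVal_apply,
        MulOpposite.unop_op, divVal_divUnif, ← WithZero.exp_neg, neg_neg]
    have hiff : opVal (divVal F D) (b.repr ((MulOpposite.op (divUnif F D))⁻¹ • w) k) ≤ 1 ↔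
        opVal (divVal F D) (b.repr w k) < 1 := by
      rw [hv, lt_one_iff]
      have : (1 : ℤᵐ⁰) = WithZero.exp 1 * WithZero.exp (-1) := by
        rw [← WithZero.exp_add]; simp
      conv_lhs => rw [this]
      exact mul_le_mul_iff_right₀ (by simp)
    rw [hiff]
    exact ⟨fun h => ⟨h.1.le, fun _ => h.1⟩, fun h => ⟨h.2 hle, fun h' => absurd h' hlt⟩⟩

theorem relIndex_ball_op :
    (ball (opVal (divVal F D)) (-1)).relIndex (ball (opVal (divVal F D)) 0) = resCard F D := by
  rw [← card_quotient_maxIdeal (mem_ordOp_iff (F := F) (D := D)), card_residue_op]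

/-- The successive quotients of an adapted chain have the dimensions prescribed by `g`. -/
theorem relIndex_nextChain_adaptedChain (i : Fin r) (j : Fin t) :
    (nextChain (adaptedChain F b) i j).toAddSubgroup.relIndex
      (adaptedChain F b i j).toAddSubgroup = resCard F D ^ g i j := by
  classical
  have h1 : (adaptedChain F b i j).toAddSubgroup = (AddSubgroup.pi Set.univ fun k : BlockIndex g =>
      ball (opVal (divVal F D)) (if k.1.1 < toLex (j, i) then -1 else 0)).comap
        b.equivFun.toLinearMap.toAddMonoidHom := by
    ext w
    refine (mem_adaptedChain (b := b)).trans ?_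
    have : (∀ k, opVal (divVal F D) (b.repr w k) ≤ 1 ∧
        (k.1.1 < toLex (j, i) → opVal (divVal F D) (b.repr w k) < 1)) ↔
        ∀ k, opVal (divVal F D) (b.repr w k) ≤
          WithZero.exp (if k.1.1 < toLex (j, i) then -1 else 0) := by
      refine forall_congr' fun k => ?_
      split_ifs with hk
      · rw [← lt_one_iff]; exact ⟨fun h => h.2 hk, fun h => ⟨h.le, fun _ => h⟩⟩
      · rw [WithZero.exp_zero]; exact ⟨fun h => h.1, fun h => ⟨h, fun h' => absurd h' hk⟩⟩
    rw [this]
    exact ⟨fun h k _ => h k, fun h k => h k trivial⟩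
  have h2 : (nextChain (adaptedChain F b) i j).toAddSubgroup =
      (AddSubgroup.pi Set.univ fun k : BlockIndex g =>
      ball (opVal (divVal F D)) (if k.1.1 ≤ toLex (j, i) then -1 else 0)).comap
        b.equivFun.toLinearMap.toAddMonoidHom := by
    ext w
    refine (mem_nextChain_adaptedChain b).trans ?_
    have : (∀ k, opVal (divVal F D) (b.repr w k) ≤ 1 ∧
        (k.1.1 ≤ toLex (j, i) → opVal (divVal F D) (b.repr w k) < 1)) ↔
        ∀ k, opVal (divVal F D) (b.repr w k) ≤
          WithZero.exp (if k.1.1 ≤ toLex (j, i) then -1 else 0) := by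
      refine forall_congr' fun k => ?_
      split_ifs with hk
      · rw [← lt_one_iff]; exact ⟨fun h => h.2 hk, fun h => ⟨h.le, fun _ => h⟩⟩
      · rw [WithZero.exp_zero]; exact ⟨fun h => h.1, fun h => ⟨h, fun h' => absurd h' hk⟩⟩
    rw [this]
    exact ⟨fun h k _ => h k, fun h k => h k trivial⟩
  rw [h1, h2, relIndex_comap_pi _ b.equivFun.surjective]
  have hk (k : BlockIndex g) : (ball (opVal (divVal F D))
      (if k.1.1 ≤ toLex (j, i) then -1 else 0)).relIndex (ball (opVal (divVal F D))
      (if k.1.1 < toLex (j, i) then -1 else 0)) =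
      if k.1.1 = toLex (j, i) then resCard F D else 1 := by
    rcases lt_trichotomy k.1.1 (toLex (j, i)) with h | h | h
    · rw [if_pos h.le, if_pos h, if_neg h.ne, AddSubgroup.relIndex_self]
    · rw [if_pos h.le, if_neg h.not_lt, if_pos h, relIndex_ball_op]
    · rw [if_neg (not_le.mpr h), if_neg h.le.not_gt, if_neg h.ne', AddSubgroup.relIndex_self]
  simp only [hk]
  rw [Finset.prod_ite, Finset.prod_const_one, mul_one, Finset.prod_const]
  congr 1
  refine Eq.trans ?_ (card_fiber_blockIndex g (toLex (j, i)))
  rw [Nat.card_eq_fintype_card, Fintype.card_subtype]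

theorem span_adaptedChain (i : Fin r) (j : Fin t) :
    Submodule.span Dᵐᵒᵖ (adaptedChain F b i j : Set W) = ⊤ := by
  rw [eq_top_iff, ← b.span_eq, Submodule.span_le]
  rintro _ ⟨k, rfl⟩
  have hπ : MulOpposite.op (divUnif F D) ≠ 0 := by simpa using divUnif_ne_zero F D
  have h : MulOpposite.op (divUnif F D) • b k ∈ adaptedChain F b i j := by
    intro l
    have hlt : opVal (divVal F D) (b.repr (MulOpposite.op (divUnif F D) • b k) l) < 1 := by
      rw [map_smul, Finsupp.smul_apply, b.repr_self, Finsupp.single_apply]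
      split_ifs
      · rw [smul_eq_mul, mul_one, lt_one_iff]
        exact (divVal_divUnif F D).le
      · simp
    exact ⟨hlt.le, fun _ => hlt⟩
  have h1 : b k = (MulOpposite.op (divUnif F D))⁻¹ • MulOpposite.op (divUnif F D) • b k := by
    rw [smul_smul, inv_mul_cancel₀ hπ, one_smul]
  rw [h1]
  exact Submodule.smul_mem _ _ (Submodule.subset_span h)

theorem adaptedChain_fg [Module F W] [IsScalarTower F Dᵐᵒᵖ W] (i : Fin r) (j : Fin t) :
    (intRestrict (adaptedChain F b i j)).FG := by
  have h1 : (intRestrict (Submodule.span (OrdOp F D) (Set.range b))).FG :=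
    (intRestrict_fg_iff _).mpr (Submodule.fg_span (Set.finite_range b))
  have : IsNoetherian 𝒪[F] (intRestrict (Submodule.span (OrdOp F D) (Set.range b))) :=
    isNoetherian_of_fg_of_noetherian _ h1
  have hle : intRestrict (adaptedChain F b i j) ≤
      intRestrict (Submodule.span (OrdOp F D) (Set.range b)) := by
    intro w hw
    rw [mem_intRestrict, ← b.sum_repr w]
    exact sum_mem fun k _ => Submodule.smul_mem _
      (⟨b.repr w k, (mem_ordOp_iff _).mpr (hw k).1⟩ : OrdOp F D)
      (Submodule.subset_span ⟨k, rfl⟩)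
  have h2 := (isNoetherian_submodule.mp this) _ hle
  exact h2

end AdaptedChains

section Classification

variable {F : Type*} [Field F] [TopologicalSpace F] [ValuativeRel F]
  [IsNonarchimedeanLocalField F]
  {Δ V L : Type*} [DivisionRing Δ] [Algebra F Δ] [FiniteDimensional F Δ]
  [AddCommGroup V] [Module Δᵐᵒᵖ V] [Module F V] [IsScalarTower F Δᵐᵒᵖ V]
  [Field L] [Algebra F L] [FiniteDimensional F L]
  {Δ' : Type*} [DivisionRing Δ'] [Algebra L Δ'] [Algebra F Δ'] [IsScalarTower F L Δ']
  [FiniteDimensional F Δ'] {t : ℕ} [NeZero t]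
  {ι : L →ₐ[F] Module.End Δᵐᵒᵖ V} {Θ : L ⊗[F] Δ ≃ₐ[L] Matrix (Fin t) (Fin t) Δ'}
  {r : ℕ} {f : Fin r → ℕ}

/-- A map commuting with the integers of `L` commutes with `L`. -/
theorem mem_centralizer_of_commute_integers {φ : Module.End Δᵐᵒᵖ V}
    (h : ∀ a ∈ integralClosure 𝒪[F] L, φ * ι a = ι a * φ) :
    φ ∈ Subalgebra.centralizer F (Set.range ι) := by
  rw [mem_centralizer_iff_commute]
  intro a v
  obtain ⟨n, hn⟩ := exists_pow_mul_le_one (F := F) (D := L) a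
  have h0 : baseUnif F ^ n ≠ 0 := pow_ne_zero _ baseUnif_ne_zero
  have h1 := LinearMap.congr_fun (h _ ((mem_integralClosure_iff _).mpr hn)) v
  have h2 (w : V) : ι (algebraMap F L (baseUnif F ^ n) * a) w = baseUnif F ^ n • ι a w := by
    rw [map_mul, AlgHom.commutes, Module.End.mul_apply, Module.algebraMap_end_apply]
  rw [Module.End.mul_apply, Module.End.mul_apply, h2, h2, ← algebraMap_smul Δᵐᵒᵖ (baseUnif F ^ n),
    map_smul, algebraMap_smul] at h1
  exact smul_right_injective V h0 h1

/-- Morphisms of flags are the maps in the centralizer of `L` that respect the chains `N_{i,j}`. -/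
theorem BiFlag.isHom_iff (hΘ : IsIwahori Θ) {N N' : BiFlag ι f} {φ : Module.End Δᵐᵒᵖ V} :
    BiFlag.IsHom N N' φ ↔ ∃ h : φ ∈ Subalgebra.centralizer F (Set.range ι),
      ∀ i j, ∀ w ∈ doubleChain Θ N i j, cornerEnd ι Θ ⟨φ, h⟩ w ∈ doubleChain Θ N' i j := by
  constructor
  · rintro ⟨h1, h2⟩
    refine ⟨mem_centralizer_of_commute_integers h2, fun i j w hw => ?_⟩
    rw [mem_doubleChain hΘ] at hw ⊢
    rw [rowMap_cornerEnd]
    exact h1 i _ hw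
  · rintro ⟨h, h1⟩
    refine ⟨fun i v hv => ?_, fun a _ => LinearMap.ext fun v =>
      (mem_centralizer_iff_commute ι).mp h a v⟩
    rw [mem_iff_forall_rowMap_colMap hΘ (N'.isStable i)]
    intro j
    have h2 := h1 i j (colMap ι Θ j v) ((mem_doubleChain hΘ N i j _).mpr
      ((N.isStable i).rowMap_colMap_mem hΘ j hv))
    rw [← colMap_of_mem_centralizer] at h2
    exact (mem_doubleChain hΘ N' i j _).mp h2

theorem BiFlag.IsHom.nextTerm_mem {N N' : BiFlag ι f} {φ : Module.End Δᵐᵒᵖ V}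
    (h : BiFlag.IsHom N N' φ) (i : Fin r) {v : V} (hv : v ∈ nextTerm N.N i) :
    φ v ∈ nextTerm N'.N i := by
  unfold nextTerm at hv ⊢
  split_ifs at hv ⊢ with hi
  · exact h.1 _ _ hv
  · rw [mem_maxIdeal_smul_iff_divUnif] at hv ⊢
    rw [← map_smul]
    exact h.1 _ _ hv

/-- The vector is an isomorphism invariant. -/
theorem HasVector.of_equiv (hL : ramIdx F L = 1) (hΘ : IsIwahori Θ) {N N' : BiFlag ι f}
    (h : N ≈ N') {g : Fin r → Fin t → ℕ} (hg : HasVector Θ N' g) : HasVector Θ N g := by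
  obtain ⟨φ, ψ, hφ, hψ, h1, h2⟩ := h
  obtain ⟨hφc, -⟩ := (BiFlag.isHom_iff hΘ).mp hφ
  obtain ⟨hψc, -⟩ := (BiFlag.isHom_iff hΘ).mp hψ
  rw [hasVector_iff hL hΘ] at hg ⊢
  intro i j
  rw [← hg i j]
  have hleft (v : V) : ψ (φ v) = v := LinearMap.congr_fun h1 v
  have e1 : piece (ι := ι) Θ (N.N i) j =
      (piece Θ (N'.N i) j).comap (cornerEnd ι Θ ⟨φ, hφc⟩).toAddMonoidHom := by
    ext w
    change rowMap ι Θ j w ∈ N.N i ↔ rowMap ι Θ j (cornerEnd ι Θ ⟨φ, hφc⟩ w) ∈ N'.N i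
    rw [rowMap_cornerEnd]
    exact ⟨hφ.1 i _, fun h => by have := hψ.1 i _ h; rwa [hleft] at this⟩
  have e2 : piece (ι := ι) Θ (nextTerm N.N i) j =
      (piece Θ (nextTerm N'.N i) j).comap (cornerEnd ι Θ ⟨φ, hφc⟩).toAddMonoidHom := by
    ext w
    change rowMap ι Θ j w ∈ nextTerm N.N i ↔
      rowMap ι Θ j (cornerEnd ι Θ ⟨φ, hφc⟩ w) ∈ nextTerm N'.N i
    rw [rowMap_cornerEnd]
    exact ⟨hφ.nextTerm_mem i, fun h => by have := hψ.nextTerm_mem i h; rwa [hleft] at this⟩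
  rw [e1, e2]
  refine relIndex_comap_of_surjective _ (fun w => ⟨cornerEnd ι Θ ⟨ψ, hψc⟩ w, ?_⟩) _ _
  apply Subtype.ext
  change (cornerEnd ι Θ ⟨φ, hφc⟩ (cornerEnd ι Θ ⟨ψ, hψc⟩ w) : V) = w
  rw [coe_cornerEnd, coe_cornerEnd]
  exact LinearMap.congr_fun h2 w

variable [Module.Finite Δᵐᵒᵖ V]

/-- Flags with the same vector are isomorphic: the linear map that takes one adapted basis to the
other respects the chains. -/
theorem HasVector.equiv [NeZero r] (hL : ramIdx F L = 1) (hΘ : IsIwahori Θ) {N N' : BiFlag ι f}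
    {g : Fin r → Fin t → ℕ} (hg : HasVector Θ N g) (hg' : HasVector Θ N' g) : N ≈ N' := by
  obtain ⟨b, hb⟩ := exists_flag_basis hL hΘ N hg
  obtain ⟨b', hb'⟩ := exists_flag_basis hL hΘ N' hg'
  let e := b.equiv b' (Equiv.refl _)
  have he (w k) : b'.repr (e w) k = b.repr w k := by
    have : b' = b.map e := by
      ext k; simp [e]
    rw [this]; simp
  have he' (w k) : b.repr (e.symm w) k = b'.repr w k := by
    rw [← he, LinearEquiv.apply_symm_apply]
  let c := centralizerEquiv ι Θ
  refine ⟨(c.symm e.toLinearMap).1, (c.symm e.symm.toLinearMap).1, ?_, ?_, ?_, ?_⟩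
  · rw [BiFlag.isHom_iff hΘ]
    refine ⟨(c.symm e.toLinearMap).2, fun i j w hw => ?_⟩
    have h : cornerEnd ι Θ ⟨(c.symm e.toLinearMap).1, (c.symm e.toLinearMap).2⟩ =
      e.toLinearMap := c.apply_symm_apply _
    rw [h, LinearEquiv.coe_coe, hb']
    simp only [he]
    exact (hb i j w).mp hw
  · rw [BiFlag.isHom_iff hΘ]
    refine ⟨(c.symm e.symm.toLinearMap).2, fun i j w hw => ?_⟩
    have h : cornerEnd ι Θ ⟨(c.symm e.symm.toLinearMap).1, (c.symm e.symm.toLinearMap).2⟩ =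
      e.symm.toLinearMap := c.apply_symm_apply _
    rw [h, LinearEquiv.coe_coe, hb]
    simp only [he']
    exact (hb' i j w).mp hw
  · change ((c.symm e.symm.toLinearMap) * (c.symm e.toLinearMap)).1 = 1
    rw [← map_mul]
    have : e.symm.toLinearMap * e.toLinearMap = 1 := LinearMap.ext fun w => e.symm_apply_apply w
    rw [this, map_one]; rfl
  · change ((c.symm e.toLinearMap) * (c.symm e.symm.toLinearMap)).1 = 1
    rw [← map_mul]
    have : e.toLinearMap * e.symm.toLinearMap = 1 := LinearMap.ext fun w => e.apply_symm_apply w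
    rw [this, map_one]; rfl

/-- In an adapted basis the endomorphisms of a flag are the matrices in the hereditary order. -/
theorem endRing_iff [NeZero r] (hL : ramIdx F L = 1) (hΘ : IsIwahori Θ) (N : BiFlag ι f)
    {g : Fin r → Fin t → ℕ} (hg : HasVector Θ N g) [DecidableEq (BlockIndex g)] :
    ∃ ψ : Subalgebra.centralizer F (Set.range ι) ≃ₐ[F] Matrix (BlockIndex g) (BlockIndex g) Δ',
      (∀ (a : L) (h : ι a ∈ Subalgebra.centralizer F (Set.range ι)),
        ψ ⟨ι a, h⟩ = algebraMap L _ a) ∧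
      ∀ φ : Module.End Δᵐᵒᵖ V, φ ∈ N.endRing ↔
        ∃ h : φ ∈ Subalgebra.centralizer F (Set.range ι),
          ψ ⟨φ, h⟩ ∈ hereditaryOrder (maxCompactSubring F Δ') g := by
  obtain ⟨b, hb⟩ := exists_flag_basis hL hΘ N hg
  have hC (i j w) : w ∈ doubleChain Θ N i j ↔ w ∈ adaptedChain F b i j := hb i j w
  refine ⟨centralizerMatrix ι Θ b, fun a h => centralizerMatrix_ι ι Θ b a, fun φ => ?_⟩
  refine (BiFlag.isHom_iff (φ := φ) hΘ).trans (exists_congr fun h => ?_)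
  rw [centralizerMatrix_apply, ← forall_mem_adaptedChain_iff]
  simp only [hC]

/-- The dimension of `V^{(t)}` over `Δ'`. -/
theorem finrank_corner : Module.finrank F L * Module.finrank Δ'ᵐᵒᵖ (corner ι Θ) =
    Module.finrank Δᵐᵒᵖ V * t := by
  have hFV : Module.Finite F V := Module.Finite.trans Δᵐᵒᵖ V
  have hΔ' : 0 < Module.finrank F Δ' := Module.finrank_pos
  have e1 := Module.finrank_mul_finrank F Δᵐᵒᵖ V
  have e2 := Module.finrank_mul_finrank F Δ'ᵐᵒᵖ (corner ι Θ)
  have e3 : Module.finrank F V = t * Module.finrank F (corner ι Θ) := by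
    rw [LinearEquiv.finrank_eq (cornerEquiv ι Θ), Module.finrank_pi_fintype]
    simp
  have e4 : Module.finrank F L * Module.finrank F Δ = t * t * Module.finrank F Δ' := by
    rw [← Module.finrank_tensorProduct, LinearEquiv.finrank_eq (Θ.toLinearEquiv.restrictScalars F),
      Module.finrank_matrix]
    simp
  have e5 : Module.finrank F Δᵐᵒᵖ = Module.finrank F Δ :=
    (LinearEquiv.finrank_eq (MulOpposite.opLinearEquiv F)).symm
  have e6 : Module.finrank F Δ'ᵐᵒᵖ = Module.finrank F Δ' :=
    (LinearEquiv.finrank_eq (MulOpposite.opLinearEquiv F)).symm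
  rw [e5] at e1
  rw [e6] at e2
  have ht : 0 < t := NeZero.pos t
  refine Nat.eq_of_mul_eq_mul_left (Nat.mul_pos ht hΔ') ?_
  calc t * Module.finrank F Δ' * (Module.finrank F L * Module.finrank Δ'ᵐᵒᵖ (corner ι Θ))
      = Module.finrank F L * (t * (Module.finrank F Δ' * Module.finrank Δ'ᵐᵒᵖ (corner ι Θ))) := by
        ring
    _ = (Module.finrank F L * Module.finrank F Δ) * Module.finrank Δᵐᵒᵖ V := by
        rw [e2, ← e3, ← e1]; ring
    _ = _ := by rw [e4]; ring

end Classification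

/-! ### Construction of flags -/

section Existence

variable {F : Type*} [Field F] [TopologicalSpace F] [ValuativeRel F]
  [IsNonarchimedeanLocalField F]
  {Δ V L : Type*} [DivisionRing Δ] [Algebra F Δ] [FiniteDimensional F Δ]
  [AddCommGroup V] [Module Δᵐᵒᵖ V] [Module F V] [IsScalarTower F Δᵐᵒᵖ V]
  [Field L] [Algebra F L] [FiniteDimensional F L]
  {Δ' : Type*} [DivisionRing Δ'] [Algebra L Δ'] [Algebra F Δ'] [IsScalarTower F L Δ']
  [FiniteDimensional F Δ'] {t : ℕ} [NeZero t]
  {ι : L →ₐ[F] Module.End Δᵐᵒᵖ V} {Θ : L ⊗[F] Δ ≃ₐ[L] Matrix (Fin t) (Fin t) Δ'}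
  {r : ℕ} {f : Fin r → ℕ} {g : Fin r → Fin t → ℕ}

/-- Tuples of vectors in the terms `C i j`, `j` varying, are stable under the Iwahori order: an
entry strictly below the diagonal lies in the maximal ideal and moves any term of the chain into any
other, and the remaining entries only have to move terms into larger ones. -/
theorem rmul_mem_of_colMap_mem (hΘ : IsIwahori Θ)
    (b : Module.Basis (BlockIndex g) Δ'ᵐᵒᵖ (corner ι Θ)) (i : Fin r) {z : L ⊗[F] Δ}
    (hz : z ∈ tball F L Δ 0) {v : V} (hv : ∀ j, colMap ι Θ j v ∈ adaptedChain F b i j)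
    (j : Fin t) : colMap ι Θ j (rmul ι z v) ∈ adaptedChain F b i j := by
  rw [hΘ.mem_tball_zero_iff, mem_iwahori] at hz
  rw [colMap_rmul]
  refine sum_mem fun k _ => ?_
  have h := hz (Fin.rev k) (Fin.rev j)
  split_ifs at h with hkj <;> rw [Fin.rev_lt_rev] at hkj
  · exact smul_mem_adaptedChain b i j (lt_one_iff.mpr h) (hv k)
  · rw [WithZero.exp_zero] at h
    have hle : toLex (j, i) ≤ toLex (k, i) := by
      rw [Prod.Lex.toLex_le_toLex]
      rcases (not_lt.mp hkj).eq_or_lt with h' | h'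
      · exact Or.inr ⟨h', le_rfl⟩
      · exact Or.inl h'
    exact (adaptedChain F b i j).smul_mem
      (⟨MulOpposite.op (Θ z (Fin.rev k) (Fin.rev j)), (mem_maxCompactSubring_iff _).mpr h⟩ :
        OrdOp F Δ') (adaptedChain_le b hle (hv k))

theorem one_tmul_mem_tball (x : OrdOp F Δ) : (1 : L) ⊗ₜ[F] x.1.unop ∈ tball F L Δ 0 :=
  tmul_mem_tball (F := F) (L := L) (Δ := Δ) (x := 1) (y := x.1.unop) (n := 0) (by simp)
    (by rw [WithZero.exp_zero]; exact (mem_ordOp_iff _).mp x.2)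

/-- The lattices of `V` assembled from the lattices of an adapted chain in `V^{(t)}`. -/
def assembled (hΘ : IsIwahori Θ) (b : Module.Basis (BlockIndex g) Δ'ᵐᵒᵖ (corner ι Θ))
    (i : Fin r) : Submodule (OrdOp F Δ) V where
  carrier := {v | ∀ j, colMap ι Θ j v ∈ adaptedChain F b i j}
  zero_mem' j := by rw [map_zero]; exact zero_mem _
  add_mem' hv hw j := by rw [map_add]; exact add_mem (hv j) (hw j)
  smul_mem' x v hv j := by
    have h : x • v = rmul ι ((1 : L) ⊗ₜ[F] x.1.unop) v := by
      rw [rmul_one_tmul, MulOpposite.op_unop]; rfl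
    rw [h]
    exact rmul_mem_of_colMap_mem hΘ b i (one_tmul_mem_tball x) hv j

variable (hΘ : IsIwahori Θ) (b : Module.Basis (BlockIndex g) Δ'ᵐᵒᵖ (corner ι Θ))

theorem mem_assembled {i : Fin r} {v : V} :
    v ∈ assembled hΘ b i ↔ ∀ j, colMap ι Θ j v ∈ adaptedChain F b i j := Iff.rfl

theorem isStable_assembled (i : Fin r) : IsStable ι (assembled hΘ b i) := by
  intro a ha v hv
  rw [← rmul_tmul_one]
  refine rmul_mem_of_colMap_mem hΘ b i ?_ hv
  exact tmul_mem_tball (n := 0) ((mem_integralClosure_iff a).mp ha) (by simp)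

theorem rowMap_mem_assembled (i : Fin r) (j : Fin t) (w : corner ι Θ) :
    w ∈ adaptedChain F b i j ↔ rowMap ι Θ j w ∈ assembled hΘ b i := by
  rw [mem_assembled]
  constructor
  · intro hw k
    rw [colMap_rowMap]
    split_ifs with h
    · exact h ▸ hw
    · exact zero_mem _
  · intro h
    have := h j
    rwa [colMap_rowMap, if_pos rfl] at this

theorem nextTerm_assembled_le (hL : ramIdx F L = 1) (i : Fin r) :
    nextTerm (assembled hΘ b) i ≤ assembled hΘ b i := by
  intro v hv
  have hst := isStable_assembled hΘ b
  rw [mem_iff_forall_rowMap_colMap hΘ (isStable_nextTerm hst i)] at hv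
  intro j
  have := hv j
  rw [← mem_nextChain_iff hL hΘ hst (rowMap_mem_assembled hΘ b), mem_nextChain_adaptedChain] at this
  exact fun k => ⟨(this k).1, fun h => (this k).2 h.le⟩

theorem relIndex_piece_assembled (hL : ramIdx F L = 1) (i : Fin r) (j : Fin t) :
    (piece (ι := ι) Θ (nextTerm (assembled hΘ b) i) j).relIndex (piece Θ (assembled hΘ b i) j) =
      resCard F Δ' ^ g i j := by
  rw [← relIndex_nextChain_adaptedChain (F := F) b i j]
  congr 1
  · ext w
    exact (mem_nextChain_iff hL hΘ (isStable_assembled hΘ b) (rowMap_mem_assembled hΘ b) i j w).symm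
  · ext w
    exact (rowMap_mem_assembled hΘ b i j w).symm

theorem assembled_fg (i : Fin r) : (assembled hΘ b i).FG := by
  rw [← intRestrict_fg_iff]
  have h : intRestrict (assembled hΘ b i) = ⨆ j, (intRestrict (adaptedChain F b i j)).map
      ((rowMap ι Θ j).restrictScalars 𝒪[F]) := by
    refine le_antisymm (fun v hv => ?_) (iSup_le fun j => ?_)
    · rw [← sum_rowMap_colMap ι Θ v]
      exact sum_mem fun j _ => Submodule.mem_iSup_of_mem j ⟨_, hv j, rfl⟩
    · rintro _ ⟨w, hw, rfl⟩
      exact (rowMap_mem_assembled hΘ b i j w).mp hw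
  rw [h]
  exact Submodule.fg_iSup _ fun j => (adaptedChain_fg b i j).map _

theorem span_assembled (i : Fin r) :
    Submodule.span Δᵐᵒᵖ (assembled hΘ b i : Set V) = ⊤ := by
  rw [span_eq_top_iff]
  intro v
  have h (j : Fin t) := (span_eq_top_iff _).mp (span_adaptedChain (F := F) b i j) (colMap ι Θ j v)
  choose n hn using h
  refine ⟨∑ j, n j, fun j => ?_⟩
  rw [map_smul]
  exact pow_smul_mem_of_le (Finset.single_le_sum (fun _ _ => Nat.zero_le _) (Finset.mem_univ j))
    (hn j)

variable [Module.Finite Δᵐᵒᵖ V]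

theorem relIndex_assembled (hL : ramIdx F L = 1) (ht : t ∣ Module.finrank F L) (i : Fin r)
    (hg : Module.finrank F L / t * ∑ j, g i j = f i) :
    (nextTerm (assembled hΘ b) i).toAddSubgroup.relIndex (assembled hΘ b i).toAddSubgroup =
      resCard F Δ ^ f i := by
  rw [relIndex_eq_prod_piece hΘ (isStable_assembled hΘ b i)
    (isStable_nextTerm (isStable_assembled hΘ b) i)]
  simp only [relIndex_piece_assembled hΘ b hL]
  rw [Finset.prod_pow_eq_pow_sum, ← sum_eq_iff hL hΘ ht, hg]

/-- The assembled lattices form a flag, if their vector satisfies the constraint. -/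
theorem isFlag_assembled (hL : ramIdx F L = 1) (ht : t ∣ Module.finrank F L)
    (hf : ∀ i, 0 < f i) (hg : ∀ i, Module.finrank F L / t * ∑ j, g i j = f i) :
    IsFlag F Δ f (assembled hΘ b) where
  free i := nonempty_basis_of_fg (assembled_fg hΘ b i) (span_assembled hΘ b i)
  lt i := by
    refine lt_of_le_of_ne (nextTerm_assembled_le hΘ b hL i) fun h => ?_
    have := relIndex_assembled hΘ b hL ht i (hg i)
    rw [h, AddSubgroup.relIndex_self] at this
    exact (Nat.one_lt_pow (hf i).ne' (one_lt_resCard : 1 < resCard F Δ)).ne this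
  dim i := by
    rw [hasResidueDim_quotient_iff]
    refine ⟨?_, relIndex_assembled hΘ b hL ht i (hg i)⟩
    have hle := nextTerm_assembled_le hΘ b hL
    refine le_trans (Submodule.smul_mono le_rfl ?_)
      (maxIdeal_smul_le_nextTerm hle i ⟨0, i.pos⟩ rfl)
    rcases (Nat.zero_le i.1).eq_or_lt with h0 | h0
    · exact le_of_eq (congrArg (assembled hΘ b) (Fin.ext h0.symm))
    · exact (le_zero_of_nextTerm_le hle ⟨0, i.pos⟩ i h0).trans (hle _)

theorem sum_eq_of_constraint (ht : t ∣ Module.finrank F L) {m : ℕ} (hfm : ∑ i, f i = m)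
    (hg : ∀ i, Module.finrank F L / t * ∑ j, g i j = f i) :
    Module.finrank F L * ∑ i, ∑ j, g i j = m * t := by
  obtain ⟨c, hc⟩ := ht
  rw [hc, Nat.mul_div_cancel_left _ (NeZero.pos t)] at hg
  rw [hc, ← hfm, ← Finset.sum_congr rfl fun i _ => hg i, ← Finset.mul_sum]
  ring

/-- Every vector satisfying the constraint occurs: assemble the lattices of a flag from the chain
adapted to an arbitrary basis of `V^{(t)}` cut into blocks of the given sizes. -/
theorem exists_flag_of_vector (hL : ramIdx F L = 1) (hΘ : IsIwahori Θ)
    (ht : t ∣ Module.finrank F L) (hf : ∀ i, 0 < f i)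
    (hfm : ∑ i, f i = Module.finrank Δᵐᵒᵖ V)
    (hg : ∀ i, Module.finrank F L / t * ∑ j, g i j = f i) :
    ∃ N : BiFlag ι f, HasVector Θ N g := by
  have hFV : Module.Finite F V := Module.Finite.trans Δᵐᵒᵖ V
  have hcard : Module.finrank Δ'ᵐᵒᵖ (corner ι Θ) = Fintype.card (BlockIndex g) := by
    have h1 := sum_eq_of_constraint ht hfm hg
    rw [← finrank_corner (Θ := Θ) (ι := ι)] at h1
    rw [card_blockIndex]
    exact (Nat.eq_of_mul_eq_mul_left Module.finrank_pos h1).symm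
  have : Module.Finite Δ'ᵐᵒᵖ (corner ι Θ) := Module.Finite.of_restrictScalars_finite F _ _
  let b : Module.Basis (BlockIndex g) Δ'ᵐᵒᵖ (corner ι Θ) :=
    (Module.finBasisOfFinrankEq _ _ hcard).reindex (Fintype.equivFin _).symm
  let N : BiFlag ι f := ⟨assembled hΘ b, isFlag_assembled hΘ b hL ht hf hg,
    isStable_assembled hΘ b⟩
  exact ⟨N, (hasVector_iff hL hΘ N g).mpr (relIndex_piece_assembled hΘ b hL)⟩

end Existence

section Parametrization

theorem finiteDimensional_of_equiv {F L Δ Δ' : Type*} [Field F] [Field L] [Algebra F L]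
    [FiniteDimensional F L] [DivisionRing Δ] [Algebra F Δ] [FiniteDimensional F Δ]
    [DivisionRing Δ'] [Algebra L Δ'] [Algebra F Δ'] [IsScalarTower F L Δ'] {t : ℕ} [NeZero t]
    (Θ : L ⊗[F] Δ ≃ₐ[L] Matrix (Fin t) (Fin t) Δ') : FiniteDimensional F Δ' := by
  have h1 : Module.Finite F (Matrix (Fin t) (Fin t) Δ') :=
    Module.Finite.equiv (Θ.toLinearEquiv.restrictScalars F)
  exact Module.Finite.of_surjective (Matrix.entryLinearMap F Δ' (0 : Fin t) (0 : Fin t))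
    fun x => ⟨Matrix.single 0 0 x, by simp⟩

/-- Flags up to isomorphism are classified by their vectors, and the endomorphism ring of a flag is
the hereditary order given by its vector. -/
theorem flag_parametrization {F : Type*} [Field F] [ValuativeRel F] [TopologicalSpace F]
    [IsNonarchimedeanLocalField F]
    {Δ V L : Type*} [DivisionRing Δ] [Algebra F Δ] [FiniteDimensional F Δ]
    [AddCommGroup V] [Module Δᵐᵒᵖ V] [Module F V] [IsScalarTower F Δᵐᵒᵖ V]
    [Module.Finite Δᵐᵒᵖ V] [Field L] [Algebra F L] [FiniteDimensional F L]
    {Δ' : Type*} [DivisionRing Δ'] [Algebra L Δ'] [Algebra F Δ'] [IsScalarTower F L Δ']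
    {t : ℕ} [NeZero t] {ι : L →ₐ[F] Module.End Δᵐᵒᵖ V}
    {Θ : L ⊗[F] Δ ≃ₐ[L] Matrix (Fin t) (Fin t) Δ'}
    {r : ℕ} [NeZero r] {f : Fin r → ℕ} (hL : ramIdx F L = 1) (hΘ : IsIwahori Θ)
    (ht : t ∣ Module.finrank F L) (hf : ∀ i, 0 < f i)
    (hfm : ∑ i, f i = Module.finrank Δᵐᵒᵖ V) :
    ∃ Φ : FL ι f ≃ {g : Fin r → Fin t → ℕ // ∀ i, Module.finrank F L / t * ∑ j, g i j = f i},
      ∀ N : BiFlag ι f,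
        HasVector Θ N (Φ ⟦N⟧).1 ∧
        Fintype.card (BlockIndex (Φ ⟦N⟧).1) =
          Module.finrank Δᵐᵒᵖ V * t / Module.finrank F L ∧
        ∃ ψ : Subalgebra.centralizer F (Set.range ι) ≃ₐ[F]
            Matrix (BlockIndex (Φ ⟦N⟧).1) (BlockIndex (Φ ⟦N⟧).1) Δ',
          (∀ (a : L) (h : ι a ∈ Subalgebra.centralizer F (Set.range ι)),
            ψ ⟨ι a, h⟩ = algebraMap L _ a) ∧
          ∀ φ : Module.End Δᵐᵒᵖ V, φ ∈ N.endRing ↔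
            ∃ h : φ ∈ Subalgebra.centralizer F (Set.range ι),
              ψ ⟨φ, h⟩ ∈ hereditaryOrder (maxCompactSubring F Δ') (Φ ⟦N⟧).1 := by
  have hfin : FiniteDimensional F Δ' := finiteDimensional_of_equiv Θ
  choose γ hγ using fun N : BiFlag ι f => exists_hasVector (Θ := Θ) hL hΘ N
  let φ : FL ι f → {g : Fin r → Fin t → ℕ // ∀ i, Module.finrank F L / t * ∑ j, g i j = f i} :=
    Quotient.lift (fun N => ⟨γ N, (hγ N).sum_eq hL hΘ ht⟩) fun N N' h =>
      Subtype.ext ((hγ N).unique hL hΘ (HasVector.of_equiv hL hΘ h (hγ N')))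
  have hφ : Function.Bijective φ := by
    constructor
    · intro x y
      induction x using Quotient.inductionOn with | h N =>
      induction y using Quotient.inductionOn with | h N' =>
      intro h
      have h' : γ N = γ N' := congrArg Subtype.val h
      exact Quotient.sound (HasVector.equiv hL hΘ (hγ N) (h' ▸ hγ N'))
    · rintro ⟨g, hg⟩
      obtain ⟨N, hN⟩ := exists_flag_of_vector hL hΘ ht hf hfm hg
      exact ⟨⟦N⟧, Subtype.ext ((hγ N).unique hL hΘ hN)⟩
  refine ⟨Equiv.ofBijective φ hφ, fun N => ?_⟩
  have h1 : (Equiv.ofBijective φ hφ ⟦N⟧).1 = γ N := rfl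
  refine ⟨hγ N, ?_, endRing_iff hL hΘ N (hγ N)⟩
  rw [h1, card_blockIndex, ← sum_eq_of_constraint ht hfm ((hγ N).sum_eq hL hΘ ht),
    Nat.mul_div_cancel_left _ Module.finrank_pos]

end Parametrization

/-! ### Teichmüller representatives -/

section Teichmuller

variable {F : Type*} [Field F] [ValuativeRel F] [TopologicalSpace F]
  [IsNonarchimedeanLocalField F] {D : Type*} [DivisionRing D] [Algebra F D]
  [FiniteDimensional F D]

theorem exists_smul_mem_ball (x : D) (n : ℤ) : ∃ N : ℕ, ∀ c : F,
    baseVal F c ≤ WithZero.exp (-(N : ℤ)) → divVal F D (c • x) ≤ WithZero.exp n := by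
  by_cases hx : divVal F D x = 0
  · exact ⟨0, fun c _ => by rw [Algebra.smul_def, map_mul, hx, mul_zero]; exact zero_le⟩
  obtain ⟨m, hm⟩ := exists_eq_exp hx
  refine ⟨(m - n).toNat, fun c hc => ?_⟩
  have he : ramIdx F D ≠ 0 := (ramIdx_pos (F := F) (D := D)).ne'
  have h1 : baseVal F c ≤ 1 := hc.trans (by
    rw [← WithZero.exp_zero, WithZero.exp_le_exp]; omega)
  rw [Algebra.smul_def, map_mul, divVal_algebraMap, hm]
  refine (mul_le_mul_left ((pow_le_of_le_one zero_le h1 he).trans hc) _).trans ?_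
  rw [← WithZero.exp_add, WithZero.exp_le_exp]
  omega

theorem ball_mem_nhds (n : ℤ) :
    (ball (divVal F D) n : Set D) ∈ @nhds D (moduleTopology F D) 0 := by
  let : TopologicalSpace D := moduleTopology F D
  have : IsModuleTopology F D := ⟨rfl⟩
  let b := Module.finBasis F D
  choose N hN using fun i => exists_smul_mem_ball (F := F) (b i) n
  have hU : ∀ i, {x : D | baseVal F (b.repr x i) ≤ WithZero.exp (-(N i : ℤ))} ∈ nhds (0 : D) := by
    intro i
    have hc : Continuous (b.coord i) := IsModuleTopology.continuous_of_linearMap _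
    refine (isOpen_baseVal_le (F := F) (by simp)).preimage hc |>.mem_nhds ?_
    simp
  refine Filter.mem_of_superset (Filter.iInter_mem.mpr hU) fun x hx => ?_
  rw [Set.mem_iInter] at hx
  change divVal F D x ≤ WithZero.exp n
  rw [← b.sum_repr x]
  exact (divVal F D).map_sum_le fun i _ => hN i _ (hx i)

/-- The maximal compact subring is complete. -/
theorem exists_limit {u : ℕ → D} (hu : ∀ n, divVal F D (u n) ≤ 1)
    (hc : ∀ n, divVal F D (u (n + 1) - u n) ≤ WithZero.exp (-(n : ℤ))) :
    ∃ z, ∀ n : ℕ, divVal F D (z - u n) ≤ WithZero.exp (-(n : ℤ)) := by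
  let : TopologicalSpace D := moduleTopology F D
  have : IsModuleTopology F D := ⟨rfl⟩
  have := IsModuleTopology.toContinuousAdd F D
  have hcomp : IsCompact {x : D | divVal F D x ≤ 1} := by
    have h := isCompact_normVal_le (F := F) (D := D)
    have h1 : {x : D | normVal F D x ≤ 1} = {x : D | divVal F D x ≤ 1} := by
      ext x
      exact (mem_maxCompactSubring_iff_normVal x).symm.trans (mem_maxCompactSubring_iff x)
    rwa [h1] at h
  obtain ⟨z, -, hz⟩ := hcomp.exists_mapClusterPt (f := Filter.atTop) (u := u) (by
    rw [Filter.le_principal_iff, Filter.mem_map]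
    exact Filter.Eventually.of_forall hu)
  have hmono (n k : ℕ) : divVal F D (u (n + k) - u n) ≤ WithZero.exp (-(n : ℤ)) := by
    induction k with
    | zero => simp
    | succ k ih =>
      have : u (n + (k + 1)) - u n = (u (n + k + 1) - u (n + k)) + (u (n + k) - u n) := by
        rw [← add_assoc]; abel
      rw [this]
      refine ((divVal F D).map_add _ _).trans (max_le ((hc _).trans ?_) ih)
      rw [WithZero.exp_le_exp]; push_cast; omega
  refine ⟨z, fun n => ?_⟩
  have hnhds : {x : D | x - z ∈ ball (divVal F D) (-(n : ℤ))} ∈ nhds z := by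
    have hcont : Continuous fun x : D => x + -z := continuous_add_const _
    have := hcont.continuousAt (x := z) |>.preimage_mem_nhds (by
      rw [add_neg_cancel]; exact ball_mem_nhds (F := F) (-(n : ℤ)))
    refine Filter.mem_of_superset this fun x hx => ?_
    rw [Set.mem_ofPred_eq, sub_eq_add_neg]; exact hx
  have hfreq := hz.frequently hnhds
  obtain ⟨m, hm, hmn⟩ := (hfreq.and_eventually (Filter.eventually_ge_atTop n)).exists
  obtain ⟨k, rfl⟩ := Nat.exists_eq_add_of_le hmn
  have h1 : z - u n = -(u (n + k) - z) + (u (n + k) - u n) := by abel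
  rw [h1]
  exact ((divVal F D).map_add _ _).trans (max_le (by rw [Valuation.map_neg]; exact hm) (hmono n k))

theorem divVal_pow_sub_pow_le {x y : D} (hx : divVal F D x ≤ 1) (hy : divVal F D y ≤ 1) (n : ℕ) :
    divVal F D (x ^ n - y ^ n) ≤ divVal F D (x - y) := by
  induction n with
  | zero => simp
  | succ n ih =>
    have : x ^ (n + 1) - y ^ (n + 1) = x ^ n * (x - y) + (x ^ n - y ^ n) * y := by
      rw [pow_succ, pow_succ]; noncomm_ring
    rw [this]
    refine ((divVal F D).map_add _ _).trans (max_le ?_ ?_)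
    · rw [map_mul, map_pow]
      exact mul_le_of_le_one_left' (pow_le_one' hx n)
    · rw [map_mul]
      exact (mul_le_of_le_one_right' hy).trans ih

theorem divVal_natCast_le (n : ℕ) : divVal F D (n : D) ≤ 1 := by
  rw [← mem_maxCompactSubring_iff]; exact natCast_mem _ n

theorem divVal_resCard_lt_one : divVal F D (resCard F D : D) < 1 := by
  obtain ⟨k, hk⟩ := exists_resCard_eq_resChar_pow F D
  have hk0 : k ≠ 0 := by
    rintro rfl
    have := one_lt_resCard (F := F) (D := D)
    rw [hk, pow_zero] at this
    exact lt_irrefl _ this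
  rw [hk, Nat.cast_pow, map_pow]
  have h1 : divVal F D (resChar F : D) < 1 := by
    have := (divVal_algebraMap_lt_one_iff (D := D) (resChar F : F)).mpr baseVal_resChar_lt_one
    rwa [map_natCast] at this
  exact pow_lt_one' h1 hk0

/-- Congruences improve under the power map, for commuting elements. -/
theorem divVal_pow_sub_pow_lt {x y : D} (hxy : Commute x y) (hx : divVal F D x ≤ 1)
    (hy : divVal F D y ≤ 1) (h : divVal F D (x - y) < 1) (hne : x ≠ y) :
    divVal F D (x ^ resCard F D - y ^ resCard F D) < divVal F D (x - y) := by
  rw [← hxy.mul_geom_sum₂, map_mul]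
  have hpos : 0 < divVal F D (x - y) := zero_lt_iff.mpr (by simpa [sub_eq_zero] using hne)
  have hsum : divVal F D (∑ i ∈ Finset.range (resCard F D), x ^ i * y ^ (resCard F D - 1 - i))
      < 1 := by
    have h1 : ∑ i ∈ Finset.range (resCard F D), x ^ i * y ^ (resCard F D - 1 - i) =
        ∑ i ∈ Finset.range (resCard F D), (x ^ i - y ^ i) * y ^ (resCard F D - 1 - i) +
          (resCard F D : D) * y ^ (resCard F D - 1) := by
      rw [← Finset.card_range (resCard F D), ← nsmul_eq_mul, ← Finset.sum_const,
        Finset.card_range, ← Finset.sum_add_distrib]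
      refine Finset.sum_congr rfl fun i hi => ?_
      rw [sub_mul, ← pow_add, Nat.add_sub_cancel' (by
        have := Finset.mem_range.mp hi; omega), sub_add_cancel]
    rw [h1]
    refine ((divVal F D).map_add _ _).trans_lt (max_lt ?_ ?_)
    · refine (divVal F D).map_sum_lt one_ne_zero fun i _ => ?_
      rw [map_mul, map_pow]
      exact mul_lt_one_of_lt_one_of_le_one ((divVal_pow_sub_pow_le hx hy i).trans_lt h)
        (pow_le_one' hy _)
    · rw [map_mul, map_pow]
      exact mul_lt_one_of_lt_one_of_le_one divVal_resCard_lt_one (pow_le_one' hy _)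
  calc divVal F D (x - y) * _ < divVal F D (x - y) * 1 :=
        (mul_lt_mul_iff_right₀ hpos).mpr hsum
    _ = _ := mul_one _

theorem divVal_le_one_of_pow_eq {x : D} (hx : x ^ resCard F D = x) : divVal F D x ≤ 1 := by
  by_cases h0 : x = 0
  · simp [h0]
  have h1 : x ^ (resCard F D - 1) = 1 := by
    have := one_lt_resCard (F := F) (D := D)
    have h2 : x ^ (resCard F D - 1) * x = 1 * x := by
      rw [← pow_succ, Nat.sub_add_cancel (by omega), hx, one_mul]
    exact mul_right_cancel₀ h0 h2
  refine le_one_of_pow_le (n := 0) fun k => ?_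
  by_contra hlt
  rw [not_le, WithZero.exp_zero] at hlt
  have h2 : (divVal F D x ^ k) ^ (resCard F D - 1) = 1 := by
    rw [← pow_mul, mul_comm, pow_mul, ← map_pow, h1, map_one, one_pow]
  have hq := one_lt_resCard (F := F) (D := D)
  exact absurd h2 (one_lt_pow' hlt (by omega)).ne'

/-- Commuting Teichmüller representatives with the same residue are equal. -/
theorem eq_of_divVal_sub_lt_one {x y : D} (hxy : Commute x y) (hx : x ^ resCard F D = x)
    (hy : y ^ resCard F D = y) (h : divVal F D (x - y) < 1) : x = y := by
  by_contra hne
  have := divVal_pow_sub_pow_lt hxy (divVal_le_one_of_pow_eq hx) (divVal_le_one_of_pow_eq hy) h hne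
  rw [hx, hy] at this
  exact lt_irrefl _ this

/-- Teichmüller representatives: the powers `a ^ (q ^ n)`, with `q` the cardinality of the residue
field, converge. -/
theorem exists_teichmuller {a : D} (ha : divVal F D a ≤ 1) :
    ∃ z, z ^ resCard F D = z ∧ divVal F D (z - a) < 1 := by
  let q := resCard F D
  let u : ℕ → D := fun n => a ^ q ^ n
  have hu (n) : divVal F D (u n) ≤ 1 := by
    change divVal F D (a ^ q ^ n) ≤ 1
    rw [map_pow]; exact pow_le_one' ha _
  have hsucc (n) : u (n + 1) = u n ^ q := by
    change a ^ q ^ (n + 1) = (a ^ q ^ n) ^ q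
    rw [← pow_mul, pow_succ]
  have hc (n : ℕ) : divVal F D (u (n + 1) - u n) ≤ WithZero.exp (-(n : ℤ) - 1) := by
    induction n with
    | zero =>
      rw [hsucc]
      have : u 0 = a := by change a ^ q ^ 0 = a; rw [pow_zero, pow_one]
      rw [this]
      simpa using lt_one_iff.mp (divVal_pow_resCard_sub_lt_one ha)
    | succ n ih =>
      by_cases hne : u (n + 1) = u n
      · rw [hsucc (n + 1), hne, ← hsucc, hne, sub_self, map_zero]; exact zero_le
      have hcomm : Commute (u (n + 1)) (u n) := (Commute.refl a).pow_pow _ _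
      have hlt : divVal F D (u (n + 1) - u n) < 1 := by
        refine ih.trans_lt ?_
        rw [← WithZero.exp_zero, WithZero.exp_lt_exp]; omega
      have h1 := divVal_pow_sub_pow_lt hcomm (hu _) (hu _) hlt hne
      rw [← hsucc, ← hsucc] at h1
      have h2 := h1.trans_le ih
      rw [lt_exp_iff] at h2
      push_cast
      convert h2 using 2
      ring
  obtain ⟨z, hz⟩ := exists_limit (F := F) hu fun n => (hc n).trans (by
    rw [WithZero.exp_le_exp]; omega)
  have hz1 : divVal F D z ≤ 1 := by
    have : z = (z - u 0) + u 0 := by abel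
    rw [this]
    refine ((divVal F D).map_add _ _).trans (max_le ?_ (hu 0))
    simpa using hz 0
  refine ⟨z, ?_, ?_⟩
  · by_contra hne
    have h0 : divVal F D (z ^ q - z) ≠ 0 := by simpa [sub_eq_zero] using hne
    obtain ⟨m, hm⟩ := exists_eq_exp h0
    obtain ⟨n, hn⟩ : ∃ n : ℕ, -(n : ℤ) < m := ⟨(-m).toNat + 1, by omega⟩
    have h1 : z ^ q - z = (z ^ q - u n ^ q) + -(z - u (n + 1)) := by rw [hsucc n]; abel
    have h2 : divVal F D (z ^ q - z) ≤ WithZero.exp (-(n : ℤ)) := by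
      rw [h1]
      refine ((divVal F D).map_add _ _).trans (max_le ?_ ?_)
      · exact (divVal_pow_sub_pow_le hz1 (hu n) q).trans (hz n)
      · rw [Valuation.map_neg]
        refine (hz (n + 1)).trans ?_
        rw [WithZero.exp_le_exp]; push_cast; omega
    rw [hm, WithZero.exp_le_exp] at h2
    omega
  · have h1 : z - a = (z - u 1) + (u 1 - u 0) := by
      change z - a = (z - u 1) + (u 1 - a ^ q ^ 0)
      rw [pow_zero, pow_one]; abel
    rw [h1]
    refine ((divVal F D).map_add _ _).trans_lt (max_lt ?_ ?_)
    · exact (hz 1).trans_lt (by rw [← WithZero.exp_zero, WithZero.exp_lt_exp]; norm_num)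
    · exact (hc 0).trans_lt (by rw [← WithZero.exp_zero, WithZero.exp_lt_exp]; norm_num)

variable (F D) in
/-- A root of unity that generates the multiplicative group of the residue field. -/
theorem exists_teichmuller_generator : ∃ z : D, orderOf z = resCard F D - 1 ∧
    ∀ x, divVal F D x = 1 → ∃ i : ℕ, divVal F D (x - z ^ i) < 1 := by
  let := resField F D
  have := finite_resField (F := F) (D := D)
  let := Fintype.ofFinite (ResField F D)
  obtain ⟨g, hg⟩ := IsCyclic.exists_generator (α := (ResField F D)ˣ)
  obtain ⟨a, ha⟩ := Ideal.Quotient.mk_surjective (g : ResField F D)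
  obtain ⟨z, hz, hza⟩ := exists_teichmuller ((mem_maxCompactSubring_iff (F := F) (a : D)).mp a.2)
  have hz1 := divVal_le_one_of_pow_eq hz
  let zO : maxCompactSubring F D := ⟨z, (mem_maxCompactSubring_iff _).mpr hz1⟩
  have hzg : Ideal.Quotient.mk (maxIdeal (maxCompactSubring F D)) zO = g := by
    rw [← ha, residue_mk_eq_iff mem_maxCompactSubring_iff]
    exact hza
  have hz0 : z ≠ 0 := by
    rintro rfl
    have : zO = 0 := rfl
    rw [this, map_zero] at hzg
    exact g.ne_zero hzg.symm
  have hq := one_lt_resCard (F := F) (D := D)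
  have hpow : z ^ (resCard F D - 1) = 1 := by
    have h2 : z ^ (resCard F D - 1) * z = 1 * z := by
      rw [← pow_succ, Nat.sub_add_cancel (by omega), hz, one_mul]
    exact mul_right_cancel₀ hz0 h2
  refine ⟨z, Nat.dvd_antisymm (orderOf_dvd_of_pow_eq_one hpow) ?_, fun x hx => ?_⟩
  · have h1 : orderOf g = resCard F D - 1 := by
      rw [orderOf_eq_card_of_forall_mem_zpowers hg, Nat.card_units, card_residue]
    rw [← h1]
    refine orderOf_dvd_of_pow_eq_one (Units.ext ?_)
    rw [Units.val_pow_eq_pow_val, ← hzg, ← map_pow, Units.val_one]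
    have : zO ^ orderOf z = 1 := Subtype.ext (pow_orderOf_eq_one z)
    rw [this, map_one]
  · let xO : maxCompactSubring F D := ⟨x, (mem_maxCompactSubring_iff _).mpr hx.le⟩
    have hx0 : Ideal.Quotient.mk (maxIdeal (maxCompactSubring F D)) xO ≠ 0 := by
      intro h
      rw [← map_zero (Ideal.Quotient.mk _), residue_mk_eq_iff mem_maxCompactSubring_iff] at h
      have h' : divVal F D (x - 0) < 1 := h
      rw [sub_zero, hx] at h'
      exact lt_irrefl _ h'
    obtain ⟨i, hi⟩ := (mem_powers_iff_mem_zpowers.mpr (hg (Units.mk0 _ hx0)))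
    refine ⟨i, ?_⟩
    refine (residue_mk_eq_iff mem_maxCompactSubring_iff xO (zO ^ i)).mp ?_
    rw [map_pow, hzg]
    exact (congrArg Units.val hi).symm

end Teichmuller

/-! ### Normalizing uniformizers -/

section FiniteFields

theorem dvd_of_pow_sub_one_dvd {p a c : ℕ} (hp : 1 < p) (h : p ^ a - 1 ∣ p ^ c - 1) : a ∣ c := by
  have h1 := Nat.pow_sub_one_gcd_pow_sub_one p a c
  rw [Nat.gcd_eq_left h] at h1
  have ha := Nat.one_le_pow a p (by omega)
  have hg := Nat.one_le_pow (a.gcd c) p (by omega)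
  have h2 : p ^ a = p ^ a.gcd c := by omega
  exact Nat.gcd_eq_left_iff_dvd.mp (Nat.pow_right_injective hp h2).symm

/-- The converse of `dvd_of_pow_sub_one_dvd`. -/
theorem pow_sub_one_dvd {p a c : ℕ} (h : a ∣ c) : p ^ a - 1 ∣ p ^ c - 1 := by
  obtain ⟨e, rfl⟩ := h
  rw [pow_mul]
  exact Nat.sub_one_dvd_pow_sub_one _ _

/-- Ring endomorphisms of a finite field are powers of the Frobenius. -/
theorem exists_eq_frobenius_pow {K : Type*} [Field K] [Finite K] {p : ℕ} [Fact p.Prime]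
    [CharP K p] (σ : K →+* K) : ∃ b : ℕ, ∀ x, σ x = x ^ p ^ b := by
  let := ZMod.algebra K p
  let σ' : K →ₐ[ZMod p] K :=
    { σ with
      commutes' := fun r => DFunLike.congr_fun
        (Subsingleton.elim (σ.comp (algebraMap (ZMod p) K)) (algebraMap (ZMod p) K)) r }
  obtain ⟨n, hn⟩ := (FiniteField.bijective_frobeniusAlgHom_pow (ZMod p) K).2 σ'
  refine ⟨n, fun x => ?_⟩
  have h (m : ℕ) (x : K) : (FiniteField.frobeniusAlgHom (ZMod p) K ^ m) x = x ^ p ^ m := by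
    induction m generalizing x with
    | zero => simp
    | succ m ih =>
      rw [pow_succ, AlgHom.mul_apply, FiniteField.frobeniusAlgHom_apply, ih, ← pow_mul, ZMod.card,
        pow_succ, mul_comm]
  rw [← h n x]
  exact (DFunLike.congr_fun hn x).symm

end FiniteFields

section RootsOfUnity

variable {F : Type*} [Field F] [ValuativeRel F] [TopologicalSpace F]
  [IsNonarchimedeanLocalField F] {D : Type*} [DivisionRing D] [Algebra F D]
  [FiniteDimensional F D]

theorem divVal_eq_one_of_pow_eq_one {x : D} {n : ℕ} (hn : n ≠ 0) (hx : x ^ n = 1) :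
    divVal F D x = 1 := by
  have h : divVal F D x ^ n = 1 := by rw [← map_pow, hx, map_one]
  exact (pow_eq_one_iff.mp h).resolve_right hn

/-- A root of unity of order prime to the residue characteristic is determined by its residue. -/
theorem eq_one_of_pow_eq_one {x : D} {n : ℕ} (hn : divVal F D (n : D) = 1) (hx : x ^ n = 1)
    (h : divVal F D (x - 1) < 1) : x = 1 := by
  have hn0 : n ≠ 0 := by rintro rfl; simp at hn
  have hx1 := divVal_eq_one_of_pow_eq_one (F := F) hn0 hx
  have h1 := mul_geom_sum x n
  rw [hx, sub_self] at h1
  refine (sub_eq_zero.mp ((mul_eq_zero.mp h1).resolve_right fun h0 => ?_))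
  have h2 : (n : D) = -∑ i ∈ Finset.range n, (x ^ i - 1) := by
    rw [Finset.sum_sub_distrib, h0]; simp
  have h3 : divVal F D (n : D) < 1 := by
    rw [h2, Valuation.map_neg]
    refine (divVal F D).map_sum_lt one_ne_zero fun i _ => ?_
    have := divVal_pow_sub_pow_le hx1.le (map_one (divVal F D)).le i
    rw [one_pow] at this
    exact this.trans_lt h
  exact h3.ne hn

theorem divVal_natCast_eq_one {n : ℕ} (h : divVal F D ((n : D) + 1) < 1) :
    divVal F D (n : D) = 1 := by
  refine le_antisymm (divVal_natCast_le n) (not_lt.mp fun hlt => ?_)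
  have h1 : (1 : D) = ((n : D) + 1) + -(n : D) := by abel
  have h2 := (divVal F D).map_add ((n : D) + 1) (-(n : D))
  rw [← h1, map_one, Valuation.map_neg] at h2
  exact absurd h2 (not_le.mpr (max_lt h hlt))

variable (F D) in
theorem divVal_resChar_lt_one : divVal F D (resChar F : D) < 1 := by
  have := (divVal_algebraMap_lt_one_iff (D := D) (resChar F : F)).mpr baseVal_resChar_lt_one
  rwa [map_natCast] at this

variable (F D) in
theorem divVal_resChar_pow_sub_one {k : ℕ} (hk : k ≠ 0) :
    divVal F D ((resChar F ^ k - 1 : ℕ) : D) = 1 := by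
  refine divVal_natCast_eq_one ?_
  have : 1 ≤ resChar F ^ k := Nat.one_le_pow _ _ resChar_prime.pos
  rw [← Nat.cast_add_one, Nat.sub_add_cancel this, Nat.cast_pow, map_pow]
  exact pow_lt_one' (divVal_resChar_lt_one F D) hk

/-- The order of a root of unity divides the order of the multiplicative group of the residue
field, if it is prime to the residue characteristic. -/
theorem orderOf_dvd_resCard_sub_one {z : D} (h : divVal F D (orderOf z : D) = 1) :
    orderOf z ∣ resCard F D - 1 := by
  have h0 : orderOf z ≠ 0 := by intro h0; rw [h0] at h; simp at h
  have hz := divVal_eq_one_of_pow_eq_one (F := F) h0 (pow_orderOf_eq_one z)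
  have hq := one_lt_resCard (F := F) (D := D)
  refine orderOf_dvd_of_pow_eq_one (eq_one_of_pow_eq_one (F := F) h ?_ ?_)
  · rw [← pow_mul, mul_comm, pow_mul, pow_orderOf_eq_one, one_pow]
  · have h1 := divVal_pow_resCard_sub_lt_one hz.le
    have h2 : z ^ resCard F D - z = (z ^ (resCard F D - 1) - 1) * z := by
      rw [sub_mul, ← pow_succ, Nat.sub_add_cancel (by omega), one_mul]
    rwa [h2, map_mul, hz, mul_one] at h1

theorem ramIdx_self : ramIdx F F = 1 := by
  obtain ⟨x, hx⟩ := divVal_surjective F F (WithZero.exp (-1))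
  have h := divVal_algebraMap (F := F) (D := F) x
  rw [Algebra.algebraMap_self, RingHom.id_apply, hx] at h
  have hx0 : baseVal F x ≠ 0 := fun h0 => by
    rw [h0, zero_pow (ramIdx_pos (F := F) (D := F)).ne'] at h
    exact WithZero.exp_ne_zero h
  obtain ⟨m, hm⟩ := exists_eq_exp hx0
  rw [hm, ← WithZero.exp_nsmul, WithZero.exp_inj, nsmul_eq_mul] at h
  have h1 : (ramIdx F F : ℤ) ∣ 1 := ⟨-m, by rw [mul_neg, ← h]; norm_num⟩
  exact Nat.dvd_one.mp (by exact_mod_cast h1)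

theorem resCard_self : resCard F F = baseCard F := by
  have := resCard_pow_ramIdx (F := F) (D := F)
  rwa [ramIdx_self, Module.finrank_self, pow_one, pow_one] at this

end RootsOfUnity

section Structure

variable {F : Type*} [Field F] [ValuativeRel F] [TopologicalSpace F]
  [IsNonarchimedeanLocalField F] {D : Type*} [DivisionRing D] [Algebra F D]
  [FiniteDimensional F D]

/-- A subalgebra that contains representatives of the residue field and a uniformizer is the whole
algebra. -/
theorem subalgebra_eq_top {z ϖ : D}
    (hz : ∀ x, divVal F D x = 1 → ∃ i : ℕ, divVal F D (x - z ^ i) < 1)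
    (hϖ : divVal F D ϖ = WithZero.exp (-1)) (S : Subalgebra F D) (hzS : z ∈ S) (hϖS : ϖ ∈ S) :
    S = ⊤ := by
  have hϖ0 : ϖ ≠ 0 := fun h => by rw [h, map_zero] at hϖ; exact WithZero.exp_ne_zero hϖ.symm
  -- digit expansions
  have hdig (x : D) (hx : divVal F D x ≤ 1) (j : ℕ) :
      ∃ s ∈ S, divVal F D (x - s) ≤ WithZero.exp (-(j : ℤ)) := by
    induction j with
    | zero => exact ⟨0, S.zero_mem, by simpa using hx⟩
    | succ j ih =>
      obtain ⟨s, hs, h⟩ := ih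
      have hy : divVal F D ((x - s) * (ϖ ^ j)⁻¹) ≤ 1 := by
        rw [map_mul, map_inv₀, map_pow, hϖ, ← WithZero.exp_nsmul, ← WithZero.exp_neg]
        refine (mul_le_mul_left h _).trans ?_
        rw [← WithZero.exp_add]; simp
      obtain ⟨d, hd, hlt⟩ : ∃ d ∈ S, divVal F D ((x - s) * (ϖ ^ j)⁻¹ - d) < 1 := by
        rcases hy.eq_or_lt with h1 | h1
        · obtain ⟨i, hi⟩ := hz _ h1
          exact ⟨z ^ i, S.pow_mem hzS i, hi⟩
        · exact ⟨0, S.zero_mem, by rwa [sub_zero]⟩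
      refine ⟨s + d * ϖ ^ j, S.add_mem hs (S.mul_mem hd (S.pow_mem hϖS j)), ?_⟩
      have h2 : x - (s + d * ϖ ^ j) = ((x - s) * (ϖ ^ j)⁻¹ - d) * ϖ ^ j := by
        rw [sub_mul, mul_assoc, inv_mul_cancel₀ (pow_ne_zero j hϖ0), mul_one]; abel
      rw [lt_one_iff] at hlt
      rw [h2, map_mul, map_pow, hϖ, ← WithZero.exp_nsmul]
      refine (mul_le_mul_left hlt _).trans ?_
      rw [← WithZero.exp_add, WithZero.exp_le_exp, nsmul_eq_mul]
      push_cast; omega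
  -- Nakayama, over the integers of `F`
  let N : Submodule 𝒪[F] D := (Subalgebra.toSubmodule S).restrictScalars 𝒪[F]
  have hle : intLattice F D ≤ N := by
    refine Submodule.le_of_le_smul_of_le_jacobson_bot (I := 𝓂[F]) (intLattice_fg F D)
      (IsLocalRing.maximalIdeal_le_jacobson _) fun x hx => ?_
    obtain ⟨s, hs, h⟩ := hdig x hx (ramIdx F D)
    rw [← add_sub_cancel s x]
    refine add_mem (Submodule.mem_sup_left hs) (Submodule.mem_sup_right ?_)
    have hb : (⟨baseUnif F, baseUnif_mem⟩ : 𝒪[F]) ∈ 𝓂[F] := by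
      rw [IsLocalRing.mem_maximalIdeal, mem_nonunits_iff]
      rintro ⟨u, hu⟩
      have h1 : baseVal F ((u : 𝒪[F]) : F) * baseVal F (((u⁻¹ : 𝒪[F]ˣ) : 𝒪[F]) : F) = 1 := by
        rw [← map_mul, ← MulMemClass.coe_mul, Units.mul_inv]; simp
      rw [hu, baseVal_baseUnif] at h1
      have h2 := (mem_integers_iff _).mp ((u⁻¹ : 𝒪[F]ˣ) : 𝒪[F]).2
      have h3 : (WithZero.exp (-1) : ℤᵐ⁰) * baseVal F (((u⁻¹ : 𝒪[F]ˣ) : 𝒪[F]) : F) < 1 :=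
        mul_lt_one_of_lt_one_of_le_one (lt_one_iff.mpr le_rfl) h2
      exact h3.ne h1
    have hw : x - s = (⟨baseUnif F, baseUnif_mem⟩ : 𝒪[F]) • ((baseUnif F)⁻¹ • (x - s)) := by
      change _ = baseUnif F • ((baseUnif F)⁻¹ • (x - s))
      rw [smul_smul, mul_inv_cancel₀ baseUnif_ne_zero, one_smul]
    rw [hw]
    refine Submodule.smul_mem_smul hb ?_
    rw [mem_intLattice, Algebra.smul_def, map_mul, map_inv₀, map_inv₀, divVal_algebraMap_baseUnif,
      ← WithZero.exp_neg, neg_neg]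
    refine (mul_le_mul_right h _).trans ?_
    rw [← WithZero.exp_add]; simp
  rw [eq_top_iff]
  intro x _
  obtain ⟨n, hn⟩ := exists_pow_mul_le_one (F := F) x
  have h1 : algebraMap F D (baseUnif F ^ n) * x ∈ S := hle hn
  have h2 : x = (baseUnif F ^ n)⁻¹ • (algebraMap F D (baseUnif F ^ n) * x) := by
    rw [← Algebra.smul_def, smul_smul, inv_mul_cancel₀ (pow_ne_zero n baseUnif_ne_zero), one_smul]
  rw [h2]
  exact S.smul_mem h1 _

/-- Conjugation by a uniformizer acts on the residue field by a power of the Frobenius. -/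
theorem exists_conj_frobenius {ϖ : D} (hϖ : ϖ ≠ 0) : ∃ b : ℕ, ∀ x, divVal F D x ≤ 1 →
    divVal F D (ϖ * x * ϖ⁻¹ - x ^ resChar F ^ b) < 1 := by
  let := resField F D
  have := finite_resField (F := F) (D := D)
  have : Fact (resChar F).Prime := ⟨resChar_prime⟩
  have hval (x : D) : divVal F D (ϖ * x * ϖ⁻¹) = divVal F D x := by
    rw [map_mul, map_mul, map_inv₀, mul_comm (divVal F D ϖ), mul_assoc,
      mul_inv_cancel₀ (by simpa using hϖ), mul_one]
  have hchar : CharP (ResField F D) (resChar F) := by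
    refine ringChar.of_eq (CharP.ringChar_of_prime_eq_zero resChar_prime ?_)
    have h1 : Ideal.Quotient.mk (maxIdeal (maxCompactSubring F D))
        (resChar F : maxCompactSubring F D) = Ideal.Quotient.mk _ 0 := by
      rw [residue_mk_eq_iff mem_maxCompactSubring_iff]
      simpa using divVal_resChar_lt_one F D
    rw [map_natCast, map_zero] at h1
    exact h1
  let c : maxCompactSubring F D →+* maxCompactSubring F D :=
    { toFun := fun x => ⟨ϖ * x * ϖ⁻¹, by
        rw [mem_maxCompactSubring_iff, hval]; exact (mem_maxCompactSubring_iff _).mp x.2⟩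
      map_one' := Subtype.ext (by simp [hϖ])
      map_zero' := Subtype.ext (by simp)
      map_add' := fun x y => Subtype.ext (by simp [mul_add, add_mul])
      map_mul' := fun x y => Subtype.ext (by
        change ϖ * (x * y : D) * ϖ⁻¹ = ϖ * x * ϖ⁻¹ * (ϖ * y * ϖ⁻¹)
        simp only [mul_assoc, inv_mul_cancel_left₀ hϖ]) }
  let σ : ResField F D →+* ResField F D :=
    Ideal.quotientMap (maxIdeal (maxCompactSubring F D)) c (by
      intro x hx
      rw [mem_maxIdeal_maxCompactSubring_iff] at hx
      rw [Ideal.mem_comap, mem_maxIdeal_maxCompactSubring_iff]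
      change divVal F D (ϖ * x * ϖ⁻¹) < 1
      rwa [hval])
  obtain ⟨b, hb⟩ := exists_eq_frobenius_pow (p := resChar F) σ
  refine ⟨b, fun x hx => ?_⟩
  let xO : maxCompactSubring F D := ⟨x, (mem_maxCompactSubring_iff _).mpr hx⟩
  refine (residue_mk_eq_iff mem_maxCompactSubring_iff (c xO) (xO ^ resChar F ^ b)).mp ?_
  have h1 := hb (Ideal.Quotient.mk _ xO)
  rw [map_pow]
  exact h1

/-- A uniformizer that normalizes the group of Teichmüller representatives, obtained by
averaging. -/
theorem exists_normalizing_uniformizer {z : D} (hz : orderOf z = resCard F D - 1) :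
    ∃ (ϖ : D) (b : ℕ), divVal F D ϖ = WithZero.exp (-1) ∧ ϖ * z = z ^ resChar F ^ b * ϖ := by
  obtain ⟨b, hb⟩ := exists_conj_frobenius (F := F) (divUnif_ne_zero F D)
  let ϖ₀ := divUnif F D
  let N := resCard F D - 1
  have hq := one_lt_resCard (F := F) (D := D)
  have hN0 : N ≠ 0 := by change resCard F D - 1 ≠ 0; omega
  have hzN : z ^ N = 1 := by change z ^ (resCard F D - 1) = 1; rw [← hz, pow_orderOf_eq_one]
  have hz1 := divVal_eq_one_of_pow_eq_one (F := F) hN0 hzN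
  have hz0 : z ≠ 0 := fun h => by rw [h, map_zero] at hz1; exact zero_ne_one hz1
  have hNv : divVal F D (N : D) = 1 := by
    refine divVal_natCast_eq_one ?_
    rw [← Nat.cast_add_one]
    change divVal F D ((resCard F D - 1 + 1 : ℕ) : D) < 1
    rw [Nat.sub_add_cancel (by omega)]
    exact divVal_resCard_lt_one
  let y := z ^ resChar F ^ b
  have hy0 : y ≠ 0 := pow_ne_zero _ hz0
  have hyN : y ^ N = 1 := by
    change (z ^ resChar F ^ b) ^ N = 1
    rw [← pow_mul, mul_comm, pow_mul, hzN, one_pow]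
  -- each `f i` is congruent to `ϖ₀` modulo higher terms, and there are `N` of them, with `N` a unit
  let f : ℕ → D := fun i => (y ^ i)⁻¹ * ϖ₀ * z ^ i
  have hf (i) : y * f (i + 1) = f i * z := by
    change y * ((y ^ (i + 1))⁻¹ * ϖ₀ * z ^ (i + 1)) = (y ^ i)⁻¹ * ϖ₀ * z ^ i * z
    rw [pow_succ y, mul_inv_rev, pow_succ z]
    simp only [mul_assoc]
    rw [mul_inv_cancel_left₀ hy0]
  have hcyc : ∑ i ∈ Finset.range N, f (i + 1) = ∑ i ∈ Finset.range N, f i := by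
    have h1 := Finset.sum_range_succ' f N
    have h2 := Finset.sum_range_succ f N
    have h3 : f N = f 0 := by
      change (y ^ N)⁻¹ * ϖ₀ * z ^ N = (y ^ 0)⁻¹ * ϖ₀ * z ^ 0
      rw [hyN, hzN, pow_zero, pow_zero]
    rw [h3, h1] at h2
    exact add_right_cancel h2
  refine ⟨∑ i ∈ Finset.range N, f i, b, ?_, ?_⟩
  · have hsmall (i) : divVal F D (f i - ϖ₀) < WithZero.exp (-1) := by
      have h1 : f i - ϖ₀ = (y ^ i)⁻¹ * (ϖ₀ * z ^ i * ϖ₀⁻¹ - (z ^ i) ^ resChar F ^ b) * ϖ₀ := by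
        have h2 : (z ^ i) ^ resChar F ^ b = y ^ i := by
          change _ = (z ^ resChar F ^ b) ^ i
          rw [← pow_mul, ← pow_mul, mul_comm]
        rw [h2, mul_sub, inv_mul_cancel₀ (pow_ne_zero i hy0), sub_mul, one_mul]
        simp only [mul_assoc]
        rw [inv_mul_cancel₀ (divUnif_ne_zero F D), mul_one]
        simp only [f, mul_assoc]
      have h3 : divVal F D (y ^ i)⁻¹ = 1 := by
        change divVal F D ((z ^ resChar F ^ b) ^ i)⁻¹ = 1
        rw [map_inv₀, map_pow, map_pow, hz1, one_pow, one_pow, inv_one]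
      have h4 := hb (z ^ i) (by rw [map_pow, hz1, one_pow])
      rw [h1, map_mul, map_mul, h3, one_mul]
      change _ * divVal F D (divUnif F D) < _
      rw [divVal_divUnif]
      calc _ < 1 * WithZero.exp (-1) := (mul_lt_mul_iff_left₀ (by simp)).mpr h4
        _ = _ := one_mul _
    have h1 : ∑ i ∈ Finset.range N, f i =
        ∑ i ∈ Finset.range N, (f i - ϖ₀) + (N : D) * ϖ₀ := by
      rw [Finset.sum_sub_distrib, Finset.sum_const, Finset.card_range, nsmul_eq_mul,
        sub_add_cancel]
    have h2 : divVal F D ((N : D) * ϖ₀) = WithZero.exp (-1) := by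
      rw [map_mul, hNv, one_mul]; exact divVal_divUnif F D
    have h3 : divVal F D (∑ i ∈ Finset.range N, (f i - ϖ₀)) < WithZero.exp (-1) :=
      (divVal F D).map_sum_lt (by simp) fun i _ => hsmall i
    rw [h1, Valuation.map_add_eq_of_lt_right _ (by rw [h2]; exact h3), h2]
  · rw [Finset.sum_mul, ← Finset.sum_congr rfl fun i _ => hf i, ← Finset.mul_sum, hcyc]

theorem pow_mul_of_mul_eq {z ϖ : D} {c : ℕ} (h : ϖ * z = z ^ c * ϖ) (i : ℕ) :
    ϖ * z ^ i = (z ^ i) ^ c * ϖ := by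
  induction i with
  | zero => simp
  | succ i ih =>
    rw [pow_succ, ← mul_assoc, ih, mul_assoc, h, ← mul_assoc, ((Commute.refl z).pow_left i).mul_pow]

theorem pow_conj {z ϖ : D} {c : ℕ} (h : ϖ * z = z ^ c * ϖ) (i : ℕ) :
    ϖ ^ i * z = z ^ c ^ i * ϖ ^ i := by
  induction i with
  | zero => simp
  | succ i ih =>
    rw [pow_succ', mul_assoc, ih, ← mul_assoc, pow_mul_of_mul_eq h, ← pow_mul, ← pow_succ,
      mul_assoc]

end Structure

/-! ### The structure of central division algebras -/

section CentralDivisionAlgebra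

variable {F : Type*} [Field F] [ValuativeRel F] [TopologicalSpace F]
  [IsNonarchimedeanLocalField F] {D : Type*} [DivisionRing D] [Algebra F D]
  [FiniteDimensional F D]

variable (F D) in
theorem exists_resCard_exponent : ∃ k : ℕ, k ≠ 0 ∧ resCard F D = resChar F ^ k := by
  obtain ⟨k, hk⟩ := exists_resCard_eq_resChar_pow F D
  refine ⟨k, ?_, hk⟩
  rintro rfl
  have := one_lt_resCard (F := F) (D := D)
  rw [hk, pow_zero] at this
  exact lt_irrefl _ this

theorem divVal_orderOf {z : D} {k : ℕ} (hk : k ≠ 0) (hz : orderOf z = resChar F ^ k - 1) :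
    divVal F D (orderOf z : D) = 1 := by
  rw [hz]; exact divVal_resChar_pow_sub_one F D hk

theorem orderOf_algebraMap_eq {F D : Type*} [Field F] [Ring D] [Nontrivial D] [Algebra F D] (y : F) :
    orderOf (algebraMap F D y) = orderOf y :=
  orderOf_injective (algebraMap F D).toMonoidHom (algebraMap F D).injective y

theorem pow_eq_self_of_orderOf_dvd {M : Type*} [Monoid M] {z : M} {n : ℕ} (hn : 0 < n)
    (h : orderOf z ∣ n - 1) : z ^ n = z := by
  obtain ⟨m, rfl⟩ : ∃ m, n = m + 1 := ⟨n - 1, by omega⟩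
  rw [Nat.add_sub_cancel] at h
  rw [pow_succ, orderOf_dvd_iff_pow_eq_one.mp h, one_mul]

theorem orderOf_dvd_of_pow_eq_self {z : D} (hz : z ≠ 0) {n : ℕ} (hn : 0 < n) (h : z ^ n = z) :
    orderOf z ∣ n - 1 := by
  obtain ⟨m, rfl⟩ : ∃ m, n = m + 1 := ⟨n - 1, by omega⟩
  refine orderOf_dvd_of_pow_eq_one (mul_right_cancel₀ hz ?_)
  rw [Nat.add_sub_cancel, ← pow_succ, h, one_mul]

variable (F D) in
/-- The structure of a central division algebra of degree `d` over a local field: it is generated by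
a root of unity `z` whose residue generates the residue field, of degree `d`, and by a uniformizer
that normalizes `⟨z⟩` and acts on it by a generator of the Galois group of the residue field. -/
theorem exists_cyclic_presentation [Algebra.IsCentral F D] {d : ℕ}
    (hd : Module.finrank F D = d ^ 2) :
    ∃ (k₀ b : ℕ) (z ϖ : D), k₀ ≠ 0 ∧ resCard F F = resChar F ^ k₀ ∧
      resCard F D = resChar F ^ (k₀ * d) ∧ Nat.gcd b (k₀ * d) = k₀ ∧
      orderOf z = resChar F ^ (k₀ * d) - 1 ∧ divVal F D ϖ = WithZero.exp (-1) ∧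
      ϖ * z = z ^ resChar F ^ b * ϖ ∧
      ∀ S : Subalgebra F D, z ∈ S → ϖ ∈ S → S = ⊤ := by
  let p := resChar F
  have hp : p.Prime := resChar_prime
  have hp1 : 1 < p := hp.one_lt
  have hpos (n : ℕ) : 0 < p ^ n := pow_pos hp.pos n
  obtain ⟨k₀, hk₀, hF⟩ := exists_resCard_exponent F F
  obtain ⟨k, hk, hD⟩ := exists_resCard_exponent F D
  obtain ⟨z, hz, hzgen⟩ := exists_teichmuller_generator F D
  obtain ⟨ϖ, b, hϖ, hconj⟩ := exists_normalizing_uniformizer hz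
  have htop := subalgebra_eq_top hzgen hϖ
  have hϖ0 : ϖ ≠ 0 := fun h => by rw [h, map_zero] at hϖ; exact WithZero.exp_ne_zero hϖ.symm
  rw [hD] at hz
  have hzn : p ^ k - 1 ≠ 0 := by
    have := Nat.one_lt_pow hk hp1
    omega
  have hz1 : divVal F D z = 1 := divVal_eq_one_of_pow_eq_one hzn (hz ▸ pow_orderOf_eq_one z)
  have hz0 : z ≠ 0 := fun h => by rw [h, map_zero] at hz1; exact zero_ne_one hz1
  -- an element that commutes with the two generators is central
  have hcent (x : D) (h1 : Commute x z) (h2 : Commute x ϖ) : ∃ y : F, algebraMap F D y = x := by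
    have h3 := htop (Subalgebra.centralizer F {x})
      (Subalgebra.mem_centralizer_iff F |>.mpr fun g hg => by
        rw [Set.mem_singleton_iff.mp hg]; exact h1)
      (Subalgebra.mem_centralizer_iff F |>.mpr fun g hg => by
        rw [Set.mem_singleton_iff.mp hg]; exact h2)
    have h4 : x ∈ Subalgebra.center F D := by
      rw [Subalgebra.mem_center_iff]
      intro y
      have : y ∈ Subalgebra.centralizer F {x} := h3 ▸ Algebra.mem_top
      exact ((Subalgebra.mem_centralizer_iff F).mp this x rfl).symm
    rw [Algebra.IsCentral.center_eq_bot] at h4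
    exact Algebra.mem_bot.mp h4
  have hteich (i : ℕ) : (z ^ i) ^ resCard F D = z ^ i := by
    have h : z ^ resCard F D = z :=
      pow_eq_self_of_orderOf_dvd (hD ▸ hpos k) (by rw [hz, hD])
    rw [← pow_mul, mul_comm, pow_mul, h]
  -- the residue field of `F` embeds into that of `D`, and is fixed by the conjugation
  obtain ⟨zF, hzF, -⟩ := exists_teichmuller_generator F F
  rw [hF] at hzF
  have hw : orderOf (algebraMap F D zF) = p ^ k₀ - 1 := by rw [orderOf_algebraMap_eq, hzF]
  have hwdvd := orderOf_dvd_resCard_sub_one (divVal_orderOf hk₀ hw)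
  have hk₀k : k₀ ∣ k := by
    rw [hw, hD] at hwdvd
    exact dvd_of_pow_sub_one_dvd hp1 hwdvd
  have hk₀b : k₀ ∣ b := by
    have hn : p ^ k₀ - 1 ≠ 0 := by
      have := Nat.one_lt_pow hk₀ hp1
      omega
    have h1 : divVal F D (algebraMap F D zF) = 1 :=
      divVal_eq_one_of_pow_eq_one hn (hw ▸ pow_orderOf_eq_one _)
    obtain ⟨i, hi⟩ := hzgen _ h1
    have h2 : algebraMap F D zF = z ^ i :=
      eq_of_divVal_sub_lt_one (Algebra.commutes zF _)
        (pow_eq_self_of_orderOf_dvd (hD ▸ hpos k) hwdvd) (hteich i) hi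
    have h3 := pow_mul_of_mul_eq hconj i
    rw [← h2, ← Algebra.commutes] at h3
    refine dvd_of_pow_sub_one_dvd hp1 (hw ▸ orderOf_dvd_of_pow_eq_self ?_ (hpos b)
      (mul_right_cancel₀ hϖ0 h3).symm)
    intro h0
    rw [h0, map_zero] at h1
    exact zero_ne_one h1
  -- the fixed field of the conjugation is the residue field of `F`
  have hg : Nat.gcd b k = k₀ := by
    refine Nat.dvd_antisymm ?_ (Nat.dvd_gcd hk₀b hk₀k)
    have hg0 : Nat.gcd b k ≠ 0 := fun h => hk (Nat.gcd_eq_zero_iff.mp h).2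
    obtain ⟨c, hc⟩ := pow_sub_one_dvd (p := p) (Nat.gcd_dvd_right b k)
    have hc0 : c ≠ 0 := by rintro rfl; rw [mul_zero] at hc; exact hzn hc
    have hξ : orderOf (z ^ c) = p ^ Nat.gcd b k - 1 := by
      rw [orderOf_pow_of_dvd hc0 (by rw [hz]; exact ⟨_, by rw [mul_comm]; exact hc⟩), hz]
      change (p ^ k - 1) / c = _
      rw [hc, Nat.mul_div_cancel _ (Nat.pos_of_ne_zero hc0)]
    have hfix : (z ^ c) ^ p ^ b = z ^ c :=
      pow_eq_self_of_orderOf_dvd (hpos b) (by rw [hξ]; exact pow_sub_one_dvd (Nat.gcd_dvd_left b k))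
    obtain ⟨y, hy⟩ := hcent (z ^ c) ((Commute.refl z).pow_left c) (by
      have := pow_mul_of_mul_eq hconj c
      rw [hfix] at this
      exact this.symm)
    have hy1 : orderOf y = p ^ Nat.gcd b k - 1 := by rw [← hξ, ← hy, orderOf_algebraMap_eq]
    have := orderOf_dvd_resCard_sub_one (divVal_orderOf hg0 hy1)
    rw [hy1, hF] at this
    exact dvd_of_pow_sub_one_dvd hp1 this
  obtain ⟨o, rfl⟩ := hk₀k
  obtain ⟨b', rfl⟩ := hk₀b
  have hcop : Nat.Coprime b' o := by
    rw [Nat.gcd_mul_left] at hg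
    exact Nat.eq_of_mul_eq_mul_left (Nat.pos_of_ne_zero hk₀) (by rw [hg, mul_one])
  have ho0 : o ≠ 0 := fun h => hk (by rw [h, mul_zero])
  have hconjpow (i : ℕ) : ϖ ^ i * z = z ^ p ^ (k₀ * b' * i) * ϖ ^ i := by
    rw [pow_conj hconj, ← pow_mul]
  -- `ϖ ^ o` is central, so the ramification index divides `o`
  have heo : ramIdx F D ∣ o := by
    obtain ⟨y, hy⟩ := hcent (ϖ ^ o) (by
      have := hconjpow o
      rw [pow_eq_self_of_orderOf_dvd (hpos _) (by
        rw [hz]; exact pow_sub_one_dvd ⟨b', by ring⟩)] at this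
      exact this) ((Commute.refl ϖ).pow_left o)
    have h1 := divVal_algebraMap (D := D) y
    rw [hy, map_pow, hϖ, ← WithZero.exp_nsmul] at h1
    have hy0 : baseVal F y ≠ 0 := fun h0 => by
      rw [h0, zero_pow (ramIdx_pos (F := F) (D := D)).ne'] at h1
      exact WithZero.exp_ne_zero h1
    obtain ⟨m, hm⟩ := exists_eq_exp hy0
    rw [hm, ← WithZero.exp_nsmul, WithZero.exp_inj, nsmul_eq_mul, nsmul_eq_mul] at h1
    have h2 : (ramIdx F D : ℤ) ∣ o := ⟨-m, by rw [mul_neg, ← h1]; ring⟩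
    exact_mod_cast h2
  -- the uniformizer of `F` is central, so `ϖ ^ e` acts trivially on the residue field
  have hoe : o ∣ ramIdx F D := by
    let e := ramIdx F D
    let u := ϖ ^ e * (algebraMap F D (baseUnif F))⁻¹
    have hu : divVal F D u = 1 := by
      rw [map_mul, map_inv₀, divVal_algebraMap_baseUnif, map_pow, hϖ, ← WithZero.exp_nsmul,
        ← WithZero.exp_neg, ← WithZero.exp_add, nsmul_eq_mul]
      simp [e]
    have h1 : u * z - z * u = (z ^ p ^ (k₀ * b' * e) - z) * u := by
      have h2 : u * z = z ^ p ^ (k₀ * b' * e) * u := by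
        change ϖ ^ e * (algebraMap F D (baseUnif F))⁻¹ * z = _ * (ϖ ^ e * _)
        rw [← map_inv₀, mul_assoc, Algebra.commutes, ← mul_assoc, hconjpow, mul_assoc]
      rw [h2, sub_mul]
    have h2 := divVal_commutator_lt_one hu.le hz1.le
    rw [h1, map_mul, hu, mul_one] at h2
    have h3 : z ^ p ^ (k₀ * b' * e) = z :=
      eq_of_divVal_sub_lt_one ((Commute.refl z).pow_left _) (hteich _)
        (by simpa using hteich 1) h2
    have h4 := dvd_of_pow_sub_one_dvd hp1 (hz ▸ orderOf_dvd_of_pow_eq_self hz0 (hpos _) h3)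
    rw [mul_assoc] at h4
    exact hcop.symm.dvd_of_dvd_mul_left
      (Nat.dvd_of_mul_dvd_mul_left (Nat.pos_of_ne_zero hk₀) h4)
  have he := Nat.dvd_antisymm heo hoe
  have hod : o = d := by
    have h1 := resCard_pow_ramIdx (F := F) (D := D)
    rw [← resCard_self, hF, hD, hd, he, ← pow_mul, ← pow_mul] at h1
    have h2 := Nat.pow_right_injective hp1 h1
    have h3 : o ^ 2 = d ^ 2 := by
      refine Nat.eq_of_mul_eq_mul_left (Nat.pos_of_ne_zero hk₀) ?_
      rw [← h2]; ring
    exact Nat.pow_left_injective two_ne_zero h3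
  subst hod
  exact ⟨k₀, k₀ * b', z, ϖ, hk₀, hF, hD, hg, hz, hϖ, hconj, htop⟩

variable (F) in
/-- The residue field of an unramified extension of degree `l` has degree `l`. -/
theorem resCard_eq_pow_finrank (L : Type*) [Field L] [Algebra F L] [FiniteDimensional F L]
    (hL : ramIdx F L = 1) {k₀ : ℕ} (hk : resCard F F = resChar F ^ k₀) :
    resCard F L = resChar F ^ (k₀ * Module.finrank F L) := by
  have h1 := resCard_pow_ramIdx (F := F) (D := L)
  rw [hL, pow_one, ← resCard_self, hk, ← pow_mul] at h1
  exact h1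

end CentralDivisionAlgebra

/-! ### Spectral idempotents and finite rings -/

section SpectralIdempotents

variable {K R : Type*} [Field K] [Ring R] [Algebra K R]

/-- The projection onto the eigenspace of `X` for the eigenvalue `a`, when `X ^ M = 1`. -/
def eigenIdem (M : ℕ) (X : R) (a : K) : R :=
  (M : K)⁻¹ • ∑ k ∈ Finset.range M, (a⁻¹ • X) ^ k

variable {M : ℕ} {X : R} {a b : K}

theorem mul_eigenIdem (ha : a ^ M = 1) (ha0 : a ≠ 0) (hX : X ^ M = 1) :
    X * eigenIdem M X a = a • eigenIdem M X a := by
  have h := mul_geom_sum (a⁻¹ • X) M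
  rw [smul_pow, hX, inv_pow, ha, inv_one, one_smul, sub_self, sub_mul, one_mul, sub_eq_zero] at h
  rw [eigenIdem, mul_smul_comm, smul_comm a]
  nth_rewrite 2 [← h]
  rw [smul_mul_assoc, smul_inv_smul₀ ha0]

theorem commute_eigenIdem {y : R} (h : Commute X y) : Commute (eigenIdem M X a) y := by
  refine Commute.smul_left (Commute.sum_left _ _ _ fun k _ => ?_) _
  exact (h.smul_left _).pow_left _

theorem inv_smul_pow_mul {y : R} (h : X * y = b • y) (k : ℕ) :
    (a⁻¹ • X) ^ k * y = (a⁻¹ * b) ^ k • y := by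
  induction k with
  | zero => simp
  | succ k ih =>
    rw [pow_succ, mul_assoc, smul_mul_assoc, h, smul_smul, mul_smul_comm, ih, smul_smul, ← pow_succ']

theorem eigenIdem_mul_of_mul_eq_smul (hM : (M : K) ≠ 0) (ha0 : a ≠ 0) {y : R}
    (h : X * y = a • y) : eigenIdem M X a * y = y := by
  rw [eigenIdem, smul_mul_assoc, Finset.sum_mul,
    Finset.sum_congr rfl fun k _ => inv_smul_pow_mul h k, ← Finset.sum_smul, smul_smul,
    inv_mul_cancel₀ ha0]
  simp [inv_mul_cancel₀ hM]

theorem eigenIdem_mul_eq_zero (ha : a ^ M = 1) (ha0 : a ≠ 0) (hb : b ^ M = 1) (hba : b ≠ a)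
    {y : R} (h : X * y = b • y) : eigenIdem M X a * y = 0 := by
  rw [eigenIdem, smul_mul_assoc, Finset.sum_mul,
    Finset.sum_congr rfl fun k _ => inv_smul_pow_mul h k, ← Finset.sum_smul, smul_smul]
  have h2 := mul_geom_sum (a⁻¹ * b) M
  rw [mul_pow, hb, inv_pow, ha, inv_one, one_mul, sub_self] at h2
  have h3 : a⁻¹ * b - 1 ≠ 0 := by
    rw [sub_ne_zero]
    intro h3
    exact hba (by rw [← mul_one a, ← h3, mul_inv_cancel_left₀ ha0])
  rw [(mul_eq_zero.mp h2).resolve_left h3, mul_zero, zero_smul]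

/-- The projections onto the eigenspaces sum to `1`. -/
theorem sum_eigenIdem (hM : (M : K) ≠ 0) (ha : IsPrimitiveRoot a M) :
    ∑ j ∈ Finset.range M, eigenIdem M X (a ^ j) = 1 := by
  have hM0 : M ≠ 0 := by rintro rfl; simp at hM
  simp_rw [eigenIdem]
  rw [← Finset.smul_sum, Finset.sum_comm]
  simp_rw [smul_pow]
  rw [Finset.sum_eq_single_of_mem 0 (Finset.mem_range.mpr (Nat.pos_of_ne_zero hM0))]
  · simp [← Nat.cast_smul_eq_nsmul K, smul_smul, hM]
  · intro k hk hk0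
    have h1 : ((a⁻¹) ^ k) ≠ 1 :=
      ha.inv.pow_ne_one_of_pos_of_lt hk0 (Finset.mem_range.mp hk)
    have h2 := mul_geom_sum ((a⁻¹) ^ k) M
    rw [← pow_mul, mul_comm k, pow_mul, ha.inv.pow_eq_one, one_pow, sub_self] at h2
    have h3 := (mul_eq_zero.mp h2).resolve_left (sub_ne_zero.mpr h1)
    rw [← Finset.sum_smul]
    have h4 : ∑ i ∈ Finset.range M, (a ^ i)⁻¹ ^ k = 0 := by
      rw [← h3]
      refine Finset.sum_congr rfl fun i _ => ?_
      rw [← inv_pow, ← pow_mul, ← pow_mul, mul_comm]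
    rw [h4, zero_smul]

theorem exists_eigenIdem_ne_zero [Nontrivial R] (hM : (M : K) ≠ 0) (ha : IsPrimitiveRoot a M) :
    ∃ b : K, b ^ M = 1 ∧ b ≠ 0 ∧ eigenIdem M X b ≠ 0 := by
  by_contra! h
  have hM0 : M ≠ 0 := by rintro rfl; simp at hM
  refine one_ne_zero (α := R) ?_
  rw [← sum_eigenIdem (X := X) hM ha]
  refine Finset.sum_eq_zero fun j _ => h _ ?_ (pow_ne_zero j (ha.ne_zero hM0))
  rw [← pow_mul, mul_comm, pow_mul, ha.pow_eq_one, one_pow]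

/-- Multiplication by `c`, which is invertible modulo `M`, permutes the exponents modulo `M`. -/
theorem sum_pow_mul {S : Type*} [Ring S] {y : S} {M c c' : ℕ} (hM : M ≠ 0) (hy : y ^ M = 1)
    (hc : c * c' ≡ 1 [MOD M]) :
    ∑ k ∈ Finset.range M, y ^ (c * k) = ∑ k ∈ Finset.range M, y ^ k := by
  have hpos := Nat.pos_of_ne_zero hM
  have key (x : ℕ) (hx : x < M) (c c' : ℕ) (h : c * c' ≡ 1 [MOD M]) :
      c * (c' * x % M) % M = x := by
    have h2 : c * (c' * x % M) ≡ x [MOD M] :=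
      ((Nat.mod_modEq _ _).mul_left c).trans (by
        rw [← mul_assoc]
        simpa using h.mul_right x)
    rw [h2, Nat.mod_eq_of_lt hx]
  refine Finset.sum_nbij' (fun k => c * k % M) (fun k => c' * k % M)
    (fun k _ => Finset.mem_range.mpr (Nat.mod_lt _ hpos))
    (fun k _ => Finset.mem_range.mpr (Nat.mod_lt _ hpos))
    (fun k hk => key k (Finset.mem_range.mp hk) c' c (by rwa [mul_comm]))
    (fun k hk => key k (Finset.mem_range.mp hk) c c' hc) (fun k _ => ?_)
  exact pow_eq_pow_mod (c * k) hy

/-- An element that conjugates `X` to `X ^ c` permutes the eigenspaces of `X`. -/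
theorem mul_eigenIdem_pow {c c' : ℕ} (hM : M ≠ 0) (ha : a ^ M = 1) (hX : X ^ M = 1)
    (hc : c * c' ≡ 1 [MOD M]) {y : R} (h : y * X = X ^ c * y) :
    y * eigenIdem M X (a ^ c) = eigenIdem M X a * y := by
  have h1 : (a⁻¹ • X) ^ M = 1 := by rw [smul_pow, hX, inv_pow, ha, inv_one, one_smul]
  have h2 (k : ℕ) : y * ((a ^ c)⁻¹ • X) ^ k = (a⁻¹ • X) ^ (c * k) * y := by
    induction k with
    | zero => simp
    | succ k ih =>
      rw [pow_succ, ← mul_assoc, ih, mul_assoc, mul_smul_comm, h, mul_add, mul_one, pow_add,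
        mul_assoc, smul_pow _ _ c, inv_pow, smul_mul_assoc]
  rw [eigenIdem, eigenIdem, mul_smul_comm, Finset.mul_sum, Finset.sum_congr rfl fun k _ => h2 k,
    ← Finset.sum_mul, sum_pow_mul hM h1 hc, smul_mul_assoc]

end SpectralIdempotents

section FiniteRings

/-- If a finite commutative ring with `Q ^ t` elements has `t` nonzero orthogonal idempotents and no
residue field with fewer than `Q` elements, then each of the idempotents cuts out a domain. -/
theorem mul_eq_zero_of_orthogonal {B : Type*} [CommRing B] [Finite B] {t Q : ℕ} (ε : Fin t → B)
    (h0 : ∀ i, ε i ≠ 0) (hidem : ∀ i, ε i * ε i = ε i) (horth : ∀ i j, i ≠ j → ε i * ε j = 0)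
    (hcard : Nat.card B = Q ^ t) (hQ : ∀ I : Ideal B, I.IsMaximal → Q ≤ Nat.card (B ⧸ I))
    (i : Fin t) {x y : B} (hxy : ε i * (x * y) = 0) : ε i * x = 0 ∨ ε i * y = 0 := by
  have hex (j : Fin t) : ∃ I : Ideal B, I.IsMaximal ∧ 1 - ε j ∈ I := by
    refine exists_max_ideal_of_mem_nonunits (mem_nonunits_iff.mpr fun hu => h0 j ?_)
    refine hu.mul_left_cancel ?_
    rw [sub_mul, one_mul, hidem, sub_self, mul_zero]
  choose I hI hIε using hex
  have hnot (j) : ε j ∉ I j := fun h => (hI j).ne_top ((Ideal.eq_top_iff_one _).mpr (by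
    simpa using add_mem (hIε j) h))
  have hmem (j k) (hjk : j ≠ k) : ε j ∈ I k := by
    have h1 : ε k * ε j ∈ I k := by rw [horth k j hjk.symm]; exact zero_mem _
    exact ((hI k).isPrime.mem_or_mem h1).resolve_left (hnot k)
  have hcop : Pairwise fun j k => IsCoprime (I j) (I k) := fun j k hjk =>
    (Ideal.isCoprime_iff_sup_eq.mpr ((hI j).coprime_of_ne (hI k)
      fun h => hnot j (h ▸ hmem j k hjk)))
  let g : B → ∀ j, B ⧸ I j := fun b j => Ideal.Quotient.mk (I j) b
  have hg : Function.Surjective g := fun z => by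
    obtain ⟨b, hb⟩ := Ideal.pi_quotient_surjective hcop z
    exact ⟨b, funext hb⟩
  have hcard' : Nat.card B ≤ Nat.card (∀ j, B ⧸ I j) := by
    rw [Nat.card_pi, hcard]
    calc Q ^ t = ∏ _j : Fin t, Q := by simp
      _ ≤ _ := Finset.prod_le_prod' fun j _ => hQ _ (hI j)
  have hinj : Function.Injective g :=
    (hg.bijective_of_nat_card_le hcard').injective
  have hzero (b : B) (hb : b ∈ I i) : ε i * b = 0 := by
    refine hinj (funext fun j => ?_)
    change Ideal.Quotient.mk _ _ = Ideal.Quotient.mk _ _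
    rw [map_zero, Ideal.Quotient.eq_zero_iff_mem]
    by_cases hij : i = j
    · subst hij; exact Ideal.mul_mem_left _ _ hb
    · exact Ideal.mul_mem_right _ _ (hmem i j hij)
  have h1 : ε i * (x * y) ∈ I i := by rw [hxy]; exact zero_mem _
  rcases (hI i).isPrime.mem_or_mem (((hI i).isPrime.mem_or_mem h1).resolve_left (hnot i)) with h | h
  · exact Or.inl (hzero x h)
  · exact Or.inr (hzero y h)

end FiniteRings

section ResidueFields

variable {F : Type*} [Field F] [ValuativeRel F] [TopologicalSpace F]
  [IsNonarchimedeanLocalField F] {D : Type*} [DivisionRing D] [Algebra F D]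
  [FiniteDimensional F D]

/-- A finite field that receives a homomorphism from the integers of `D` contains the residue field
of `D`, as far as its cardinality is concerned. -/
theorem dvd_card_sub_one {K : Type*} [Field K] [Finite K] (g : maxCompactSubring F D →+* K)
    {k : ℕ} (hk : k ≠ 0) (hD : resCard F D = resChar F ^ k) :
    resChar F ^ k - 1 ∣ Nat.card K - 1 := by
  obtain ⟨z, hz, -⟩ := exists_teichmuller_generator F D
  rw [hD] at hz
  have hn := Nat.one_lt_pow hk (resChar_prime (F := F)).one_lt
  have hz1 : divVal F D z = 1 :=
    divVal_eq_one_of_pow_eq_one (n := resChar F ^ k - 1) (by omega) (hz ▸ pow_orderOf_eq_one z)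
  let zO : maxCompactSubring F D := ⟨z, (mem_maxCompactSubring_iff _).mpr hz1.le⟩
  have hpow : zO ^ (resChar F ^ k - 1) = 1 := Subtype.ext (by
    change z ^ (resChar F ^ k - 1) = 1
    rw [← hz, pow_orderOf_eq_one])
  have hord : orderOf (g zO) = resChar F ^ k - 1 := by
    refine (orderOf_eq_iff (by omega)).mpr ⟨by rw [← map_pow, hpow, map_one], fun m hm hm0 h => ?_⟩
    -- `z ^ m - 1` is a unit
    have h1 : divVal F D (z ^ m - 1) = 1 := by
      refine le_antisymm ?_ (not_lt.mp fun hlt => ?_)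
      · exact (mem_maxCompactSubring_iff _).mp (zO ^ m - 1).2
      · have h2 : z ^ m = 1 := eq_one_of_pow_eq_one (F := F) (n := orderOf z) (divVal_orderOf hk hz)
          (by rw [← pow_mul, mul_comm, pow_mul, pow_orderOf_eq_one, one_pow]) hlt
        have h3 := Nat.le_of_dvd hm0 (orderOf_dvd_of_pow_eq_one h2)
        omega
    have h2 : z ^ m - 1 ≠ 0 := fun h0 => by rw [h0, map_zero] at h1; exact zero_ne_one h1
    let w : maxCompactSubring F D := ⟨(z ^ m - 1)⁻¹, (mem_maxCompactSubring_iff _).mpr (by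
      rw [map_inv₀, h1, inv_one])⟩
    have h3 : (zO ^ m - 1) * w = 1 := Subtype.ext (mul_inv_cancel₀ h2)
    have h4 := congrArg g h3
    rw [map_mul, map_sub, map_pow, h, map_one, sub_self, zero_mul] at h4
    exact zero_ne_one h4
  have := Fintype.ofFinite K
  rw [← hord, Nat.card_eq_fintype_card]
  refine orderOf_dvd_of_pow_eq_one (FiniteField.pow_card_sub_one_eq_one _ fun h0 => ?_)
  have h5 := congrArg g hpow
  rw [map_pow, h0, map_one, zero_pow (by omega)] at h5
  exact zero_ne_one h5

end ResidueFields

/-! ### Units and residue fields of `O_L ⊗ O_Δ` -/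

section TensorUnits

variable {F : Type*} [Field F] [ValuativeRel F] [TopologicalSpace F]
  [IsNonarchimedeanLocalField F] {L : Type*} [Field L] [Algebra F L] [FiniteDimensional F L]
  {Δ : Type*} [DivisionRing Δ] [Algebra F Δ] [FiniteDimensional F Δ]

variable (F L) in
/-- The unit `1 ⊗ ϖ` of `L ⊗ Δ`. -/
def tensorUnit (ϖ : Δˣ) : (L ⊗[F] Δ)ˣ :=
  Units.map (Algebra.TensorProduct.includeRight : Δ →ₐ[F] L ⊗[F] Δ).toRingHom.toMonoidHom ϖ

theorem coe_tensorUnit_zpow (ϖ : Δˣ) (n : ℤ) :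
    ((tensorUnit F L ϖ ^ n : (L ⊗[F] Δ)ˣ) : L ⊗[F] Δ) = 1 ⊗ₜ ((ϖ ^ n : Δˣ) : Δ) := by
  rw [tensorUnit, ← map_zpow]; rfl

theorem divVal_zpow {ϖ : Δˣ} (hϖ : divVal F Δ ϖ = WithZero.exp (-1)) (n : ℤ) :
    divVal F Δ ((ϖ ^ n : Δˣ) : Δ) = WithZero.exp (-n) := by
  rw [Units.val_zpow_eq_zpow_val, map_zpow₀, hϖ, ← WithZero.exp_zsmul]
  simp

theorem mul_tensorUnit_mem_tball_iff {ϖ : Δˣ} (hϖ : divVal F Δ ϖ = WithZero.exp (-1))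
    {z : L ⊗[F] Δ} (k n m : ℤ) (h : n = m + k) :
    z * ((tensorUnit F L ϖ ^ k : (L ⊗[F] Δ)ˣ) : L ⊗[F] Δ) ∈ tball F L Δ m ↔
      z ∈ tball F L Δ n := by
  rw [coe_tensorUnit_zpow, ← mul_unif_mem_tball_iff (divVal_zpow hϖ k) n, h, add_neg_cancel_right]

theorem tensorUnit_mul_mem_tball_iff {ϖ : Δˣ} (hϖ : divVal F Δ ϖ = WithZero.exp (-1))
    {z : L ⊗[F] Δ} (k n m : ℤ) (h : n = m + k) :
    ((tensorUnit F L ϖ ^ k : (L ⊗[F] Δ)ˣ) : L ⊗[F] Δ) * z ∈ tball F L Δ m ↔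
      z ∈ tball F L Δ n := by
  rw [coe_tensorUnit_zpow, ← unif_mul_mem_tball_iff (divVal_zpow hϖ k) n, h, add_neg_cancel_right]

theorem smul_mem_tball {a : L} (ha : divVal F L a ≤ 1) {z : L ⊗[F] Δ} {n : ℤ}
    (hz : z ∈ tball F L Δ n) : a • z ∈ tball F L Δ n := by
  have h : a • z = (a ⊗ₜ 1) * z := by
    rw [Algebra.smul_def]; rfl
  rw [h, ← zero_add n]
  exact mul_mem_tball (tmul_mem_tball ha (by simp)) hz

theorem eigenIdem_mem_tball {M : ℕ} (hM : divVal F L (M : L) = 1) {X : L ⊗[F] Δ}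
    (hX : X ∈ tball F L Δ 0) {a : L} (ha : divVal F L a = 1) :
    eigenIdem M X a ∈ tball F L Δ 0 := by
  refine smul_mem_tball (by rw [map_inv₀, hM, inv_one]) (sum_mem fun k _ => ?_)
  rw [← mul_zero (k : ℤ)]
  exact pow_mem_tball (smul_mem_tball (by rw [map_inv₀, ha, inv_one]) hX) k

/-- A nonzero idempotent survives in the reduction, as its powers do not tend to zero. -/
theorem notMem_tball_of_idempotent {e : L ⊗[F] Δ} (he : e * e = e) (h0 : e ≠ 0) :
    e ∉ tball F L Δ (-1) := fun h => h0 (eq_zero_of_forall_mem_tball fun n => by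
  rcases Nat.eq_zero_or_pos n with rfl | hn
  · exact tball_mono (by simp) h
  · have h1 := pow_mem_tball h n
    rwa [IsIdempotentElem.pow_eq he hn.ne', mul_neg_one] at h1)

/-- An element of `L ⊗ Δ` that commutes with `Δ` lies in `L`, if `Δ` is central. -/
theorem eq_smul_one_of_commute [Algebra.IsCentral F Δ] {w : L ⊗[F] Δ}
    (h : ∀ y : Δ, Commute w (1 ⊗ₜ y)) : ∃ a : L, w = a • 1 := by
  have h1 (i) : ∃ c : F, algebraMap F Δ c = tcoord F L Δ w i := by
    have h2 : tcoord F L Δ w i ∈ Subalgebra.center F Δ := by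
      rw [Subalgebra.mem_center_iff]
      intro y
      rw [← tcoord_mul_left, ← tcoord_mul_right, (h y).eq]
    rw [Algebra.IsCentral.center_eq_bot] at h2
    exact Algebra.mem_bot.mp h2
  choose c hc using h1
  refine ⟨∑ i, c i • intBasis F L i, ?_⟩
  rw [Algebra.TensorProduct.one_def, TensorProduct.smul_tmul', smul_eq_mul, mul_one,
    TensorProduct.sum_tmul]
  conv_lhs => rw [← sum_tcoord w]
  refine Finset.sum_congr rfl fun i _ => ?_
  rw [← hc, Algebra.algebraMap_eq_smul_one, TensorProduct.tmul_smul, TensorProduct.smul_tmul']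

theorem commute_of_generators {w : L ⊗[F] Δ} {z ϖ : Δ}
    (htop : ∀ S : Subalgebra F Δ, z ∈ S → ϖ ∈ S → S = ⊤) (hz : Commute w (1 ⊗ₜ z))
    (hϖ : Commute w (1 ⊗ₜ ϖ)) (y : Δ) : Commute w (1 ⊗ₜ y) := by
  have h := htop ((Subalgebra.centralizer F {w}).comap
    (Algebra.TensorProduct.includeRight : Δ →ₐ[F] L ⊗[F] Δ))
    (by
      rw [Subalgebra.mem_comap, Subalgebra.mem_centralizer_iff]
      rintro g rfl; exact hz)
    (by
      rw [Subalgebra.mem_comap, Subalgebra.mem_centralizer_iff]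
      rintro g rfl; exact hϖ)
  have hy : y ∈ (Subalgebra.centralizer F {w}).comap
    (Algebra.TensorProduct.includeRight : Δ →ₐ[F] L ⊗[F] Δ) := h ▸ Algebra.mem_top
  rw [Subalgebra.mem_comap, Subalgebra.mem_centralizer_iff] at hy
  exact hy w rfl

/-- The residue fields of `O_L ⊗ O_Δ` contain those of `L` and `Δ`. -/
theorem le_card_residueField {k₀ l d : ℕ} (hk : k₀ ≠ 0) (hl : l ≠ 0) (hd : d ≠ 0)
    (hkL : resCard F L = resChar F ^ (k₀ * l)) (hkD : resCard F Δ = resChar F ^ (k₀ * d))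
    (I : Ideal (TensorResidue F L Δ)) (hI : I.IsMaximal) :
    resChar F ^ (k₀ * Nat.lcm l d) ≤ Nat.card (TensorResidue F L Δ ⧸ I) := by
  have hp : (resChar F).Prime := resChar_prime
  have hcard := card_tensorResidue F L Δ
  rw [hkD, ← pow_mul] at hcard
  have : Finite (TensorResidue F L Δ) :=
    Nat.finite_of_card_ne_zero (by rw [hcard]; exact pow_ne_zero _ hp.ne_zero)
  let := Ideal.Quotient.field I
  have hfin : Finite (TensorResidue F L Δ ⧸ I) :=
    Finite.of_surjective _ Ideal.Quotient.mk_surjective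
  obtain ⟨c, -, hc⟩ := (Nat.dvd_prime_pow hp).mp
    (hcard ▸ AddSubgroup.card_quotient_dvd_card I.toAddSubgroup)
  change Nat.card (TensorResidue F L Δ ⧸ I) = _ at hc
  let gD : maxCompactSubring F Δ →+* TensorResidue F L Δ ⧸ I :=
    ((Ideal.Quotient.mk I).comp (tmk F L Δ)).comp
      ((Algebra.TensorProduct.includeRight : Δ →ₐ[F] L ⊗[F] Δ).toRingHom.restrict _ _ fun x hx =>
        (mem_tensorOrder_iff _).mpr
          (tmul_mem_tball (by simp) (by simpa using (mem_maxCompactSubring_iff _).mp hx)))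
  let gL : maxCompactSubring F L →+* TensorResidue F L Δ ⧸ I :=
    ((Ideal.Quotient.mk I).comp (tmk F L Δ)).comp
      ((Algebra.TensorProduct.includeLeft : L →ₐ[F] L ⊗[F] Δ).toRingHom.restrict _ _ fun x hx =>
        (mem_tensorOrder_iff _).mpr
          (tmul_mem_tball ((mem_maxCompactSubring_iff _).mp hx) (by simp)))
  have hD := dvd_card_sub_one gD (mul_ne_zero hk hd) hkD
  have hL := dvd_card_sub_one gL (mul_ne_zero hk hl) hkL
  rw [hc] at hD hL ⊢
  have h1 : k₀ * Nat.lcm l d ∣ c := by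
    rw [← Nat.lcm_mul_left]
    exact Nat.lcm_dvd (dvd_of_pow_sub_one_dvd hp.one_lt hL) (dvd_of_pow_sub_one_dvd hp.one_lt hD)
  refine Nat.pow_le_pow_right hp.pos (Nat.le_of_dvd (Nat.pos_of_ne_zero ?_) h1)
  rintro rfl
  rw [pow_zero] at hc
  exact absurd hc (Finite.one_lt_card (α := TensorResidue F L Δ ⧸ I)).ne'

end TensorUnits

/-! ### The corner idempotent -/

section CornerIdempotent

variable {F : Type*} [Field F] [ValuativeRel F] [TopologicalSpace F]
  [IsNonarchimedeanLocalField F] {L : Type*} [Field L] [Algebra F L] [FiniteDimensional F L]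
  {Δ : Type*} [DivisionRing Δ] [Algebra F Δ] [FiniteDimensional F Δ]

theorem orderOf_pow_div {K : Type*} [Monoid K] {z : K} {N M : ℕ} (hz : orderOf z = N)
    (hN : N ≠ 0) (hM : M ∣ N) : orderOf (z ^ (N / M)) = M := by
  obtain ⟨c, rfl⟩ := hM
  have hM0 : M ≠ 0 := fun h => hN (by rw [h, zero_mul])
  have hc0 : c ≠ 0 := fun h => hN (by rw [h, mul_zero])
  rw [Nat.mul_div_cancel_left _ (Nat.pos_of_ne_zero hM0),
    orderOf_pow_of_dvd hc0 (hz ▸ Dvd.intro_left M rfl), hz,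
    Nat.mul_div_cancel _ (Nat.pos_of_ne_zero hc0)]

variable (F L) in
/-- The conjugate of `e` by the `n`-th power of `1 ⊗ ϖ`. -/
def conjIdem (ϖ : Δˣ) (e : L ⊗[F] Δ) (n : ℤ) : L ⊗[F] Δ :=
  ((tensorUnit F L ϖ ^ (-n) : (L ⊗[F] Δ)ˣ) : L ⊗[F] Δ) * e *
    ((tensorUnit F L ϖ ^ n : (L ⊗[F] Δ)ˣ) : L ⊗[F] Δ)

theorem conjIdem_add (ϖ : Δˣ) (e : L ⊗[F] Δ) (m n : ℤ) :
    conjIdem F L ϖ e (m + n) = conjIdem F L ϖ (conjIdem F L ϖ e m) n := by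
  rw [conjIdem, conjIdem, conjIdem, neg_add_rev, zpow_add, zpow_add, Units.val_mul, Units.val_mul]
  simp only [mul_assoc]

theorem conjIdem_zero (ϖ : Δˣ) (e : L ⊗[F] Δ) : conjIdem F L ϖ e 0 = e := by
  simp [conjIdem]

theorem conjIdem_eq_of_mul_eq {ϖ : Δˣ} {e e' : L ⊗[F] Δ} {n : ℤ}
    (h : ((tensorUnit F L ϖ ^ n : (L ⊗[F] Δ)ˣ) : L ⊗[F] Δ) * e' =
      e * ((tensorUnit F L ϖ ^ n : (L ⊗[F] Δ)ˣ) : L ⊗[F] Δ)) : conjIdem F L ϖ e n = e' := by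
  rw [conjIdem, mul_assoc, ← h, zpow_neg, Units.inv_mul_cancel_left]

/-- An idempotent whose conjugates under powers of the uniformizer decompose `1` into `t` orthogonal
idempotents, and which cuts out a domain in the reduction of `O_L ⊗ O_Δ`. -/
structure IsCornerIdem (ϖ : Δˣ) (t : ℕ) (e : L ⊗[F] Δ) : Prop where
  mem : e ∈ tball F L Δ 0
  ne_zero : e ≠ 0
  idem : IsIdempotentElem e
  conj_of_dvd : ∀ n : ℤ, (t : ℤ) ∣ n → conjIdem F L ϖ e n = e
  mul_conj : ∀ n : ℤ, ¬ (t : ℤ) ∣ n → e * conjIdem F L ϖ e n = 0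
  sum_conj : ∑ i ∈ Finset.range t, conjIdem F L ϖ e i = 1
  domain : ∀ x ∈ tball F L Δ 0, ∀ y ∈ tball F L Δ 0, e * (x * y) ∈ tball F L Δ (-1) →
    e * x ∈ tball F L Δ (-1) ∨ e * y ∈ tball F L Δ (-1)

variable (F L Δ) in
/-- Let `ω` in `Δ` and `η` in `L` be roots of unity of order `q ^ t - 1`, with `q` the cardinality
of the residue field of `F`. The idempotent `e` projects to an eigenspace of `1 ⊗ ω`, the eigenvalue
being a power of `η`. Conjugation by a normalizing uniformizer permutes the eigenspaces. The sum of
the projections in an orbit commutes with `Δ`, hence it is a scalar, hence it is `1`, which forces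
the orbit to have length `t`. Finally `O_L ⊗ (O_Δ / 𝔓_Δ)` is too small to contain `t` orthogonal
idempotents unless each of them cuts out a domain. -/
theorem exists_isCornerIdem [Algebra.IsCentral F Δ] (hL : ramIdx F L = 1) {d t : ℕ}
    (hd : Module.finrank F Δ = d ^ 2) (ht : t = Nat.gcd (Module.finrank F L) d) :
    ∃ (ϖ : Δˣ) (e : L ⊗[F] Δ), divVal F Δ ϖ = WithZero.exp (-1) ∧ IsCornerIdem ϖ t e := by
  classical
  let p := resChar F
  have hp : p.Prime := resChar_prime
  have hp1 : 1 < p := hp.one_lt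
  have hpos (n : ℕ) : 0 < p ^ n := pow_pos hp.pos n
  let l := Module.finrank F L
  have hl0 : l ≠ 0 := Module.finrank_pos.ne'
  have hd0 : d ≠ 0 := by
    rintro rfl
    exact (Module.finrank_pos (R := F) (M := Δ)).ne' (by rw [hd]; rfl)
  obtain ⟨k₀, b, z, ϖ, hk₀, hkF, hkD, hg, hz, hϖ, hconj, htop⟩ := exists_cyclic_presentation F Δ hd
  have hkL := resCard_eq_pow_finrank F L hL hkF
  change resCard F L = p ^ (k₀ * l) at hkL
  have htl : t ∣ l := ht ▸ Nat.gcd_dvd_left _ _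
  have htd : t ∣ d := ht ▸ Nat.gcd_dvd_right _ _
  have ht0 : t ≠ 0 := fun h => hl0 (Nat.eq_zero_of_zero_dvd (h ▸ htl))
  have hk₀t := mul_ne_zero hk₀ ht0
  obtain ⟨b', rfl⟩ : k₀ ∣ b := hg ▸ Nat.gcd_dvd_left _ _
  have hcop : Nat.Coprime b' d := by
    rw [Nat.gcd_mul_left] at hg
    exact Nat.eq_of_mul_eq_mul_left (Nat.pos_of_ne_zero hk₀) (by rw [hg, mul_one])
  have hsub {n : ℕ} (hn : n ≠ 0) : p ^ n - 1 ≠ 0 := by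
    have := Nat.one_lt_pow hn hp1
    omega
  -- roots of unity of order `M` in `Δ` and in `L`
  let M := p ^ (k₀ * t) - 1
  have hM0 : M ≠ 0 := hsub hk₀t
  let c := p ^ (k₀ * b')
  have hω := orderOf_pow_div hz (hsub (mul_ne_zero hk₀ hd0))
    (pow_sub_one_dvd (p := p) (mul_dvd_mul_left k₀ htd))
  obtain ⟨zL, hzL, -⟩ := exists_teichmuller_generator F L
  rw [hkL] at hzL
  have hη := orderOf_pow_div hzL (hsub (mul_ne_zero hk₀ hl0))
    (pow_sub_one_dvd (p := p) (mul_dvd_mul_left k₀ htl))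
  generalize zL ^ ((p ^ (k₀ * l) - 1) / (p ^ (k₀ * t) - 1)) = η at hη
  have hηM : IsPrimitiveRoot η M := by
    have := IsPrimitiveRoot.orderOf η
    rwa [hη] at this
  have hωconj := pow_mul_of_mul_eq hconj ((resChar F ^ (k₀ * d) - 1) / (p ^ (k₀ * t) - 1))
  have hωz := (Commute.refl z).pow_left ((resChar F ^ (k₀ * d) - 1) / (p ^ (k₀ * t) - 1))
  generalize z ^ ((resChar F ^ (k₀ * d) - 1) / (p ^ (k₀ * t) - 1)) = ω at hω hωconj hωz
  have hωM : ω ^ M = 1 := by rw [← pow_orderOf_eq_one ω, hω]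
  have hω1 := divVal_eq_one_of_pow_eq_one (F := F) hM0 hωM
  have hMv : divVal F L (M : L) = 1 := divVal_resChar_pow_sub_one F L hk₀t
  have hML : (M : L) ≠ 0 := fun h => by rw [h, map_zero] at hMv; exact zero_ne_one hMv
  have hct : M ∣ c ^ t - 1 := by
    change p ^ (k₀ * t) - 1 ∣ (p ^ (k₀ * b')) ^ t - 1
    rw [← pow_mul]
    exact pow_sub_one_dvd ⟨b', by ring⟩
  have hcc : c * c ^ (t - 1) ≡ 1 [MOD M] := by
    rw [← pow_succ', Nat.sub_add_cancel (Nat.one_le_iff_ne_zero.mpr ht0)]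
    exact ((Nat.modEq_iff_dvd' (Nat.one_le_pow _ _ (hpos _))).mpr hct).symm
  let inR : Δ →ₐ[F] L ⊗[F] Δ := Algebra.TensorProduct.includeRight
  let X : L ⊗[F] Δ := inR ω
  have hX : X ^ M = 1 := by
    change inR ω ^ M = 1
    rw [← map_pow, hωM, map_one]
  have hXball : X ∈ tball F L Δ 0 := tmul_mem_tball (by simp) (by simp [hω1])
  have hYX : inR ϖ * X = X ^ c * inR ϖ := by
    change inR ϖ * inR ω = inR ω ^ c * inR ϖ
    rw [← map_pow, ← map_mul, ← map_mul, hωconj]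
  -- an eigenvalue and its orbit
  obtain ⟨a, haM, ha0, hea⟩ := exists_eigenIdem_ne_zero (R := L ⊗[F] Δ) (X := X) hML hηM
  let f : L → L := fun x => x ^ c
  have hf (x : L) (n : ℕ) : f^[n] x = x ^ c ^ n := by
    induction n with
    | zero => simp
    | succ n ih => rw [Function.iterate_succ_apply', ih, pow_succ, pow_mul]
  have hper : Function.IsPeriodicPt f t a := by
    change f^[t] a = a
    rw [hf]
    exact pow_eq_self_of_orderOf_dvd (pow_pos (hpos _) t)
      ((orderOf_dvd_of_pow_eq_one haM).trans hct)
  let s := Function.minimalPeriod f a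
  have hst : s ∣ t := hper.minimalPeriod_dvd
  have hs0 : 0 < s := hper.minimalPeriod_pos (Nat.pos_of_ne_zero ht0)
  let ev : ℕ → L := fun i => f^[i] a
  have hev0 (i) : ev i ≠ 0 := by change f^[i] a ≠ 0; rw [hf]; exact pow_ne_zero _ ha0
  have hevM (i) : ev i ^ M = 1 := by
    change (f^[i] a) ^ M = 1
    rw [hf, ← pow_mul, mul_comm, pow_mul, haM, one_pow]
  have hevs (i) : ev (i + s) = ev i := Function.iterate_add_minimalPeriod_eq
  have hev1 (i) : divVal F L (ev i) = 1 := divVal_eq_one_of_pow_eq_one hM0 (hevM i)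
  let E : ℕ → L ⊗[F] Δ := fun i => eigenIdem M X (ev i)
  have hE1 (i) : X * E i = ev i • E i := mul_eigenIdem (hevM i) (hev0 i) hX
  have hEidem (i) : E i * E i = E i := eigenIdem_mul_of_mul_eq_smul hML (hev0 i) (hE1 i)
  have hEorth (i j) (hij : ev i ≠ ev j) : E i * E j = 0 :=
    eigenIdem_mul_eq_zero (hevM i) (hev0 i) (hevM j) hij.symm (hE1 j)
  have hEs (i) : E (i + s) = E i := by
    change eigenIdem M X (ev (i + s)) = _
    rw [hevs]
  have hEconj (i) : inR ϖ * E (i + 1) = E i * inR ϖ := by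
    have h1 : ev (i + 1) = ev i ^ c := Function.iterate_succ_apply' f i a
    change inR ϖ * eigenIdem M X (ev (i + 1)) = _
    rw [h1]
    exact mul_eigenIdem_pow hM0 (hevM i) hX hcc hYX
  have hevinj (i j) (hi : i < s) (hj : j < s) (h : ev i = ev j) : i = j :=
    Function.iterate_injOn_Iio_minimalPeriod hi hj h
  -- the sum over the orbit is central
  have hsum : ∑ i ∈ Finset.range s, E i = 1 := by
    have hcomm : Commute (∑ i ∈ Finset.range s, E i) (1 ⊗ₜ ϖ) := by
      have h2 : ∑ i ∈ Finset.range s, E (i + 1) = ∑ i ∈ Finset.range s, E i := by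
        have h3 := Finset.sum_range_succ' E s
        have h4 := Finset.sum_range_succ E s
        have h5 : E s = E 0 := by simpa using hEs 0
        rw [h3, h5] at h4
        exact add_right_cancel h4
      change _ * inR ϖ = inR ϖ * _
      rw [Finset.sum_mul]
      conv_rhs => rw [← h2, Finset.mul_sum]
      exact Finset.sum_congr rfl fun i _ => (hEconj i).symm
    have hcommz : Commute (∑ i ∈ Finset.range s, E i) (1 ⊗ₜ z) :=
      Commute.sum_left _ _ _ fun i _ => commute_eigenIdem (by
        change inR ω * inR z = inR z * inR ω
        rw [← map_mul, ← map_mul, hωz.eq])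
    obtain ⟨x, hx⟩ := eq_smul_one_of_commute (commute_of_generators htop hcommz hcomm)
    have h1 : E 0 * ∑ i ∈ Finset.range s, E i = E 0 := by
      rw [Finset.mul_sum, Finset.sum_eq_single_of_mem 0 (Finset.mem_range.mpr hs0), hEidem]
      intro j hj hj0
      exact hEorth 0 j fun h => hj0 (hevinj 0 j hs0 (Finset.mem_range.mp hj) h).symm
    rw [hx, mul_smul_comm, mul_one] at h1
    have h2 : (x - 1) • E 0 = 0 := by rw [sub_smul, h1, one_smul, sub_self]
    rw [hx, sub_eq_zero.mp ((smul_eq_zero.mp h2).resolve_right hea), one_smul]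
  -- hence the orbit is as large as possible
  have hs : s = t := by
    refine Nat.dvd_antisymm hst ?_
    have hXpow (n i) : X ^ n * E i = ev i ^ n • E i := by
      induction n with
      | zero => simp
      | succ n ih =>
        rw [pow_succ, mul_assoc, hE1, mul_smul_comm, ih, smul_smul, ← pow_succ']
    have h1 : X ^ c ^ s = X := by
      have h2 : X ^ c ^ s * ∑ i ∈ Finset.range s, E i = X * ∑ i ∈ Finset.range s, E i := by
        rw [Finset.mul_sum, Finset.mul_sum]
        refine Finset.sum_congr rfl fun i _ => ?_
        rw [hXpow, hE1]
        have h3 := hevs i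
        change f^[i + s] a = _ at h3
        rw [add_comm, Function.iterate_add_apply, hf] at h3
        exact congrArg (· • E i) h3
      rwa [hsum, mul_one, mul_one] at h2
    have h2 : ω ^ c ^ s = ω := by
      refine Algebra.TensorProduct.includeRight_injective (R := F) (A := L) (B := Δ)
        (FaithfulSMul.algebraMap_injective F L) ?_
      change inR _ = inR _
      rw [map_pow]; exact h1
    have hω0 : ω ≠ 0 := fun h => by rw [h, map_zero] at hω1; exact zero_ne_one hω1
    have h3 := orderOf_dvd_of_pow_eq_self hω0 (pow_pos (hpos _) s) h2
    rw [hω] at h3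
    change p ^ (k₀ * t) - 1 ∣ (p ^ (k₀ * b')) ^ s - 1 at h3
    rw [← pow_mul] at h3
    have h4 := dvd_of_pow_sub_one_dvd hp1 h3
    rw [mul_assoc] at h4
    exact (hcop.symm.coprime_dvd_left htd).dvd_of_dvd_mul_left
      (Nat.dvd_of_mul_dvd_mul_left (Nat.pos_of_ne_zero hk₀) h4)
  have hϖ0 : ϖ ≠ 0 := fun h => by rw [h, map_zero] at hϖ; exact WithZero.exp_ne_zero hϖ.symm
  let u : Δˣ := Units.mk0 ϖ hϖ0
  have hconjE (m i : ℕ) : conjIdem F L u (E i) m = E (i + m) := by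
    induction m with
    | zero => exact conjIdem_zero _ _
    | succ m ih =>
      rw [Nat.cast_add, conjIdem_add, ih]
      refine conjIdem_eq_of_mul_eq ?_
      rw [Nat.cast_one, zpow_one]
      exact hEconj (i + m)
  have hconjt (n : ℤ) (hn : (t : ℤ) ∣ n) (i : ℕ) : conjIdem F L u (E i) n = E i := by
    obtain ⟨q, rfl⟩ := hn
    have h1 := hconjE s i
    rw [hEs, conjIdem, zpow_neg, mul_assoc] at h1
    have h2 : Commute (E i) ((tensorUnit F L u ^ (s : ℤ) : (L ⊗[F] Δ)ˣ) : L ⊗[F] Δ) := by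
      have h3 := congrArg (((tensorUnit F L u ^ (s : ℤ) : (L ⊗[F] Δ)ˣ) : L ⊗[F] Δ) * ·) h1
      simp only [Units.mul_inv_cancel_left] at h3
      exact h3
    refine conjIdem_eq_of_mul_eq ?_
    rw [← hs, zpow_mul]
    exact (h2.units_zpow_right q).symm.eq
  -- `l * d = t * lcm l d`, and `lcm l d` is the least possible degree of a residue field, which
  -- contains those of `L` and `Δ`
  have hcardB : Nat.card (TensorResidue F L Δ) = (p ^ (k₀ * Nat.lcm l d)) ^ t := by
    rw [card_tensorResidue, hkD, ← pow_mul, ← pow_mul]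
    congr 1
    have h1 := Nat.gcd_mul_lcm l d
    rw [← ht] at h1
    rw [mul_assoc, mul_assoc, mul_comm _ t, h1, mul_comm l d]
  refine ⟨u, E 0, hϖ, eigenIdem_mem_tball hMv hXball (hev1 0), hea, hEidem 0,
    fun n hn => hconjt n hn 0, fun n hn => ?_, ?_, fun x hx y hy hxy => ?_⟩
  · have ht0' : (t : ℤ) ≠ 0 := by exact_mod_cast ht0
    obtain ⟨r, hr⟩ := Int.eq_ofNat_of_zero_le (Int.emod_nonneg n ht0')
    have hrt : r < t := by
      have := Int.emod_lt_of_pos n (show (0 : ℤ) < t by omega)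
      omega
    have hr0 : r ≠ 0 := by
      rintro rfl
      exact hn (Int.dvd_of_emod_eq_zero (by simpa using hr))
    rw [← Int.mul_ediv_add_emod n t, conjIdem_add, hconjt _ (dvd_mul_right _ _), hr]
    change _ * conjIdem F L u (E 0) (r : ℤ) = 0
    rw [hconjE, zero_add]
    exact hEorth 0 r fun h => hr0 (hevinj 0 r hs0 (hs ▸ hrt) h).symm
  · rw [← hs, ← hsum]
    exact Finset.sum_congr rfl fun i _ => by rw [hconjE, zero_add]
  · have : Finite (TensorResidue F L Δ) :=
      Nat.finite_of_card_ne_zero (by rw [hcardB]; exact pow_ne_zero _ (hpos _).ne')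
    let EO (i : ℕ) : tensorOrder F Δ L :=
      ⟨E i, (mem_tensorOrder_iff _).mpr (eigenIdem_mem_tball hMv hXball (hev1 i))⟩
    let xO : tensorOrder F Δ L := ⟨x, (mem_tensorOrder_iff _).mpr hx⟩
    let yO : tensorOrder F Δ L := ⟨y, (mem_tensorOrder_iff _).mpr hy⟩
    have hE0 (i : ℕ) : E i ≠ 0 := by
      have h1 : E 0 = conjIdem F L u (conjIdem F L u (E 0) i) (-i) := by
        rw [← conjIdem_add, add_neg_cancel, conjIdem_zero]
      intro h
      rw [hconjE, zero_add, h, conjIdem, mul_zero, zero_mul] at h1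
      exact hea h1
    have hEO (i) : EO i * EO i = EO i := Subtype.ext (hEidem i)
    have hEO' (i j) (h : ev i ≠ ev j) : EO i * EO j = 0 := Subtype.ext (hEorth i j h)
    have h0 (i : ℕ) : tmk F L Δ (EO i) ≠ 0 := fun h =>
      notMem_tball_of_idempotent (hEidem i) (hE0 i) ((tmk_eq_zero_iff (EO i)).mp h)
    have h1 (i : ℕ) : tmk F L Δ (EO i) * tmk F L Δ (EO i) = tmk F L Δ (EO i) := by
      rw [← map_mul, hEO]
    have h2 (i j : Fin t) (hij : i ≠ j) : tmk F L Δ (EO i) * tmk F L Δ (EO j) = 0 := by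
      rw [← map_mul, hEO' i j fun h =>
        hij (Fin.ext (hevinj i j (hs ▸ i.2) (hs ▸ j.2) h)), map_zero]
    have h3 : tmk F L Δ (EO 0) * (tmk F L Δ xO * tmk F L Δ yO) = 0 := by
      rw [← map_mul, ← map_mul, tmk_eq_zero_iff]
      exact hxy
    have key := mul_eq_zero_of_orthogonal (fun i : Fin t => tmk F L Δ (EO i))
      (fun i => h0 i) (fun i => h1 i) h2 hcardB
      (fun I hI => le_card_residueField hk₀ hl0 hd0 hkL hkD I hI)
      ⟨0, Nat.pos_of_ne_zero ht0⟩ h3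
    rw [← map_mul, ← map_mul, tmk_eq_zero_iff, tmk_eq_zero_iff] at key
    exact key

end CornerIdempotent

/-! ### Corner rings and their valuation -/

section CornerRings

/-- A presentation of a `K`-algebra `W` as the corner ring `e R e` of an idempotent `e`. -/
structure CornerModel {K R : Type*} [Field K] [Ring R] [Algebra K R] (e : R) (W : Type*) [Ring W]
    [Algebra K W] where
  incl : W →ₗ[K] R
  proj : R →ₗ[K] W
  incl_injective : Function.Injective incl
  incl_mul : ∀ x y, incl (x * y) = incl x * incl y
  incl_one : incl 1 = e
  incl_proj : ∀ a, incl (proj a) = e * a * e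

variable {K R : Type*} [Field K] [Ring R] [Algebra K R] {e : R}

namespace CornerModel

variable {W : Type*} [Ring W] [Algebra K W] (c : CornerModel (K := K) e W)

theorem mul_incl (x : W) : e * c.incl x = c.incl x := by
  have h := c.incl_mul 1 x
  rwa [one_mul, c.incl_one, eq_comm] at h

theorem incl_mul_self (x : W) : c.incl x * e = c.incl x := by
  have h := c.incl_mul x 1
  rwa [mul_one, c.incl_one, eq_comm] at h

end CornerModel

/-- Scalars act on the corner ring of an idempotent. -/
instance cornerAlgebra (he : IsIdempotentElem e) : Algebra K he.Corner where
  smul a x := ⟨a • x.1, by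
    obtain ⟨y, hy⟩ := x.2
    exact ⟨a • y, by rw [← hy]; simp⟩⟩
  algebraMap :=
    { toFun := fun a => ⟨a • e, a • e, by simp [he.eq]⟩
      map_one' := Subtype.ext (one_smul K e)
      map_mul' := fun a b => Subtype.ext (by
        change (a * b) • e = (a • e) * (b • e)
        rw [smul_mul_smul_comm, he.eq])
      map_zero' := Subtype.ext (zero_smul K e)
      map_add' := fun a b => Subtype.ext (add_smul a b e) }
  commutes' a x := Subtype.ext (by
    change (a • e) * x.1 = x.1 * (a • e)
    have h := (Subsemigroup.mem_corner_iff he).mp x.2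
    rw [smul_mul_assoc, mul_smul_comm, h.1, h.2])
  smul_def' a x := Subtype.ext (by
    change a • x.1 = (a • e) * x.1
    rw [smul_mul_assoc, ((Subsemigroup.mem_corner_iff he).mp x.2).1])

/-- The corner ring, as a subset of the ambient ring. -/
def cornerModel (he : IsIdempotentElem e) : CornerModel (K := K) e he.Corner where
  incl :=
    { toFun := fun x => x.1
      map_add' := fun _ _ => rfl
      map_smul' := fun _ _ => rfl }
  proj :=
    { toFun := fun a => ⟨e * a * e, a, rfl⟩
      map_add' := fun a b => Subtype.ext (by
        change e * (a + b) * e = e * a * e + e * b * e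
        rw [mul_add, add_mul])
      map_smul' := fun a b => Subtype.ext (by
        change e * (a • b) * e = a • (e * b * e)
        rw [mul_smul_comm, smul_mul_assoc]) }
  incl_injective := Subtype.val_injective
  incl_mul _ _ := rfl
  incl_one := rfl
  incl_proj _ := rfl

end CornerRings

section CornerLevels

variable {F : Type*} [Field F] [ValuativeRel F] [TopologicalSpace F]
  [IsNonarchimedeanLocalField F] {L : Type*} [Field L] [Algebra F L] [FiniteDimensional F L]
  {Δ : Type*} [DivisionRing Δ] [Algebra F Δ] [FiniteDimensional F Δ]
  {ϖ : Δˣ} {t : ℕ} {e : L ⊗[F] Δ}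

/-- The exact level of a nonzero element in the filtration of `L ⊗ Δ`. -/
theorem exists_level {x : L ⊗[F] Δ} (hx : x ≠ 0) :
    ∃ n : ℤ, x ∈ tball F L Δ n ∧ x ∉ tball F L Δ (n - 1) := by
  obtain ⟨N, hN⟩ := exists_mem_tball x
  obtain ⟨m, hm⟩ : ∃ m : ℕ, x ∉ tball F L Δ (-(m : ℤ)) := by
    by_contra! h
    exact hx (eq_zero_of_forall_mem_tball h)
  by_contra! h
  have key (k : ℕ) : x ∈ tball F L Δ ((N : ℤ) - k) := by
    induction k with
    | zero => simpa using hN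
    | succ k ih =>
      rw [Nat.cast_succ, ← sub_sub]
      exact h _ ih
  have := key (N + m)
  rw [Nat.cast_add, sub_add_cancel_left] at this
  exact hm this

theorem IsCornerIdem.commute (he : IsCornerIdem ϖ t e) {n : ℤ} (hn : (t : ℤ) ∣ n) :
    Commute e ((tensorUnit F L ϖ ^ n : (L ⊗[F] Δ)ˣ) : L ⊗[F] Δ) := by
  have h1 := he.conj_of_dvd n hn
  rw [conjIdem, zpow_neg, mul_assoc] at h1
  have h2 := congrArg (((tensorUnit F L ϖ ^ n : (L ⊗[F] Δ)ˣ) : L ⊗[F] Δ) * ·) h1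
  simp only [Units.mul_inv_cancel_left] at h2
  exact h2

theorem mul_zpow_eq_mul_conjIdem (ϖ : Δˣ) (e : L ⊗[F] Δ) (n : ℤ) :
    e * ((tensorUnit F L ϖ ^ n : (L ⊗[F] Δ)ˣ) : L ⊗[F] Δ) =
      ((tensorUnit F L ϖ ^ n : (L ⊗[F] Δ)ˣ) : L ⊗[F] Δ) * conjIdem F L ϖ e n := by
  rw [conjIdem, zpow_neg, mul_assoc, Units.mul_inv_cancel_left]

/-- The levels at which the filtration of the corner ring jumps are multiples of `t`. -/
theorem IsCornerIdem.mem_tball_sub_one (hϖ : divVal F Δ ϖ = WithZero.exp (-1))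
    (he : IsCornerIdem ϖ t e) {x : L ⊗[F] Δ} (h1 : e * x = x) (h2 : x * e = x) {n : ℤ}
    (hn : ¬ (t : ℤ) ∣ n) (hx : x ∈ tball F L Δ n) : x ∈ tball F L Δ (n - 1) := by
  have hx' : x * ((tensorUnit F L ϖ ^ n : (L ⊗[F] Δ)ˣ) : L ⊗[F] Δ) ∈ tball F L Δ 0 :=
    (mul_tensorUnit_mem_tball_iff hϖ n n 0 (by ring)).mpr hx
  rw [← mul_tensorUnit_mem_tball_iff hϖ n (n - 1) (-1) (by ring)]
  generalize hy : x * ((tensorUnit F L ϖ ^ n : (L ⊗[F] Δ)ˣ) : L ⊗[F] Δ) = y at hx' ⊢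
  have hey : e * y = y := by rw [← hy, ← mul_assoc, h1]
  have hye : y * conjIdem F L ϖ e n = y := by
    rw [← hy, mul_assoc, ← mul_zpow_eq_mul_conjIdem, ← mul_assoc, h2]
  have hc : conjIdem F L ϖ e n ∈ tball F L Δ 0 := by
    rw [conjIdem, mul_tensorUnit_mem_tball_iff hϖ n n 0 (by ring),
      tensorUnit_mul_mem_tball_iff hϖ (-n) 0 n (by ring)]
    exact he.mem
  have h3 := mul_mem_tball he.mem (commutator_mem_tball hx' hc)
  rwa [mul_sub, hye, hey, ← mul_assoc, he.mul_conj n hn, zero_mul, sub_zero, zero_add] at h3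

/-- Levels that are not separated by a multiple of `t` define the same part of the corner ring. -/
theorem IsCornerIdem.mem_tball_of_not_dvd (hϖ : divVal F Δ ϖ = WithZero.exp (-1))
    (he : IsCornerIdem ϖ t e) {x : L ⊗[F] Δ} (h1 : e * x = x) (h2 : x * e = x) {m n : ℤ}
    (hmn : ∀ k, m < k → k ≤ n → ¬ (t : ℤ) ∣ k) (hx : x ∈ tball F L Δ n) : x ∈ tball F L Δ m := by
  rcases le_total n m with h | h
  · exact tball_mono h hx
  obtain ⟨k, rfl⟩ : ∃ k : ℕ, n = m + k := ⟨(n - m).toNat, by omega⟩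
  clear h
  induction k with
  | zero => simpa using hx
  | succ k ih =>
    refine ih (fun i hi hik => hmn i hi (by push_cast; omega)) ?_
    have := he.mem_tball_sub_one hϖ h1 h2 (hmn _ (by push_cast; omega) le_rfl) hx
    rwa [Nat.cast_succ, ← add_assoc, add_sub_cancel_right] at this

/-- Levels are additive in the corner ring. -/
theorem IsCornerIdem.mem_tball_or_of_mul (hϖ : divVal F Δ ϖ = WithZero.exp (-1))
    (he : IsCornerIdem ϖ t e) {x y : L ⊗[F] Δ} (h1 : e * x = x) (h2 : x * e = x)
    (h3 : e * y = y) {n m : ℤ} (hx : x ∈ tball F L Δ n) (hy : y ∈ tball F L Δ m)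
    (hxy : x * y ∈ tball F L Δ (n + m - 1)) :
    x ∈ tball F L Δ (n - 1) ∨ y ∈ tball F L Δ (m - 1) := by
  by_cases hn : (t : ℤ) ∣ n
  swap
  · exact Or.inl (he.mem_tball_sub_one hϖ h1 h2 hn hx)
  let U (k : ℤ) : L ⊗[F] Δ := ((tensorUnit F L ϖ ^ k : (L ⊗[F] Δ)ˣ) : L ⊗[F] Δ)
  have hx' : x * U n ∈ tball F L Δ 0 := (mul_tensorUnit_mem_tball_iff hϖ n n 0 (by ring)).mpr hx
  have hy' : U (-n) * y * U (n + m) ∈ tball F L Δ 0 := by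
    rw [mul_tensorUnit_mem_tball_iff hϖ (n + m) (n + m) 0 (by ring),
      tensorUnit_mul_mem_tball_iff hϖ (-n) m (n + m) (by ring)]
    exact hy
  have hU : U n * U (-n) = 1 := by
    simp only [U, zpow_neg, Units.mul_inv]
  have hxy' : e * (x * U n * (U (-n) * y * U (n + m))) ∈ tball F L Δ (-1) := by
    have h4 : e * (x * U n * (U (-n) * y * U (n + m))) = x * y * U (n + m) := by
      rw [← mul_assoc, ← mul_assoc e, h1, mul_assoc x, ← mul_assoc (U n), ← mul_assoc (U n), hU,
        one_mul, ← mul_assoc]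
    rw [h4, mul_tensorUnit_mem_tball_iff hϖ (n + m) (n + m - 1) (-1) (by ring)]
    exact hxy
  rcases he.domain _ hx' _ hy' hxy' with h | h
  · left
    rw [← mul_assoc, h1] at h
    exact (mul_tensorUnit_mem_tball_iff hϖ n (n - 1) (-1) (by ring)).mp h
  · right
    have h5 : e * U (-n) = U (-n) * e := (he.commute ((dvd_neg).mpr hn)).eq
    rw [← mul_assoc, ← mul_assoc, h5, mul_assoc (U (-n)), h3,
      mul_tensorUnit_mem_tball_iff hϖ (n + m) (n + m - 1) (-1) (by ring),
      tensorUnit_mul_mem_tball_iff hϖ (-n) (m - 1) (n + m - 1) (by ring)] at h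
    exact h

theorem IsCornerIdem.eq_zero_or_eq_zero (hϖ : divVal F Δ ϖ = WithZero.exp (-1))
    (he : IsCornerIdem ϖ t e) {x y : L ⊗[F] Δ} (h1 : e * x = x) (h2 : x * e = x)
    (h3 : e * y = y) (hxy : x * y = 0) : x = 0 ∨ y = 0 := by
  by_contra! h
  obtain ⟨n, hn, hn'⟩ := exists_level h.1
  obtain ⟨m, hm, hm'⟩ := exists_level h.2
  exact (he.mem_tball_or_of_mul hϖ h1 h2 h3 hn hm (hxy ▸ zero_mem _)).elim hn' hm'

end CornerLevels

section CornerValuation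

variable {F : Type*} [Field F] [ValuativeRel F] [TopologicalSpace F]
  [IsNonarchimedeanLocalField F] {L : Type*} [Field L] [Algebra F L] [FiniteDimensional F L]
  {Δ : Type*} [DivisionRing Δ] [Algebra F Δ] [FiniteDimensional F Δ]
  {ϖ : Δˣ} {t : ℕ} {e : L ⊗[F] Δ}
  {W : Type*} [DivisionRing W] [Algebra L W] [Algebra F W] [IsScalarTower F L W]
  [FiniteDimensional F W] (c : CornerModel (K := L) e W)

/-- The valuation is bounded on the projection of `O_L ⊗ O_Δ` to the corner ring, as `O_L ⊗ O_Δ` is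
finitely generated over the integers of `F`. -/
theorem exists_divVal_proj_le : ∃ N : ℤ, ∀ a ∈ tball F L Δ 0,
    divVal F W (c.proj a) ≤ WithZero.exp N := by
  obtain ⟨b, hb⟩ := exists_integral_basis F Δ
  have hbound (i) (j) : ∃ N : ℤ, divVal F W (c.proj (intBasis F L i ⊗ₜ b j)) ≤ WithZero.exp N := by
    by_cases h : divVal F W (c.proj (intBasis F L i ⊗ₜ b j)) = 0
    · exact ⟨0, by simp [h]⟩
    · obtain ⟨m, hm⟩ := exists_eq_exp h
      exact ⟨m, hm.le⟩
  choose N hN using hbound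
  obtain ⟨B, hB⟩ := Finite.bddAbove_range fun p : _ × _ => N p.1 p.2
  refine ⟨B, fun a ha => ?_⟩
  rw [← sum_tcoord a, map_sum]
  refine (divVal F W).map_sum_le fun i _ => ?_
  have h1 : tcoord F L Δ a i ∈ maxCompactSubring F Δ :=
    (mem_maxCompactSubring_iff _).mpr (by simpa using mem_tball.mp ha i)
  rw [← b.sum_repr (tcoord F L Δ a i), TensorProduct.tmul_sum, map_sum]
  refine (divVal F W).map_sum_le fun j _ => ?_
  have h2 : c.proj (intBasis F L i ⊗ₜ[F] (b.repr (tcoord F L Δ a i) j • b j)) =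
      algebraMap F W (b.repr (tcoord F L Δ a i) j) * c.proj (intBasis F L i ⊗ₜ b j) := by
    rw [TensorProduct.tmul_smul, ← algebraMap_smul L (b.repr (tcoord F L Δ a i) j) (_ ⊗ₜ _),
      map_smul, algebraMap_smul, Algebra.smul_def]
  rw [h2, map_mul]
  exact (mul_le_of_le_one_left' ((divVal_algebraMap_le_one_iff _).mpr ((hb _).mp h1 j))).trans
    ((hN i j).trans (WithZero.exp_le_exp.mpr (hB ⟨(i, j), rfl⟩)))

theorem CornerModel.proj_incl (x : W) : c.proj (c.incl x) = x :=
  c.incl_injective (by rw [c.incl_proj, c.mul_incl, c.incl_mul_self])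

theorem CornerModel.incl_pow (x : W) (n : ℕ) : c.incl (x ^ (n + 1)) = c.incl x ^ (n + 1) := by
  induction n with
  | zero => simp
  | succ n ih => rw [pow_succ, c.incl_mul, ih, ← pow_succ]

/-- The powers of an element of the corner of `O_L ⊗ O_Δ` are bounded, so that it has valuation at
most `1`. -/
theorem divVal_le_one_of_mem_tball (hmem : e ∈ tball F L Δ 0) {x : W}
    (hx : c.incl x ∈ tball F L Δ 0) : divVal F W x ≤ 1 := by
  obtain ⟨N, hN⟩ := exists_divVal_proj_le c
  refine le_one_of_pow_le (n := N) fun k => ?_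
  rw [← map_pow, ← c.proj_incl (x ^ k)]
  refine hN _ ?_
  rcases k with - | k
  · rw [pow_zero, c.incl_one]; exact hmem
  · rw [c.incl_pow, ← mul_zero ((k + 1 : ℕ) : ℤ)]
    exact pow_mem_tball hx _

theorem divVal_lt_one_of_mem_tball (hmem : e ∈ tball F L Δ 0) {x : W}
    (hx : c.incl x ∈ tball F L Δ (-1)) : divVal F W x < 1 := by
  obtain ⟨k, hk⟩ : ∃ k, ramIdx F Δ = k + 1 :=
    ⟨ramIdx F Δ - 1, by have := ramIdx_pos (F := F) (D := Δ); omega⟩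
  have h1 : c.incl (x ^ (k + 1)) ∈ tball F L Δ (-(ramIdx F Δ : ℤ)) := by
    rw [c.incl_pow, ← hk]
    have := pow_mem_tball hx (ramIdx F Δ)
    rwa [mul_neg_one] at this
  have h2 : divVal F W (algebraMap F W (baseUnif F)⁻¹ * x ^ (k + 1)) ≤ 1 := by
    refine divVal_le_one_of_mem_tball c hmem ?_
    have h3 : c.incl (algebraMap F W (baseUnif F)⁻¹ * x ^ (k + 1)) =
        (1 ⊗ₜ algebraMap F Δ (baseUnif F)⁻¹) * c.incl (x ^ (k + 1)) := by
      rw [← Algebra.smul_def, ← algebraMap_smul L (baseUnif F)⁻¹, map_smul, algebraMap_smul,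
        Algebra.smul_def]
      congr 1
      rw [Algebra.TensorProduct.algebraMap_apply']
    rw [h3]
    have h4 : divVal F Δ (algebraMap F Δ (baseUnif F)⁻¹) = WithZero.exp (ramIdx F Δ : ℤ) := by
      rw [map_inv₀, map_inv₀, divVal_algebraMap_baseUnif, ← WithZero.exp_neg, neg_neg]
    have := (unif_mul_mem_tball_iff h4 (-(ramIdx F Δ : ℤ))).mpr h1
    rwa [neg_add_cancel] at this
  have h5 : x ^ (k + 1) = algebraMap F W (baseUnif F) *
      (algebraMap F W (baseUnif F)⁻¹ * x ^ (k + 1)) := by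
    rw [← mul_assoc, ← map_mul, mul_inv_cancel₀ baseUnif_ne_zero, map_one, one_mul]
  have h6 : divVal F W x ^ (k + 1) < 1 := by
    rw [← map_pow, h5, map_mul]
    refine mul_lt_one_of_lt_one_of_le_one ?_ h2
    rw [divVal_algebraMap_lt_one_iff, baseVal_baseUnif, lt_one_iff]
  exact not_le.mp fun h => absurd h6 (not_lt.mpr (one_le_pow_of_one_le' h _))

/-- Since levels are additive, the level of the inverse is at most the negative of the level. -/
theorem IsCornerIdem.incl_inv_mem_tball (hϖ : divVal F Δ ϖ = WithZero.exp (-1))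
    (he : IsCornerIdem ϖ t e) {x : W} (hx0 : x ≠ 0) {n : ℤ}
    (hx : c.incl x ∉ tball F L Δ (n - 1)) : c.incl x⁻¹ ∈ tball F L Δ (-n) := by
  have hinj {y : W} (hy : y ≠ 0) : c.incl y ≠ 0 := fun h =>
    hy (c.incl_injective (by rw [h, map_zero]))
  obtain ⟨k, hk, hk'⟩ := exists_level (hinj hx0)
  obtain ⟨m, hm, hm'⟩ := exists_level (hinj (inv_ne_zero hx0))
  have hnk : n ≤ k := by
    by_contra h
    exact hx (tball_mono (by omega) hk)
  have h1 : c.incl x * c.incl x⁻¹ = e := by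
    rw [← c.incl_mul, mul_inv_cancel₀ hx0, c.incl_one]
  have hkm : k + m ≤ 0 := by
    by_contra h
    refine (he.mem_tball_or_of_mul hϖ (c.mul_incl x) (c.incl_mul_self x) (c.mul_incl _) hk hm ?_).elim
      hk' hm'
    rw [h1]
    exact tball_mono (by omega) he.mem
  exact tball_mono (by omega) hm

/-- The maximal ideal of the integers of the corner ring is the corner of the ideal generated by
`𝔓_Δ`. -/
theorem IsCornerIdem.divVal_lt_one_iff (hϖ : divVal F Δ ϖ = WithZero.exp (-1))
    (he : IsCornerIdem ϖ t e) (x : W) : divVal F W x < 1 ↔ c.incl x ∈ tball F L Δ (-1) := by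
  refine ⟨fun h => ?_, divVal_lt_one_of_mem_tball c he.mem⟩
  by_contra hx
  have hx0 : x ≠ 0 := by rintro rfl; exact hx (by simp)
  have h1 := divVal_le_one_of_mem_tball c he.mem
    (he.incl_inv_mem_tball c hϖ hx0 (n := 0) (by simpa using hx))
  have h2 : divVal F W x * divVal F W x⁻¹ = 1 := by
    rw [← map_mul, mul_inv_cancel₀ hx0, map_one]
  exact (mul_lt_one_of_lt_one_of_le_one h h1).ne h2

/-- The integers of the corner ring are the corner of `O_L ⊗ O_Δ`. -/
theorem IsCornerIdem.divVal_le_one_iff (hϖ : divVal F Δ ϖ = WithZero.exp (-1))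
    (he : IsCornerIdem ϖ t e) (x : W) : divVal F W x ≤ 1 ↔ c.incl x ∈ tball F L Δ 0 := by
  refine ⟨fun h => ?_, divVal_le_one_of_mem_tball c he.mem⟩
  by_contra hx
  have hx0 : x ≠ 0 := by rintro rfl; exact hx (by simp)
  have h1 := divVal_lt_one_of_mem_tball c he.mem
    (he.incl_inv_mem_tball c hϖ hx0 (n := 1) (by simpa using hx))
  have h2 : divVal F W x * divVal F W x⁻¹ = 1 := by
    rw [← map_mul, mul_inv_cancel₀ hx0, map_one]
  exact (mul_lt_one_of_le_one_of_lt_one h h1).ne h2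

end CornerValuation

/-! ### The Peirce decomposition of `L ⊗ Δ` -/

section PeirceDecomposition

variable {F : Type*} [Field F] [ValuativeRel F] [TopologicalSpace F]
  [IsNonarchimedeanLocalField F] {L : Type*} [Field L] [Algebra F L] [FiniteDimensional F L]
  {Δ : Type*} [DivisionRing Δ] [Algebra F Δ] [FiniteDimensional F Δ]
  {ϖ : Δˣ} {t : ℕ} {e : L ⊗[F] Δ}

variable (F L) in
/-- The element `1 ⊗ ϖ ^ k` of `L ⊗ Δ`. -/
def unifPow (ϖ : Δˣ) (k : ℤ) : L ⊗[F] Δ := ((tensorUnit F L ϖ ^ k : (L ⊗[F] Δ)ˣ) : L ⊗[F] Δ)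

theorem unifPow_add (ϖ : Δˣ) (k m : ℤ) :
    unifPow F L ϖ (k + m) = unifPow F L ϖ k * unifPow F L ϖ m := by
  rw [unifPow, zpow_add]; rfl

theorem unifPow_zero (ϖ : Δˣ) : unifPow F L ϖ 0 = 1 := by simp [unifPow]

theorem conjIdem_eq (ϖ : Δˣ) (e : L ⊗[F] Δ) (n : ℤ) :
    conjIdem F L ϖ e n = unifPow F L ϖ (-n) * e * unifPow F L ϖ n := rfl

/-- The components `e (1 ⊗ ϖ ^ k) e` vanish for `0 < |k| < t`. -/
theorem IsCornerIdem.mul_unifPow_mul (he : IsCornerIdem ϖ t e) {n : ℤ} (hn : ¬ (t : ℤ) ∣ n) :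
    e * unifPow F L ϖ n * e = 0 := by
  have h := he.mul_conj (-n) (fun h => hn ((dvd_neg).mp h))
  rw [conjIdem_eq, neg_neg] at h
  have h2 : e * unifPow F L ϖ n * e = e * (unifPow F L ϖ n * e * unifPow F L ϖ (-n)) *
      unifPow F L ϖ n := by
    simp only [mul_assoc]
    rw [← unifPow_add, neg_add_cancel, unifPow_zero, mul_one]
  rw [h2, h, zero_mul]

theorem not_dvd_sub {t : ℕ} {i j : Fin t} (hij : i ≠ j) : ¬ (t : ℤ) ∣ (i : ℤ) - j := by
  intro h
  have h1 := Int.eq_zero_of_abs_lt_dvd h (by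
    have := i.2; have := j.2
    rw [abs_lt]; constructor <;> omega)
  exact hij (Fin.ext (by omega))

theorem IsCornerIdem.sum_fin (he : IsCornerIdem ϖ t e) :
    ∑ i : Fin t, unifPow F L ϖ (-(i : ℤ)) * e * unifPow F L ϖ i = 1 := by
  rw [← he.sum_conj, Finset.sum_range]
  rfl

variable {W : Type*} [DivisionRing W] [Algebra L W] (c : CornerModel (K := L) e W)

/-- The matrix of an element of `L ⊗ Δ` for the decomposition of `1` into the conjugates of `e`. -/
def peirceMatrix (ϖ : Δˣ) (t : ℕ) : L ⊗[F] Δ →ₗ[L] Matrix (Fin t) (Fin t) W where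
  toFun a := Matrix.of fun i j => c.proj (unifPow F L ϖ i * a * unifPow F L ϖ (-(j : ℤ)))
  map_add' a b := by
    ext i j
    simp [mul_add, add_mul]
  map_smul' r a := by
    ext i j
    simp

theorem incl_peirceMatrix (a : L ⊗[F] Δ) (i j : Fin t) :
    c.incl (peirceMatrix c ϖ t a i j) =
      e * (unifPow F L ϖ i * a * unifPow F L ϖ (-(j : ℤ))) * e :=
  c.incl_proj _

/-- The decomposition of `L ⊗ Δ` as a matrix ring over the corner ring. -/
def peirceHom (he : IsCornerIdem ϖ t e) : L ⊗[F] Δ →ₐ[L] Matrix (Fin t) (Fin t) W :=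
  AlgHom.ofLinearMap (peirceMatrix c ϖ t)
    (by
      ext i j
      refine c.incl_injective ?_
      rw [incl_peirceMatrix, mul_one, ← unifPow_add, ← sub_eq_add_neg]
      by_cases hij : i = j
      · rw [hij, Matrix.one_apply_eq, c.incl_one, sub_self, unifPow_zero, mul_one, he.idem.eq]
      · rw [Matrix.one_apply_ne hij, map_zero, he.mul_unifPow_mul (not_dvd_sub hij)])
    (fun a b => by
      ext i j
      refine c.incl_injective ?_
      rw [incl_peirceMatrix, Matrix.mul_apply, map_sum]
      simp_rw [c.incl_mul, incl_peirceMatrix]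
      have h (k : Fin t) : e * (unifPow F L ϖ i * a * unifPow F L ϖ (-(k : ℤ))) * e *
          (e * (unifPow F L ϖ k * b * unifPow F L ϖ (-(j : ℤ))) * e) =
          e * (unifPow F L ϖ i * a) * (unifPow F L ϖ (-(k : ℤ)) * e * unifPow F L ϖ k) *
          (b * unifPow F L ϖ (-(j : ℤ)) * e) := by
        have hee (x : L ⊗[F] Δ) : e * (e * x) = e * x := by rw [← mul_assoc, he.idem.eq]
        simp only [mul_assoc, hee]
      simp_rw [h]
      rw [← Finset.sum_mul, ← Finset.mul_sum, he.sum_fin]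
      simp only [mul_assoc, one_mul])

theorem peirceHom_apply (he : IsCornerIdem ϖ t e) (a : L ⊗[F] Δ) :
    peirceHom c he a = peirceMatrix c ϖ t a := rfl

/-- An element is determined by its matrix. -/
theorem sum_peirceMatrix (he : IsCornerIdem ϖ t e) (a : L ⊗[F] Δ) :
    ∑ i : Fin t, ∑ j : Fin t,
      unifPow F L ϖ (-(i : ℤ)) * c.incl (peirceMatrix c ϖ t a i j) * unifPow F L ϖ j = a := by
  simp_rw [incl_peirceMatrix]
  have h (i j : Fin t) : unifPow F L ϖ (-(i : ℤ)) *
      (e * (unifPow F L ϖ i * a * unifPow F L ϖ (-(j : ℤ))) * e) * unifPow F L ϖ j =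
      (unifPow F L ϖ (-(i : ℤ)) * e * unifPow F L ϖ i) * a *
        (unifPow F L ϖ (-(j : ℤ)) * e * unifPow F L ϖ j) := by
    simp only [mul_assoc]
  simp_rw [h]
  rw [← Finset.sum_mul_sum, ← Finset.sum_mul, he.sum_fin, one_mul, mul_one]

/-- The matrix with the single entry `w` in the position `(k, l)` comes from the element `ϖ ^ (-k) w
ϖ ^ l`. -/
theorem peirceMatrix_unifPow_mul (he : IsCornerIdem ϖ t e) (w : W) (k l : Fin t) :
    peirceMatrix c ϖ t (unifPow F L ϖ (-(k : ℤ)) * c.incl w * unifPow F L ϖ l) =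
      Matrix.single k l w := by
  ext i j
  refine c.incl_injective ?_
  have hw : c.incl w = e * c.incl w * e := by rw [c.mul_incl, c.incl_mul_self]
  have h : c.incl (peirceMatrix c ϖ t
      (unifPow F L ϖ (-(k : ℤ)) * c.incl w * unifPow F L ϖ l) i j) =
      (e * unifPow F L ϖ ((i : ℤ) - k) * e) * c.incl w * (e * unifPow F L ϖ ((l : ℤ) - j) * e) := by
    rw [incl_peirceMatrix, hw, sub_eq_add_neg, sub_eq_add_neg, unifPow_add, unifPow_add, ← hw]
    conv_lhs => rw [hw]
    simp only [mul_assoc]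
  rw [h]
  by_cases hki : k = i
  · by_cases hlj : l = j
    · subst hki hlj
      rw [Matrix.single_apply_same, sub_self, sub_self, unifPow_zero, mul_one, he.idem.eq,
        ← hw]
    · rw [Matrix.single_apply_of_col_ne _ _ hlj, map_zero, he.mul_unifPow_mul (not_dvd_sub hlj),
        mul_zero]
  · rw [Matrix.single_apply_of_row_ne hki, map_zero,
      he.mul_unifPow_mul (not_dvd_sub (Ne.symm hki)), zero_mul, zero_mul]

theorem peirceHom_bijective (he : IsCornerIdem ϖ t e) : Function.Bijective (peirceHom c he) := by
  refine ⟨fun a b h => ?_, fun X => ?_⟩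
  · rw [peirceHom_apply, peirceHom_apply] at h
    rw [← sum_peirceMatrix c he a, h, sum_peirceMatrix c he]
  · refine ⟨∑ i : Fin t, ∑ j : Fin t,
      unifPow F L ϖ (-(i : ℤ)) * c.incl (X i j) * unifPow F L ϖ j, ?_⟩
    rw [peirceHom_apply, map_sum]
    simp_rw [map_sum, peirceMatrix_unifPow_mul c he]
    exact (Matrix.matrix_eq_sum_single X).symm

/-- The isomorphism of `L ⊗ Δ` with a matrix ring over the corner ring. -/
def peirceEquiv (he : IsCornerIdem ϖ t e) : L ⊗[F] Δ ≃ₐ[L] Matrix (Fin t) (Fin t) W :=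
  AlgEquiv.ofBijective (peirceHom c he) (peirceHom_bijective c he)

variable [Algebra F W] [IsScalarTower F L W] [FiniteDimensional F W]

/-- The entry in the position `(k, l)` of an element of `O_L ⊗ O_Δ` has level at most `l - k`, and
levels in the corner ring are multiples of `t`; this is the condition of the Iwahori order. -/
theorem isIwahori_peirceEquiv (hϖ : divVal F Δ ϖ = WithZero.exp (-1))
    (he : IsCornerIdem ϖ t e) : IsIwahori (peirceEquiv c he) := by
  intro a
  rw [mem_tensorOrder_iff, mem_blockOrder_id_iff, mem_iwahori]
  change _ ↔ ∀ k l, divVal F W (peirceMatrix c ϖ t a k l) ≤ _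
  have h1 (x : W) (k l : Fin t) : divVal F W x ≤ WithZero.exp (if l < k then -1 else 0) ↔
      c.incl x ∈ tball F L Δ (if l < k then -1 else 0) := by
    split_ifs with h
    · rw [← he.divVal_lt_one_iff c hϖ, lt_one_iff]
    · rw [← he.divVal_le_one_iff c hϖ, WithZero.exp_zero]
  simp_rw [h1]
  -- no multiple of `t` lies strictly between the levels that are compared
  have hnd {k : ℤ} (h1 : -(t : ℤ) < k) (h2 : k < t) (h0 : k ≠ 0) : ¬ (t : ℤ) ∣ k := fun h =>
    h0 (Int.eq_zero_of_abs_lt_dvd h (abs_lt.mpr ⟨h1, h2⟩))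
  constructor
  · intro ha k l
    have hk := k.2
    have hl := l.2
    have h2 : c.incl (peirceMatrix c ϖ t a k l) ∈ tball F L Δ ((l : ℤ) - k) := by
      rw [incl_peirceMatrix]
      have h3 : unifPow F L ϖ k * a * unifPow F L ϖ (-(l : ℤ)) ∈ tball F L Δ ((l : ℤ) - k) := by
        rw [unifPow, unifPow, mul_tensorUnit_mem_tball_iff hϖ _ (-(k : ℤ)) _ (by ring),
          tensorUnit_mul_mem_tball_iff hϖ _ 0 _ (by ring)]
        exact ha
      simpa using mul_mem_tball (mul_mem_tball he.mem h3) he.mem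
    refine he.mem_tball_of_not_dvd hϖ (c.mul_incl _) (c.incl_mul_self _) (fun i hi hi' => ?_) h2
    split_ifs at hi with hlk
    · omega
    · exact hnd (by omega) (by omega) (by omega)
  · intro h
    rw [← sum_peirceMatrix c he a]
    refine sum_mem fun k _ => sum_mem fun l _ => ?_
    have hk := k.2
    have hl := l.2
    rw [unifPow, unifPow, mul_tensorUnit_mem_tball_iff hϖ _ (l : ℤ) _ (by ring),
      tensorUnit_mul_mem_tball_iff hϖ _ ((l : ℤ) - k) _ (by ring)]
    refine he.mem_tball_of_not_dvd hϖ (c.mul_incl _) (c.incl_mul_self _) (fun i hi hi' => ?_)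
      (h k l)
    split_ifs at hi' with hlk
    · have : (l : ℕ) < k := hlk
      exact hnd (by omega) (by omega) (by omega)
    · have : (k : ℕ) ≤ l := not_lt.mp hlk
      omega

end PeirceDecomposition

section Existence

variable {F : Type*} [Field F] [ValuativeRel F] [TopologicalSpace F]
  [IsNonarchimedeanLocalField F] {L : Type*} [Field L] [Algebra F L] [FiniteDimensional F L]
  {Δ : Type*} [DivisionRing Δ] [Algebra F Δ] [FiniteDimensional F Δ]

/-- `L ⊗ Δ` is central over `L`, hence so is the division algebra in its matrix presentation. -/
theorem isCentral_of_equiv [Algebra.IsCentral F Δ] {W : Type*} [DivisionRing W] [Algebra L W]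
    {t : ℕ} [NeZero t] (Θ : L ⊗[F] Δ ≃ₐ[L] Matrix (Fin t) (Fin t) W) : Algebra.IsCentral L W where
  out w hw := by
    rw [Subalgebra.mem_center_iff] at hw
    obtain ⟨a, ha⟩ := eq_smul_one_of_commute (w := Θ.symm (Matrix.scalar (Fin t) w)) (fun y => by
      refine Θ.injective ?_
      rw [map_mul, map_mul, AlgEquiv.apply_symm_apply]
      exact Matrix.scalar_commute w (fun v => (hw v).symm) _)
    have h := congrArg Θ ha
    rw [AlgEquiv.apply_symm_apply, map_smul, map_one] at h
    have h0 := congrFun (congrFun h 0) 0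
    rw [Algebra.mem_bot]
    refine ⟨a, ?_⟩
    rw [Algebra.algebraMap_eq_smul_one]
    simpa using h0.symm

theorem finrank_of_equiv {W : Type*} [DivisionRing W] [Algebra L W] {d t : ℕ} [NeZero t]
    (hd : Module.finrank F Δ = d ^ 2) (ht : t ∣ d)
    (Θ : L ⊗[F] Δ ≃ₐ[L] Matrix (Fin t) (Fin t) W) : Module.finrank L W = (d / t) ^ 2 := by
  obtain ⟨s, rfl⟩ := ht
  have ht0 : 0 < t := Nat.pos_of_ne_zero (NeZero.ne t)
  have h1 := Θ.toLinearEquiv.finrank_eq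
  rw [Module.finrank_baseChange, hd, Module.finrank_matrix, Fintype.card_fin] at h1
  rw [Nat.mul_div_cancel_left _ ht0]
  refine Nat.eq_of_mul_eq_mul_left (Nat.mul_pos ht0 ht0) ?_
  rw [← h1]; ring

/-- The corner ring of a suitable idempotent is a division algebra over which `L ⊗ Δ` is a matrix
algebra, with `O_L ⊗ O_Δ` the Iwahori order. -/
theorem exists_isIwahori {F : Type*} {Δ : Type v} {L : Type x} [Field F] [ValuativeRel F]
    [TopologicalSpace F] [IsNonarchimedeanLocalField F] [Field L] [Algebra F L]
    [FiniteDimensional F L] [DivisionRing Δ] [Algebra F Δ] [FiniteDimensional F Δ]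
    [Algebra.IsCentral F Δ] (hL : ramIdx F L = 1) {d t : ℕ} [NeZero t]
    (hd : Module.finrank F Δ = d ^ 2) (ht : t = Nat.gcd (Module.finrank F L) d) :
    ∃ (Δ' : Type (max v x)) (_ : DivisionRing Δ') (_ : Algebra L Δ') (_ : Algebra F Δ')
      (_ : IsScalarTower F L Δ') (Θ : L ⊗[F] Δ ≃ₐ[L] Matrix (Fin t) (Fin t) Δ'),
      Algebra.IsCentral L Δ' ∧ Module.finrank L Δ' = (d / t) ^ 2 ∧ IsIwahori Θ := by
  obtain ⟨ϖ, e, hϖ, he⟩ := exists_isCornerIdem F L Δ hL hd ht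
  let c := cornerModel (K := L) he.idem
  have : IsScalarTower F L he.idem.Corner :=
    ⟨fun a b x => Subtype.ext (smul_assoc a b x.1)⟩
  have : Module.Finite L he.idem.Corner := Module.Finite.of_injective c.incl c.incl_injective
  have : Nontrivial he.idem.Corner := ⟨1, 0, fun h => he.ne_zero (by
    have h1 := congrArg c.incl h
    rwa [c.incl_one, map_zero] at h1)⟩
  have : NoZeroDivisors he.idem.Corner := ⟨fun {x y} h => by
    have h1 : c.incl x * c.incl y = 0 := by rw [← c.incl_mul, h, map_zero]
    exact (he.eq_zero_or_eq_zero hϖ (c.mul_incl x) (c.incl_mul_self x) (c.mul_incl y) h1).imp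
      (fun h => c.incl_injective (h.trans (map_zero _).symm))
      (fun h => c.incl_injective (h.trans (map_zero _).symm))⟩
  have : IsDomain he.idem.Corner := NoZeroDivisors.to_isDomain _
  let := divisionRingOfFiniteDimensional L he.idem.Corner
  have : FiniteDimensional F he.idem.Corner := Module.Finite.trans L _
  let Θ := peirceEquiv c he
  exact ⟨he.idem.Corner, inferInstance, inferInstance, inferInstance, inferInstance, Θ,
    isCentral_of_equiv Θ, finrank_of_equiv hd (ht ▸ Nat.gcd_dvd_right _ _) Θ,
    isIwahori_peirceEquiv c hϖ he⟩

end Existence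

end LocalFlag

end

theorem theorem7p10
    -- a non-Archimedean local field, a central division algebra of degree `d` over it
    {F : Type u} [Field F] [ValuativeRel F] [TopologicalSpace F] [IsNonarchimedeanLocalField F]
    {Δ : Type v} [DivisionRing Δ] [Algebra F Δ] [FiniteDimensional F Δ] [Algebra.IsCentral F Δ]
    (d : ℕ) (hd : Module.finrank F Δ = d ^ 2)
    -- a nonzero right `Δ`-vector space `V` of finite rank `m`; the algebra `D` is `End_Δ(V)`
    {V : Type w} [AddCommGroup V] [Module Δᵐᵒᵖ V] [Module F V] [IsScalarTower F Δᵐᵒᵖ V]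
    [Module.Finite Δᵐᵒᵖ V] [Nontrivial V]
    -- an unramified extension `L` of `F` embedded in `D`
    {L : Type x} [Field L] [Algebra F L] [FiniteDimensional F L]
    [Algebra.FormallyUnramified 𝒪[F] (integralClosure 𝒪[F] L)]
    (ι : L →ₐ[F] Module.End Δᵐᵒᵖ V)
    (t : ℕ) [NeZero t] (ht : t = Nat.gcd (Module.finrank F L) d)
    -- the type `f`
    {r : ℕ} (f : Fin r → ℕ) (hf : ∀ i, 0 < f i) (hfm : ∑ i, f i = Module.finrank Δᵐᵒᵖ V) :
    -- `L ⊗ Δ` is `Mat_t(Δ')` with `O_L ⊗ O_Δ` the standard Iwahori order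
    (∃ (Δ' : Type (max v x)) (_ : DivisionRing Δ') (_ : Algebra L Δ') (_ : Algebra F Δ')
      (_ : IsScalarTower F L Δ') (Θ : L ⊗[F] Δ ≃ₐ[L] Matrix (Fin t) (Fin t) Δ'),
      Algebra.IsCentral L Δ' ∧ Module.finrank L Δ' = (d / t) ^ 2 ∧ LocalFlag.IsIwahori Θ) ∧
    -- and for every such identification:
    ∀ (Δ' : Type y) [DivisionRing Δ'] [Algebra L Δ'] [Algebra F Δ'] [IsScalarTower F L Δ']
      (Θ : L ⊗[F] Δ ≃ₐ[L] Matrix (Fin t) (Fin t) Δ'), LocalFlag.IsIwahori Θ →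
      ∃ Φ : LocalFlag.FL ι f ≃
          {g : Fin r → Fin t → ℕ // ∀ i, Module.finrank F L / t * ∑ j, g i j = f i},
        ∀ N : LocalFlag.BiFlag ι f,
          LocalFlag.HasVector Θ N (Φ ⟦N⟧).1 ∧
          Fintype.card (LocalFlag.BlockIndex (Φ ⟦N⟧).1) =
            Module.finrank Δᵐᵒᵖ V * t / Module.finrank F L ∧
          ∃ ψ : Subalgebra.centralizer F (Set.range ι) ≃ₐ[F]
              Matrix (LocalFlag.BlockIndex (Φ ⟦N⟧).1) (LocalFlag.BlockIndex (Φ ⟦N⟧).1) Δ',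
            (∀ (a : L) (h : ι a ∈ Subalgebra.centralizer F (Set.range ι)),
              ψ ⟨ι a, h⟩ = algebraMap L _ a) ∧
            ∀ φ : Module.End Δᵐᵒᵖ V, φ ∈ N.endRing ↔
              ∃ h : φ ∈ Subalgebra.centralizer F (Set.range ι),
                ψ ⟨φ, h⟩ ∈ LocalFlag.hereditaryOrder
                  (LocalFlag.maxCompactSubring F Δ') (Φ ⟦N⟧).1 := by
  have hL : LocalFlag.ramIdx F L = 1 := LocalFlag.ramIdx_eq_one
  -- the flag has at least one term, as `V` is not zero
  have : NeZero r := ⟨by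
    rintro rfl
    have h : 0 < Module.finrank Δᵐᵒᵖ V := Module.finrank_pos
    rw [← hfm] at h
    simp at h⟩
  refine ⟨LocalFlag.exists_isIwahori hL hd ht, fun Δ' _ _ _ _ Θ hΘ => ?_⟩
  exact LocalFlag.flag_parametrization hL hΘ (ht ▸ Nat.gcd_dvd_left _ _) hf hfm
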